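/- **Setting.** For $p\ge 1$ let $X,Y$ be independent with law $\mathcal N(0,p^{-1}I_p)$ on $\mathbb R^p$, put $\xi_p=\sqrt p\,X^TY$, let $q_p$ be the density of $\xi_p$, and let $\mathcal H_p=L^2(\mathbb R,q_p(x)\,dx)$. Let $P_{0,p},P_{1,p},\dots$ be the orthonormal polynomials of $\mathcal H_p$ obtained from $1,x,x^2,\dots$ by the Gram–Schmidt procedure. Given real functions $f(\cdot\,;p)$, put $k(x;p)=\sqrt p\,f(x/\sqrt p;p)$ and $a_{l,p}=\int k(x;p)P_{l,p}(x)q_p(x)\,dx$. Let $a,\nu,\gamma$ be real numbers with $\gamma>0$. Assume: * (C.Variance) for all $p\ge 1$, $k(\cdot\,;p)\in\mathcal H_p$ and $\mathbb E\,k(\xi_p;p)=0$; and $\mathrm{Var}(k(\xi_p;p))\to\nu$ as $p\to\infty$. * (C.$p$-Uniform) the expansion of $k(\cdot\,;p)$ in the $P_{l,p}$ converges in $\mathcal H_p$ uniformly in $p$: for every $\epsilon>0$ there are $L,p_0$ such that $\int \bigl(k(x;p)-\sum_{l=0}^{L}a_{l,p}P_{l,p}(x)\bigr)^2q_p(x)\,dx<\epsilon$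 for all $p>p_0$ (the integral equals $\sum_{l>L}a_{l,p}^2$). * (C.$a_1$) $a_{1,p}\to a$ as $p\to\infty$. Let $p,n\to\infty$ along a sequence of pairs with $n$ strictly increasing and $p/n=\gamma$. For each such pair let $X_1,\dots,X_n$ be i.i.d. $\mathcal N(0,p^{-1}I_p)$, the vectors for all the pairs being defined on one probability space (with arbitrary dependence between different pairs), and let $A$ be the $n\times n$ matrix with $A_{ij}=f(X_i^TX_j;p)$ for $i\ne j$ and $A_{ii}=0$. **Theorem.** For every $z$ with $\Im z>0$ the equation $$-\frac1m=z+a\Bigl(1-\frac{1}{1+\frac a\gamma m}\Bigr)+\frac{\nu-a^2}{\gamma}\,m$$ has exactly one solution $m=m(z)$ with $\Im m>0$. There is a (deterministic) probability measure $\mu$ on $\mathbb R$ with $\int\frac{d\mu(t)}{t-z}=m(z)$ for all $\Im z>0$ such that, almost surely, the empirical spectral distribution $\frac1n\sum_{i=1}^n\delta_{\lambda_i(A)}$ converges weakly to $\mu$. If $a^2<\nu$, or if $a\ne0$ and $\gamma\ge1$, then $\mu$ is absolutely continuous. If $0<a^2<\nu$, then for every $u\in\mathbb R$ $$\lim_{v\to0+}\Im\,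 m(u+iv)=\begin{cases}0,&D\le0,\\ \frac{\sqrt3}{2}\Bigl((\sqrt D+R)^{1/3}+(\sqrt D-R)^{1/3}\Bigr),&D>0,\end{cases}$$ with real cube roots, where $D=Q^3+R^2$, $R=(9\alpha_2\alpha_1-27\alpha_0-2\alpha_2^3)/54$, $Q=(3\alpha_1-\alpha_2^2)/9$, and $$\alpha_2=\frac{(\nu+au)\gamma}{a(\nu-a^2)},\qquad \alpha_1=\frac{(a+\gamma u)\gamma}{a(\nu-a^2)},\qquad \alpha_0=\frac{\gamma^2}{a(\nu-a^2)}.$$ -/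

import Mathlib

open MeasureTheory ProbabilityTheory Filter Topology
open scoped NNReal ENNReal

noncomputable section

namespace RandomKernel

/-- The Gaussian distribution `N(0, p⁻¹ I_p)` on `ℝ^p`: the `p` coordinates are independent
real Gaussians with mean `0` and variance `p⁻¹`. -/
def gaussianVec (p : ℕ) : Measure (Fin p → ℝ) :=
  Measure.pi (fun _ => gaussianReal 0 ((p : ℝ≥0)⁻¹))

/-- The law of `ξ_p = √p ⟨X, Y⟩`, where `X`, `Y` are independent with law `N(0, p⁻¹ I_p)`.
For `p ≥ 1` it has a density `q_p`, and `L²(ℝ, q_p dx)` is the `L²` space of this measure. -/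
def xiLaw (p : ℕ) : Measure ℝ :=
  ((gaussianVec p).prod (gaussianVec p)).map (fun w => √(p : ℝ) * (w.1 ⬝ᵥ w.2))

/-- The `l`-th orthonormal polynomial of `L²(μ)`, given by the Gram-Schmidt procedure applied to
the monomials `1, x, x², …` (so the leading coefficient is positive). It is meant for measures
with all moments finite and infinite support, such as `xiLaw p` with `p ≥ 1`. -/
def orthoPoly (μ : Measure ℝ) (l : ℕ) : Polynomial ℝ :=
  let R : Polynomial ℝ := Polynomial.X ^ l -
    ∑ j : Fin l, Polynomial.C (∫ x, x ^ l * (orthoPoly μ j).eval x ∂μ) * orthoPoly μ j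
  Polynomial.C (√(∫ x, (R.eval x) ^ 2 ∂μ))⁻¹ * R
termination_by l
decreasing_by all_goals exact j.isLt

/-- The rescaled kernel function `k(x; p) = √p f(x / √p; p)`. -/
def rescaledKernel (f : ℕ → ℝ → ℝ) (p : ℕ) (x : ℝ) : ℝ :=
  √(p : ℝ) * f p (x / √(p : ℝ))

/-- The coefficient `a_{l,p} = ∫ k(x; p) P_{l,p}(x) q_p(x) dx`. -/
def coeff (k : ℕ → ℝ → ℝ) (l p : ℕ) : ℝ :=
  ∫ x, k p x * (orthoPoly (xiLaw p) l).eval x ∂(xiLaw p)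

/-- The truncated expansion `k_L(x; p) = ∑_{l ≤ L} a_{l,p} P_{l,p}(x)`. -/
def truncation (k : ℕ → ℝ → ℝ) (L p : ℕ) (x : ℝ) : ℝ :=
  ∑ l ∈ Finset.range (L + 1), coeff k l p * (orthoPoly (xiLaw p) l).eval x

/-- Condition (C.Variance), with limit `ν`. -/
structure CVariance (k : ℕ → ℝ → ℝ) (ν : ℝ) : Prop where
  memLp : ∀ p : ℕ, 1 ≤ p → MemLp (k p) 2 (xiLaw p)
  mean_zero : ∀ p : ℕ, 1 ≤ p → ∫ x, k p x ∂(xiLaw p) = 0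
  tendsto_variance : Tendsto (fun p : ℕ => variance (k p) (xiLaw p)) atTop (𝓝 ν)

/-- Condition (C.p-Uniform): the expansion of `k(·; p)` in the orthonormal polynomials converges
in `L²(q_p dx)` uniformly in `p`. The squared distance below equals `∑_{l > L} a_{l,p}²` and is
nonincreasing in `L`. -/
def CUniform (k : ℕ → ℝ → ℝ) : Prop :=
  ∀ ε : ℝ, 0 < ε → ∃ L p₀ : ℕ, ∀ p : ℕ, p₀ < p →
    ∫ x, (k p x - truncation k L p x) ^ 2 ∂(xiLaw p) < ε

/-- Condition (C.a₁), with limit `a`. -/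
def CLinear (k : ℕ → ℝ → ℝ) (a : ℝ) : Prop :=
  Tendsto (fun p : ℕ => coeff k 1 p) atTop (𝓝 a)

/-- The kernel matrix: `f(X_iᵀ X_j; p)` off the diagonal and `0` on the diagonal. -/
def kernelMatrix (f : ℕ → ℝ → ℝ) {n p : ℕ} (x : Fin n → Fin p → ℝ) :
    Matrix (Fin n) (Fin n) ℝ :=
  Matrix.of fun i j => if i = j then 0 else f p (x i ⬝ᵥ x j)

theorem kernelMatrix_isHermitian (f : ℕ → ℝ → ℝ) {n p : ℕ} (x : Fin n → Fin p → ℝ) :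
    (kernelMatrix f x).IsHermitian := by
  ext i j
  simp [kernelMatrix, eq_comm, dotProduct_comm]

/-- The empirical spectral distribution `n⁻¹ ∑ δ_{λ_i}` of an `n × n` real symmetric matrix
(a probability measure when `n ≥ 1`). -/
def esd {n : ℕ} (A : Matrix (Fin n) (Fin n) ℝ) (hA : A.IsHermitian) : FiniteMeasure ℝ :=
  ⟨(n : ℝ≥0)⁻¹ • ∑ i, Measure.dirac (hA.eigenvalues i), inferInstance⟩

/-- The Stieltjes transform `m(z) = ∫ 1 / (t - z) dμ(t)`. -/
def stieltjes (μ : Measure ℝ) (z : ℂ) : ℂ :=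
  ∫ t : ℝ, 1 / ((t : ℂ) - z) ∂μ

/-- The equation `-1/m = z + a (1 - 1 / (1 + (a/γ) m)) + ((ν - a²)/γ) m`. -/
def LimitEq (γ a ν : ℝ) (z m : ℂ) : Prop :=
  -1 / m = z + a * (1 - 1 / (1 + (a / γ : ℂ) * m)) + ((ν - a ^ 2) / γ : ℂ) * m

/-- The real cube root. -/
def cbrt (x : ℝ) : ℝ := SignType.sign x * |x| ^ (1 / 3 : ℝ)

def alpha2 (γ a ν u : ℝ) : ℝ := (ν + a * u) * γ / (a * (ν - a ^ 2))
def alpha1 (γ a ν u : ℝ) : ℝ := (a + γ * u) * γ / (a * (ν - a ^ 2))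
def alpha0 (γ a ν : ℝ) : ℝ := γ ^ 2 / (a * (ν - a ^ 2))

def cardanoQ (γ a ν u : ℝ) : ℝ := (3 * alpha1 γ a ν u - alpha2 γ a ν u ^ 2) / 9
def cardanoR (γ a ν u : ℝ) : ℝ :=
  (9 * alpha2 γ a ν u * alpha1 γ a ν u - 27 * alpha0 γ a ν - 2 * alpha2 γ a ν u ^ 3) / 54
def cardanoD (γ a ν u : ℝ) : ℝ := cardanoQ γ a ν u ^ 3 + cardanoR γ a ν u ^ 2

open Classical in
/-- The explicit boundary value `y(u; a, ν, γ)`, for `0 < a² < ν`. -/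
def boundaryIm (γ a ν u : ℝ) : ℝ :=
  if cardanoD γ a ν u ≤ 0 then 0
  else √3 / 2 * (cbrt (√(cardanoD γ a ν u) + cardanoR γ a ν u)
    + cbrt (√(cardanoD γ a ν u) - cardanoR γ a ν u))

end RandomKernel

end

/-!
The argument is the Stieltjes transform method. Let `R = (A - z)⁻¹` be the resolvent of the kernel
matrix `A` and `m = n⁻¹ tr R` (`normTrace`), the Stieltjes transform of the spectral distribution
(`stieltjes_esd`). Since `A_ij = p^(-1/2) k(√p X_i·X_j)`, the Schur complement formula
(`resolv_apply_self_mul`) expresses `R_ii` through the quadratic form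
`p⁻¹ ∑ M_jk k(√p X_j·X_i) k(√p X_k·X_i)`, where the matrix `M`, the resolvent of the minor of `A`
without the index `i`, does not depend on `X_i`.

The probabilistic core is the concentration of the forms
`p⁻¹ ∑ M_jk h(√p X_j·x) h'(√p X_k·x)` (`bilForm`) in a new Gaussian vector `x`, for an arbitrary
symmetric `M` of bounded operator norm. Given the `X_j`, the numbers `√p X_j·x` are nearly standard
Gaussian and weakly correlated; off the diagonal only the means of `h`, `h'` and their linear parts
`𝔼 ξh`, `𝔼 ξh'` survive, while all of `𝔼 hh'` is seen on the diagonal. So for centred `h'` the form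
is close to
`p⁻¹ ((𝔼 hh' - 𝔼 ξh 𝔼 ξh') tr M + 𝔼 ξh 𝔼 ξh' ∑ M_jl X_j·X_l)` (`formMean`). For exponentials
`h = exp(i s ·)`, `h' = exp(i t ·)` the means are explicit, and the variance is bounded by a
Gaussian Poincaré inequality, which for trigonometric sums reduces to the positivity of the
Hadamard powers of Gram matrices (`integral_norm_trigSum_sub_sq_le`). The kernel itself is reached
by approximation: by the uniformity hypothesis it is close, in `L²` of the law of `ξ_p` and
uniformly in `p`, to polynomials of fixed degree with bounded coefficients, and a power of `x` is
close to the same power of `M sin(x / M)`, a trigonometric sum (`expApprox_of_cUniform`). An `L²`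
bound for the form, uniform in `M`, makes the approximation harmless
(`eventually_eLpNorm_formDiff_le`).

Two instances of this give a closed system. The form with `h = h' = k` yields an equation between
`m` and `T = p⁻¹ ∑ R_jl X_j·X_l`; the form with `h = id`, `h' = k`, which occurs in the pairing of a
column of `R` with the Gram matrix, yields a second one. Eliminating `T` shows that `m` is an
approximate root of the cubic equation of the theorem (`norm_limitPoly_normTrace_le`,
`eventually_integral_norm_limitPoly_le`). Changing one sample vector moves `m` by at most
`2 / (n Im z)`, so McDiarmid's inequality and the Borel-Cantelli lemma give the almost sure
concentration of `m` at its mean, whatever the dependence between different pairs `(n, p)`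
(`ae_forall_tendsto_normTrace_sub`). The means are bounded, each of their limit points is a root of
the cubic equation in the upper half-plane, and there is only one such root (`LimitEq.unique`):
hence they converge, and the existence of the root comes out at the same time
(`exists_tendsto_meanNormTrace`). As the root behaves like `-1/z` at infinity, no mass is lost and
the spectral distributions converge weakly (`exists_tendsto_of_tendsto_stieltjes`).

Absolute continuity follows from local boundedness of the transform near the real line: for
`a² < ν` the imaginary part of the equation gives `|m|² ≤ γ / (ν - a²)`
(`absolutelyContinuous_of_lt`); for `a² = ν` the equation is quadratic and degenerates only at
`-a`, which for `γ ≥ 1` is not an atom (`absolutelyContinuous_of_eq`). The boundary values are the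
roots in the closed upper half-plane of a real cubic, given by Cardano's formula
(`tendsto_im_boundaryIm`).

The kernels are only assumed to be in `L²`, hence almost everywhere measurable; they are first
replaced by measurable ones, which changes no kernel matrix outside a null set
(`exists_measurable_kernel`, `ae_kernelMatrix_eq`).
-/

noncomputable section

namespace RandomKernel

/-! ### The limiting equation -/

/-- The cubic polynomial in `m` obtained from the limiting equation by clearing denominators. -/
def limitPoly (γ a ν : ℝ) (z m : ℂ) : ℂ :=
  (1 + (a / γ : ℂ) * m) * (1 + z * m + ((ν - a ^ 2) / γ : ℂ) * m ^ 2) + (a ^ 2 / γ : ℂ) * m ^ 2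

theorem one_add_mul_ne_zero_of_im_pos (γ a : ℝ) {m : ℂ} (hm : 0 < m.im) :
    1 + (a / γ : ℂ) * m ≠ 0 := by
  intro h
  have hc : (a / γ : ℂ) = ((a / γ : ℝ) : ℂ) := by push_cast; rfl
  rw [hc] at h
  have h1 := congrArg Complex.im h
  have h2 := congrArg Complex.re h
  simp only [Complex.add_im, Complex.one_im, Complex.re_ofReal_mul, Complex.im_ofReal_mul,
    Complex.zero_im, zero_add, Complex.add_re, Complex.one_re, Complex.zero_re] at h1 h2
  rcases mul_eq_zero.1 h1 with h0 | h0
  · rw [h0] at h2; norm_num at h2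
  · exact hm.ne' h0

theorem ne_zero_of_im_pos {m : ℂ} (hm : 0 < m.im) : m ≠ 0 := by
  rintro rfl; simp at hm

theorem limitEq_iff_limitPoly {γ a ν : ℝ} (hγ : 0 < γ) {z m : ℂ} (hm : 0 < m.im) :
    LimitEq γ a ν z m ↔ limitPoly γ a ν z m = 0 := by
  have h0 := ne_zero_of_im_pos hm
  have h1 := one_add_mul_ne_zero_of_im_pos γ a hm
  have hγ' : (γ : ℂ) ≠ 0 := by exact_mod_cast hγ.ne'
  have key : -1 / m - (z + a * (1 - 1 / (1 + (a / γ : ℂ) * m)) + ((ν - a ^ 2) / γ : ℂ) * m)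
      = - limitPoly γ a ν z m / (m * (1 + (a / γ : ℂ) * m)) := by
    rw [limitPoly, eq_div_iff (mul_ne_zero h0 h1)]
    have e1 : 1 / (1 + (a / γ : ℂ) * m) * (1 + (a / γ : ℂ) * m) = 1 := by
      exact one_div_mul_cancel h1
    have e2 : -1 / m * m = -1 := by field_simp
    have e3 : (a : ℂ) * (a / γ : ℂ) = a ^ 2 / γ := by field_simp
    linear_combination (1 + (a / γ : ℂ) * m) * e2 + (a : ℂ) * m * e1 - m ^ 2 * e3
  rw [LimitEq, ← sub_eq_zero, key, div_eq_zero_iff]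
  constructor
  · rintro (h | h)
    · simpa using h
    · exact absurd h (mul_ne_zero h0 h1)
  · intro h; left; rw [h, neg_zero]

/-- The imaginary part of the limiting equation. -/
theorem LimitEq.im_identity {γ a ν : ℝ} {z m : ℂ} (h : LimitEq γ a ν z m) :
    m.im / Complex.normSq m = z.im
      + a ^ 2 / γ * (m.im / Complex.normSq (1 + (a / γ : ℂ) * m)) + (ν - a ^ 2) / γ * m.im := by
  have h' := congrArg Complex.im h
  have e1 : (-1 / m : ℂ).im = m.im / Complex.normSq m := by
    rw [neg_div, Complex.neg_im, one_div, Complex.inv_im]; ring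
  have e2 : (a * (1 - 1 / (1 + (a / γ : ℂ) * m)) : ℂ).im
      = a ^ 2 / γ * (m.im / Complex.normSq (1 + (a / γ : ℂ) * m)) := by
    have hc : (a / γ : ℂ) = ((a / γ : ℝ) : ℂ) := by push_cast; rfl
    rw [Complex.im_ofReal_mul, one_div, Complex.sub_im, Complex.inv_im, hc]
    simp only [Complex.one_im, Complex.add_im, Complex.im_ofReal_mul]
    ring
  have e3 : (((ν - a ^ 2) / γ : ℂ) * m).im = (ν - a ^ 2) / γ * m.im := by
    have hc : ((ν - a ^ 2) / γ : ℂ) = (((ν - a ^ 2) / γ : ℝ) : ℂ) := by push_cast; rfl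
    rw [hc, Complex.im_ofReal_mul]
  rw [Complex.add_im, Complex.add_im, e1, e2, e3] at h'
  exact h'

theorem LimitEq.normSq_lt {γ a ν : ℝ} {z m : ℂ} (hz : 0 < z.im)
    (hm : 0 < m.im) (h : LimitEq γ a ν z m) :
    a ^ 2 / γ * (1 / Complex.normSq (1 + (a / γ : ℂ) * m)) + (ν - a ^ 2) / γ
      < 1 / Complex.normSq m := by
  have h1 := h.im_identity
  have h2 : 1 / Complex.normSq m = (m.im / Complex.normSq m) / m.im := by
    field_simp
  rw [h2, h1, lt_div_iff₀ hm]
  have : (a ^ 2 / γ * (1 / Complex.normSq (1 + (a / γ : ℂ) * m)) + (ν - a ^ 2) / γ) * m.im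
    = a ^ 2 / γ * (m.im / Complex.normSq (1 + (a / γ : ℂ) * m)) + (ν - a ^ 2) / γ * m.im := by
    ring
  linarith

/-- The limiting equation has at most one solution in the upper half-plane: two solutions would
satisfy `1 / (m₁ m₂) = (a² / γ) / ((1 + (a/γ) m₁)(1 + (a/γ) m₂)) + (ν - a²) / γ`, which the
Cauchy-Schwarz inequality and `LimitEq.normSq_lt` exclude. -/
theorem LimitEq.unique {γ a ν : ℝ} (hγ : 0 < γ) (hν : a ^ 2 ≤ ν) {z m₁ m₂ : ℂ} (hz : 0 < z.im)
    (hm₁ : 0 < m₁.im) (hm₂ : 0 < m₂.im) (h₁ : LimitEq γ a ν z m₁) (h₂ : LimitEq γ a ν z m₂) :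
    m₁ = m₂ := by
  by_contra hne
  have n1 := ne_zero_of_im_pos hm₁
  have n2 := ne_zero_of_im_pos hm₂
  have d1 := one_add_mul_ne_zero_of_im_pos γ a hm₁
  have d2 := one_add_mul_ne_zero_of_im_pos γ a hm₂
  have i1 := h₁.normSq_lt hz hm₁
  have i2 := h₂.normSq_lt hz hm₂
  have hγ' : (γ : ℂ) ≠ 0 := by exact_mod_cast hγ.ne'
  have key : 1 / (m₁ * m₂) = (a ^ 2 / γ : ℂ) * (1 / ((1 + (a / γ : ℂ) * m₁) * (1 + (a / γ : ℂ) * m₂)))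
      + ((ν - a ^ 2) / γ : ℂ) := by
    unfold LimitEq at h₁ h₂
    have hs : -1 / m₁ - -1 / m₂ = (m₁ - m₂) * (1 / (m₁ * m₂)) := by field_simp; ring
    have hr : (a : ℂ) * (1 - 1 / (1 + (a / γ : ℂ) * m₁)) - a * (1 - 1 / (1 + (a / γ : ℂ) * m₂))
        = (m₁ - m₂) * ((a ^ 2 / γ : ℂ) *
          (1 / ((1 + (a / γ : ℂ) * m₁) * (1 + (a / γ : ℂ) * m₂)))) := by
      generalize hp : 1 + (a / γ : ℂ) * m₁ = p at *
      generalize hq : 1 + (a / γ : ℂ) * m₂ = q at *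
      have e : (a : ℂ) * (p - q) = (m₁ - m₂) * (a ^ 2 / γ) := by
        rw [← hp, ← hq]; ring
      have e' : (a : ℂ) * (1 - 1 / p) - a * (1 - 1 / q) = a * (p - q) * (1 / (p * q)) := by
        field_simp; ring
      rw [e', e]; ring
    have hd : m₁ - m₂ ≠ 0 := sub_ne_zero.2 hne
    apply mul_left_cancel₀ hd
    linear_combination h₁ - h₂ - hs + hr
  have hnorm := congrArg norm key
  have hle : ‖1 / (m₁ * m₂)‖ ≤ a ^ 2 / γ * (1 / (‖1 + (a / γ : ℂ) * m₁‖ * ‖1 + (a / γ : ℂ) * m₂‖))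
      + (ν - a ^ 2) / γ := by
    rw [hnorm]
    refine (norm_add_le _ _).trans (add_le_add (le_of_eq ?_) (le_of_eq ?_))
    · rw [norm_mul, norm_div, norm_div, norm_mul, norm_pow, norm_one, Complex.norm_real,
        Complex.norm_real, Real.norm_eq_abs, Real.norm_eq_abs, sq_abs, abs_of_pos hγ]
    · have hc : ((ν - a ^ 2) / γ : ℂ) = (((ν - a ^ 2) / γ : ℝ) : ℂ) := by push_cast; rfl
      rw [hc, Complex.norm_real, Real.norm_eq_abs, abs_of_nonneg (by
        apply div_nonneg (by linarith) hγ.le)]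
  rw [norm_div, norm_mul, norm_one] at hle
  rw [Complex.normSq_eq_norm_sq, Complex.normSq_eq_norm_sq] at i1 i2
  have p1 : 0 < ‖m₁‖ := norm_pos_iff.2 n1
  have p2 : 0 < ‖m₂‖ := norm_pos_iff.2 n2
  have q1 : 0 < ‖1 + (a / γ : ℂ) * m₁‖ := norm_pos_iff.2 d1
  have q2 : 0 < ‖1 + (a / γ : ℂ) * m₂‖ := norm_pos_iff.2 d2
  generalize ‖1 + (a / γ : ℂ) * m₁‖ = y₁ at *
  generalize ‖1 + (a / γ : ℂ) * m₂‖ = y₂ at *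
  have hA : 0 ≤ a ^ 2 / γ := by positivity
  have hC : 0 ≤ (ν - a ^ 2) / γ := div_nonneg (by linarith) hγ.le
  generalize a ^ 2 / γ = A at *
  generalize (ν - a ^ 2) / γ = C at *
  have r1 : 1 / (‖m₁‖ * ‖m₂‖) = ‖m₁‖⁻¹ * ‖m₂‖⁻¹ := by field_simp
  have r2 : 1 / (y₁ * y₂) = y₁⁻¹ * y₂⁻¹ := by field_simp
  have r3 : ∀ t : ℝ, 1 / t ^ 2 = t⁻¹ ^ 2 := fun t => by simp
  rw [r1, r2] at hle
  rw [r3, r3] at i1 i2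
  have s1 : 0 < ‖m₁‖⁻¹ := inv_pos.2 p1
  have s2 : 0 < ‖m₂‖⁻¹ := inv_pos.2 p2
  have t1 : 0 < y₁⁻¹ := inv_pos.2 q1
  have t2 : 0 < y₂⁻¹ := inv_pos.2 q2
  generalize ‖m₁‖⁻¹ = u₁ at *
  generalize ‖m₂‖⁻¹ = u₂ at *
  generalize y₁⁻¹ = w₁ at *
  generalize y₂⁻¹ = w₂ at *
  -- Cauchy-Schwarz for the weights `A` and `C`
  have c1 : (A * (w₁ * w₂) + C) ^ 2 ≤ (A * w₁ ^ 2 + C) * (A * w₂ ^ 2 + C) := by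
    have := mul_nonneg (mul_nonneg hA hC) (sq_nonneg (w₁ - w₂))
    nlinarith
  have c2 : (A * w₁ ^ 2 + C) * (A * w₂ ^ 2 + C) < u₁ ^ 2 * u₂ ^ 2 :=
    mul_lt_mul'' i1 i2 (by positivity) (by positivity)
  have c3 : (u₁ * u₂) ^ 2 ≤ (A * (w₁ * w₂) + C) ^ 2 :=
    pow_le_pow_left₀ (by positivity) hle 2
  nlinarith

/-- The uniform bound `|m|² ≤ γ / (ν - a²)` for solutions of the limiting equation. -/
theorem LimitEq.norm_sq_mul_le {γ a ν : ℝ} (hγ : 0 < γ) {z m : ℂ}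
    (hz : 0 < z.im) (hm : 0 < m.im) (h : LimitEq γ a ν z m) :
    (ν - a ^ 2) / γ * ‖m‖ ^ 2 ≤ 1 := by
  have i1 := h.normSq_lt hz hm
  rw [Complex.normSq_eq_norm_sq m] at i1
  have p1 : 0 < ‖m‖ := norm_pos_iff.2 (ne_zero_of_im_pos hm)
  have h0 : 0 ≤ a ^ 2 / γ * (1 / Complex.normSq (1 + (a / γ : ℂ) * m)) :=
    mul_nonneg (by positivity) (one_div_nonneg.2 (Complex.normSq_nonneg _))
  rw [← le_div_iff₀ (by positivity)]
  linarith

/-! ### Boundary values of the solution: Cardano's formula -/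

theorem cbrt_pow_three (x : ℝ) : cbrt (x ^ 3) = x := by
  unfold cbrt
  rcases lt_trichotomy x 0 with h | h | h
  · have h3 : x ^ 3 < 0 := by
      have := pow_pos (neg_pos.2 h) 3; nlinarith
    rw [sign_neg h3, abs_of_neg h3]
    have : -x ^ 3 = (-x) ^ (3 : ℕ) := by ring
    rw [this, ← Real.rpow_natCast (-x) 3, ← Real.rpow_mul (by linarith)]
    norm_num
  · subst h; simp
  · rw [sign_pos (pow_pos h 3), abs_of_pos (pow_pos h 3), ← Real.rpow_natCast x 3,
      ← Real.rpow_mul h.le]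
    norm_num

theorem exists_real_root_of_cubic (A B C : ℝ) : ∃ r : ℝ, r ^ 3 + A * r ^ 2 + B * r + C = 0 := by
  set K := 1 + |A| + |B| + |C|
  have hA := abs_nonneg A
  have hB := abs_nonneg B
  have hC := abs_nonneg C
  have hK : 1 ≤ K := by simp only [K]; linarith
  have h1 : |A| * K ^ 2 + |B| * K + |C| ≤ K ^ 3 := by
    have : K ^ 3 = K ^ 2 + |A| * K ^ 2 + |B| * K ^ 2 + |C| * K ^ 2 := by
      simp only [K]; ring
    have e1 : |B| * K ≤ |B| * K ^ 2 := by gcongr; nlinarith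
    have e2 : |C| * 1 ≤ |C| * K ^ 2 := by gcongr; nlinarith
    nlinarith [sq_nonneg K]
  have hcont : ContinuousOn (fun r : ℝ => r ^ 3 + A * r ^ 2 + B * r + C) (Set.Icc (-K) K) := by
    fun_prop
  have := intermediate_value_Icc (by linarith : -K ≤ K) hcont
  have hm : (0 : ℝ) ∈ Set.Icc ((-K) ^ 3 + A * (-K) ^ 2 + B * (-K) + C)
      (K ^ 3 + A * K ^ 2 + B * K + C) := by
    have a1 := neg_abs_le A
    have a2 := le_abs_self A
    have b1 := neg_abs_le B
    have b2 := le_abs_self B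
    have c1 := neg_abs_le C
    have c2 := le_abs_self C
    have hK2 : 0 ≤ K ^ 2 := sq_nonneg K
    constructor
    · nlinarith
    · nlinarith
  obtain ⟨r, -, hr⟩ := this hm
  exact ⟨r, hr⟩

theorem exists_roots_of_cubic (A B C : ℂ) : ∃ x y z : ℂ, ∀ m : ℂ,
    m ^ 3 + A * m ^ 2 + B * m + C = (m - x) * (m - y) * (m - z) := by
  let P : Cubic ℂ := ⟨1, A, B, C⟩
  have ha : P.a ≠ 0 := one_ne_zero
  have hs : (Cubic.map (RingHom.id ℂ) P).toPoly.Splits := IsAlgClosed.splits _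
  have hs' : (P.toPoly.map (RingHom.id ℂ)).Splits := IsAlgClosed.splits _
  obtain ⟨x, y, z, h⟩ := (Cubic.splits_iff_roots_eq_three (φ := RingHom.id ℂ) ha).1 hs'
  refine ⟨x, y, z, fun m => ?_⟩
  have h2 := congrArg (Polynomial.eval m) (Cubic.eq_prod_three_roots ha h)
  simpa [Cubic.toPoly, P, Cubic.map] using h2

/-- If a monic complex cubic is small at `w`, then it has a root near `w`. -/
theorem exists_root_near_of_cubic (A B C w : ℂ) : ∃ x : ℂ, x ^ 3 + A * x ^ 2 + B * x + C = 0 ∧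
    ‖w - x‖ ^ 3 ≤ ‖w ^ 3 + A * w ^ 2 + B * w + C‖ := by
  obtain ⟨x, y, z, h⟩ := exists_roots_of_cubic A B C
  have hx := h x
  have hy := h y
  have hz := h z
  simp only [sub_self, zero_mul, mul_zero] at hx hy hz
  rw [h w, norm_mul, norm_mul]
  have nx := norm_nonneg (w - x)
  have ny := norm_nonneg (w - y)
  have nz := norm_nonneg (w - z)
  by_cases h1 : ‖w - x‖ ≤ ‖w - y‖ ∧ ‖w - x‖ ≤ ‖w - z‖
  · refine ⟨x, hx, ?_⟩
    calc ‖w - x‖ ^ 3 = ‖w - x‖ * ‖w - x‖ * ‖w - x‖ := by ring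
      _ ≤ _ := by gcongr; exacts [h1.1, h1.2]
  · by_cases h2 : ‖w - y‖ ≤ ‖w - x‖ ∧ ‖w - y‖ ≤ ‖w - z‖
    · refine ⟨y, hy, ?_⟩
      calc ‖w - y‖ ^ 3 = ‖w - y‖ * ‖w - y‖ * ‖w - y‖ := by ring
        _ ≤ _ := by gcongr; exacts [h2.1, h2.2]
    · refine ⟨z, hz, ?_⟩
      have h3 : ‖w - z‖ ≤ ‖w - x‖ ∧ ‖w - z‖ ≤ ‖w - y‖ := by
        rw [not_and_or, not_le, not_le] at h1 h2
        constructor <;> rcases h1 with h1 | h1 <;> rcases h2 with h2 | h2 <;> linarith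
      calc ‖w - z‖ ^ 3 = ‖w - z‖ * ‖w - z‖ * ‖w - z‖ := by ring
        _ ≤ _ := by gcongr; exacts [h3.1, h3.2]

/-- The real cubic whose roots are the boundary values of the solution at `u`. -/
def boundaryCubic (γ a ν u : ℝ) (m : ℂ) : ℂ :=
  m ^ 3 + (alpha2 γ a ν u : ℂ) * m ^ 2 + (alpha1 γ a ν u : ℂ) * m + (alpha0 γ a ν : ℂ)

/-- Away from the real axis the limiting cubic is a perturbation of the boundary cubic, of size
`O(|t|)` for bounded `m`. -/
theorem limitPoly_eq_boundaryCubic {γ a ν : ℝ} (hγ : 0 < γ) (ha : a ≠ 0) (hν : a ^ 2 < ν)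
    (u : ℝ) (t m : ℂ) :
    limitPoly γ a ν (u + t) m = (a * (ν - a ^ 2) / γ ^ 2 : ℂ) *
      (boundaryCubic γ a ν u m + t * (γ ^ 2 / (a * (ν - a ^ 2)) : ℂ) * ((a / γ : ℂ) * m ^ 2 + m)) := by
  have h1 : (γ : ℂ) ≠ 0 := by exact_mod_cast hγ.ne'
  have h2 : (a : ℂ) ≠ 0 := by exact_mod_cast ha
  have h3 : (ν - a ^ 2 : ℂ) ≠ 0 := by
    have : (ν - a ^ 2 : ℝ) ≠ 0 := by linarith
    exact_mod_cast this
  simp only [limitPoly, boundaryCubic, alpha2, alpha1, alpha0]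
  push_cast
  field_simp
  ring

/-- The discriminant of the cubic `(m - r)(m² + β m + δ)`: it has the sign that excludes `D > 0` as
soon as the quadratic factor has real roots. -/
theorem cardano_real_roots {γ a ν u r β δ : ℝ} (h2 : alpha2 γ a ν u = β - r)
    (h1 : alpha1 γ a ν u = δ - r * β) (h0 : alpha0 γ a ν = - r * δ) :
    cardanoD γ a ν u = - (β ^ 2 - 4 * δ) * (r ^ 2 + β * r + δ) ^ 2 / 108 := by
  simp only [cardanoD, cardanoQ, cardanoR, h2, h1, h0]
  ring

/-- If the boundary cubic has the roots `r` and `s ± i t`, both radicands in Cardano's formula are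
perfect cubes, and their cube roots add up to `2 t / √3`. -/
theorem boundaryIm_of_complex_roots {γ a ν u r s t : ℝ} (ht : 0 < t)
    (h2 : alpha2 γ a ν u = - 2 * s - r)
    (h1 : alpha1 γ a ν u = s ^ 2 + t ^ 2 + 2 * r * s)
    (h0 : alpha0 γ a ν = - r * (s ^ 2 + t ^ 2)) :
    boundaryIm γ a ν u = t := by
  have hD : cardanoD γ a ν u = t ^ 2 * ((r - s) ^ 2 + t ^ 2) ^ 2 / 27 := by
    simp only [cardanoD, cardanoQ, cardanoR, h2, h1, h0]
    ring
  have hpos : 0 < cardanoD γ a ν u := by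
    rw [hD]; positivity
  have h3 : √(3 : ℝ) ^ 2 = 3 := Real.sq_sqrt (by norm_num)
  have h3' : √(3 : ℝ) ≠ 0 := by positivity
  have h33 : √(3 : ℝ) ^ 3 = 3 * √3 := by rw [pow_succ, h3]
  have hs : √(cardanoD γ a ν u) = t * ((r - s) ^ 2 + t ^ 2) * √3 / 9 := by
    rw [hD, Real.sqrt_eq_iff_mul_self_eq (by positivity) (by positivity)]
    linear_combination -(t * ((r - s) ^ 2 + t ^ 2)) ^ 2 / 81 * h3
  have hR : cardanoR γ a ν u = ((r - s) ^ 3 + 9 * (r - s) * t ^ 2) / 27 := by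
    simp only [cardanoR, h2, h1, h0]
    ring
  rw [boundaryIm, if_neg (not_le.2 hpos), hs, hR]
  have e1 : t * ((r - s) ^ 2 + t ^ 2) * √3 / 9 + ((r - s) ^ 3 + 9 * (r - s) * t ^ 2) / 27
      = ((r - s) / 3 + t * √3 / 3) ^ 3 := by
    linear_combination (-(r - s) * t ^ 2 / 9 - t ^ 3 * √3 / 27) * h3
  have e2 : t * ((r - s) ^ 2 + t ^ 2) * √3 / 9 - ((r - s) ^ 3 + 9 * (r - s) * t ^ 2) / 27
      = (t * √3 / 3 - (r - s) / 3) ^ 3 := by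
    linear_combination ((r - s) * t ^ 2 / 9 - t ^ 3 * √3 / 27) * h3
  rw [e1, e2, cbrt_pow_three, cbrt_pow_three]
  linear_combination t / 3 * h3

/-- The boundary values of the imaginary part of the solution of the limiting equation. If the
boundary cubic has only real roots, its smallness at `m` forces `Im m` to be small. Otherwise a
root of the perturbed cubic stays near the nonreal root with positive imaginary part, and it is
the solution by uniqueness. -/
theorem tendsto_im_boundaryIm {γ a ν : ℝ} (hγ : 0 < γ) (ha : a ≠ 0) (hν : a ^ 2 < ν)
    {m : ℂ → ℂ} (him : ∀ z : ℂ, 0 < z.im → 0 < (m z).im)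
    (hm : ∀ z : ℂ, 0 < z.im → LimitEq γ a ν z (m z)) (u : ℝ) :
    Tendsto (fun v : ℝ => (m ((u : ℂ) + (v : ℂ) * Complex.I)).im) (𝓝[>] 0)
      (𝓝 (boundaryIm γ a ν u)) := by
  have hzim : ∀ v : ℝ, ((u : ℂ) + (v : ℂ) * Complex.I).im = v := fun v => by simp
  obtain ⟨r, hr⟩ := exists_real_root_of_cubic (alpha2 γ a ν u) (alpha1 γ a ν u) (alpha0 γ a ν)
  set β := alpha2 γ a ν u + r with hβ
  set δ := alpha1 γ a ν u + r * β with hδ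
  have h2 : alpha2 γ a ν u = β - r := by rw [hβ]; ring
  have h1 : alpha1 γ a ν u = δ - r * β := by rw [hδ]; ring
  have h0 : alpha0 γ a ν = - r * δ := by
    have : r ^ 3 + (β - r) * r ^ 2 + (δ - r * β) * r + alpha0 γ a ν = 0 := by
      rw [← h2, ← h1]; exact hr
    linarith
  have hfac : ∀ w : ℂ, boundaryCubic γ a ν u w = (w - r) * (w ^ 2 + β * w + δ) := by
    intro w
    rw [boundaryCubic, h2, h1, h0]; push_cast; ring
  have hbc : (a * (ν - a ^ 2) / γ ^ 2 : ℂ) ≠ 0 := by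
    have : (a * (ν - a ^ 2) / γ ^ 2 : ℝ) ≠ 0 :=
      div_ne_zero (mul_ne_zero ha (by linarith)) (by positivity)
    exact_mod_cast this
  set κ : ℂ := (γ ^ 2 / (a * (ν - a ^ 2)) : ℂ) with hκ
  rcases le_or_gt 0 (β ^ 2 - 4 * δ) with hΔ | hΔ
  · -- all roots of the cubic are real
    have hD : cardanoD γ a ν u ≤ 0 := by
      rw [cardano_real_roots h2 h1 h0]
      have := mul_nonneg hΔ (sq_nonneg (r ^ 2 + β * r + δ))
      linarith
    rw [boundaryIm, if_pos hD]
    have hsplit : ∀ w : ℂ, |w.im| ^ 3 ≤ ‖boundaryCubic γ a ν u w‖ := by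
      intro w
      set q := √(β ^ 2 - 4 * δ)
      have hq : q ^ 2 = β ^ 2 - 4 * δ := Real.sq_sqrt hΔ
      have hq' : (q : ℂ) ^ 2 = β ^ 2 - 4 * δ := by exact_mod_cast hq
      have e : boundaryCubic γ a ν u w = (w - r) * ((w - ((-β + q) / 2 : ℝ)) *
          (w - ((-β - q) / 2 : ℝ))) := by
        rw [hfac]; push_cast
        linear_combination (w - r) / 4 * hq'
      have him' : ∀ x : ℝ, |w.im| ≤ ‖w - x‖ := by
        intro x
        have := Complex.abs_im_le_norm (w - x)
        simpa using this
      rw [e, norm_mul, norm_mul]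
      calc |w.im| ^ 3 = |w.im| * (|w.im| * |w.im|) := by ring
        _ ≤ _ := by gcongr <;> exact him' _
    -- the solution stays bounded, so the cubic tends to zero along it
    obtain ⟨K, hK⟩ : ∃ K : ℝ, ∀ z : ℂ, 0 < z.im → ‖m z‖ ≤ K := by
      refine ⟨1 + γ / (ν - a ^ 2), fun z hz => ?_⟩
      have := (hm z hz).norm_sq_mul_le hγ hz (him z hz)
      have hp : 0 < ν - a ^ 2 := by linarith
      have h3 : ‖m z‖ ^ 2 ≤ γ / (ν - a ^ 2) := by
        rw [le_div_iff₀ hp]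
        calc ‖m z‖ ^ 2 * (ν - a ^ 2) = γ * ((ν - a ^ 2) / γ * ‖m z‖ ^ 2) := by field_simp
          _ ≤ γ * 1 := by gcongr
          _ = γ := mul_one _
      nlinarith [sq_nonneg (‖m z‖ - 1)]
    have hcub : ∀ v : ℝ, 0 < v → |(m (u + v * Complex.I)).im| ^ 3 ≤
        v * (‖κ‖ * (‖(a / γ : ℂ)‖ * K ^ 2 + K)) := by
      intro v hv
      have hz : 0 < ((u : ℂ) + (v : ℂ) * Complex.I).im := by rw [hzim]; exact hv
      have hp := (limitEq_iff_limitPoly hγ (him _ hz)).1 (hm _ hz)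
      rw [limitPoly_eq_boundaryCubic hγ ha hν, mul_eq_zero, or_iff_right hbc] at hp
      have hk := hK _ hz
      have e := eq_neg_of_add_eq_zero_left hp
      refine (hsplit _).trans ?_
      rw [e, norm_neg, norm_mul, norm_mul, norm_mul, Complex.norm_I, Complex.norm_real,
        Real.norm_eq_abs, abs_of_pos hv, mul_one, mul_assoc]
      gcongr
      refine (norm_add_le _ _).trans ?_
      rw [norm_mul, norm_pow]
      gcongr
    have hlim : Tendsto (fun v : ℝ => |(m (u + v * Complex.I)).im| ^ 3) (𝓝[>] 0) (𝓝 0) := by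
      refine squeeze_zero' (Eventually.of_forall fun v => by positivity)
        (eventually_nhdsWithin_of_forall fun v hv => hcub v hv) ?_
      have : Tendsto (fun v : ℝ => v * (‖κ‖ * (‖(a / γ : ℂ)‖ * K ^ 2 + K))) (𝓝 0) (𝓝 (0 * (‖κ‖ * (‖(a / γ : ℂ)‖ * K ^ 2 + K)))) :=
        tendsto_id.mul_const _
      rw [zero_mul] at this
      exact this.mono_left nhdsWithin_le_nhds
    rw [tendsto_zero_iff_abs_tendsto_zero]
    rw [Metric.tendsto_nhds] at hlim ⊢
    intro ε hε
    filter_upwards [hlim (ε ^ 3) (by positivity)] with v hv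
    simp only [dist_zero_right, norm_pow, Real.norm_eq_abs, abs_abs, Function.comp] at hv ⊢
    exact lt_of_pow_lt_pow_left₀ 3 hε.le hv
  · -- a pair of nonreal roots
    set t := √(4 * δ - β ^ 2) / 2 with ht
    have hsq : √(4 * δ - β ^ 2) ^ 2 = 4 * δ - β ^ 2 := Real.sq_sqrt (by linarith)
    have htpos : 0 < t := by
      have : 0 < √(4 * δ - β ^ 2) := Real.sqrt_pos.2 (by linarith)
      positivity
    have ht2 : t ^ 2 = δ - β ^ 2 / 4 := by rw [ht, div_pow, hsq]; ring
    have hb : boundaryIm γ a ν u = t := by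
      apply boundaryIm_of_complex_roots (r := r) (s := -β / 2) htpos
      · rw [h2]; ring
      · rw [h1, ht2]; ring
      · rw [h0, ht2]; ring
    rw [hb]
    set w : ℂ := ⟨-β / 2, t⟩ with hw
    have hwim : w.im = t := rfl
    have hw0 : boundaryCubic γ a ν u w = 0 := by
      rw [hfac]
      have : w ^ 2 + β * w + δ = 0 := by
        apply Complex.ext
        · simp [hw, pow_two]; nlinarith
        · simp [hw, pow_two]; ring
      rw [this, mul_zero]
    have hnear : ∀ v : ℝ, 0 < v → v * (‖κ‖ * ‖(a / γ : ℂ) * w ^ 2 + w‖) < t ^ 3 →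
        |(m (u + v * Complex.I)).im - t| ^ 3 ≤ v * (‖κ‖ * ‖(a / γ : ℂ) * w ^ 2 + w‖) := by
      intro v hv hsmall
      have hz : 0 < ((u : ℂ) + (v : ℂ) * Complex.I).im := by rw [hzim]; exact hv
      have hform : ∀ y : ℂ, y ^ 3 + ((alpha2 γ a ν u : ℂ) + v * Complex.I * κ * (a / γ : ℂ)) * y ^ 2
          + ((alpha1 γ a ν u : ℂ) + v * Complex.I * κ) * y + (alpha0 γ a ν : ℂ)
          = boundaryCubic γ a ν u y + v * Complex.I * κ * ((a / γ : ℂ) * y ^ 2 + y) := by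
        intro y; rw [boundaryCubic]; ring
      obtain ⟨x, hx, hxw⟩ := exists_root_near_of_cubic
        ((alpha2 γ a ν u : ℂ) + v * Complex.I * κ * (a / γ : ℂ))
        ((alpha1 γ a ν u : ℂ) + v * Complex.I * κ) (alpha0 γ a ν : ℂ) w
      rw [hform] at hx hxw
      rw [hw0, zero_add, norm_mul, norm_mul, norm_mul, Complex.norm_I, Complex.norm_real,
        Real.norm_eq_abs, abs_of_pos hv, mul_one, mul_assoc] at hxw
      have habs : |x.im - t| ≤ ‖w - x‖ := by
        have := Complex.abs_im_le_norm (w - x)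
        rw [Complex.sub_im, hwim, abs_sub_comm] at this
        exact this
      have hxim : 0 < x.im := by
        have h3 : ‖w - x‖ < t := lt_of_pow_lt_pow_left₀ 3 htpos.le (hxw.trans_lt hsmall)
        have := (abs_lt.1 (habs.trans_lt h3)).1
        linarith
      have hxeq : LimitEq γ a ν (u + v * Complex.I) x := by
        rw [limitEq_iff_limitPoly hγ hxim, limitPoly_eq_boundaryCubic hγ ha hν, ← hκ, hx, mul_zero]
      rw [(hm _ hz).unique hγ hν.le hz (him _ hz) hxim hxeq]
      exact (pow_le_pow_left₀ (abs_nonneg _) habs 3).trans hxw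
    have hlin : Tendsto (fun v : ℝ => v * (‖κ‖ * ‖(a / γ : ℂ) * w ^ 2 + w‖)) (𝓝[>] 0) (𝓝 0) := by
      have : Tendsto (fun v : ℝ => v * (‖κ‖ * ‖(a / γ : ℂ) * w ^ 2 + w‖)) (𝓝 0)
          (𝓝 (0 * (‖κ‖ * ‖(a / γ : ℂ) * w ^ 2 + w‖))) := tendsto_id.mul_const _
      rw [zero_mul] at this
      exact this.mono_left nhdsWithin_le_nhds
    rw [Metric.tendsto_nhds]
    intro ε hε
    have hmin : 0 < min (ε ^ 3) (t ^ 3) := lt_min (by positivity) (by positivity)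
    filter_upwards [hlin.eventually (gt_mem_nhds hmin), self_mem_nhdsWithin] with v hv hv0
    have := hnear v hv0 (hv.trans_le (min_le_right _ _))
    rw [Real.dist_eq]
    exact lt_of_pow_lt_pow_left₀ 3 hε.le (this.trans_lt (hv.trans_le (min_le_left _ _)))

/-! ### The Stieltjes transform -/

section Stieltjes

theorem sub_ne_zero_of_im_pos {z : ℂ} (hz : 0 < z.im) (t : ℝ) : (t : ℂ) - z ≠ 0 := by
  intro h
  have := congrArg Complex.im h
  simp at this
  exact hz.ne' this

theorem norm_one_div_sub_le {z : ℂ} (hz : 0 < z.im) (t : ℝ) : ‖1 / ((t : ℂ) - z)‖ ≤ 1 / z.im := by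
  rw [norm_div, norm_one]
  apply one_div_le_one_div_of_le hz
  have := Complex.abs_im_le_norm ((t : ℂ) - z)
  simp only [Complex.sub_im, Complex.ofReal_im, zero_sub, abs_neg] at this
  exact (le_abs_self _).trans this

theorem continuous_one_div_sub {z : ℂ} (hz : 0 < z.im) :
    Continuous fun t : ℝ => 1 / ((t : ℂ) - z) :=
  continuous_const.div (by fun_prop) (sub_ne_zero_of_im_pos hz)

theorem integrable_one_div_sub (μ : Measure ℝ) [IsFiniteMeasure μ] {z : ℂ} (hz : 0 < z.im) :
    Integrable (fun t : ℝ => 1 / ((t : ℂ) - z)) μ :=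
  .of_bound (continuous_one_div_sub hz).aestronglyMeasurable (1 / z.im)
    (ae_of_all _ (norm_one_div_sub_le hz))

theorem im_one_div_sub (x v t : ℝ) :
    (1 / ((t : ℂ) - (x + v * Complex.I))).im = v / ((t - x) ^ 2 + v ^ 2) := by
  rw [one_div, Complex.inv_im, Complex.normSq_apply]
  simp [pow_two]

theorem im_stieltjes (μ : Measure ℝ) [IsFiniteMeasure μ] (x : ℝ) {v : ℝ} (hv : 0 < v) :
    (stieltjes μ (x + v * Complex.I)).im = ∫ t, v / ((t - x) ^ 2 + v ^ 2) ∂μ := by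
  have hz : 0 < ((x : ℂ) + v * Complex.I).im := by simpa using hv
  have := integral_im (integrable_one_div_sub μ hz)
  simp only [RCLike.im_to_complex] at this
  rw [stieltjes, ← this]
  simp_rw [im_one_div_sub]

theorem integrable_poissonKernel (μ : Measure ℝ) [IsFiniteMeasure μ] (x : ℝ) {v : ℝ} (hv : 0 < v) :
    Integrable (fun t : ℝ => v / ((t - x) ^ 2 + v ^ 2)) μ := by
  have hz : 0 < ((x : ℂ) + v * Complex.I).im := by simpa using hv
  have := (integrable_one_div_sub μ hz).im
  simpa only [RCLike.im_to_complex, im_one_div_sub] using this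

theorem im_stieltjes_pos (μ : Measure ℝ) [IsProbabilityMeasure μ] {z : ℂ} (hz : 0 < z.im) :
    0 < (stieltjes μ z).im := by
  have e : z = (z.re : ℂ) + z.im * Complex.I := (Complex.re_add_im z).symm
  rw [e, im_stieltjes μ _ hz]
  rw [integral_pos_iff_support_of_nonneg (fun t => by positivity) (integrable_poissonKernel μ _ hz)]
  have : Function.support (fun t : ℝ => z.im / ((t - z.re) ^ 2 + z.im ^ 2)) = Set.univ := by
    ext t
    simp only [Function.mem_support, Set.mem_univ, iff_true]
    positivity
  rw [this, measure_univ]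
  exact one_pos

theorem norm_stieltjes_sub_le (μ : Measure ℝ) [IsProbabilityMeasure μ] {z w : ℂ} (hz : 0 < z.im)
    (hw : 0 < w.im) : ‖stieltjes μ z - stieltjes μ w‖ ≤ ‖z - w‖ / (z.im * w.im) := by
  rw [stieltjes, stieltjes, ← integral_sub (integrable_one_div_sub μ hz)
    (integrable_one_div_sub μ hw)]
  have : ∀ t : ℝ, ‖1 / ((t : ℂ) - z) - 1 / ((t : ℂ) - w)‖ ≤ ‖z - w‖ / (z.im * w.im) := by
    intro t
    have e : 1 / ((t : ℂ) - z) - 1 / ((t : ℂ) - w)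
        = (z - w) * ((1 / ((t : ℂ) - z)) * (1 / ((t : ℂ) - w))) := by
      have h1 := sub_ne_zero_of_im_pos hz t
      have h2 := sub_ne_zero_of_im_pos hw t
      field_simp
      ring
    have e' : ‖z - w‖ / (z.im * w.im) = ‖z - w‖ * (1 / z.im * (1 / w.im)) := by field_simp
    rw [e, norm_mul, norm_mul, e']
    gcongr
    · exact norm_one_div_sub_le hz t
    · exact norm_one_div_sub_le hw t
  simpa using norm_integral_le_of_norm_le_const (μ := μ) (ae_of_all _ this)

theorem tendsto_stieltjes {μs : ℕ → ProbabilityMeasure ℝ} {μ : ProbabilityMeasure ℝ}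
    {F : Filter ℕ} (h : Tendsto μs F (𝓝 μ)) {z : ℂ} (hz : 0 < z.im) :
    Tendsto (fun n => stieltjes (μs n : Measure ℝ) z) F (𝓝 (stieltjes (μ : Measure ℝ) z)) := by
  rw [ProbabilityMeasure.tendsto_iff_forall_integral_rclike_tendsto ℂ] at h
  exact h (BoundedContinuousFunction.ofNormedAddCommGroup _ (continuous_one_div_sub hz) _
    (norm_one_div_sub_le hz))

/-- The density `x ↦ π⁻¹ Im m(x + i v)` of the convolution of `μ` with the Cauchy law of
scale `v`. -/
def smoothedDensity (μ : Measure ℝ) (v : ℝ) (x : ℝ) : ℝ≥0∞ :=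
  ENNReal.ofReal (Real.pi⁻¹ * (stieltjes μ (x + v * Complex.I)).im)

theorem smoothedDensity_eq_lintegral (μ : Measure ℝ) [IsFiniteMeasure μ] {v : ℝ≥0} (hv : 0 < v)
    (x : ℝ) : smoothedDensity μ v x = ∫⁻ t, cauchyPDF t v x ∂μ := by
  have hv' : (0 : ℝ) < v := hv
  rw [smoothedDensity, im_stieltjes μ x hv', ← integral_const_mul, ofReal_integral_eq_lintegral_ofReal]
  · refine lintegral_congr fun t => ?_
    rw [cauchyPDF, cauchyPDFReal_def]
    congr 1
    rw [show (x - t) ^ 2 = (t - x) ^ 2 by ring]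
    ring
  · exact (integrable_poissonKernel μ x hv').const_mul _
  · exact ae_of_all _ fun t => by simp only [Pi.zero_apply]; positivity

theorem measurable_cauchyPDF_uncurry (v : ℝ≥0) :
    Measurable (Function.uncurry fun t x : ℝ => cauchyPDF t v x) := by
  unfold cauchyPDF Function.uncurry
  simp only [cauchyPDFReal_def]
  fun_prop

theorem lintegral_smoothedDensity (μ : Measure ℝ) [IsFiniteMeasure μ] {v : ℝ≥0} (hv : 0 < v)
    (V : Set ℝ) :
    ∫⁻ x in V, smoothedDensity μ v x = ∫⁻ t, (∫⁻ x in V, cauchyPDF t v x) ∂μ := by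
  simp_rw [smoothedDensity_eq_lintegral μ hv]
  rw [lintegral_lintegral_swap]
  exact ((measurable_cauchyPDF_uncurry v).comp measurable_swap).aemeasurable

/-- The Cauchy law of scale `v` centred at `t` has mass `O(v)` outside a neighbourhood of `t`. -/
theorem one_le_lintegral_cauchyPDF_add {V : Set ℝ} {t r : ℝ} (hr : 0 < r)
    (hV : Metric.ball t r ⊆ V) {v : ℝ≥0} (hv : 0 < v) :
    1 ≤ (∫⁻ x in V, cauchyPDF t v x) + ENNReal.ofReal (v * (1 + 1 / r ^ 2)) := by
  have h1 : ∫⁻ x, cauchyPDF t v x = 1 := lintegral_cauchyPDF_eq_one t hv.ne'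
  have h2 : ∫⁻ x, cauchyPDF t 1 x = 1 := lintegral_cauchyPDF_eq_one t one_ne_zero
  rw [← lintegral_add_compl _ (measurableSet_ball (x := t) (ε := r))] at h1
  have h3 : ∫⁻ x in (Metric.ball t r)ᶜ, cauchyPDF t v x ≤ ENNReal.ofReal (v * (1 + 1 / r ^ 2)) := by
    calc ∫⁻ x in (Metric.ball t r)ᶜ, cauchyPDF t v x
        ≤ ∫⁻ x in (Metric.ball t r)ᶜ, ENNReal.ofReal (v * (1 + 1 / r ^ 2)) * cauchyPDF t 1 x := by
          refine setLIntegral_mono' measurableSet_ball.compl fun x hx => ?_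
          have hx' : r ≤ |x - t| := by
            simpa [Metric.mem_ball, Real.dist_eq] using hx
          rw [cauchyPDF, cauchyPDF, ← ENNReal.ofReal_mul (by positivity)]
          apply ENNReal.ofReal_le_ofReal
          rw [cauchyPDFReal_def, cauchyPDFReal_def]
          have hs : r ^ 2 ≤ (x - t) ^ 2 := by
            rw [← sq_abs (x - t)]; gcongr
          have hs0 : 0 < (x - t) ^ 2 := lt_of_lt_of_le (by positivity) hs
          have key : ((x - t) ^ 2 + (v : ℝ) ^ 2)⁻¹ ≤ (1 + 1 / r ^ 2) * ((x - t) ^ 2 + 1)⁻¹ := by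
            calc ((x - t) ^ 2 + (v : ℝ) ^ 2)⁻¹ ≤ ((x - t) ^ 2)⁻¹ := by
                  apply inv_anti₀ hs0; nlinarith [sq_nonneg (v : ℝ)]
              _ = (1 + 1 / (x - t) ^ 2) * ((x - t) ^ 2 + 1)⁻¹ := by
                  generalize (x - t) ^ 2 = y at hs0
                  field_simp
              _ ≤ _ := by gcongr
          simp only [NNReal.coe_one, one_pow, mul_one]
          have hpi : 0 ≤ Real.pi⁻¹ * (v : ℝ) := by positivity
          calc Real.pi⁻¹ * (v : ℝ) * ((x - t) ^ 2 + (v : ℝ) ^ 2)⁻¹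
              ≤ Real.pi⁻¹ * (v : ℝ) * ((1 + 1 / r ^ 2) * ((x - t) ^ 2 + 1)⁻¹) := by gcongr
            _ = _ := by ring
      _ ≤ ∫⁻ x, ENNReal.ofReal (v * (1 + 1 / r ^ 2)) * cauchyPDF t 1 x :=
          setLIntegral_le_lintegral _ _
      _ = _ := by
          rw [lintegral_const_mul _ (measurable_cauchyPDF t 1), h2, mul_one]
  rw [← h1]
  gcongr

/-- The smoothed densities at scales tending to zero do not lose mass on open sets. -/
theorem measure_open_le_liminf_smoothed (μ : Measure ℝ) [IsFiniteMeasure μ] {V : Set ℝ}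
    (hV : IsOpen V) :
    μ V ≤ liminf (fun k : ℕ => ∫⁻ x in V, smoothedDensity μ (((k : ℝ≥0) + 1)⁻¹ : ℝ≥0) x) atTop := by
  have hpos : ∀ k : ℕ, (0 : ℝ≥0) < ((k : ℝ≥0) + 1)⁻¹ := fun k => by positivity
  simp_rw [lintegral_smoothedDensity μ (hpos _)]
  rw [← lintegral_indicator_one hV.measurableSet]
  refine le_trans ?_ (lintegral_liminf_le fun k => ?_)
  · refine lintegral_mono fun t => ?_
    by_cases ht : t ∈ V
    · rw [Set.indicator_of_mem ht]
      obtain ⟨r, hr, hrV⟩ := Metric.isOpen_iff.1 hV t ht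
      have h0 : Tendsto (fun k : ℕ => ENNReal.ofReal (((((k : ℝ≥0) + 1)⁻¹ : ℝ≥0) : ℝ) * (1 + 1 / r ^ 2)))
          atTop (𝓝 0) := by
        have h1 : Tendsto (fun k : ℕ => 1 / ((k : ℝ) + 1)) atTop (𝓝 0) :=
          tendsto_one_div_add_atTop_nhds_zero_nat
        have h2 := ENNReal.tendsto_ofReal (h1.mul_const (1 + 1 / r ^ 2))
        rw [zero_mul, ENNReal.ofReal_zero] at h2
        refine h2.congr fun k => ?_
        congr 1
        push_cast
        rw [one_div ((k : ℝ) + 1)]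
      refine ENNReal.le_of_forall_pos_le_add fun ε hε _ => ?_
      have hev : ∀ᶠ k : ℕ in atTop, (1 : ℝ≥0∞) - ε
          ≤ ∫⁻ x in V, cauchyPDF t (((k : ℝ≥0) + 1)⁻¹) x := by
        filter_upwards [h0.eventually (gt_mem_nhds (show (0 : ℝ≥0∞) < ε by exact_mod_cast hε))]
          with k hk
        rw [tsub_le_iff_right]
        exact (one_le_lintegral_cauchyPDF_add hr hrV (hpos k)).trans (by gcongr)
      have := le_liminf_of_le (by isBoundedDefault) hev
      rw [tsub_le_iff_right] at this
      exact this
    · rw [Set.indicator_of_notMem ht]; exact bot_le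
  · exact Measurable.lintegral_prod_right (measurable_cauchyPDF_uncurry _)

/-- The convolution of a probability measure with the Cauchy law of scale `v`. -/
def smoothed (μ : Measure ℝ) (v : ℝ) : Measure ℝ := volume.withDensity (smoothedDensity μ v)

theorem isProbabilityMeasure_smoothed (μ : Measure ℝ) [IsProbabilityMeasure μ] {v : ℝ≥0}
    (hv : 0 < v) : IsProbabilityMeasure (smoothed μ v) := by
  constructor
  rw [smoothed, withDensity_apply _ MeasurableSet.univ, lintegral_smoothedDensity μ hv]
  simp [lintegral_cauchyPDF_eq_one _ hv.ne']

/-- A probability measure is determined by its Stieltjes transform. -/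
theorem eq_of_stieltjes_eq {μ μ' : ProbabilityMeasure ℝ}
    (h : ∀ z : ℂ, 0 < z.im → stieltjes (μ : Measure ℝ) z = stieltjes (μ' : Measure ℝ) z) :
    μ = μ' := by
  have hpos : ∀ k : ℕ, (0 : ℝ≥0) < ((k : ℝ≥0) + 1)⁻¹ := fun k => by positivity
  let s : ProbabilityMeasure ℝ → ℕ → ProbabilityMeasure ℝ := fun μ k =>
    ⟨smoothed μ (((k : ℝ≥0) + 1)⁻¹ : ℝ≥0), isProbabilityMeasure_smoothed _ (hpos k)⟩
  have hs : ∀ μ, Tendsto (s μ) atTop (𝓝 μ) := by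
    intro μ
    refine tendsto_of_forall_isOpen_le_liminf' fun G hG => ?_
    refine (measure_open_le_liminf_smoothed (μ : Measure ℝ) hG).trans (le_of_eq ?_)
    congr 1
    funext k
    simp only [ProbabilityMeasure.coe_mk, smoothed]
    rw [withDensity_apply _ hG.measurableSet]
  have he : s μ = s μ' := by
    funext k
    apply Subtype.ext
    simp only [s, smoothed]
    congr 1
    funext x
    rw [smoothedDensity, smoothedDensity, h]
    rw [Complex.add_im, Complex.ofReal_im, zero_add, Complex.im_ofReal_mul, Complex.I_im, mul_one]
    exact hpos k
  exact tendsto_nhds_unique (hs μ) (he ▸ hs μ')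

/-- Boundedness of the imaginary part of the Stieltjes transform above an open set makes the
measure absolutely continuous there. -/
theorem measure_inter_eq_zero_of_im_stieltjes_le (μ : Measure ℝ) [IsFiniteMeasure μ] {U : Set ℝ}
    (hU : IsOpen U) {C : ℝ} (hC : ∀ x ∈ U, ∀ v : ℝ, 0 < v → v ≤ 1 →
      (stieltjes μ (x + v * Complex.I)).im ≤ C) {N : Set ℝ} (hN : volume N = 0) :
    μ (N ∩ U) = 0 := by
  have hopen : ∀ V : Set ℝ, IsOpen V → V ⊆ U → μ V ≤ ENNReal.ofReal (Real.pi⁻¹ * C) * volume V := by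
    intro V hV hVU
    refine (measure_open_le_liminf_smoothed μ hV).trans ?_
    refine liminf_le_of_frequently_le' (Frequently.of_forall fun k => ?_)
    calc ∫⁻ x in V, smoothedDensity μ (((k : ℝ≥0) + 1)⁻¹ : ℝ≥0) x
        ≤ ∫⁻ x in V, ENNReal.ofReal (Real.pi⁻¹ * C) := by
          refine setLIntegral_mono' hV.measurableSet fun x hx => ?_
          apply ENNReal.ofReal_le_ofReal
          have h1 : (0 : ℝ) < ((((k : ℝ≥0) + 1)⁻¹ : ℝ≥0) : ℝ) := by
            have : (0 : ℝ≥0) < ((k : ℝ≥0) + 1)⁻¹ := by positivity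
            exact this
          have h2 : ((((k : ℝ≥0) + 1)⁻¹ : ℝ≥0) : ℝ) ≤ 1 := by
            push_cast
            apply inv_le_one_of_one_le₀
            have : (0 : ℝ) ≤ k := Nat.cast_nonneg k
            linarith
          have := hC x (hVU hx) _ h1 h2
          have hpi := Real.pi_pos
          gcongr
      _ = _ := by simp
  have hzero : volume (N ∩ U) = 0 := measure_mono_null Set.inter_subset_left hN
  refine le_antisymm (ENNReal.le_of_forall_pos_le_add fun ε hε _ => ?_) bot_le
  set K := ENNReal.ofReal (Real.pi⁻¹ * C) + 1 with hK
  have hK0 : K ≠ 0 := by simp [hK]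
  have hKt : K ≠ ∞ := by simp [hK]
  obtain ⟨V, hVs, hVo, hV⟩ := Set.exists_isOpen_lt_of_lt (N ∩ U) ((ε : ℝ≥0∞) / K)
    (by rw [hzero]; exact ENNReal.div_pos (by exact_mod_cast hε.ne') hKt)
  rw [zero_add]
  calc μ (N ∩ U) ≤ μ (V ∩ U) := measure_mono (Set.subset_inter hVs Set.inter_subset_right)
    _ ≤ ENNReal.ofReal (Real.pi⁻¹ * C) * volume (V ∩ U) :=
        hopen _ (hVo.inter hU) Set.inter_subset_right
    _ ≤ K * ((ε : ℝ≥0∞) / K) := by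
        gcongr
        · exact le_self_add
        · exact (measure_mono Set.inter_subset_left).trans hV.le
    _ = ε := ENNReal.mul_div_cancel hK0 hKt

/-- The mass far away is controlled by the Stieltjes transform on the imaginary axis. -/
theorem measureReal_abs_gt_le (μ : Measure ℝ) [IsProbabilityMeasure μ] {v : ℝ} (hv : 0 < v) :
    μ.real {t | v < ‖t‖} ≤ 2 * (1 - v * (stieltjes μ (v * Complex.I)).im) := by
  have h := im_stieltjes μ 0 hv
  rw [Complex.ofReal_zero, zero_add] at h
  have hint := integrable_poissonKernel μ 0 hv
  rw [h, ← integral_const_mul]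
  have h1 : (1 : ℝ) = ∫ _t : ℝ, (1 : ℝ) ∂μ := by simp
  have h2 : 2 * (1 - ∫ t : ℝ, v * (v / ((t - 0) ^ 2 + v ^ 2)) ∂μ)
      = ∫ t : ℝ, 2 * (1 - v * (v / ((t - 0) ^ 2 + v ^ 2))) ∂μ := by
    rw [integral_const_mul (2 : ℝ), integral_sub (integrable_const _) (hint.const_mul _), ← h1]
  rw [h2]
  have hms : MeasurableSet {t : ℝ | v < ‖t‖} := measurableSet_lt measurable_const measurable_norm
  rw [← integral_indicator_one hms]
  refine integral_mono ((integrable_const (1 : ℝ)).indicator hms)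
    (((integrable_const _).sub (hint.const_mul _)).const_mul _) fun t => ?_
  simp only [sub_zero]
  have hd : 0 < t ^ 2 + v ^ 2 := by positivity
  have e : 1 - v * (v / (t ^ 2 + v ^ 2)) = t ^ 2 / (t ^ 2 + v ^ 2) := by field_simp; ring
  rw [e]
  by_cases ht : t ∈ {t : ℝ | v < ‖t‖}
  · rw [Set.indicator_of_mem ht, Pi.one_apply, ← mul_div_assoc, le_div_iff₀ hd]
    have h3 : v ^ 2 ≤ |t| ^ 2 := by
      have : v < |t| := ht
      gcongr
    rw [sq_abs] at h3
    linarith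
  · rw [Set.indicator_of_notMem ht]
    positivity

/-- Convergence of the Stieltjes transforms to a limit `m` with `k Im m(i k) → 1` gives weak
convergence to a probability measure with Stieltjes transform `m`: the condition at infinity is
tightness, and the limit points are determined by `m`. -/
theorem exists_tendsto_of_tendsto_stieltjes {μs : ℕ → ProbabilityMeasure ℝ} {m : ℂ → ℂ}
    (h : ∀ z : ℂ, 0 < z.im → Tendsto (fun n => stieltjes (μs n : Measure ℝ) z) atTop (𝓝 (m z)))
    (hm : Tendsto (fun k : ℕ => (k : ℝ) * (m ((k : ℝ) * Complex.I)).im) atTop (𝓝 1)) :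
    ∃ μ : ProbabilityMeasure ℝ, Tendsto μs atTop (𝓝 μ) ∧
      ∀ z : ℂ, 0 < z.im → stieltjes (μ : Measure ℝ) z = m z := by
  have htight : IsTightMeasureSet (Set.range fun n => (μs n : Measure ℝ)) := by
    apply isTightMeasureSet_range_of_tendsto_limsup_measure_norm_gt
    rw [ENNReal.tendsto_atTop_zero]
    intro ε hε
    obtain ⟨δ, hδ, hδε⟩ : ∃ δ : ℝ≥0, 0 < δ ∧ (δ : ℝ≥0∞) ≤ ε := by
      obtain ⟨δ, h1, h2⟩ := ENNReal.lt_iff_exists_nnreal_btwn.1 hε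
      exact ⟨δ, by exact_mod_cast h1, h2.le⟩
    have hev : ∀ᶠ k : ℕ in atTop, 1 - (δ : ℝ) / 4 < (k : ℝ) * (m ((k : ℝ) * Complex.I)).im :=
      hm.eventually (lt_mem_nhds (by have : (0 : ℝ) < δ := hδ; linarith))
    obtain ⟨k, hk, hk1⟩ := (hev.and (eventually_ge_atTop 1)).exists
    have hk0 : (0 : ℝ) < k := by exact_mod_cast hk1
    refine ⟨k, fun r hr => ?_⟩
    refine limsup_le_of_le (by isBoundedDefault) ?_
    have hz : 0 < ((k : ℝ) * Complex.I).im := by simpa using hk0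
    have hlim := ((Complex.continuous_im.tendsto _).comp (h _ hz)).const_mul (k : ℝ)
    have hev2 := hlim.eventually (lt_mem_nhds (show 1 - (δ : ℝ) / 2 <
      (k : ℝ) * (m ((k : ℝ) * Complex.I)).im by have : (0 : ℝ) < δ := hδ; linarith))
    filter_upwards [hev2] with n hn
    refine le_trans ?_ hδε
    calc (μs n : Measure ℝ) {x | r < ‖x‖} ≤ (μs n : Measure ℝ) {x | (k : ℝ) < ‖x‖} :=
          measure_mono fun x hx => lt_of_le_of_lt hr hx
      _ = ENNReal.ofReal ((μs n : Measure ℝ).real {x | (k : ℝ) < ‖x‖}) := by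
          rw [ofReal_measureReal]
      _ ≤ ENNReal.ofReal δ := by
          apply ENNReal.ofReal_le_ofReal
          refine (measureReal_abs_gt_le (μs n : Measure ℝ) hk0).trans ?_
          simp only [Function.comp] at hn
          linarith
      _ = δ := ENNReal.ofReal_coe_nnreal
  -- by tightness every ultrafilter has a limit, and its transform `m` determines it
  have hcomp : IsCompact (closure (Set.range μs)) := by
    apply isCompact_closure_of_isTightMeasureSet
    refine htight.subset ?_
    rintro _ ⟨μ, ⟨n, rfl⟩, rfl⟩
    exact ⟨n, rfl⟩
  have hmem : ∀ᶠ n in (atTop : Filter ℕ), μs n ∈ closure (Set.range μs) :=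
    Eventually.of_forall fun n => subset_closure ⟨n, rfl⟩
  have hclu : ∀ (U : Ultrafilter ℕ) (μ' : ProbabilityMeasure ℝ), (U : Filter ℕ) ≤ atTop →
      Tendsto μs U (𝓝 μ') → ∀ z : ℂ, 0 < z.im → stieltjes (μ' : Measure ℝ) z = m z :=
    fun U μ' hU hμ' z hz => tendsto_nhds_unique (tendsto_stieltjes hμ' hz) ((h z hz).mono_left hU)
  have hex : ∀ U : Ultrafilter ℕ, (U : Filter ℕ) ≤ atTop →
      ∃ μ' : ProbabilityMeasure ℝ, Tendsto μs U (𝓝 μ') := by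
    intro U hU
    obtain ⟨μ', -, hμ'⟩ := hcomp.ultrafilter_le_nhds (U.map μs)
      (le_principal_iff.2 (hU hmem))
    exact ⟨μ', hμ'⟩
  obtain ⟨μ, hμ⟩ := hex (Ultrafilter.of atTop) (Ultrafilter.of_le _)
  have hμm := hclu _ μ (Ultrafilter.of_le _) hμ
  refine ⟨μ, ?_, hμm⟩
  refine (tendsto_iff_ultrafilter _ _ _).2 fun U hU => ?_
  obtain ⟨μ', hμ'⟩ := hex U hU
  have : μ' = μ := eq_of_stieltjes_eq fun z hz => by rw [hclu U μ' hU hμ' z hz, hμm z hz]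
  exact this ▸ hμ'

/-- The atom of `μ` at `x` is read off from the Stieltjes transform above `x`. -/
theorem tendsto_mul_stieltjes_atom (μ : Measure ℝ) [IsProbabilityMeasure μ] (x : ℝ) :
    Tendsto (fun k : ℕ => (((1 / ((k : ℝ) + 1) : ℝ) : ℂ)) *
      stieltjes μ (x + ((1 / ((k : ℝ) + 1) : ℝ) : ℂ) * Complex.I)) atTop
      (𝓝 (Complex.I * (μ.real {x} : ℂ))) := by
  have hv : ∀ k : ℕ, (0 : ℝ) < 1 / ((k : ℝ) + 1) := fun k => by positivity
  have hz : ∀ k : ℕ, 0 < ((x : ℂ) + ((1 / ((k : ℝ) + 1) : ℝ) : ℂ) * Complex.I).im := fun k => by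
    rw [Complex.add_im, Complex.ofReal_im, zero_add, Complex.im_ofReal_mul, Complex.I_im, mul_one]
    exact hv k
  have hlim : Complex.I * (μ.real {x} : ℂ)
      = ∫ t, ({x} : Set ℝ).indicator (fun _ => Complex.I) t ∂μ := by
    rw [integral_indicator (measurableSet_singleton x), setIntegral_const]
    rw [mul_comm]; rfl
  rw [hlim]
  simp only [stieltjes]
  simp_rw [← integral_const_mul]
  refine tendsto_integral_of_dominated_convergence (fun _ => 1) ?_ (integrable_const _) ?_ ?_
  · intro k
    exact ((continuous_one_div_sub (hz k)).const_mul _).aestronglyMeasurable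
  · intro k
    refine ae_of_all _ fun t => ?_
    rw [norm_mul, Complex.norm_real, Real.norm_eq_abs, abs_of_pos (hv k)]
    have := norm_one_div_sub_le (hz k) t
    have e : ((x : ℂ) + ((1 / ((k : ℝ) + 1) : ℝ) : ℂ) * Complex.I).im = 1 / ((k : ℝ) + 1) := by
      rw [Complex.add_im, Complex.ofReal_im, zero_add, Complex.im_ofReal_mul, Complex.I_im, mul_one]
    rw [e] at this
    calc _ ≤ (1 / ((k : ℝ) + 1)) * (1 / (1 / ((k : ℝ) + 1))) := by gcongr
      _ = 1 := by have := hv k; field_simp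
  · refine ae_of_all _ fun t => ?_
    have h0 : Tendsto (fun k : ℕ => ((1 / ((k : ℝ) + 1) : ℝ) : ℂ)) atTop (𝓝 0) := by
      have := (Complex.continuous_ofReal.tendsto 0).comp
        (tendsto_one_div_add_atTop_nhds_zero_nat (𝕜 := ℝ))
      simpa [Function.comp_def] using this
    by_cases ht : t = x
    · subst ht
      rw [Set.indicator_of_mem (Set.mem_singleton _)]
      refine tendsto_const_nhds.congr fun k => ?_
      have : ((1 / ((k : ℝ) + 1) : ℝ) : ℂ) ≠ 0 := by exact_mod_cast (hv k).ne'
      generalize ((1 / ((k : ℝ) + 1) : ℝ) : ℂ) = y at this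
      rw [sub_add_cancel_left, one_div, ← neg_inv, mul_inv, Complex.inv_I]
      field_simp
    · rw [Set.indicator_of_notMem (by simpa using ht)]
      have hne : (t : ℂ) - x ≠ 0 := by
        rw [sub_ne_zero]; exact_mod_cast ht
      have h1 : Tendsto (fun k : ℕ => 1 / ((t : ℂ) - (x + ((1 / ((k : ℝ) + 1) : ℝ) : ℂ) * Complex.I)))
          atTop (𝓝 (1 / ((t : ℂ) - (x + 0 * Complex.I)))) := by
        refine tendsto_const_nhds.div (tendsto_const_nhds.sub (tendsto_const_nhds.add
          (h0.mul_const _))) (by simpa using hne)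
      simpa using h0.mul h1

end Stieltjes

/-! ### Consequences of the limiting equation for the limit measure -/

/-- Solutions of the limiting equation satisfy the bound of a Stieltjes transform: the imaginary
part of the equation gives `Im z ≤ Im m / |m|²`. -/
theorem LimitEq.norm_le {γ a ν : ℝ} (hγ : 0 < γ) (hν : a ^ 2 ≤ ν) {z m : ℂ} (hz : 0 < z.im)
    (hm : 0 < m.im) (h : LimitEq γ a ν z m) : ‖m‖ ≤ 1 / z.im := by
  have h1 := h.im_identity
  have p : 0 < ‖m‖ := norm_pos_iff.2 (ne_zero_of_im_pos hm)
  have h2 : 0 ≤ a ^ 2 / γ * (m.im / Complex.normSq (1 + (a / γ : ℂ) * m)) :=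
    mul_nonneg (by positivity) (div_nonneg hm.le (Complex.normSq_nonneg _))
  have h3 : 0 ≤ (ν - a ^ 2) / γ * m.im := mul_nonneg (div_nonneg (by linarith) hγ.le) hm.le
  have h4 : z.im ≤ m.im / Complex.normSq m := by linarith
  rw [Complex.normSq_eq_norm_sq, le_div_iff₀ (by positivity)] at h4
  have h5 := (le_abs_self _).trans (Complex.abs_im_le_norm m)
  rw [le_div_iff₀ hz]
  by_contra hcon
  nlinarith

/-- The solution of the limiting equation behaves like `-1/z` at infinity. -/
theorem tendsto_mul_im_of_limitEq {γ a ν : ℝ} (hγ : 0 < γ) (hν : a ^ 2 ≤ ν) {m : ℂ → ℂ}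
    (him : ∀ z : ℂ, 0 < z.im → 0 < (m z).im)
    (hm : ∀ z : ℂ, 0 < z.im → LimitEq γ a ν z (m z)) :
    Tendsto (fun k : ℕ => (k : ℝ) * (m ((k : ℝ) * Complex.I)).im) atTop (𝓝 1) := by
  set s : ℕ → ℂ := fun k => m ((k : ℝ) * Complex.I) with hs
  have hz : ∀ k : ℕ, 1 ≤ k → 0 < (((k : ℝ) : ℂ) * Complex.I).im := fun k hk => by
    rw [Complex.im_ofReal_mul, Complex.I_im, mul_one]; exact_mod_cast hk
  have hs0 : Tendsto s atTop (𝓝 0) := by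
    refine squeeze_zero_norm' ?_ tendsto_one_div_atTop_nhds_zero_nat
    filter_upwards [eventually_ge_atTop 1] with k hk
    have := (hm _ (hz k hk)).norm_le hγ hν (hz k hk) (him _ (hz k hk))
    rwa [Complex.im_ofReal_mul, Complex.I_im, mul_one] at this
  have hlim : Tendsto (fun k => -1 - s k * (a * (1 - 1 / (1 + (a / γ : ℂ) * s k))
      + ((ν - a ^ 2) / γ : ℂ) * s k)) atTop (𝓝 (-1 - 0 * (a * (1 - 1 / (1 + (a / γ : ℂ) * 0))
      + ((ν - a ^ 2) / γ : ℂ) * 0))) := by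
    refine tendsto_const_nhds.sub (hs0.mul ((tendsto_const_nhds.mul (tendsto_const_nhds.sub
      (tendsto_const_nhds.div (tendsto_const_nhds.add (hs0.const_mul _)) ?_))).add
      (hs0.const_mul _)))
    simp
  have h2 := (Complex.continuous_re.tendsto _).comp hlim
  have e0 : (-1 - 0 * (a * (1 - 1 / (1 + (a / γ : ℂ) * 0)) + ((ν - a ^ 2) / γ : ℂ) * 0) : ℂ).re
      = -1 := by simp
  rw [e0] at h2
  have h3 := h2.neg
  rw [neg_neg] at h3
  refine h3.congr' ?_
  filter_upwards [eventually_ge_atTop 1] with k hk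
  have e := hm _ (hz k hk)
  have hne : s k ≠ 0 := ne_zero_of_im_pos (him _ (hz k hk))
  have e2 : -1 - s k * (a * (1 - 1 / (1 + (a / γ : ℂ) * s k)) + ((ν - a ^ 2) / γ : ℂ) * s k)
      = (k : ℝ) * (Complex.I * s k) := by
    have e3 : -1 / s k = _ := e
    rw [div_eq_iff hne] at e3
    linear_combination e3
  simp only [Function.comp]
  rw [e2, Complex.re_ofReal_mul, Complex.I_mul_re]
  ring

/-- For `a² < ν` the Stieltjes transform is bounded on the whole upper half-plane. -/
theorem absolutelyContinuous_of_lt {γ a ν : ℝ} (hγ : 0 < γ) (hν : a ^ 2 < ν)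
    (μ : ProbabilityMeasure ℝ)
    (hm : ∀ z : ℂ, 0 < z.im → LimitEq γ a ν z (stieltjes (μ : Measure ℝ) z)) :
    (μ : Measure ℝ) ≪ volume := by
  intro N hN
  rw [← Set.inter_univ N]
  refine measure_inter_eq_zero_of_im_stieltjes_le _ isOpen_univ (C := 1 + γ / (ν - a ^ 2)) ?_ hN
  intro x _ v hv _
  have hz : 0 < ((x : ℂ) + v * Complex.I).im := by simpa using hv
  have h1 := (hm _ hz).norm_sq_mul_le hγ hz (im_stieltjes_pos _ hz)
  have h2 := (le_abs_self _).trans (Complex.abs_im_le_norm (stieltjes (μ : Measure ℝ)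
    (x + v * Complex.I)))
  have hp : 0 < ν - a ^ 2 := by linarith
  set q := ‖stieltjes (μ : Measure ℝ) (x + v * Complex.I)‖
  have h3 : q ^ 2 ≤ γ / (ν - a ^ 2) := by
    rw [le_div_iff₀ hp]
    calc q ^ 2 * (ν - a ^ 2) = γ * ((ν - a ^ 2) / γ * q ^ 2) := by field_simp
      _ ≤ γ * 1 := by gcongr
      _ = γ := mul_one _
  nlinarith [sq_nonneg (q - 1)]

/-- In the Marchenko-Pastur case `ν = a²` the equation is quadratic: the Stieltjes transform is
locally bounded away from `-a`, and for `γ ≥ 1` the point `-a` is not an atom. -/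
theorem absolutelyContinuous_of_eq {γ a : ℝ} (hγ : 1 ≤ γ) (ha : a ≠ 0)
    (μ : ProbabilityMeasure ℝ)
    (hm : ∀ z : ℂ, 0 < z.im → LimitEq γ a (a ^ 2) z (stieltjes (μ : Measure ℝ) z)) :
    (μ : Measure ℝ) ≪ volume := by
  have hγ0 : 0 < γ := by linarith
  have hγc : (γ : ℂ) ≠ 0 := by exact_mod_cast hγ0.ne'
  have hac : (a : ℂ) ≠ 0 := by exact_mod_cast ha
  set s := stieltjes (μ : Measure ℝ) with hs
  set b : ℝ := a / γ with hb
  have hb0 : b ≠ 0 := div_ne_zero ha hγ0.ne'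
  have hbc : (b : ℂ) = (a / γ : ℂ) := by rw [hb]; push_cast; rfl
  have hquad : ∀ z : ℂ, 0 < z.im → b * (z + a) * s z ^ 2 + (z + b) * s z + 1 = 0 := by
    intro z hz
    have h := (limitEq_iff_limitPoly hγ0 (im_stieltjes_pos _ hz)).1 (hm z hz)
    rw [limitPoly] at h
    have e : (a ^ 2 / γ : ℂ) = a * b := by rw [hbc]; ring
    have e2 : (((a ^ 2 : ℝ) : ℂ) - (a : ℂ) ^ 2) / γ = 0 := by push_cast; simp
    rw [e, e2, ← hbc] at h
    linear_combination h
  -- no atom at `-a`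
  have hatom : (μ : Measure ℝ) {-a} = 0 := by
    set M := (μ : Measure ℝ).real {-a} with hM
    have hM0 : 0 ≤ M := measureReal_nonneg
    have hlim := tendsto_mul_stieltjes_atom (μ : Measure ℝ) (-a)
    set ε : ℕ → ℂ := fun k => ((1 / ((k : ℝ) + 1) : ℝ) : ℂ) with hε
    have hε0 : Tendsto ε atTop (𝓝 0) := by
      have := (Complex.continuous_ofReal.tendsto 0).comp
        (tendsto_one_div_add_atTop_nhds_zero_nat (𝕜 := ℝ))
      rw [Complex.ofReal_zero] at this
      exact this
    set y : ℕ → ℂ := fun k => ε k * s ((-a : ℝ) + ε k * Complex.I) with hy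
    have hy0 : Tendsto y atTop (𝓝 (Complex.I * (M : ℂ))) := hlim
    -- the quadratic equation at `-a + i ε`, multiplied by `ε`; in the limit it is an equation for the
    -- mass `M` of `-a`
    have hyq : ∀ k, b * Complex.I * y k ^ 2 + (b - a + ε k * Complex.I) * y k + ε k = 0 := by
      intro k
      have hz : 0 < (((-a : ℝ) : ℂ) + ε k * Complex.I).im := by
        simp only [hε]
        rw [Complex.add_im, Complex.ofReal_im, zero_add, Complex.im_ofReal_mul, Complex.I_im,
          mul_one]
        positivity
      have := hquad _ hz
      simp only [hy]
      push_cast at this ⊢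
      linear_combination ε k * this
    have hlim2 := (((hy0.pow 2).const_mul (b * Complex.I)).add
      ((tendsto_const_nhds (x := (b - a : ℂ))).add (hε0.mul_const Complex.I) |>.mul hy0)).add hε0
    have h0 := tendsto_nhds_unique (hlim2.congr hyq) tendsto_const_nhds
    have h1 : M * (b - a - b * M) = 0 := by
      have h2 : Complex.I * ((M * (b - a - b * M) : ℝ) : ℂ) = 0 := by
        push_cast
        have hI := Complex.I_sq
        linear_combination h0 - (b * M ^ 2 : ℂ) * Complex.I * hI
      exact_mod_cast (mul_eq_zero.1 h2).resolve_left Complex.I_ne_zero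
    have hMz : M = 0 := by
      rcases mul_eq_zero.1 h1 with h | h
      · exact h
      · have h3 : b * (1 - γ - M) = 0 := by
          have : b * γ = a := by rw [hb]; field_simp
          linear_combination h - this
        have := (mul_eq_zero.1 h3).resolve_left hb0
        linarith
    rwa [hM, measureReal_eq_zero_iff] at hMz
  intro N hN
  -- away from `-a` the leading coefficient of the quadratic equation is bounded below on bounded sets
  have hcover : N ⊆ {-a} ∪ ⋃ j : ℕ, N ∩ {x : ℝ | 1 / ((j : ℝ) + 1) < |x + a| ∧ |x| < (j : ℝ) + 1} := by
    intro x hx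
    by_cases hxa : x = -a
    · left; exact hxa
    · right
      have hpos : 0 < |x + a| := abs_pos.2 fun h => hxa (by linarith)
      obtain ⟨j₁, hj₁⟩ := exists_nat_one_div_lt hpos
      obtain ⟨j₂, hj₂⟩ := exists_nat_gt |x|
      refine Set.mem_iUnion.2 ⟨max j₁ j₂, hx, ?_, ?_⟩
      · refine lt_of_le_of_lt ?_ hj₁
        gcongr
        exact le_max_left _ _
      · have : (j₂ : ℝ) ≤ ((max j₁ j₂ : ℕ) : ℝ) := by exact_mod_cast le_max_right _ _
        linarith
  refine measure_mono_null hcover (measure_union_null hatom (measure_iUnion_null fun j => ?_))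
  refine measure_inter_eq_zero_of_im_stieltjes_le _
    (C := 1 + ((j : ℝ) + 3 + |b|) / (|b| / ((j : ℝ) + 1))) ?_ ?_ hN
  · exact (isOpen_lt continuous_const (continuous_id.add continuous_const).abs).inter
      (isOpen_lt continuous_abs continuous_const)
  · rintro x ⟨hx1, hx2⟩ v hv hv1
    have hz : 0 < ((x : ℂ) + v * Complex.I).im := by simpa using hv
    have hq := hquad _ hz
    have h2 := (le_abs_self _).trans (Complex.abs_im_le_norm (s (x + v * Complex.I)))
    refine h2.trans ?_
    set w := s (x + v * Complex.I)
    set z : ℂ := x + v * Complex.I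
    have hza : 1 / ((j : ℝ) + 1) ≤ ‖z + a‖ := by
      have := Complex.abs_re_le_norm (z + a)
      have e : (z + a).re = x + a := by simp [z]
      rw [e] at this
      linarith
    have hzb : ‖z + b‖ ≤ (j : ℝ) + 2 + |b| := by
      calc ‖z + b‖ ≤ ‖z‖ + ‖(b : ℂ)‖ := norm_add_le _ _
        _ ≤ (‖(x : ℂ)‖ + ‖(v : ℂ) * Complex.I‖) + ‖(b : ℂ)‖ := by gcongr; exact norm_add_le _ _
        _ ≤ _ := by
          rw [norm_mul, Complex.norm_I, Complex.norm_real, Complex.norm_real, Complex.norm_real,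
            Real.norm_eq_abs, Real.norm_eq_abs, Real.norm_eq_abs, abs_of_pos hv]
          linarith
    have hpos : 0 < |b| / ((j : ℝ) + 1) := div_pos (abs_pos.2 hb0) (by positivity)
    by_cases hw : ‖w‖ ≤ 1
    · have : 0 ≤ ((j : ℝ) + 3 + |b|) / (|b| / ((j : ℝ) + 1)) := by positivity
      linarith
    · push Not at hw
      have e : b * (z + a) * w ^ 2 = -((z + b) * w + 1) := by linear_combination hq
      have e2 := congrArg norm e
      rw [norm_neg, norm_mul, norm_mul, norm_pow, Complex.norm_real, Real.norm_eq_abs] at e2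
      have h3 : ‖(z + b) * w + 1‖ ≤ ((j : ℝ) + 3 + |b|) * ‖w‖ := by
        calc ‖(z + b) * w + 1‖ ≤ ‖z + b‖ * ‖w‖ + 1 := by
              refine (norm_add_le _ _).trans ?_
              rw [norm_mul, norm_one]
          _ ≤ ((j : ℝ) + 2 + |b|) * ‖w‖ + ‖w‖ := by gcongr
          _ = _ := by ring
      have h4 : |b| / ((j : ℝ) + 1) * ‖w‖ ^ 2 ≤ |b| * ‖z + a‖ * ‖w‖ ^ 2 := by
        rw [div_eq_mul_one_div]
        gcongr
      have h5 : |b| / ((j : ℝ) + 1) * ‖w‖ ≤ (j : ℝ) + 3 + |b| := by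
        have hw0 : 0 < ‖w‖ := by linarith
        have : |b| / ((j : ℝ) + 1) * ‖w‖ * ‖w‖ ≤ ((j : ℝ) + 3 + |b|) * ‖w‖ := by nlinarith
        exact le_of_mul_le_mul_right this hw0
      have : ‖w‖ ≤ ((j : ℝ) + 3 + |b|) / (|b| / ((j : ℝ) + 1)) := by
        rw [le_div_iff₀ hpos]; linarith
      linarith

/-! ### Resolvents of real symmetric matrices -/

section Resolvent

open Matrix

variable {ι : Type*} [Fintype ι]

/-- The squared Euclidean norm of a complex vector. -/
def nsq (u : ι → ℂ) : ℝ := ∑ i, ‖u i‖ ^ 2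

theorem nsq_nonneg (u : ι → ℂ) : 0 ≤ nsq u := Finset.sum_nonneg fun _ _ => by positivity

theorem norm_sq_le_nsq (u : ι → ℂ) (i : ι) : ‖u i‖ ^ 2 ≤ nsq u :=
  Finset.single_le_sum (f := fun i => ‖u i‖ ^ 2) (fun _ _ => by positivity) (Finset.mem_univ i)

theorem norm_dotProduct_le (u w : ι → ℂ) : ‖u ⬝ᵥ w‖ ≤ √(nsq u) * √(nsq w) := by
  calc ‖u ⬝ᵥ w‖ ≤ ∑ i, ‖u i‖ * ‖w i‖ := by
        refine (norm_sum_le _ _).trans (Finset.sum_le_sum fun i _ => by rw [norm_mul])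
    _ ≤ _ := Real.sum_mul_le_sqrt_mul_sqrt _ _ _

theorem nsq_star (u : ι → ℂ) : nsq (star u) = nsq u := by simp [nsq]

theorem star_dotProduct_self (u : ι → ℂ) : star u ⬝ᵥ u = (nsq u : ℂ) := by
  rw [nsq, dotProduct]
  push_cast
  refine Finset.sum_congr rfl fun i _ => ?_
  simp only [Pi.star_apply, RCLike.star_def]
  rw [← Complex.normSq_eq_conj_mul_self, Complex.normSq_eq_norm_sq]
  push_cast; rfl

/-- A bound `c` for the Euclidean operator norm of a complex matrix. -/
def OpBound (M : Matrix ι ι ℂ) (c : ℝ) : Prop := ∀ u : ι → ℂ, nsq (M *ᵥ u) ≤ c ^ 2 * nsq u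

theorem OpBound.norm_dotProduct_mulVec_le {M : Matrix ι ι ℂ} {c : ℝ} (hc : 0 ≤ c)
    (h : OpBound M c) (u w : ι → ℂ) : ‖u ⬝ᵥ (M *ᵥ w)‖ ≤ c * (√(nsq u) * √(nsq w)) := by
  refine (norm_dotProduct_le _ _).trans ?_
  calc √(nsq u) * √(nsq (M *ᵥ w)) ≤ √(nsq u) * √(c ^ 2 * nsq w) := by gcongr; exact h w
    _ = √(nsq u) * (c * √(nsq w)) := by rw [Real.sqrt_mul (sq_nonneg c), Real.sqrt_sq hc]
    _ = _ := by ring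

theorem norm_sum_mul_mul_le (w : ι → ℂ) (B : ι → ι → ℂ) :
    ‖∑ j, ∑ k, w j * w k * B j k‖ ≤ nsq w * √(∑ j, ∑ k, ‖B j k‖ ^ 2) := by
  have h1 := norm_dotProduct_le (fun q : ι × ι => w q.1 * w q.2) (fun q : ι × ι => B q.1 q.2)
  simp only [nsq, dotProduct, Fintype.sum_prod_type, norm_mul, mul_pow] at h1
  refine h1.trans (le_of_eq ?_)
  have h2 := Real.sqrt_mul_self (nsq_nonneg w)
  rw [nsq] at h2 ⊢
  rw [← Finset.sum_mul_sum, h2]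

variable [DecidableEq ι]

theorem nsq_single (i : ι) : nsq (Pi.single i (1 : ℂ)) = 1 := by
  rw [nsq, Finset.sum_eq_single i]
  · simp
  · intro j _ hj; simp [hj]
  · simp

theorem OpBound.sum_norm_sq_le {M : Matrix ι ι ℂ} {c : ℝ} (h : OpBound M c) :
    ∑ j, ∑ k, ‖M j k‖ ^ 2 ≤ c ^ 2 * Fintype.card ι := by
  rw [Finset.sum_comm]
  have : ∀ k, ∑ j, ‖M j k‖ ^ 2 ≤ c ^ 2 := by
    intro k
    have := h (Pi.single k 1)
    rw [nsq_single, mul_one, mulVec_single_one] at this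
    exact this
  calc _ ≤ ∑ _k : ι, c ^ 2 := Finset.sum_le_sum fun k _ => this k
    _ = _ := by simp [mul_comm]

theorem OpBound.norm_entry_le {M : Matrix ι ι ℂ} {c : ℝ} (hc : 0 ≤ c) (h : OpBound M c) (j k : ι) :
    ‖M j k‖ ≤ c := by
  have h1 := h (Pi.single k 1)
  rw [nsq_single, mul_one, mulVec_single_one] at h1
  have h2 := (norm_sq_le_nsq (M.col k) j).trans h1
  exact le_of_sq_le_sq h2 hc

theorem OpBound.norm_sum_mul_le {M : Matrix ι ι ℂ} {c : ℝ} (hc : 0 ≤ c) (h : OpBound M c)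
    (D : ι → ι → ℂ) : ‖∑ j, ∑ k, M j k * D j k‖
      ≤ c * (√(Fintype.card ι) * √(∑ j, ∑ k, ‖D j k‖ ^ 2)) := by
  have h1 := norm_dotProduct_le (fun q : ι × ι => M q.1 q.2) (fun q : ι × ι => D q.1 q.2)
  simp only [nsq, dotProduct, Fintype.sum_prod_type] at h1
  refine h1.trans ?_
  rw [← mul_assoc]
  gcongr
  rw [← Real.sqrt_sq hc, ← Real.sqrt_mul (sq_nonneg c)]
  exact Real.sqrt_le_sqrt h.sum_norm_sq_le

theorem OpBound.norm_trace_le {M : Matrix ι ι ℂ} {c : ℝ} (hc : 0 ≤ c) (h : OpBound M c) :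
    ‖M.trace‖ ≤ c * Fintype.card ι := by
  refine (norm_sum_le _ _).trans ?_
  calc _ ≤ ∑ _i : ι, c := Finset.sum_le_sum fun i _ => h.norm_entry_le hc i i
    _ = _ := by simp [mul_comm]

/-- The matrix `A - z` over the complex numbers. -/
def shifted (A : Matrix ι ι ℝ) (z : ℂ) : Matrix ι ι ℂ := A.map Complex.ofReal - z • 1

/-- The resolvent `(A - z)⁻¹`. -/
def resolv (A : Matrix ι ι ℝ) (z : ℂ) : Matrix ι ι ℂ := (shifted A z)⁻¹

theorem shifted_mulVec (A : Matrix ι ι ℝ) (z : ℂ) (u : ι → ℂ) :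
    shifted A z *ᵥ u = A.map Complex.ofReal *ᵥ u - z • u := by
  rw [shifted, sub_mulVec, smul_mulVec, one_mulVec]

theorem im_star_dotProduct_shifted {A : Matrix ι ι ℝ} (hA : A.IsSymm) (z : ℂ) (u : ι → ℂ) :
    (star u ⬝ᵥ (shifted A z *ᵥ u)).im = - (z.im * nsq u) := by
  have hH : (A.map Complex.ofReal).IsHermitian := by
    ext i j
    simp only [conjTranspose_apply, map_apply, RCLike.star_def, Complex.conj_ofReal]
    rw [hA.apply]
  have h1 := hH.im_star_dotProduct_mulVec_self u
  simp only [RCLike.im_to_complex] at h1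
  rw [shifted_mulVec, dotProduct_sub, Complex.sub_im, h1, dotProduct_smul, star_dotProduct_self,
    smul_eq_mul, Complex.im_mul_ofReal]
  ring

theorem nsq_shifted_ge {A : Matrix ι ι ℝ} (hA : A.IsSymm) {z : ℂ} (hz : 0 < z.im) (u : ι → ℂ) :
    z.im ^ 2 * nsq u ≤ nsq (shifted A z *ᵥ u) := by
  have h1 : z.im * nsq u ≤ √(nsq u) * √(nsq (shifted A z *ᵥ u)) := by
    have := (Complex.abs_im_le_norm _).trans (norm_dotProduct_le (star u) (shifted A z *ᵥ u))
    rw [im_star_dotProduct_shifted hA, nsq_star, abs_neg, abs_of_nonneg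
      (mul_nonneg hz.le (nsq_nonneg u))] at this
    exact this
  have h2 := Real.sq_sqrt (nsq_nonneg u)
  have h3 := Real.sq_sqrt (nsq_nonneg (shifted A z *ᵥ u))
  by_cases h0 : nsq u = 0
  · rw [h0, mul_zero]; exact nsq_nonneg _
  have hpos : 0 < nsq u := lt_of_le_of_ne (nsq_nonneg u) (Ne.symm h0)
  have h4 : (z.im * nsq u) ^ 2 ≤ nsq u * nsq (shifted A z *ᵥ u) := by
    calc (z.im * nsq u) ^ 2 ≤ (√(nsq u) * √(nsq (shifted A z *ᵥ u))) ^ 2 := by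
          apply pow_le_pow_left₀ (mul_nonneg hz.le hpos.le) h1
      _ = _ := by rw [mul_pow, h2, h3]
  have h5 : nsq u * (z.im ^ 2 * nsq u) ≤ nsq u * nsq (shifted A z *ᵥ u) := by nlinarith
  exact le_of_mul_le_mul_left h5 hpos

theorem isUnit_shifted {A : Matrix ι ι ℝ} (hA : A.IsSymm) {z : ℂ} (hz : 0 < z.im) :
    IsUnit (shifted A z) := by
  rw [← mulVec_injective_iff_isUnit]
  intro u w huw
  have h0 : shifted A z *ᵥ (u - w) = 0 := by
    rw [mulVec_sub]; exact sub_eq_zero.2 huw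
  have h1 := nsq_shifted_ge hA hz (u - w)
  rw [h0] at h1
  have h2 : nsq (0 : ι → ℂ) = 0 := by simp [nsq]
  rw [h2] at h1
  have h3 : nsq (u - w) ≤ 0 := by
    by_contra hcon
    push Not at hcon
    have : 0 < z.im ^ 2 * nsq (u - w) := by positivity
    linarith
  funext i
  have h4 := (norm_sq_le_nsq (u - w) i).trans h3
  have h5 : ‖(u - w) i‖ = 0 := by nlinarith [norm_nonneg ((u - w) i)]
  have := norm_eq_zero.1 h5
  simpa [sub_eq_zero] using this

theorem shifted_mul_resolv {A : Matrix ι ι ℝ} (hA : A.IsSymm) {z : ℂ} (hz : 0 < z.im) :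
    shifted A z * resolv A z = 1 :=
  mul_nonsing_inv _ ((isUnit_iff_isUnit_det _).1 (isUnit_shifted hA hz))

theorem resolv_mul_shifted {A : Matrix ι ι ℝ} (hA : A.IsSymm) {z : ℂ} (hz : 0 < z.im) :
    resolv A z * shifted A z = 1 :=
  nonsing_inv_mul _ ((isUnit_iff_isUnit_det _).1 (isUnit_shifted hA hz))

theorem resolv_isSymm {A : Matrix ι ι ℝ} (hA : A.IsSymm) (z : ℂ) : (resolv A z).IsSymm := by
  have : (shifted A z).IsSymm := by
    ext i j
    simp only [shifted, transpose_apply, Matrix.sub_apply, map_apply, Matrix.smul_apply, one_apply, eq_comm (a := i)]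
    rw [hA.apply]
  rw [IsSymm, resolv, transpose_nonsing_inv, this.eq]

theorem opBound_resolv {A : Matrix ι ι ℝ} (hA : A.IsSymm) {z : ℂ} (hz : 0 < z.im) :
    OpBound (resolv A z) (1 / z.im) := by
  intro u
  have h := nsq_shifted_ge hA hz (resolv A z *ᵥ u)
  rw [mulVec_mulVec, shifted_mul_resolv hA hz, one_mulVec] at h
  rw [one_div, inv_pow, ← div_eq_inv_mul, le_div_iff₀ (by positivity)]
  linarith

/-- The matrix `A` with its `i`-th row and column replaced by zero. -/
def cut {κ : Type*} [DecidableEq κ] (A : Matrix κ κ ℝ) (i : κ) : Matrix κ κ ℝ :=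
  of fun j k => if j = i ∨ k = i then 0 else A j k

theorem cut_isSymm {κ : Type*} [DecidableEq κ] {A : Matrix κ κ ℝ} (hA : A.IsSymm) (i : κ) : (cut A i).IsSymm := by
  ext j k
  simp only [cut, transpose_apply, of_apply, or_comm (a := j = i)]
  rw [hA.apply]

/-- The resolvent of the minor of `A` without the index `i`, extended by zero to the full index
set. -/
def minorResolv (A : Matrix ι ι ℝ) (z : ℂ) (i : ι) : Matrix ι ι ℂ :=
  resolv (cut A i) z * (1 - vecMulVec (Pi.single i 1) (Pi.single i 1))

theorem one_sub_vecMulVec_mulVec (i : ι) (u : ι → ℂ) :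
    (1 - vecMulVec (Pi.single i 1) (Pi.single i 1) : Matrix ι ι ℂ) *ᵥ u
      = Function.update u i 0 := by
  ext j
  rw [sub_mulVec, one_mulVec, vecMulVec_mulVec]
  by_cases h : j = i
  · subst h; simp
  · simp [h]

theorem nsq_update_zero_le (u : ι → ℂ) (i : ι) : nsq (Function.update u i 0) ≤ nsq u := by
  refine Finset.sum_le_sum fun j _ => ?_
  by_cases h : j = i
  · subst h; simp
  · simp [h]

theorem opBound_minorResolv {A : Matrix ι ι ℝ} (hA : A.IsSymm) {z : ℂ} (hz : 0 < z.im) (i : ι) :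
    OpBound (minorResolv A z i) (1 / z.im) := by
  intro u
  rw [minorResolv, ← mulVec_mulVec, one_sub_vecMulVec_mulVec]
  refine (opBound_resolv (cut_isSymm hA i) hz _).trans ?_
  gcongr
  exact nsq_update_zero_le u i

theorem shifted_cut_mulVec_single (A : Matrix ι ι ℝ) (z : ℂ) (i : ι) :
    shifted (cut A i) z *ᵥ Pi.single i 1 = -z • Pi.single i 1 := by
  rw [shifted_mulVec, mulVec_single_one]
  ext j
  simp [cut]

theorem resolv_cut_mulVec_single {A : Matrix ι ι ℝ} (hA : A.IsSymm) {z : ℂ} (hz : 0 < z.im)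
    (i : ι) : resolv (cut A i) z *ᵥ Pi.single i 1 = (-z)⁻¹ • Pi.single i 1 := by
  have h := congrArg (resolv (cut A i) z *ᵥ ·) (shifted_cut_mulVec_single A z i)
  simp only [mulVec_mulVec, resolv_mul_shifted (cut_isSymm hA i) hz, one_mulVec, mulVec_smul] at h
  have hz0 : -z ≠ 0 := neg_ne_zero.2 (ne_zero_of_im_pos hz)
  conv_rhs => rw [h]
  rw [smul_smul, inv_mul_cancel₀ hz0, one_smul]

theorem minorResolv_mulVec_single (A : Matrix ι ι ℝ) (z : ℂ) (i : ι) :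
    minorResolv A z i *ᵥ Pi.single i 1 = 0 := by
  rw [minorResolv, ← mulVec_mulVec, one_sub_vecMulVec_mulVec]
  have : Function.update (Pi.single i 1 : ι → ℂ) i 0 = 0 := by
    ext j; by_cases h : j = i
    · subst h; simp
    · simp [h]
  rw [this, mulVec_zero]

theorem minorResolv_eq_add {A : Matrix ι ι ℝ} (hA : A.IsSymm) {z : ℂ} (hz : 0 < z.im) (i : ι) :
    minorResolv A z i = resolv (cut A i) z
      + z⁻¹ • vecMulVec (Pi.single i 1) (Pi.single i 1) := by
  rw [minorResolv, mul_sub, mul_one, mul_vecMulVec, resolv_cut_mulVec_single hA hz,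
    smul_vecMulVec, inv_neg, neg_smul, sub_neg_eq_add]

theorem minorResolv_isSymm {A : Matrix ι ι ℝ} (hA : A.IsSymm) {z : ℂ} (hz : 0 < z.im) (i : ι) :
    (minorResolv A z i).IsSymm := by
  rw [minorResolv_eq_add hA hz, IsSymm, transpose_add, (resolv_isSymm (cut_isSymm hA i) z).eq,
    transpose_smul, transpose_vecMulVec]

theorem minorResolv_apply_left {A : Matrix ι ι ℝ} (hA : A.IsSymm) {z : ℂ} (hz : 0 < z.im)
    (i k : ι) : minorResolv A z i i k = 0 := by
  rw [← (minorResolv_isSymm hA hz i).apply]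
  have := congrFun (minorResolv_mulVec_single A z i) k
  rwa [mulVec_single_one] at this

theorem minorResolv_apply_right (A : Matrix ι ι ℝ) (z : ℂ)
    (i k : ι) : minorResolv A z i k i = 0 := by
  have := congrFun (minorResolv_mulVec_single A z i) k
  rwa [mulVec_single_one] at this

theorem shifted_eq_cut_add {κ : Type*} [DecidableEq κ] {A : Matrix κ κ ℝ} (hA : A.IsSymm)
    (z : ℂ) {i : κ} (hii : A i i = 0) :
    shifted A z = shifted (cut A i) z
      + vecMulVec (Pi.single i 1) (fun j => (A i j : ℂ))
      + vecMulVec (fun j => (A i j : ℂ)) (Pi.single i 1) := by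
  ext j k
  simp only [shifted, cut, Matrix.sub_apply, Matrix.add_apply, map_apply, of_apply, vecMulVec_apply]
  by_cases hj : j = i <;> by_cases hk : k = i
  · subst hj; subst hk; simp [hii]
  · subst hj; simp [hk]; ring
  · subst hk; simp [hj, hA.apply]
  · simp [hj, hk]

/-- The vector `e_i - M a`, where `M` is the resolvent of the minor without the index `i` and `a`
is the `i`-th column of `A`. It is proportional to the `i`-th column of the resolvent of `A`. -/
def schurVec (A : Matrix ι ι ℝ) (z : ℂ) (i : ι) : ι → ℂ :=
  Pi.single i 1 - minorResolv A z i *ᵥ fun j => (A i j : ℂ)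

/-- The quadratic form in the Schur complement formula for a diagonal entry of the resolvent. -/
def schurForm (A : Matrix ι ι ℝ) (z : ℂ) (i : ι) : ℂ :=
  (fun j => (A i j : ℂ)) ⬝ᵥ (minorResolv A z i *ᵥ fun j => (A i j : ℂ))

theorem minorResolv_mulVec_apply {A : Matrix ι ι ℝ} (hA : A.IsSymm) {z : ℂ} (hz : 0 < z.im)
    (i : ι) (u : ι → ℂ) : (minorResolv A z i *ᵥ u) i = 0 := by
  rw [mulVec, dotProduct]
  exact Finset.sum_eq_zero fun k _ => by rw [minorResolv_apply_left hA hz, zero_mul]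

theorem schurVec_apply_self {A : Matrix ι ι ℝ} (hA : A.IsSymm) {z : ℂ} (hz : 0 < z.im) (i : ι) :
    schurVec A z i i = 1 := by
  simp [schurVec, minorResolv_mulVec_apply hA hz]

theorem shifted_cut_mul_minorResolv {A : Matrix ι ι ℝ} (hA : A.IsSymm) {z : ℂ} (hz : 0 < z.im)
    (i : ι) : shifted (cut A i) z * minorResolv A z i
      = 1 - vecMulVec (Pi.single i 1) (Pi.single i 1) := by
  rw [minorResolv, ← Matrix.mul_assoc, shifted_mul_resolv (cut_isSymm hA i) hz, Matrix.one_mul]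

theorem shifted_mulVec_schurVec {A : Matrix ι ι ℝ} (hA : A.IsSymm) {z : ℂ} (hz : 0 < z.im) {i : ι}
    (hii : A i i = 0) :
    shifted A z *ᵥ schurVec A z i = (-z - schurForm A z i) • Pi.single i 1 := by
  set α : ι → ℂ := fun j => (A i j : ℂ) with hα
  have hαi : α i = 0 := by simp [hα, hii]
  have h1 : shifted (cut A i) z *ᵥ schurVec A z i = -z • Pi.single i 1 - α := by
    rw [schurVec, mulVec_sub, shifted_cut_mulVec_single, mulVec_mulVec,
      shifted_cut_mul_minorResolv hA hz, one_sub_vecMulVec_mulVec]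
    congr 1
    rw [← hα]
    conv_rhs => rw [← Function.update_eq_self i α, hαi]
  have h2 : α ⬝ᵥ schurVec A z i = - schurForm A z i := by
    rw [schurVec, dotProduct_sub, dotProduct_single, hαi, zero_mul, zero_sub, schurForm]
  have h3 : (Pi.single i 1 : ι → ℂ) ⬝ᵥ schurVec A z i = 1 := by
    rw [single_dotProduct, schurVec_apply_self hA hz, one_mul]
  rw [shifted_eq_cut_add hA z hii, add_mulVec, add_mulVec, vecMulVec_mulVec, vecMulVec_mulVec,
    h1, ← hα, h2, h3]
  ext j
  simp
  ring

theorem schurVec_eq {A : Matrix ι ι ℝ} (hA : A.IsSymm) {z : ℂ} (hz : 0 < z.im) {i : ι}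
    (hii : A i i = 0) :
    schurVec A z i = (-z - schurForm A z i) • (resolv A z).col i := by
  have h := congrArg (resolv A z *ᵥ ·) (shifted_mulVec_schurVec hA hz hii)
  simp only [mulVec_mulVec, resolv_mul_shifted hA hz, one_mulVec, mulVec_smul,
    mulVec_single_one] at h
  exact h

/-- The Schur complement formula for the diagonal entries of the resolvent. -/
theorem resolv_apply_self_mul {A : Matrix ι ι ℝ} (hA : A.IsSymm) {z : ℂ} (hz : 0 < z.im) {i : ι}
    (hii : A i i = 0) : resolv A z i i * (-z - schurForm A z i) = 1 := by
  have h := congrFun (schurVec_eq hA hz hii) i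
  rw [schurVec_apply_self hA hz, Pi.smul_apply, smul_eq_mul, col_apply] at h
  rw [mul_comm]; exact h.symm

/-- The `i`-th column of the resolvent of `A` in terms of the resolvent of the minor. -/
theorem resolv_apply_eq {A : Matrix ι ι ℝ} (hA : A.IsSymm) {z : ℂ} (hz : 0 < z.im) {i : ι}
    (hii : A i i = 0) (j : ι) : resolv A z j i = resolv A z i i * schurVec A z i j := by
  have h := congrFun (schurVec_eq hA hz hii) j
  rw [Pi.smul_apply, smul_eq_mul, col_apply] at h
  rw [h, ← mul_assoc, resolv_apply_self_mul hA hz hii, one_mul]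

/-- The resolvent differs from that of the minor by a matrix of rank one. -/
theorem resolv_eq_minorResolv_add {A : Matrix ι ι ℝ} (hA : A.IsSymm) {z : ℂ} (hz : 0 < z.im)
    {i : ι} (hii : A i i = 0) :
    resolv A z = minorResolv A z i
      + resolv A z i i • vecMulVec (schurVec A z i) (schurVec A z i) := by
  set α : ι → ℂ := fun j => (A i j : ℂ) with hα
  have h1 : shifted A z * (minorResolv A z i
      + resolv A z i i • vecMulVec (schurVec A z i) (schurVec A z i)) = 1 := by
    have e1 : shifted A z * minorResolv A z i = 1 - vecMulVec (Pi.single i 1) (Pi.single i 1)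
        + vecMulVec (Pi.single i 1) (minorResolv A z i *ᵥ α) := by
      rw [shifted_eq_cut_add hA z hii, Matrix.add_mul, Matrix.add_mul,
        shifted_cut_mul_minorResolv hA hz, vecMulVec_mul, vecMulVec_mul, ← mulVec_transpose,
        ← mulVec_transpose, (minorResolv_isSymm hA hz i).eq, minorResolv_mulVec_single,
        vecMulVec_zero, add_zero]
    rw [Matrix.mul_add, e1, Matrix.mul_smul, mul_vecMulVec, shifted_mulVec_schurVec hA hz hii,
      smul_vecMulVec, smul_smul, resolv_apply_self_mul hA hz hii, one_smul]
    have e2 : schurVec A z i = Pi.single i 1 - minorResolv A z i *ᵥ α := rfl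
    rw [e2, vecMulVec_sub]
    abel
  have h2 := congrArg (resolv A z * ·) h1
  simp only [← Matrix.mul_assoc, resolv_mul_shifted hA hz, Matrix.one_mul, Matrix.mul_one] at h2
  exact h2.symm

theorem norm_resolv_mul_nsq_schurVec_le {A : Matrix ι ι ℝ} (hA : A.IsSymm) {z : ℂ} (hz : 0 < z.im)
    {i : ι} (hii : A i i = 0) :
    ‖resolv A z i i‖ * nsq (schurVec A z i) ≤ 1 / z.im := by
  have h1 := im_star_dotProduct_shifted hA z (schurVec A z i)
  rw [shifted_mulVec_schurVec hA hz hii, dotProduct_smul, dotProduct_single, Pi.star_apply,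
    schurVec_apply_self hA hz, star_one, one_mul, smul_eq_mul, mul_one] at h1
  have h2 := Complex.abs_im_le_norm (-z - schurForm A z i)
  rw [h1, abs_neg, abs_of_nonneg (mul_nonneg hz.le (nsq_nonneg _))] at h2
  have h3 := congrArg norm (resolv_apply_self_mul hA hz hii)
  rw [norm_mul, norm_one] at h3
  rw [le_div_iff₀ hz]
  calc ‖resolv A z i i‖ * nsq (schurVec A z i) * z.im
      = ‖resolv A z i i‖ * (z.im * nsq (schurVec A z i)) := by ring
    _ ≤ ‖resolv A z i i‖ * ‖-z - schurForm A z i‖ := by gcongr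
    _ = 1 := h3

theorem sum_resolv_sub_minorResolv {A : Matrix ι ι ℝ} (hA : A.IsSymm) {z : ℂ} (hz : 0 < z.im)
    {i : ι} (hii : A i i = 0) (B : ι → ι → ℂ) :
    ∑ j, ∑ k, resolv A z j k * B j k - ∑ j, ∑ k, minorResolv A z i j k * B j k
      = resolv A z i i * ∑ j, ∑ k, schurVec A z i j * schurVec A z i k * B j k := by
  rw [← Finset.sum_sub_distrib, Finset.mul_sum]
  refine Finset.sum_congr rfl fun j _ => ?_
  rw [← Finset.sum_sub_distrib, Finset.mul_sum]
  refine Finset.sum_congr rfl fun k _ => ?_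
  have h := congrFun (congrFun (resolv_eq_minorResolv_add hA hz hii) j) k
  rw [Matrix.add_apply, Matrix.smul_apply, vecMulVec_apply, smul_eq_mul] at h
  linear_combination h * B j k

theorem norm_sum_resolv_sub_minorResolv_le {A : Matrix ι ι ℝ} (hA : A.IsSymm) {z : ℂ}
    (hz : 0 < z.im) {i : ι} (hii : A i i = 0) (B : ι → ι → ℂ) :
    ‖∑ j, ∑ k, resolv A z j k * B j k - ∑ j, ∑ k, minorResolv A z i j k * B j k‖
      ≤ 1 / z.im * √(∑ j, ∑ k, ‖B j k‖ ^ 2) := by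
  rw [sum_resolv_sub_minorResolv hA hz hii, norm_mul]
  calc _ ≤ ‖resolv A z i i‖ * (nsq (schurVec A z i) * √(∑ j, ∑ k, ‖B j k‖ ^ 2)) := by
        gcongr; exact norm_sum_mul_mul_le _ _
    _ = ‖resolv A z i i‖ * nsq (schurVec A z i) * √(∑ j, ∑ k, ‖B j k‖ ^ 2) := by ring
    _ ≤ _ := by gcongr; exact norm_resolv_mul_nsq_schurVec_le hA hz hii

theorem norm_trace_resolv_sub_le {A : Matrix ι ι ℝ} (hA : A.IsSymm) {z : ℂ} (hz : 0 < z.im)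
    {i : ι} (hii : A i i = 0) :
    ‖(resolv A z).trace - (minorResolv A z i).trace‖ ≤ 1 / z.im := by
  rw [← trace_sub]
  nth_rewrite 1 [resolv_eq_minorResolv_add hA hz hii]
  rw [add_sub_cancel_left, trace_smul, trace_vecMulVec, smul_eq_mul, norm_mul]
  refine le_trans ?_ (norm_resolv_mul_nsq_schurVec_le hA hz hii)
  gcongr
  refine (norm_dotProduct_le _ _).trans (le_of_eq ?_)
  exact Real.mul_self_sqrt (nsq_nonneg _)

/-- The Stieltjes transform of the empirical spectral distribution is the normalized trace of the
resolvent. -/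
theorem stieltjes_esd {n : ℕ} (A : Matrix (Fin n) (Fin n) ℝ) (hA : A.IsHermitian) {z : ℂ}
    (hz : 0 < z.im) :
    stieltjes (esd A hA : Measure ℝ) z = (n : ℂ)⁻¹ * (resolv A z).trace := by
  have hsymm : A.IsSymm := by
    have := hA.eq
    rwa [conjTranspose_eq_transpose_of_trivial] at this
  have h1 : stieltjes (esd A hA : Measure ℝ) z
      = (n : ℂ)⁻¹ * ∑ i, 1 / ((hA.eigenvalues i : ℂ) - z) := by
    have e : (esd A hA : Measure ℝ) = (n : ℝ≥0)⁻¹ • ∑ i, Measure.dirac (hA.eigenvalues i) := rfl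
    rw [stieltjes, e, integral_smul_nnreal_measure, integral_finsetSum_measure]
    · simp only [integral_dirac, NNReal.smul_def, Complex.real_smul]
      push_cast
      rfl
    · exact fun i _ => integrable_one_div_sub _ hz
  rw [h1]
  congr 1
  set U : Matrix (Fin n) (Fin n) ℝ := (hA.eigenvectorUnitary : Matrix (Fin n) (Fin n) ℝ) with hU
  have hUU : U * star U = 1 := Unitary.coe_mul_star_self hA.eigenvectorUnitary
  have hUU' : star U * U = 1 := Unitary.coe_star_mul_self hA.eigenvectorUnitary
  have hspec : A = U * diagonal hA.eigenvalues * star U := by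
    have := hA.spectral_theorem
    rw [Unitary.conjStarAlgAut_apply] at this
    exact this
  set V := U.map Complex.ofReal
  set W := (star U).map Complex.ofReal
  have hmul : ∀ B C : Matrix (Fin n) (Fin n) ℝ, (B * C).map Complex.ofReal
      = B.map Complex.ofReal * C.map Complex.ofReal := fun B C => by
    exact Matrix.map_mul (f := Complex.ofRealHom)
  have hone : (1 : Matrix (Fin n) (Fin n) ℝ).map Complex.ofReal = 1 := by
    exact Matrix.map_one _ Complex.ofReal_zero Complex.ofReal_one
  have hVW : V * W = 1 := by rw [← hmul, hUU, hone]
  have hWV : W * V = 1 := by rw [← hmul, hUU', hone]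
  have hA' : shifted A z = V * diagonal (fun i => (hA.eigenvalues i : ℂ) - z) * W := by
    have e2 : A.map Complex.ofReal = V * diagonal (fun i => (hA.eigenvalues i : ℂ)) * W := by
      conv_lhs => rw [hspec]
      rw [hmul, hmul, diagonal_map Complex.ofReal_zero]
    have e3 : diagonal (fun i => (hA.eigenvalues i : ℂ) - z)
        = diagonal (fun i => (hA.eigenvalues i : ℂ)) - z • 1 := by
      rw [smul_one_eq_diagonal, diagonal_sub]
    rw [shifted, e2, e3, mul_sub, sub_mul, Matrix.mul_smul, Matrix.smul_mul, Matrix.mul_one, hVW]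
  have hinv : resolv A z = V * diagonal (fun i => 1 / ((hA.eigenvalues i : ℂ) - z)) * W := by
    rw [resolv]
    apply inv_eq_right_inv
    rw [hA']
    calc V * diagonal (fun i => (hA.eigenvalues i : ℂ) - z) * W
          * (V * diagonal (fun i => 1 / ((hA.eigenvalues i : ℂ) - z)) * W)
        = V * diagonal (fun i => (hA.eigenvalues i : ℂ) - z) * (W * V)
          * diagonal (fun i => 1 / ((hA.eigenvalues i : ℂ) - z)) * W := by
          simp only [Matrix.mul_assoc]
      _ = V * (diagonal (fun i => (hA.eigenvalues i : ℂ) - z)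
          * diagonal (fun i => 1 / ((hA.eigenvalues i : ℂ) - z))) * W := by
          rw [hWV, Matrix.mul_one, Matrix.mul_assoc V]
      _ = 1 := by
          rw [diagonal_mul_diagonal]
          have : (fun i => ((hA.eigenvalues i : ℂ) - z) * (1 / ((hA.eigenvalues i : ℂ) - z)))
              = fun _ => (1 : ℂ) := by
            funext i
            rw [mul_one_div, div_self (sub_ne_zero_of_im_pos hz _)]
          rw [this, diagonal_one, Matrix.mul_one, hVW]
  rw [hinv, trace_mul_cycle, hWV, Matrix.one_mul, trace_diagonal]

end Resolvent

/-! ### Gaussian vectors and the law of their inner products -/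

section Gaussian

theorem dotProduct_self_nonneg {p : ℕ} (y : Fin p → ℝ) : 0 ≤ y ⬝ᵥ y :=
  Finset.sum_nonneg fun i _ => mul_self_nonneg (y i)

instance isProbabilityMeasure_gaussianVec (p : ℕ) : IsProbabilityMeasure (gaussianVec p) := by
  unfold gaussianVec; infer_instance

instance isProbabilityMeasure_xiLaw (p : ℕ) : IsProbabilityMeasure (xiLaw p) := by
  unfold xiLaw
  exact Measure.isProbabilityMeasure_map (by simp only [dotProduct]; fun_prop)

@[fun_prop]
theorem measurable_dotProduct_of_measurable {α : Type*} [MeasurableSpace α] {p : ℕ}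
    {f g : α → Fin p → ℝ} (hf : Measurable f) (hg : Measurable g) :
    Measurable fun a => f a ⬝ᵥ g a := by
  simp only [dotProduct]; fun_prop

/-- The characteristic function of `N(0, p⁻¹ I_p)`. -/
theorem integral_exp_gaussianVec (p : ℕ) (l : Fin p → ℝ) :
    ∫ x, Complex.exp (((l ⬝ᵥ x : ℝ) : ℂ) * Complex.I) ∂(gaussianVec p)
      = (Real.exp (-(l ⬝ᵥ l) / (2 * p)) : ℝ) := by
  have h1 : ∀ x : Fin p → ℝ, Complex.exp (((l ⬝ᵥ x : ℝ) : ℂ) * Complex.I)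
      = ∏ i, Complex.exp ((l i : ℂ) * (x i : ℂ) * Complex.I) := by
    intro x
    rw [← Complex.exp_sum, dotProduct]
    push_cast
    rw [Finset.sum_mul]
  simp_rw [h1]
  rw [gaussianVec, integral_fintype_prod_eq_prod
    (f := fun i (x : ℝ) => Complex.exp ((l i : ℂ) * (x : ℂ) * Complex.I))]
  have h2 : ∀ i, ∫ x : ℝ, Complex.exp ((l i : ℂ) * (x : ℂ) * Complex.I)
      ∂(gaussianReal 0 ((p : ℝ≥0)⁻¹)) = Complex.exp (-(l i * l i) / (2 * p)) := by
    intro i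
    rw [← charFun_apply_real, charFun_gaussianReal]
    congr 1
    push_cast
    ring
  simp_rw [h2]
  rw [← Complex.exp_sum]
  push_cast
  congr 1
  rw [dotProduct]
  push_cast
  rw [neg_div, Finset.sum_div, ← Finset.sum_neg_distrib]
  exact Finset.sum_congr rfl fun i _ => by ring

theorem sqrt_mul_dotProduct_smul (p : ℕ) (t : ℝ) (y x : Fin p → ℝ) :
    t * (√(p : ℝ) * (y ⬝ᵥ x)) = ((t * √(p : ℝ)) • y) ⬝ᵥ x := by
  rw [smul_dotProduct, smul_eq_mul]; ring

theorem integral_exp_sqrt_mul_dotProduct {p : ℕ} (hp : 1 ≤ p) (y : Fin p → ℝ) (t : ℝ) :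
    ∫ x, Complex.exp (((t * (√(p : ℝ) * (y ⬝ᵥ x)) : ℝ) : ℂ) * Complex.I) ∂(gaussianVec p)
      = (Real.exp (-(t ^ 2 * (y ⬝ᵥ y)) / 2) : ℝ) := by
  simp_rw [sqrt_mul_dotProduct_smul]
  rw [integral_exp_gaussianVec, smul_dotProduct, dotProduct_smul, smul_eq_mul, smul_eq_mul]
  have hp' : (0 : ℝ) < p := by exact_mod_cast hp
  congr 2
  have := Real.mul_self_sqrt hp'.le
  field_simp
  linear_combination (-(t ^ 2 * (y ⬝ᵥ y))) * this

theorem norm_exp_mul_I (x : ℝ) : ‖Complex.exp ((x : ℂ) * Complex.I)‖ = 1 :=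
  Complex.norm_exp_ofReal_mul_I x

/-- The law of `ξ_p` is that of `|Y| g` with `Y ∼ N(0, p⁻¹ I_p)` and `g` an independent standard
Gaussian. -/
theorem xiLaw_eq_map {p : ℕ} (hp : 1 ≤ p) :
    xiLaw p = ((gaussianVec p).prod (gaussianReal 0 1)).map
      (fun w => √(w.1 ⬝ᵥ w.1) * w.2) := by
  have hm1 : Measurable fun w : (Fin p → ℝ) × (Fin p → ℝ) => √(p : ℝ) * (w.1 ⬝ᵥ w.2) := by fun_prop
  have hm2 : Measurable fun w : (Fin p → ℝ) × ℝ => √(w.1 ⬝ᵥ w.1) * w.2 := by fun_prop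
  have := Measure.isProbabilityMeasure_map (μ := (gaussianVec p).prod (gaussianReal 0 1))
    hm2.aemeasurable
  apply Measure.ext_of_charFun
  funext t
  rw [charFun_apply_real, charFun_apply_real, xiLaw, integral_map hm1.aemeasurable (by fun_prop),
    integral_map hm2.aemeasurable (by fun_prop)]
  have hi : ∀ {α : Type} [MeasurableSpace α] (μ : Measure α) [IsFiniteMeasure μ] (f : α → ℝ),
      Measurable f → Integrable (fun w => Complex.exp ((t : ℂ) * (f w : ℂ) * Complex.I)) μ := by
    intro α _ μ _ f hf
    refine .of_bound (by fun_prop) 1 (ae_of_all _ fun w => ?_)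
    rw [← Complex.ofReal_mul, norm_exp_mul_I]
  rw [integral_prod _ (hi _ _ hm1), integral_prod _ (hi _ _ hm2)]
  congr 1
  funext y
  have e1 := integral_exp_sqrt_mul_dotProduct hp y t
  push_cast at e1 ⊢
  rw [e1]
  have hnn : 0 ≤ y ⬝ᵥ y := dotProduct_self_nonneg y
  have e2 := charFun_gaussianReal (μ := 0) (v := 1) (t * √(y ⬝ᵥ y))
  rw [charFun_apply_real] at e2
  have e3 : ∀ g : ℝ, (t : ℂ) * ((√(y ⬝ᵥ y) : ℂ) * (g : ℂ)) * Complex.I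
      = ((t * √(y ⬝ᵥ y) : ℝ) : ℂ) * (g : ℂ) * Complex.I := fun g => by push_cast; ring
  simp_rw [e3]
  rw [e2]
  congr 1
  have h4 : ((√(y ⬝ᵥ y) : ℝ) : ℂ) ^ 2 = ((y ⬝ᵥ y : ℝ) : ℂ) := by
    rw [← Complex.ofReal_pow, Real.sq_sqrt hnn]
  push_cast
  linear_combination (t ^ 2 / 2 : ℂ) * h4

/-- The moment of order `2 q` of the standard Gaussian law. -/
def gaussMoment (q : ℕ) : ℝ := ∫ g, g ^ (2 * q) ∂(gaussianReal 0 1)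

theorem integrable_pow_gaussianReal (v : ℝ≥0) (q : ℕ) :
    Integrable (fun g : ℝ => g ^ q) (gaussianReal 0 v) := by
  have h := (memLp_id_gaussianReal (μ := 0) (v := v) (q : ℝ≥0)).integrable_norm_pow'
  refine (integrable_norm_iff (by fun_prop)).1 ?_
  simpa using h

theorem gaussMoment_nonneg (q : ℕ) : 0 ≤ gaussMoment q :=
  integral_nonneg fun g => by rw [pow_mul]; positivity

theorem integral_pow_gaussianReal_inv {p : ℕ} (q : ℕ) :
    ∫ g, g ^ (2 * q) ∂(gaussianReal 0 ((p : ℝ≥0)⁻¹)) = ((p : ℝ)⁻¹) ^ q * gaussMoment q := by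
  have h : gaussianReal 0 ((p : ℝ≥0)⁻¹) = (gaussianReal 0 1).map ((√((p : ℝ)⁻¹)) * ·) := by
    rw [gaussianReal_map_const_mul]
    congr 1
    · simp
    · ext
      push_cast
      rw [Real.sq_sqrt (by positivity), mul_one]
  rw [h, integral_map (by fun_prop) (by fun_prop)]
  simp_rw [mul_pow]
  rw [integral_const_mul, gaussMoment, pow_mul, Real.sq_sqrt (by positivity)]

theorem integrable_coord_pow (p : ℕ) (i : Fin p) (q : ℕ) :
    Integrable (fun y : Fin p → ℝ => y i ^ q) (gaussianVec p) := by
  exact integrable_comp_eval (μ := fun _ => gaussianReal 0 ((p : ℝ≥0)⁻¹)) (f := fun g : ℝ => g ^ q) (integrable_pow_gaussianReal _ q)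

theorem integral_coord_pow (p : ℕ) (i : Fin p) (q : ℕ) :
    ∫ y, y i ^ (2 * q) ∂(gaussianVec p) = ((p : ℝ)⁻¹) ^ q * gaussMoment q := by
  rw [← integral_pow_gaussianReal_inv]
  exact integral_comp_eval (μ := fun _ => gaussianReal 0 ((p : ℝ≥0)⁻¹))
    (f := fun g : ℝ => g ^ (2 * q)) (by fun_prop)

theorem dotProduct_self_pow_le {p : ℕ} (y : Fin p → ℝ) (q : ℕ) :
    (y ⬝ᵥ y) ^ (q + 1) ≤ (p : ℝ) ^ q * ∑ i, y i ^ (2 * (q + 1)) := by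
  have h := pow_sum_div_card_le_sum_pow (s := Finset.univ) (f := fun i => y i ^ 2)
    (fun i _ => sq_nonneg _) q
  rcases Nat.eq_zero_or_pos p with hp | hp
  · subst hp; simp
  have hp' : (0 : ℝ) < (p : ℝ) ^ q := by positivity
  rw [Finset.card_univ, Fintype.card_fin, div_le_iff₀ hp'] at h
  have e : y ⬝ᵥ y = ∑ i, y i ^ 2 := by simp [dotProduct, pow_two]
  rw [e]
  refine h.trans (le_of_eq ?_)
  rw [mul_comm]
  simp_rw [← pow_mul]

theorem integrable_dotProduct_self_pow (p q : ℕ) :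
    Integrable (fun y : Fin p → ℝ => (y ⬝ᵥ y) ^ q) (gaussianVec p) := by
  cases q with
  | zero => simp
  | succ q =>
    refine Integrable.mono' (g := fun y => (p : ℝ) ^ q * ∑ i, y i ^ (2 * (q + 1)))
      ((integrable_finsetSum _ fun i _ => integrable_coord_pow p i _).const_mul _)
      (Measurable.aestronglyMeasurable (by fun_prop)) (ae_of_all _ fun y => ?_)
    rw [Real.norm_eq_abs, abs_of_nonneg (pow_nonneg (dotProduct_self_nonneg y) _)]
    exact dotProduct_self_pow_le y q

theorem integral_dotProduct_self_pow_le (p q : ℕ) :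
    ∫ y, (y ⬝ᵥ y) ^ q ∂(gaussianVec p) ≤ 1 + gaussMoment q := by
  have h0 := gaussMoment_nonneg q
  cases q with
  | zero => simp only [pow_zero, integral_const, probReal_univ, one_smul]; linarith
  | succ q =>
    rcases Nat.eq_zero_or_pos p with hp | hp
    · subst hp
      have : ∀ y : Fin 0 → ℝ, (y ⬝ᵥ y) ^ (q + 1) = 0 := fun y => by simp
      simp_rw [this]
      simp only [integral_zero]
      linarith
    have hp' : (0 : ℝ) < p := by exact_mod_cast hp
    calc ∫ y, (y ⬝ᵥ y) ^ (q + 1) ∂(gaussianVec p)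
        ≤ ∫ y, (p : ℝ) ^ q * ∑ i, y i ^ (2 * (q + 1)) ∂(gaussianVec p) := by
          refine integral_mono (integrable_dotProduct_self_pow _ _)
            ((integrable_finsetSum _ fun i _ => integrable_coord_pow p i _).const_mul _)
            fun y => dotProduct_self_pow_le y q
      _ = gaussMoment (q + 1) := by
          rw [integral_const_mul, integral_finsetSum _ fun i _ => integrable_coord_pow p i _]
          simp_rw [integral_coord_pow]
          rw [Finset.sum_const, Finset.card_univ, Fintype.card_fin, nsmul_eq_mul, inv_pow]
          field_simp
          ring
      _ ≤ _ := by linarith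

theorem gaussMoment_one : gaussMoment 1 = 1 := by
  have h2 := variance_fun_id_gaussianReal (μ := 0) (v := 1)
  rw [variance_eq_integral (by fun_prop), integral_id_gaussianReal] at h2
  simpa [gaussMoment] using h2

theorem integral_dotProduct_self {p : ℕ} (hp : 1 ≤ p) :
    ∫ y, y ⬝ᵥ y ∂(gaussianVec p) = 1 := by
  have hp' : (0 : ℝ) < p := by exact_mod_cast hp
  have e : ∀ y : Fin p → ℝ, y ⬝ᵥ y = ∑ i, y i ^ (2 * 1) := fun y => by simp [dotProduct, pow_two]
  simp_rw [e]
  rw [integral_finsetSum _ fun i _ => integrable_coord_pow p i _]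
  simp_rw [integral_coord_pow]
  rw [Finset.sum_const, Finset.card_univ, Fintype.card_fin, nsmul_eq_mul, gaussMoment_one]
  field_simp

/-- The squared norm of a `N(0, p⁻¹ I_p)` vector concentrates at `1`. -/
theorem integral_dotProduct_self_sub_one_sq_le {p : ℕ} (hp : 1 ≤ p) :
    ∫ y, (y ⬝ᵥ y - 1) ^ 2 ∂(gaussianVec p) ≤ gaussMoment 2 / p := by
  have hp' : (0 : ℝ) < p := by exact_mod_cast hp
  set ρ := gaussianReal 0 ((p : ℝ≥0)⁻¹) with hρ
  have hmem : MemLp (fun g : ℝ => g ^ 2) 2 ρ := by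
    rw [memLp_two_iff_integrable_sq (by fun_prop)]
    simpa [← pow_mul] using integrable_pow_gaussianReal ((p : ℝ≥0)⁻¹) 4
  have hvar := variance_sum_pi (μ := fun _ : Fin p => ρ) (X := fun _ g => g ^ 2) (fun _ => hmem)
  have e : (∑ i : Fin p, fun ω : Fin p → ℝ => ω i ^ 2) = fun y => y ⬝ᵥ y := by
    funext y; simp [dotProduct, pow_two]
  rw [e] at hvar
  have hm : Measurable fun y : Fin p → ℝ => y ⬝ᵥ y := by fun_prop
  rw [variance_eq_integral hm.aemeasurable] at hvar
  have hmean : ∫ y, y ⬝ᵥ y ∂(Measure.pi fun _ : Fin p => ρ) = 1 := integral_dotProduct_self hp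
  rw [hmean] at hvar
  have hv1 : Var[fun g : ℝ => g ^ 2; ρ] ≤ ((p : ℝ)⁻¹) ^ 2 * gaussMoment 2 := by
    refine (variance_le_expectation_sq (by fun_prop)).trans (le_of_eq ?_)
    rw [← integral_pow_gaussianReal_inv]
    refine integral_congr_ae (ae_of_all _ fun g => ?_)
    simp only [Pi.pow_apply]; ring
  calc ∫ y, (y ⬝ᵥ y - 1) ^ 2 ∂(gaussianVec p) = ∑ _i : Fin p, Var[fun g : ℝ => g ^ 2; ρ] := hvar
    _ ≤ ∑ _i : Fin p, ((p : ℝ)⁻¹) ^ 2 * gaussMoment 2 := Finset.sum_le_sum fun _ _ => hv1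
    _ = gaussMoment 2 / p := by
      rw [Finset.sum_const, Finset.card_univ, Fintype.card_fin, nsmul_eq_mul]
      field_simp

theorem integrable_dotProduct_self_sub_one_sq (p : ℕ) :
    Integrable (fun y : Fin p → ℝ => (y ⬝ᵥ y - 1) ^ 2) (gaussianVec p) := by
  have h : (fun y : Fin p → ℝ => (y ⬝ᵥ y - 1) ^ 2)
      = fun y => (y ⬝ᵥ y) ^ 2 - 2 * (y ⬝ᵥ y) ^ 1 + 1 := by funext y; ring
  rw [h]
  exact ((integrable_dotProduct_self_pow p 2).sub
    ((integrable_dotProduct_self_pow p 1).const_mul 2)).add (integrable_const 1)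

theorem integrable_dotProduct_self (p : ℕ) :
    Integrable (fun y : Fin p → ℝ => y ⬝ᵥ y) (gaussianVec p) := by
  simpa using integrable_dotProduct_self_pow p 1

theorem integral_abs_dotProduct_self_sub_one_le {p : ℕ} (hp : 1 ≤ p) :
    ∫ y, |y ⬝ᵥ y - 1| ∂(gaussianVec p) ≤ √(gaussMoment 2 / p) := by
  apply Real.le_sqrt_of_sq_le
  refine le_trans ?_ (integral_dotProduct_self_sub_one_sq_le hp)
  have hm : Measurable fun y : Fin p → ℝ => |y ⬝ᵥ y - 1| := by fun_prop
  have h := variance_nonneg (fun y : Fin p → ℝ => |y ⬝ᵥ y - 1|) (gaussianVec p)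
  rw [variance_eq_sub] at h
  · simp only [Pi.pow_apply, sq_abs] at h
    linarith
  · rw [memLp_two_iff_integrable_sq hm.aestronglyMeasurable]
    simpa using integrable_dotProduct_self_sub_one_sq p

theorem integrable_pow_xiLaw {p : ℕ} (hp : 1 ≤ p) (q : ℕ) :
    Integrable (fun x : ℝ => x ^ q) (xiLaw p) := by
  have heven : ∀ q, Integrable (fun x : ℝ => x ^ (2 * q)) (xiLaw p) := by
    intro q
    rw [xiLaw_eq_map hp, integrable_map_measure (by fun_prop)
      (Measurable.aemeasurable (by fun_prop))]
    have := (integrable_dotProduct_self_pow p q).mul_prod (integrable_pow_gaussianReal 1 (2 * q))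
    refine this.congr (ae_of_all _ fun w => ?_)
    simp only [Function.comp]
    rw [mul_pow, pow_mul √_, Real.sq_sqrt (dotProduct_self_nonneg _)]
  refine Integrable.mono' ((integrable_const (1 : ℝ)).add (heven q)) (by fun_prop)
    (ae_of_all _ fun x => ?_)
  simp only [Pi.add_apply]
  rw [norm_pow, Real.norm_eq_abs, mul_comm 2 q, pow_mul, ← sq_abs (x ^ q), abs_pow]
  nlinarith [sq_nonneg (|x| ^ q - 1), sq_nonneg (|x| ^ q)]

theorem integral_pow_xiLaw {p : ℕ} (hp : 1 ≤ p) (q : ℕ) :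
    ∫ x, x ^ (2 * q) ∂(xiLaw p) = (∫ y, (y ⬝ᵥ y) ^ q ∂(gaussianVec p)) * gaussMoment q := by
  rw [xiLaw_eq_map hp, integral_map (Measurable.aemeasurable (by fun_prop)) (by fun_prop),
    gaussMoment, ← integral_prod_mul]
  refine integral_congr_ae (ae_of_all _ fun w => ?_)
  simp only
  rw [mul_pow, pow_mul, Real.sq_sqrt (dotProduct_self_nonneg _)]

theorem integral_pow_xiLaw_le {p : ℕ} (hp : 1 ≤ p) (q : ℕ) :
    ∫ x, x ^ (2 * q) ∂(xiLaw p) ≤ (1 + gaussMoment q) * gaussMoment q := by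
  rw [integral_pow_xiLaw hp]
  exact mul_le_mul_of_nonneg_right (integral_dotProduct_self_pow_le p q) (gaussMoment_nonneg q)

theorem integral_sq_xiLaw {p : ℕ} (hp : 1 ≤ p) : ∫ x, x ^ 2 ∂(xiLaw p) = 1 := by
  have := integral_pow_xiLaw hp 1
  simp only [mul_one, pow_one] at this
  rw [this, integral_dotProduct_self hp, gaussMoment_one, mul_one]

theorem integral_id_xiLaw {p : ℕ} (hp : 1 ≤ p) : ∫ x, x ∂(xiLaw p) = 0 := by
  rw [xiLaw_eq_map hp, integral_map (Measurable.aemeasurable (by fun_prop)) (by fun_prop)]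
  rw [integral_prod_mul (fun y : Fin p → ℝ => √(y ⬝ᵥ y)) (fun g : ℝ => g)]
  rw [integral_id_gaussianReal, mul_zero]

/-- The characteristic function of the standard Gaussian law. -/
def gaussChar (s : ℝ) : ℝ := Real.exp (-s ^ 2 / 2)

theorem gaussChar_nonneg (s : ℝ) : 0 ≤ gaussChar s := (Real.exp_pos _).le

theorem gaussChar_le_one (s : ℝ) : gaussChar s ≤ 1 := by
  rw [gaussChar, Real.exp_le_one_iff]; nlinarith [sq_nonneg s]

theorem integral_exp_gaussianReal (s : ℝ) :
    ∫ g : ℝ, Complex.exp (((s * g : ℝ) : ℂ) * Complex.I) ∂(gaussianReal 0 1) = gaussChar s := by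
  have h := charFun_gaussianReal (μ := 0) (v := 1) s
  rw [charFun_apply_real] at h
  push_cast
  rw [h, gaussChar]
  push_cast
  congr 1
  simp; ring

theorem integral_mul_exp_gaussianReal (s : ℝ) :
    ∫ g : ℝ, (g : ℂ) * Complex.exp (((s * g : ℝ) : ℂ) * Complex.I) ∂(gaussianReal 0 1)
      = Complex.I * s * gaussChar s := by
  have hz : ((s : ℂ) * Complex.I).re ∈ interior (integrableExpSet id (gaussianReal 0 1)) := by
    rw [integrableExpSet_id_gaussianReal, interior_univ]; exact Set.mem_univ _
  have h1 := hasDerivAt_complexMGF hz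
  have h2 : HasDerivAt (complexMGF id (gaussianReal 0 1))
      (Complex.exp (((s : ℂ) * Complex.I) ^ 2 / 2) * ((s : ℂ) * Complex.I)) ((s : ℂ) * Complex.I) := by
    have e : complexMGF id (gaussianReal 0 1) = fun z => Complex.exp (z ^ 2 / 2) := by
      funext z
      rw [complexMGF_id_gaussianReal]; simp
    rw [e]
    have h3 : HasDerivAt (fun z : ℂ => z ^ 2 / 2) ((s : ℂ) * Complex.I) ((s : ℂ) * Complex.I) := by
      refine ((hasDerivAt_pow 2 ((s : ℂ) * Complex.I)).div_const 2).congr_deriv ?_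
      push_cast
      ring
    exact h3.cexp
  have h4 := h1.unique h2
  have h5 : ((s : ℂ) * Complex.I) ^ 2 / 2 = ((-s ^ 2 / 2 : ℝ) : ℂ) := by
    rw [mul_pow, Complex.I_sq]; push_cast; ring
  rw [h5, ← Complex.ofReal_exp] at h4
  have h6 : ∀ g : ℝ, (g : ℂ) * Complex.exp (((s * g : ℝ) : ℂ) * Complex.I)
      = ((id g : ℝ) : ℂ) * Complex.exp ((s : ℂ) * Complex.I * ((id g : ℝ) : ℂ)) := fun g => by
    simp only [id]; push_cast; ring_nf
  simp_rw [h6]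
  rw [h4, gaussChar]
  ring

theorem abs_exp_neg_sub_exp_neg_le {x y : ℝ} (hx : 0 ≤ x) (hy : 0 ≤ y) :
    |Real.exp (-x) - Real.exp (-y)| ≤ |x - y| := by
  wlog h : x ≤ y with H
  · rw [abs_sub_comm, abs_sub_comm x y]; exact H hy hx (le_of_not_ge h)
  have h1 : Real.exp (-y) ≤ Real.exp (-x) := Real.exp_le_exp.2 (by linarith)
  rw [abs_of_nonneg (by linarith), abs_sub_comm, abs_of_nonneg (by linarith)]
  have h2 : Real.exp (-y) = Real.exp (-x) * Real.exp (-(y - x)) := by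
    rw [← Real.exp_add]; congr 1; ring
  have h3 := Real.add_one_le_exp (-(y - x))
  have h4 : Real.exp (-x) ≤ 1 := Real.exp_le_one_iff.2 (by linarith)
  have h5 := Real.exp_pos (-x)
  rw [h2]
  nlinarith

theorem abs_exp_sub_gaussChar_le (s : ℝ) {r : ℝ} (hr : 0 ≤ r) :
    |Real.exp (-(s ^ 2 * r) / 2) - gaussChar s| ≤ s ^ 2 / 2 * |r - 1| := by
  have h := abs_exp_neg_sub_exp_neg_le (x := s ^ 2 * r / 2) (y := s ^ 2 / 2) (by positivity)
    (by positivity)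
  have e : s ^ 2 * r / 2 - s ^ 2 / 2 = s ^ 2 / 2 * (r - 1) := by ring
  rw [e, abs_mul, abs_of_nonneg (by positivity : 0 ≤ s ^ 2 / 2)] at h
  rw [gaussChar, neg_div, neg_div]
  exact h

theorem integral_exp_xiLaw {p : ℕ} (hp : 1 ≤ p) (s : ℝ) :
    ∫ x : ℝ, Complex.exp (((s * x : ℝ) : ℂ) * Complex.I) ∂(xiLaw p)
      = ((∫ y, Real.exp (-(s ^ 2 * (y ⬝ᵥ y)) / 2) ∂(gaussianVec p) : ℝ) : ℂ) := by
  rw [xiLaw_eq_map hp, integral_map (Measurable.aemeasurable (by fun_prop)) (by fun_prop),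
    integral_prod]
  · rw [← integral_complex_ofReal]
    congr 1
    funext y
    simp only
    have e : ∀ g : ℝ, s * (√(y ⬝ᵥ y) * g) = (s * √(y ⬝ᵥ y)) * g := fun g => by ring
    simp_rw [e]
    rw [integral_exp_gaussianReal, gaussChar, mul_pow, Real.sq_sqrt (dotProduct_self_nonneg _)]
  · exact .of_bound (Measurable.aestronglyMeasurable (by fun_prop)) 1
      (ae_of_all _ fun w => (norm_exp_mul_I _).le)

theorem integral_mul_exp_xiLaw {p : ℕ} (hp : 1 ≤ p) (s : ℝ) :
    ∫ x : ℝ, (x : ℂ) * Complex.exp (((s * x : ℝ) : ℂ) * Complex.I) ∂(xiLaw p)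
      = Complex.I * s *
        ((∫ y, (y ⬝ᵥ y) * Real.exp (-(s ^ 2 * (y ⬝ᵥ y)) / 2) ∂(gaussianVec p) : ℝ) : ℂ) := by
  have hx : Integrable (fun x : ℝ => (x : ℂ) * Complex.exp (((s * x : ℝ) : ℂ) * Complex.I))
      (xiLaw p) := by
    have h1 := integrable_pow_xiLaw hp 1
    refine Integrable.mono h1 (Measurable.aestronglyMeasurable (by fun_prop)) (ae_of_all _ fun x => ?_)
    rw [norm_mul, norm_exp_mul_I, mul_one, pow_one, Complex.norm_real]
  rw [xiLaw_eq_map hp] at hx ⊢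
  rw [integrable_map_measure (Measurable.aestronglyMeasurable (by fun_prop))
    (Measurable.aemeasurable (by fun_prop))] at hx
  simp only [Function.comp_def] at hx
  rw [integral_map (Measurable.aemeasurable (by fun_prop)) (by fun_prop), integral_prod _ hx,
    ← integral_complex_ofReal, ← integral_const_mul]
  congr 1
  funext y
  simp only [Complex.ofReal_mul]
  have e : ∀ g : ℝ, ((√(y ⬝ᵥ y) : ℝ) : ℂ) * (g : ℂ) *
      Complex.exp ((s : ℂ) * ((√(y ⬝ᵥ y) : ℂ) * (g : ℂ)) * Complex.I)
      = (√(y ⬝ᵥ y) : ℂ) * ((g : ℂ) *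
        Complex.exp ((((s * √(y ⬝ᵥ y)) * g : ℝ) : ℂ) * Complex.I)) := fun g => by
    push_cast; ring_nf
  simp_rw [e]
  rw [integral_const_mul, integral_mul_exp_gaussianReal, gaussChar, mul_pow,
    Real.sq_sqrt (dotProduct_self_nonneg _)]
  have h4 : ((√(y ⬝ᵥ y) : ℝ) : ℂ) ^ 2 = ((y ⬝ᵥ y : ℝ) : ℂ) := by
    rw [← Complex.ofReal_pow, Real.sq_sqrt (dotProduct_self_nonneg _)]
  push_cast
  rw [← h4]
  ring

end Gaussian

/-! ### A Poincaré inequality for trigonometric sums of a Gaussian vector -/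

section Poincare

/-- The Hadamard powers of a Gram matrix are positive semidefinite. -/
theorem sum_re_mul_dotProduct_pow_nonneg {κ : Type*} [Fintype κ] {p : ℕ} (d : κ → ℂ)
    (l : κ → Fin p → ℝ) (q : ℕ) :
    0 ≤ ∑ j, ∑ k, (d j * starRingEnd ℂ (d k)).re * (l j ⬝ᵥ l k) ^ q := by
  have h : ((∑ j, ∑ k, (d j * starRingEnd ℂ (d k)).re * (l j ⬝ᵥ l k) ^ q : ℝ) : ℝ)
      = ∑ f : Fin q → Fin p, ‖∑ j, d j * ((∏ i, l j (f i) : ℝ) : ℂ)‖ ^ 2 := by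
    have e : ∀ f : Fin q → Fin p, ‖∑ j, d j * ((∏ i, l j (f i) : ℝ) : ℂ)‖ ^ 2
        = ∑ j, ∑ k, (d j * starRingEnd ℂ (d k)).re * ∏ i, (l j (f i) * l k (f i)) := by
      intro f
      rw [← Complex.ofReal_re (‖_‖ ^ 2), Complex.ofReal_pow, ← Complex.mul_conj', map_sum,
        Finset.sum_mul_sum, Complex.re_sum]
      refine Finset.sum_congr rfl fun j _ => ?_
      rw [Complex.re_sum]
      refine Finset.sum_congr rfl fun k _ => ?_
      rw [map_mul, Complex.conj_ofReal, mul_mul_mul_comm, ← Complex.ofReal_mul,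
        Complex.re_mul_ofReal, Finset.prod_mul_distrib]
    simp_rw [e]
    symm
    rw [Finset.sum_comm]
    refine Finset.sum_congr rfl fun j _ => ?_
    rw [Finset.sum_comm]
    refine Finset.sum_congr rfl fun k _ => ?_
    rw [← Finset.mul_sum, dotProduct, Fintype.sum_pow]
  rw [h]
  positivity

theorem hasSum_mul_exp_sub_exp_add_one (t : ℝ) :
    HasSum (fun m : ℕ => t ^ (m + 1) * (1 / (m.factorial : ℝ) - 1 / ((m + 1).factorial : ℝ)))
      (t * Real.exp t - Real.exp t + 1) := by
  have h1 : HasSum (fun m : ℕ => t ^ m / (m.factorial : ℝ)) (Real.exp t) := by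
    rw [Real.exp_eq_exp_ℝ]; exact NormedSpace.expSeries_div_hasSum_exp t
  have h2 := h1.mul_left t
  have h3 : HasSum (fun m : ℕ => t ^ (m + 1) / ((m + 1).factorial : ℝ)) (Real.exp t - 1) := by
    have := (hasSum_nat_add_iff' 1).2 h1
    simpa using this
  have h4 := h2.sub h3
  have e : (fun m : ℕ => t ^ (m + 1) * (1 / (m.factorial : ℝ) - 1 / ((m + 1).factorial : ℝ)))
      = fun m : ℕ => t * (t ^ m / (m.factorial : ℝ)) - t ^ (m + 1) / ((m + 1).factorial : ℝ) := by
    funext m; ring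
  rw [e, show t * Real.exp t - Real.exp t + 1 = t * Real.exp t - (Real.exp t - 1) by ring]
  exact h4

/-- The Hermitian form with kernel `ψ(⟨l_j, l_k⟩ / p)` is nonnegative, as the Taylor coefficients
`1/m! - 1/(m+1)!` of `ψ(t) = t eᵗ - eᵗ + 1` are. -/
theorem sum_re_mul_exp_nonneg {κ : Type*} [Fintype κ] {p : ℕ} (d : κ → ℂ)
    (l : κ → Fin p → ℝ) :
    0 ≤ ∑ j, ∑ k, (d j * starRingEnd ℂ (d k)).re *
      ((l j ⬝ᵥ l k / p) * Real.exp (l j ⬝ᵥ l k / p) - Real.exp (l j ⬝ᵥ l k / p) + 1) := by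
  have h : HasSum (fun m : ℕ => ∑ j, ∑ k, (d j * starRingEnd ℂ (d k)).re *
      ((l j ⬝ᵥ l k / p) ^ (m + 1) * (1 / (m.factorial : ℝ) - 1 / ((m + 1).factorial : ℝ)))) _ :=
    hasSum_sum fun j _ => hasSum_sum fun k _ =>
      (hasSum_mul_exp_sub_exp_add_one (l j ⬝ᵥ l k / p)).mul_left _
  refine h.nonneg fun m => ?_
  have hc : (0 : ℝ) ≤ 1 / (m.factorial : ℝ) - 1 / ((m + 1).factorial : ℝ) := by
    rw [sub_nonneg]
    gcongr
    omega
  have e : ∑ j, ∑ k, (d j * starRingEnd ℂ (d k)).re *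
      ((l j ⬝ᵥ l k / p) ^ (m + 1) * (1 / (m.factorial : ℝ) - 1 / ((m + 1).factorial : ℝ)))
      = (1 / (m.factorial : ℝ) - 1 / ((m + 1).factorial : ℝ)) / (p : ℝ) ^ (m + 1) *
        ∑ j, ∑ k, (d j * starRingEnd ℂ (d k)).re * (l j ⬝ᵥ l k) ^ (m + 1) := by
    simp_rw [Finset.mul_sum, div_pow]
    refine Finset.sum_congr rfl fun j _ => Finset.sum_congr rfl fun k _ => by ring
  rw [e]
  exact mul_nonneg (by positivity) (sum_re_mul_dotProduct_pow_nonneg _ _ _)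

/-- The trigonometric sum `∑ c_k exp(i ⟨l_k, x⟩)`. -/
def trigSum {κ : Type*} [Fintype κ] {p : ℕ} (c : κ → ℂ) (l : κ → Fin p → ℝ) (x : Fin p → ℝ) : ℂ :=
  ∑ k, c k * Complex.exp (((l k ⬝ᵥ x : ℝ) : ℂ) * Complex.I)

@[fun_prop]
theorem measurable_trigSum {κ : Type*} [Fintype κ] {p : ℕ} (c : κ → ℂ) (l : κ → Fin p → ℝ) :
    Measurable (trigSum c l) := by
  unfold trigSum; fun_prop

theorem norm_trigSum_le {κ : Type*} [Fintype κ] {p : ℕ} (c : κ → ℂ) (l : κ → Fin p → ℝ)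
    (x : Fin p → ℝ) : ‖trigSum c l x‖ ≤ ∑ k, ‖c k‖ :=
  (norm_sum_le _ _).trans (Finset.sum_le_sum fun k _ => by rw [norm_mul, norm_exp_mul_I, mul_one])

theorem integrable_exp_dotProduct {p : ℕ} (l : Fin p → ℝ) :
    Integrable (fun x : Fin p → ℝ => Complex.exp (((l ⬝ᵥ x : ℝ) : ℂ) * Complex.I))
      (gaussianVec p) :=
  .of_bound (Measurable.aestronglyMeasurable (by fun_prop)) 1
    (ae_of_all _ fun _ => (norm_exp_mul_I _).le)

theorem integral_trigSum {κ : Type*} [Fintype κ] {p : ℕ} (c : κ → ℂ) (l : κ → Fin p → ℝ) :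
    ∫ x, trigSum c l x ∂(gaussianVec p)
      = ∑ k, c k * (Real.exp (-(l k ⬝ᵥ l k) / (2 * p)) : ℝ) := by
  unfold trigSum
  rw [integral_finsetSum _ fun k _ => (integrable_exp_dotProduct (l k)).const_mul (c k)]
  simp_rw [integral_const_mul, integral_exp_gaussianVec]

theorem integral_norm_trigSum_sq {κ : Type*} [Fintype κ] {p : ℕ} (c : κ → ℂ)
    (l : κ → Fin p → ℝ) :
    ∫ x, ‖trigSum c l x‖ ^ 2 ∂(gaussianVec p)
      = ∑ j, ∑ k, (c j * starRingEnd ℂ (c k)).re *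
        Real.exp (-((l j - l k) ⬝ᵥ (l j - l k)) / (2 * p)) := by
  have e : ∀ x, ((‖trigSum c l x‖ ^ 2 : ℝ) : ℂ)
      = ∑ j, ∑ k, (c j * starRingEnd ℂ (c k)) *
        Complex.exp ((((l j - l k) ⬝ᵥ x : ℝ) : ℂ) * Complex.I) := by
    intro x
    rw [Complex.ofReal_pow, ← Complex.mul_conj', trigSum, map_sum, Finset.sum_mul_sum]
    refine Finset.sum_congr rfl fun j _ => Finset.sum_congr rfl fun k _ => ?_
    rw [map_mul, ← Complex.exp_conj, map_mul, Complex.conj_I, Complex.conj_ofReal,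
      mul_mul_mul_comm, ← Complex.exp_add, sub_dotProduct]
    push_cast
    ring_nf
  have h : ((∫ x, ‖trigSum c l x‖ ^ 2 ∂(gaussianVec p) : ℝ) : ℂ)
      = ∑ j, ∑ k, (c j * starRingEnd ℂ (c k)) *
        (Real.exp (-((l j - l k) ⬝ᵥ (l j - l k)) / (2 * p)) : ℝ) := by
    rw [← integral_complex_ofReal]
    simp_rw [e]
    rw [integral_finsetSum _ fun j _ => integrable_finsetSum _ fun k _ =>
      (integrable_exp_dotProduct _).const_mul _]
    refine Finset.sum_congr rfl fun j _ => ?_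
    rw [integral_finsetSum _ fun k _ => (integrable_exp_dotProduct _).const_mul _]
    simp_rw [integral_const_mul, integral_exp_gaussianVec]
  have h2 := congrArg Complex.re h
  rw [Complex.ofReal_re, Complex.re_sum] at h2
  rw [h2]
  refine Finset.sum_congr rfl fun j _ => ?_
  rw [Complex.re_sum]
  refine Finset.sum_congr rfl fun k _ => by rw [Complex.re_mul_ofReal]

/-- The Gaussian Poincaré inequality for trigonometric sums. In the variables
`d_k = c_k exp(-|l_k|² / 2p)` the difference of the two sides is the Hermitian form with kernel
`ψ(⟨l_j, l_k⟩ / p)`, where `ψ(t) = t eᵗ - eᵗ + 1` has nonnegative Taylor coefficients. -/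
theorem integral_norm_trigSum_sub_sq_le {κ : Type*} [Fintype κ] {p : ℕ} (c : κ → ℂ)
    (l : κ → Fin p → ℝ) :
    ∫ x, ‖trigSum c l x - ∫ y, trigSum c l y ∂(gaussianVec p)‖ ^ 2 ∂(gaussianVec p)
      ≤ (p : ℝ)⁻¹ * ∫ x, ∑ α, ‖trigSum (fun k => c k * (l k α : ℂ)) l x‖ ^ 2 ∂(gaussianVec p) := by
  have hint : ∀ c' : κ → ℂ, Integrable (fun x => ‖trigSum c' l x‖ ^ 2) (gaussianVec p) := by
    intro c'
    refine .of_bound (Measurable.aestronglyMeasurable (by fun_prop)) ((∑ k, ‖c' k‖) ^ 2)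
      (ae_of_all _ fun x => ?_)
    rw [Real.norm_of_nonneg (by positivity)]
    exact pow_le_pow_left₀ (norm_nonneg _) (norm_trigSum_le _ _ _) 2
  have hint1 : Integrable (trigSum c l) (gaussianVec p) :=
    .of_bound (measurable_trigSum c l).aestronglyMeasurable _ (ae_of_all _ (norm_trigSum_le c l))
  set d : κ → ℂ := fun k => c k * (Real.exp (-(l k ⬝ᵥ l k) / (2 * p)) : ℝ) with hd
  set μ := ∫ y, trigSum c l y ∂(gaussianVec p) with hμ
  have hμd : μ = ∑ k, d k := integral_trigSum c l
  -- the covariance structure: `𝔼 exp(i ⟨l_j - l_k, x⟩) = exp(-|l_j - l_k|² / 2p)` in terms of `d`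
  have hdd : ∀ j k, (d j * starRingEnd ℂ (d k)).re * Real.exp (l j ⬝ᵥ l k / p)
      = (c j * starRingEnd ℂ (c k)).re *
        Real.exp (-((l j - l k) ⬝ᵥ (l j - l k)) / (2 * p)) := by
    intro j k
    have e1 : d j * starRingEnd ℂ (d k) = (c j * starRingEnd ℂ (c k)) *
        ((Real.exp (-(l j ⬝ᵥ l j) / (2 * p)) * Real.exp (-(l k ⬝ᵥ l k) / (2 * p)) : ℝ) : ℂ) := by
      simp only [hd, map_mul, Complex.conj_ofReal]
      push_cast
      ring
    rw [e1, Complex.re_mul_ofReal, mul_assoc, ← Real.exp_add, ← Real.exp_add]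
    congr 2
    rw [sub_dotProduct, dotProduct_sub, dotProduct_sub, dotProduct_comm (l k) (l j)]
    ring
  have hvar : ∫ x, ‖trigSum c l x - μ‖ ^ 2 ∂(gaussianVec p)
      = ∫ x, ‖trigSum c l x‖ ^ 2 ∂(gaussianVec p) - ‖μ‖ ^ 2 := by
    have e : ∀ x, ‖trigSum c l x - μ‖ ^ 2 = ‖trigSum c l x‖ ^ 2
        - 2 * (trigSum c l x * starRingEnd ℂ μ).re + ‖μ‖ ^ 2 := by
      intro x
      rw [← Complex.normSq_eq_norm_sq, ← Complex.normSq_eq_norm_sq, ← Complex.normSq_eq_norm_sq,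
        Complex.normSq_sub]
      ring
    simp_rw [e]
    have hi : Integrable (fun x => (trigSum c l x * starRingEnd ℂ μ).re) (gaussianVec p) :=
      (hint1.mul_const _).re
    have hs : Integrable (fun x => ‖trigSum c l x‖ ^ 2
        - 2 * (trigSum c l x * starRingEnd ℂ μ).re) (gaussianVec p) :=
      (hint c).sub (hi.const_mul 2)
    rw [integral_add hs (integrable_const _),
      integral_sub (hint c) (hi.const_mul 2), integral_const_mul]
    have h3 : ∫ x, (trigSum c l x * starRingEnd ℂ μ).re ∂(gaussianVec p) = ‖μ‖ ^ 2 := by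
      have := integral_re (hint1.mul_const (starRingEnd ℂ μ))
      simp only [RCLike.re_eq_complex_re] at this
      rw [this, integral_mul_const, ← hμ, Complex.mul_conj', ← Complex.ofReal_pow,
        Complex.ofReal_re]
    rw [h3]
    simp
    ring
  have hμsq : ‖μ‖ ^ 2 = ∑ j, ∑ k, (d j * starRingEnd ℂ (d k)).re := by
    rw [← Complex.ofReal_re (‖μ‖ ^ 2), Complex.ofReal_pow, ← Complex.mul_conj', hμd, map_sum,
        Finset.sum_mul_sum, Complex.re_sum]
    refine Finset.sum_congr rfl fun j _ => by rw [Complex.re_sum]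
  -- the sums over `α` are the components of the gradient
  have hgrad : (p : ℝ)⁻¹ * ∫ x, ∑ α, ‖trigSum (fun k => c k * (l k α : ℂ)) l x‖ ^ 2 ∂(gaussianVec p)
      = ∑ j, ∑ k, (d j * starRingEnd ℂ (d k)).re *
        ((l j ⬝ᵥ l k / p) * Real.exp (l j ⬝ᵥ l k / p)) := by
    rw [integral_finsetSum _ fun α _ => hint _]
    simp_rw [integral_norm_trigSum_sq]
    rw [Finset.sum_comm, Finset.mul_sum]
    refine Finset.sum_congr rfl fun j _ => ?_
    rw [Finset.sum_comm, Finset.mul_sum]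
    refine Finset.sum_congr rfl fun k _ => ?_
    have e2 : ∀ α, (c j * (l j α : ℂ) * starRingEnd ℂ (c k * (l k α : ℂ))).re
        = (c j * starRingEnd ℂ (c k)).re * (l j α * l k α) := by
      intro α
      rw [map_mul, Complex.conj_ofReal, mul_mul_mul_comm, ← Complex.ofReal_mul,
        Complex.re_mul_ofReal]
    simp_rw [e2]
    rw [← Finset.sum_mul, ← Finset.mul_sum]
    have := hdd j k
    rw [show (d j * starRingEnd ℂ (d k)).re * (l j ⬝ᵥ l k / p * Real.exp (l j ⬝ᵥ l k / p))
      = (l j ⬝ᵥ l k / p) * ((d j * starRingEnd ℂ (d k)).re * Real.exp (l j ⬝ᵥ l k / p)) by ring, this]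
    rw [show ∑ α, l j α * l k α = l j ⬝ᵥ l k from rfl]
    ring
  rw [hvar, hμsq, hgrad, integral_norm_trigSum_sq, ← sub_nonneg]
  refine (sum_re_mul_exp_nonneg d l).trans (le_of_eq ?_)
  simp_rw [← hdd, ← Finset.sum_sub_distrib]
  refine Finset.sum_congr rfl fun j _ => Finset.sum_congr rfl fun k _ => by ring

end Poincare

/-! ### Quadratic forms in trigonometric functions of a new Gaussian vector -/

section TrigForms

variable {ι : Type*} [Fintype ι]

/-- The quadratic form `p⁻¹ ∑ M_jk h(√p ⟨X_j, x⟩) h'(√p ⟨X_k, x⟩)`. -/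
def bilForm {p : ℕ} (M : Matrix ι ι ℂ) (h h' : ℝ → ℂ) (X : ι → Fin p → ℝ) (x : Fin p → ℝ) : ℂ :=
  (p : ℂ)⁻¹ * ∑ j, ∑ k, M j k * (h (√(p : ℝ) * (X j ⬝ᵥ x)) * h' (√(p : ℝ) * (X k ⬝ᵥ x)))

/-- The value around which `bilForm M h h' X` concentrates, where `e`, `m`, `k` stand for
`𝔼 h h'`, `𝔼 h 𝔼 h'` and `𝔼 ξh 𝔼 ξh'`. -/
def formLimit {p : ℕ} (M : Matrix ι ι ℂ) (X : ι → Fin p → ℝ) (e m k : ℂ) : ℂ :=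
  (p : ℂ)⁻¹ * ((e - m - k) * M.trace + k * (∑ j, ∑ l, M j l * ((X j ⬝ᵥ X l : ℝ) : ℂ))
    + m * ∑ j, ∑ l, M j l)

/-- The character `x ↦ exp(i s x)`. -/
def expI (s x : ℝ) : ℂ := Complex.exp (((s * x : ℝ) : ℂ) * Complex.I)

theorem norm_expI (s x : ℝ) : ‖expI s x‖ = 1 := norm_exp_mul_I _

@[fun_prop]
theorem measurable_expI (s : ℝ) : Measurable (expI s) := by unfold expI; fun_prop

theorem expI_mul_expI (s t x : ℝ) : expI s x * expI t x = expI (s + t) x := by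
  rw [expI, expI, expI, ← Complex.exp_add]; congr 1; push_cast; ring

theorem sum_norm_sum_smul_sq_le {p : ℕ} (X : ι → Fin p → ℝ) (y : ι → ℂ) :
    ∑ α, ‖∑ j, (X j α : ℂ) * y j‖ ^ 2 ≤ nsq y * √(∑ j, ∑ k, (X j ⬝ᵥ X k) ^ 2) := by
  have e : ((∑ α, ‖∑ j, (X j α : ℂ) * y j‖ ^ 2 : ℝ) : ℂ)
      = ∑ j, ∑ k, (y j * starRingEnd ℂ (y k)) * ((X j ⬝ᵥ X k : ℝ) : ℂ) := by
    push_cast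
    simp_rw [← Complex.mul_conj', map_sum, Finset.sum_mul_sum]
    rw [Finset.sum_comm]
    refine Finset.sum_congr rfl fun j _ => ?_
    rw [Finset.sum_comm]
    refine Finset.sum_congr rfl fun k _ => ?_
    rw [dotProduct, Complex.ofReal_sum, Finset.mul_sum]
    refine Finset.sum_congr rfl fun α _ => ?_
    rw [map_mul, Complex.conj_ofReal]
    push_cast
    ring
  have h1 := norm_dotProduct_le (fun q : ι × ι => y q.1 * starRingEnd ℂ (y q.2))
    (fun q : ι × ι => ((X q.1 ⬝ᵥ X q.2 : ℝ) : ℂ))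
  simp only [nsq, dotProduct, Fintype.sum_prod_type, norm_mul, mul_pow, RCLike.norm_conj,
    Complex.norm_real, Real.norm_eq_abs, sq_abs] at h1
  simp only [dotProduct] at e
  rw [← e, Complex.norm_real, ← Finset.sum_mul_sum] at h1
  rw [Real.sqrt_mul_self (Finset.sum_nonneg fun _ _ => by positivity)] at h1
  exact (le_abs_self _).trans h1

theorem bilForm_expI_eq_trigSum {p : ℕ} (M : Matrix ι ι ℂ) (s t : ℝ) (X : ι → Fin p → ℝ) :
    bilForm M (expI s) (expI t) X = trigSum (fun q : ι × ι => (p : ℂ)⁻¹ * M q.1 q.2)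
      (fun q => (s * √(p : ℝ)) • X q.1 + (t * √(p : ℝ)) • X q.2) := by
  funext x
  rw [bilForm, trigSum, Fintype.sum_prod_type, Finset.mul_sum]
  refine Finset.sum_congr rfl fun j _ => ?_
  rw [Finset.mul_sum]
  refine Finset.sum_congr rfl fun k _ => ?_
  rw [expI, expI, ← Complex.exp_add, ← mul_assoc]
  congr 2
  rw [add_dotProduct, smul_dotProduct, smul_dotProduct, smul_eq_mul, smul_eq_mul]
  push_cast
  ring

theorem norm_add_sq_le (a b : ℂ) : ‖a + b‖ ^ 2 ≤ 2 * ‖a‖ ^ 2 + 2 * ‖b‖ ^ 2 := by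
  have h := pow_le_pow_left₀ (norm_nonneg _) (norm_add_le a b) 2
  nlinarith [sq_nonneg (‖a‖ - ‖b‖)]

/-- Variance of a quadratic form in exponentials, by the Poincaré inequality. -/
theorem integral_norm_bilForm_expI_sub_sq_le {p : ℕ} (hp : 1 ≤ p) {M : Matrix ι ι ℂ}
    (hM : M.IsSymm) {c : ℝ} (h : OpBound M c) (s t : ℝ) (X : ι → Fin p → ℝ) :
    ∫ x, ‖bilForm M (expI s) (expI t) X x
        - ∫ y, bilForm M (expI s) (expI t) X y ∂(gaussianVec p)‖ ^ 2 ∂(gaussianVec p)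
      ≤ 2 * (s ^ 2 + t ^ 2) * c ^ 2 * Fintype.card ι / (p : ℝ) ^ 2
        * √(∑ j, ∑ k, (X j ⬝ᵥ X k) ^ 2) := by
  have hp' : (0 : ℝ) < p := by exact_mod_cast hp
  set F := √(∑ j, ∑ k, (X j ⬝ᵥ X k) ^ 2) with hF
  rw [bilForm_expI_eq_trigSum]
  refine (integral_norm_trigSum_sub_sq_le _ _).trans ?_
  set l : ι × ι → Fin p → ℝ := fun q => (s * √(p : ℝ)) • X q.1 + (t * √(p : ℝ)) • X q.2 with hl
  -- the gradient of the form is `p^(-1/2) (s ∑ X_j u_j (M w)_j + t ∑ X_j w_j (M u)_j)`, where `u`, `w`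
  -- are the vectors of the exponentials
  have key : ∀ x, ∑ α, ‖trigSum (fun k : ι × ι => (p : ℂ)⁻¹ * M k.1 k.2 * (l k α : ℂ)) l x‖ ^ 2
      ≤ (p : ℝ)⁻¹ * (2 * (s ^ 2 + t ^ 2) * (c ^ 2 * Fintype.card ι) * F) := by
    intro x
    set u : ι → ℂ := fun j => expI s (√(p : ℝ) * (X j ⬝ᵥ x)) with hu
    set w : ι → ℂ := fun j => expI t (√(p : ℝ) * (X j ⬝ᵥ x)) with hw
    have hy : ∀ (u' w' : ι → ℂ), (∀ j, ‖u' j‖ = 1) → (∀ j, ‖w' j‖ = 1) →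
        ∑ α, ‖∑ j, (X j α : ℂ) * (u' j * (M.mulVec w') j)‖ ^ 2 ≤ c ^ 2 * Fintype.card ι * F := by
      intro u' w' hu' hw'
      refine (sum_norm_sum_smul_sq_le X _).trans ?_
      refine mul_le_mul_of_nonneg_right ?_ (Real.sqrt_nonneg _)
      have e : nsq (fun j => u' j * (M.mulVec w') j) = nsq (M.mulVec w') := by
        simp only [nsq, norm_mul, hu', one_mul]
      rw [e]
      refine (h w').trans (le_of_eq ?_)
      simp [nsq, hw']
    have e : ∀ α, trigSum (fun k : ι × ι => (p : ℂ)⁻¹ * M k.1 k.2 * (l k α : ℂ)) l x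
        = ((p : ℂ)⁻¹ * (√(p : ℝ) : ℂ)) *
          ((s : ℂ) * (∑ j, (X j α : ℂ) * (u j * (M.mulVec w) j))
            + (t : ℂ) * ∑ j, (X j α : ℂ) * (w j * (M.mulVec u) j)) := by
      intro α
      have e1 : ∀ q : ι × ι, Complex.exp (((l q ⬝ᵥ x : ℝ) : ℂ) * Complex.I) = u q.1 * w q.2 := by
        intro q
        rw [hu, hw]
        simp only [expI, hl]
        rw [← Complex.exp_add]
        congr 1
        rw [add_dotProduct, smul_dotProduct, smul_dotProduct, smul_eq_mul, smul_eq_mul]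
        push_cast
        ring
      have e2 : ∑ j, (X j α : ℂ) * (w j * (M.mulVec u) j)
          = ∑ j, ∑ k, M j k * (X k α : ℂ) * (u j * w k) := by
        rw [Finset.sum_comm]
        refine Finset.sum_congr rfl fun k _ => ?_
        rw [Matrix.mulVec, dotProduct, Finset.mul_sum, Finset.mul_sum]
        refine Finset.sum_congr rfl fun j _ => ?_
        rw [← hM.apply j k]
        ring
      have e3 : ∑ j, (X j α : ℂ) * (u j * (M.mulVec w) j)
          = ∑ j, ∑ k, M j k * (X j α : ℂ) * (u j * w k) := by
        refine Finset.sum_congr rfl fun j _ => ?_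
        rw [Matrix.mulVec, dotProduct, Finset.mul_sum, Finset.mul_sum]
        refine Finset.sum_congr rfl fun k _ => ?_
        ring
      rw [e2, e3, trigSum, Fintype.sum_prod_type]
      simp_rw [e1, Finset.mul_sum, ← Finset.sum_add_distrib, Finset.mul_sum]
      refine Finset.sum_congr rfl fun j _ => Finset.sum_congr rfl fun k _ => ?_
      simp only [hl, Pi.add_apply, Pi.smul_apply, smul_eq_mul]
      push_cast
      ring
    have hc : ‖(p : ℂ)⁻¹ * (√(p : ℝ) : ℂ)‖ ^ 2 = (p : ℝ)⁻¹ := by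
      rw [norm_mul, mul_pow, norm_inv, Complex.norm_natCast, Complex.norm_real, Real.norm_eq_abs,
        sq_abs, Real.sq_sqrt hp'.le]
      field_simp
    have hs : ∀ (r : ℝ) (z : ℂ), ‖(r : ℂ) * z‖ ^ 2 = r ^ 2 * ‖z‖ ^ 2 := by
      intro r z
      rw [norm_mul, mul_pow, Complex.norm_real, Real.norm_eq_abs, sq_abs]
    calc ∑ α, ‖trigSum (fun k : ι × ι => (p : ℂ)⁻¹ * M k.1 k.2 * (l k α : ℂ)) l x‖ ^ 2
        ≤ ∑ α, (p : ℝ)⁻¹ * (2 * (s ^ 2 * ‖∑ j, (X j α : ℂ) * (u j * (M.mulVec w) j)‖ ^ 2)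
            + 2 * (t ^ 2 * ‖∑ j, (X j α : ℂ) * (w j * (M.mulVec u) j)‖ ^ 2)) := by
          refine Finset.sum_le_sum fun α _ => ?_
          rw [e α, norm_mul, mul_pow, hc, ← hs, ← hs]
          exact mul_le_mul_of_nonneg_left (norm_add_sq_le _ _) (by positivity)
      _ = (p : ℝ)⁻¹ * (2 * (s ^ 2 * ∑ α, ‖∑ j, (X j α : ℂ) * (u j * (M.mulVec w) j)‖ ^ 2)
            + 2 * (t ^ 2 * ∑ α, ‖∑ j, (X j α : ℂ) * (w j * (M.mulVec u) j)‖ ^ 2)) := by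
          rw [← Finset.mul_sum, Finset.sum_add_distrib]
          simp_rw [← Finset.mul_sum]
      _ ≤ (p : ℝ)⁻¹ * (2 * (s ^ 2 * (c ^ 2 * Fintype.card ι * F))
            + 2 * (t ^ 2 * (c ^ 2 * Fintype.card ι * F))) := by
          have h1 := hy u w (fun _ => norm_expI _ _) (fun _ => norm_expI _ _)
          have h2 := hy w u (fun _ => norm_expI _ _) (fun _ => norm_expI _ _)
          gcongr
      _ = _ := by ring
  have hF0 : 0 ≤ F := Real.sqrt_nonneg _
  calc (p : ℝ)⁻¹ * ∫ x, ∑ α, ‖trigSum (fun k : ι × ι => (p : ℂ)⁻¹ * M k.1 k.2 * (l k α : ℂ)) l x‖ ^ 2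
        ∂(gaussianVec p)
      ≤ (p : ℝ)⁻¹ * ∫ _x, (p : ℝ)⁻¹ * (2 * (s ^ 2 + t ^ 2) * (c ^ 2 * Fintype.card ι) * F)
        ∂(gaussianVec p) := by
        refine mul_le_mul_of_nonneg_left ?_ (by positivity)
        exact integral_mono_of_nonneg (ae_of_all _ fun x => Finset.sum_nonneg fun _ _ => by positivity)
          (integrable_const _) (ae_of_all _ key)
    _ = _ := by
      rw [integral_const, probReal_univ, one_smul]
      field_simp

theorem abs_mul_exp_neg_sub_add_le {a x : ℝ} (ha : 0 ≤ a) (ha1 : a ≤ 1)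
    (hK : a * Real.exp (-x) ≤ 1) : |a * (Real.exp (-x) - 1 + x)| ≤ x ^ 2 := by
  have h0 : 0 ≤ Real.exp (-x) - 1 + x := by linarith [Real.add_one_le_exp (-x)]
  rw [abs_of_nonneg (mul_nonneg ha h0)]
  have hx1 : Real.exp (-x) * Real.exp x = 1 := by rw [← Real.exp_add]; simp
  have h5 := Real.add_one_le_exp x
  rcases le_total 0 x with hx | hx
  · have h2 : Real.exp (-x) - 1 + x ≤ x ^ 2 := by
      have h3 : Real.exp (-x) * (x + 1) ≤ 1 := by
        exact (mul_le_mul_of_nonneg_left h5 (Real.exp_pos _).le).trans_eq hx1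
      nlinarith
    calc a * (Real.exp (-x) - 1 + x) ≤ 1 * (Real.exp (-x) - 1 + x) := by gcongr
      _ ≤ x ^ 2 := by rw [one_mul]; exact h2
  -- for `x < 0` the exponential is first factored out
  · have h6 : a * (Real.exp (-x) - 1 + x) = a * Real.exp (-x) * (1 - (1 - x) * Real.exp x) := by
      linear_combination a * (1 - x) * hx1
    have h7 : 0 ≤ a * Real.exp (-x) := by positivity
    have h8 : 1 - (1 - x) * Real.exp x ≤ x ^ 2 := by nlinarith
    rw [h6]
    calc a * Real.exp (-x) * (1 - (1 - x) * Real.exp x) ≤ a * Real.exp (-x) * x ^ 2 := by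
          gcongr
      _ ≤ 1 * x ^ 2 := by gcongr
      _ = _ := one_mul _

/-- The off-diagonal remainder in the expansion of `exp(-(A + B)/2 - x)`. -/
theorem offDiag_remainder_sq_le {a b φ ψ x η : ℝ} (ha : 0 ≤ a) (ha1 : a ≤ 1) (hb : 0 ≤ b)
    (hb1 : b ≤ 1) (hφ : 0 ≤ φ) (hφ1 : φ ≤ 1) (hψ : 0 ≤ ψ) (hψ1 : ψ ≤ 1)
    (hK : a * b * Real.exp (-x) ≤ 1) (hη : 1 ≤ η) :
    (a * b * Real.exp (-x) - φ * ψ * (1 - x) - (a * b - φ * ψ)) ^ 2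
      ≤ 6 * η * x ^ 4 + 2 / η * ((a - φ) ^ 2 + (b - ψ) ^ 2) := by
  have h1 := abs_mul_exp_neg_sub_add_le (mul_nonneg ha hb) (mul_le_one₀ ha1 hb hb1) hK
  set y := a * b * (Real.exp (-x) - 1 + x) with hy
  set d := (a * b - φ * ψ) * x with hd
  have e : a * b * Real.exp (-x) - φ * ψ * (1 - x) - (a * b - φ * ψ) = y - d := by
    rw [hy, hd]; ring
  have hy2 : y ^ 2 ≤ x ^ 4 := by
    rw [← sq_abs y]
    calc |y| ^ 2 ≤ (x ^ 2) ^ 2 := by gcongr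
      _ = x ^ 4 := by ring
  have hab : |a * b - φ * ψ| ≤ |a - φ| + |b - ψ| := by
    have e1 : a * b - φ * ψ = (a - φ) * b + φ * (b - ψ) := by ring
    rw [e1]
    refine (abs_add_le _ _).trans ?_
    rw [abs_mul, abs_mul, abs_of_nonneg hb, abs_of_nonneg hφ]
    nlinarith [abs_nonneg (a - φ), abs_nonneg (b - ψ)]
  have hab2 : (a * b - φ * ψ) ^ 2 ≤ 2 * ((a - φ) ^ 2 + (b - ψ) ^ 2) := by
    rw [← sq_abs (a * b - φ * ψ), ← sq_abs (a - φ), ← sq_abs (b - ψ)]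
    nlinarith [abs_nonneg (a * b - φ * ψ), sq_nonneg (|a - φ| - |b - ψ|)]
  have hη0 : 0 < η := by linarith
  have key : ∀ u : ℝ, u ^ 2 ≤ 1 → u ^ 2 * x ^ 2 ≤ (η * x ^ 4 + u ^ 2 / η) / 2 := by
    intro u hu
    have h3 : 2 * (u ^ 2 * x ^ 2) ≤ η * x ^ 4 + u ^ 4 / η := by
      have e2 : η * x ^ 4 + u ^ 4 / η - 2 * (u ^ 2 * x ^ 2) = (η * x ^ 2 - u ^ 2) ^ 2 / η := by
        field_simp; ring
      have : 0 ≤ (η * x ^ 2 - u ^ 2) ^ 2 / η := by positivity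
      linarith
    have h4 : u ^ 4 / η ≤ u ^ 2 / η := by
      gcongr ?_ / η
      nlinarith [sq_nonneg u]
    linarith
  have ka := key (a - φ) (by rw [sq_le_one_iff_abs_le_one, abs_le]; constructor <;> linarith)
  have kb := key (b - ψ) (by rw [sq_le_one_iff_abs_le_one, abs_le]; constructor <;> linarith)
  have hd2 : d ^ 2 ≤ 2 * ((a - φ) ^ 2 + (b - ψ) ^ 2) * x ^ 2 := by
    rw [hd, mul_pow]; gcongr
  have hx4 : x ^ 4 ≤ η * x ^ 4 := le_mul_of_one_le_left (by positivity) hη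
  rw [e]
  have e3 : 2 / η * ((a - φ) ^ 2 + (b - ψ) ^ 2) = 2 * ((a - φ) ^ 2 / η + (b - ψ) ^ 2 / η) := by ring
  rw [e3]
  nlinarith [sq_nonneg (y + d)]

/-- The squared deviation `∑ (|X_j|² - 1)²` of the norms. -/
def normDev {p : ℕ} (X : ι → Fin p → ℝ) : ℝ := ∑ j, (X j ⬝ᵥ X j - 1) ^ 2

/-- The sum of the fourth powers of the off-diagonal Gram entries. -/
def offGram [DecidableEq ι] {p : ℕ} (X : ι → Fin p → ℝ) : ℝ :=
  ∑ j, ∑ k, if j = k then 0 else (X j ⬝ᵥ X k) ^ 4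

theorem normDev_nonneg {p : ℕ} (X : ι → Fin p → ℝ) : 0 ≤ normDev X :=
  Finset.sum_nonneg fun _ _ => sq_nonneg _

theorem sum_sq_exp_sub_gaussChar_le {p : ℕ} (X : ι → Fin p → ℝ) (s : ℝ) :
    ∑ j, (Real.exp (-(s ^ 2 * (X j ⬝ᵥ X j)) / 2) - gaussChar s) ^ 2
      ≤ s ^ 4 / 4 * normDev X := by
  rw [normDev, Finset.mul_sum]
  refine Finset.sum_le_sum fun j _ => ?_
  have := abs_exp_sub_gaussChar_le s (dotProduct_self_nonneg (X j))
  rw [← sq_abs]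
  calc _ ≤ (s ^ 2 / 2 * |X j ⬝ᵥ X j - 1|) ^ 2 := by gcongr
    _ = _ := by rw [mul_pow, sq_abs]; ring

theorem OpBound.norm_dotProduct_mulVec_sq_le {M : Matrix ι ι ℂ} {c : ℝ} (hc : 0 ≤ c)
    (h : OpBound M c) (u w : ι → ℂ) :
    ‖u ⬝ᵥ (M.mulVec w)‖ ^ 2 ≤ c ^ 2 * (nsq u * nsq w) := by
  calc _ ≤ (c * (√(nsq u) * √(nsq w))) ^ 2 := by
        gcongr; exact h.norm_dotProduct_mulVec_le hc u w
    _ = _ := by rw [mul_pow, mul_pow, Real.sq_sqrt (nsq_nonneg _), Real.sq_sqrt (nsq_nonneg _)]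

theorem OpBound.norm_sum_mul_sq_le [DecidableEq ι] {M : Matrix ι ι ℂ} {c : ℝ} (hc : 0 ≤ c)
    (h : OpBound M c) (D : ι → ι → ℂ) :
    ‖∑ j, ∑ k, M j k * D j k‖ ^ 2 ≤ c ^ 2 * (Fintype.card ι * ∑ j, ∑ k, ‖D j k‖ ^ 2) := by
  calc _ ≤ (c * (√(Fintype.card ι) * √(∑ j, ∑ k, ‖D j k‖ ^ 2))) ^ 2 := by
        gcongr; exact h.norm_sum_mul_le hc D
    _ = _ := by
      rw [mul_pow, mul_pow, Real.sq_sqrt (by positivity), Real.sq_sqrt (by positivity)]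

theorem dotProduct_mulVec_eq_sum (M : Matrix ι ι ℂ) (u w : ι → ℂ) :
    u ⬝ᵥ (M.mulVec w) = ∑ j, ∑ k, M j k * (u j * w k) := by
  simp only [dotProduct, Matrix.mulVec, Finset.mul_sum]
  exact Finset.sum_congr rfl fun j _ => Finset.sum_congr rfl fun k _ => by ring

theorem integral_bilForm_expI {p : ℕ} (hp : 1 ≤ p) (M : Matrix ι ι ℂ) (s t : ℝ)
    (X : ι → Fin p → ℝ) :
    ∫ x, bilForm M (expI s) (expI t) X x ∂(gaussianVec p)
      = (p : ℂ)⁻¹ * ∑ j, ∑ k, M j k *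
        ((Real.exp (-(s ^ 2 * (X j ⬝ᵥ X j)) / 2) * Real.exp (-(t ^ 2 * (X k ⬝ᵥ X k)) / 2)
          * Real.exp (-(s * t * (X j ⬝ᵥ X k))) : ℝ) : ℂ) := by
  have hp' : (0 : ℝ) < p := by exact_mod_cast hp
  rw [bilForm_expI_eq_trigSum, integral_trigSum, Fintype.sum_prod_type, Finset.mul_sum]
  refine Finset.sum_congr rfl fun j _ => ?_
  rw [Finset.mul_sum]
  refine Finset.sum_congr rfl fun k _ => ?_
  rw [← mul_assoc]
  congr 2
  rw [← Real.exp_add, ← Real.exp_add]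
  congr 1
  simp only [add_dotProduct, dotProduct_add, smul_dotProduct, dotProduct_smul, smul_eq_mul]
  rw [dotProduct_comm (X k) (X j)]
  have := Real.mul_self_sqrt hp'.le
  field_simp
  rw [Real.sq_sqrt hp'.le]
  ring

/-- The mean of a quadratic form in exponentials is close to its limit. -/
theorem norm_integral_bilForm_expI_sub_sq_le [DecidableEq ι] {p : ℕ} (hp : 1 ≤ p) {M : Matrix ι ι ℂ}
    {c : ℝ} (hc : 0 ≤ c) (h : OpBound M c) (s t : ℝ) (X : ι → Fin p → ℝ) {η : ℝ} (hη : 1 ≤ η) :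
    ‖∫ x, bilForm M (expI s) (expI t) X x ∂(gaussianVec p)
        - formLimit M X (gaussChar (s + t)) (gaussChar s * gaussChar t)
          (-(s * t * (gaussChar s * gaussChar t)))‖ ^ 2
      ≤ 3 * c ^ 2 * Fintype.card ι / (p : ℝ) ^ 2 *
        ((s ^ 4 / 4 + t ^ 4 / 4 + ((s + t) ^ 2 / 2 + |s * t| + s ^ 2 / 2 + t ^ 2 / 2) ^ 2
          + 2 / η * Fintype.card ι * (s ^ 4 / 4 + t ^ 4 / 4)) * normDev X
          + 6 * η * (s * t) ^ 4 * offGram X) := by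
  set φ := gaussChar s with hφ
  set ψ := gaussChar t with hψ
  set a : ι → ℝ := fun j => Real.exp (-(s ^ 2 * (X j ⬝ᵥ X j)) / 2) with ha
  set b : ι → ℝ := fun j => Real.exp (-(t ^ 2 * (X j ⬝ᵥ X j)) / 2) with hb
  have hr : ∀ j, 0 ≤ X j ⬝ᵥ X j := fun j => dotProduct_self_nonneg _
  have ha0 : ∀ j, 0 ≤ a j := fun j => (Real.exp_pos _).le
  have hb0 : ∀ j, 0 ≤ b j := fun j => (Real.exp_pos _).le
  have ha1 : ∀ j, a j ≤ 1 := fun j => Real.exp_le_one_iff.2 (by have := hr j; nlinarith [mul_nonneg (sq_nonneg s) (hr j)])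
  have hb1 : ∀ j, b j ≤ 1 := fun j => Real.exp_le_one_iff.2 (by nlinarith [mul_nonneg (sq_nonneg t) (hr j)])
  set D : ι → ι → ℝ := fun j k => a j * b k * Real.exp (-(s * t * (X j ⬝ᵥ X k)))
    - φ * ψ * (1 - s * t * (X j ⬝ᵥ X k)) - (a j * b k - φ * ψ)
    - if j = k then gaussChar (s + t) - φ * ψ + s * t * (φ * ψ) else 0 with hD
  -- the constant in front of the deviation of the norms on the diagonal
  set C := (s + t) ^ 2 / 2 + |s * t| + s ^ 2 / 2 + t ^ 2 / 2 with hC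
  have hsa := sum_sq_exp_sub_gaussChar_le X s
  have hsb := sum_sq_exp_sub_gaussChar_le X t
  -- the product `φ ψ` of the means is compared with `a_j b_k` by two bilinear terms that use the norm
  -- of `M`; the rest `D` is small entrywise
  have hdecomp : ∫ x, bilForm M (expI s) (expI t) X x ∂(gaussianVec p)
        - formLimit M X (gaussChar (s + t)) (φ * ψ) (-(s * t * (φ * ψ)))
      = (p : ℂ)⁻¹ * ((fun j => ((a j - φ : ℝ) : ℂ)) ⬝ᵥ (M.mulVec fun k => (b k : ℂ))
        + (fun _ => (φ : ℂ)) ⬝ᵥ (M.mulVec fun k => ((b k - ψ : ℝ) : ℂ))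
        + ∑ j, ∑ k, M j k * (D j k : ℂ)) := by
    have htr : M.trace = ∑ j, ∑ k, M j k * (if j = k then 1 else 0) := by
      simp [Matrix.trace]
    have hI : ∫ x, bilForm M (expI s) (expI t) X x ∂(gaussianVec p) = (p : ℂ)⁻¹ * ∑ j, ∑ k, M j k *
        ((a j * b k * Real.exp (-(s * t * (X j ⬝ᵥ X k))) : ℝ) : ℂ) := integral_bilForm_expI hp M s t X
    rw [hI, formLimit, ← mul_sub, htr, dotProduct_mulVec_eq_sum, dotProduct_mulVec_eq_sum]
    congr 1
    simp only [Finset.mul_sum, ← Finset.sum_sub_distrib, ← Finset.sum_add_distrib]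
    refine Finset.sum_congr rfl fun j _ => Finset.sum_congr rfl fun k _ => ?_
    simp only [hD]
    by_cases hjk : j = k
    · simp only [hjk, if_true]
      push_cast
      ring
    · simp only [hjk, if_false]
      push_cast
      ring
  have hDoff : ∀ j k, j ≠ k → (D j k) ^ 2 ≤ 6 * η * (s * t) ^ 4 * (X j ⬝ᵥ X k) ^ 4
      + 2 / η * ((a j - φ) ^ 2 + (b k - ψ) ^ 2) := by
    intro j k hjk
    -- the left side is `exp(-|s X_j + t X_k|² / 2)`
    have hK : a j * b k * Real.exp (-(s * t * (X j ⬝ᵥ X k))) ≤ 1 := by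
      simp only [ha, hb]
      rw [← Real.exp_add, ← Real.exp_add, Real.exp_le_one_iff]
      have := dotProduct_self_nonneg (s • X j + t • X k)
      simp only [add_dotProduct, dotProduct_add, smul_dotProduct, dotProduct_smul, smul_eq_mul] at this
      rw [dotProduct_comm (X k) (X j)] at this
      linarith
    have := offDiag_remainder_sq_le (ha0 j) (ha1 j) (hb0 k) (hb1 k) (gaussChar_nonneg s)
      (gaussChar_le_one s) (gaussChar_nonneg t) (gaussChar_le_one t) hK hη
    simp only [hD, hjk, if_false, sub_zero]
    refine this.trans (le_of_eq ?_)
    ring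
  have hDdiag : ∀ j, (D j j) ^ 2 ≤ C ^ 2 * (X j ⬝ᵥ X j - 1) ^ 2 := by
    intro j
    set r := X j ⬝ᵥ X j with hr'
    have e1 : a j * b j * Real.exp (-(s * t * r)) = Real.exp (-((s + t) ^ 2 * r) / 2) := by
      simp only [ha, hb]
      rw [← Real.exp_add, ← Real.exp_add]
      congr 1
      ring
    have e2 : D j j = (Real.exp (-((s + t) ^ 2 * r) / 2) - gaussChar (s + t))
        + φ * ψ * (s * t) * (r - 1) - ((a j - φ) * b j + φ * (b j - ψ)) := by
      simp only [hD, if_true]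
      rw [← hr', e1]
      ring
    have h1 := abs_exp_sub_gaussChar_le (s + t) (hr j)
    have h2 := abs_exp_sub_gaussChar_le s (hr j)
    have h3 := abs_exp_sub_gaussChar_le t (hr j)
    have h4 : |D j j| ≤ C * |r - 1| := by
      rw [e2]
      refine (abs_sub _ _).trans ?_
      have h5 := abs_add_le (Real.exp (-((s + t) ^ 2 * r) / 2) - gaussChar (s + t))
        (φ * ψ * (s * t) * (r - 1))
      have h6 := abs_add_le ((a j - φ) * b j) (φ * (b j - ψ))
      have h7 : |φ * ψ * (s * t) * (r - 1)| ≤ |s * t| * |r - 1| := by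
        rw [abs_mul, abs_mul, abs_mul φ ψ, abs_of_nonneg (gaussChar_nonneg s),
          abs_of_nonneg (gaussChar_nonneg t)]
        have := mul_le_one₀ (gaussChar_le_one s) (gaussChar_nonneg t) (gaussChar_le_one t)
        gcongr
        exact mul_le_of_le_one_left (abs_nonneg _) this
      have h8 : |(a j - φ) * b j| ≤ s ^ 2 / 2 * |r - 1| := by
        rw [abs_mul, abs_of_nonneg (hb0 j)]
        exact (mul_le_of_le_one_right (abs_nonneg _) (hb1 j)).trans h2
      have h9 : |φ * (b j - ψ)| ≤ t ^ 2 / 2 * |r - 1| := by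
        rw [abs_mul, abs_of_nonneg (gaussChar_nonneg s)]
        exact (mul_le_of_le_one_left (abs_nonneg _) (gaussChar_le_one s)).trans h3
      rw [hC]
      linarith
    rw [← sq_abs (D j j), ← sq_abs (r - 1), ← mul_pow]
    exact pow_le_pow_left₀ (abs_nonneg _) h4 2
  have hη0 : 0 < η := by linarith
  have hDsum : ∑ j, ∑ k, (D j k) ^ 2 ≤ C ^ 2 * normDev X + 6 * η * (s * t) ^ 4 * offGram X
      + 2 / η * Fintype.card ι * (s ^ 4 / 4 + t ^ 4 / 4) * normDev X := by
    calc ∑ j, ∑ k, (D j k) ^ 2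
        ≤ ∑ j, ∑ k, ((if j = k then C ^ 2 * (X j ⬝ᵥ X j - 1) ^ 2 else 0)
            + 6 * η * (s * t) ^ 4 * (if j = k then 0 else (X j ⬝ᵥ X k) ^ 4)
            + 2 / η * ((a j - φ) ^ 2 + (b k - ψ) ^ 2)) := by
          refine Finset.sum_le_sum fun j _ => Finset.sum_le_sum fun k _ => ?_
          by_cases hjk : j = k
          · subst hjk
            simp only [if_true]
            have := hDdiag j
            have : 0 ≤ 2 / η * ((a j - φ) ^ 2 + (b j - ψ) ^ 2) := by positivity
            linarith
          · simp only [hjk, if_false]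
            linarith [hDoff j k hjk]
      _ = C ^ 2 * normDev X + 6 * η * (s * t) ^ 4 * offGram X
          + 2 / η * Fintype.card ι * ((∑ j, (a j - φ) ^ 2) + ∑ k, (b k - ψ) ^ 2) := by
          simp only [Finset.sum_add_distrib, ← Finset.mul_sum, Finset.sum_ite_eq, Finset.mem_univ,
            if_true, normDev, offGram, Finset.sum_const, Finset.card_univ, nsmul_eq_mul]
          ring
      _ ≤ C ^ 2 * normDev X + 6 * η * (s * t) ^ 4 * offGram X
          + 2 / η * Fintype.card ι * (s ^ 4 / 4 * normDev X + t ^ 4 / 4 * normDev X) := by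
          gcongr
      _ = _ := by ring
  have hn1 : nsq (fun k => (b k : ℂ)) ≤ Fintype.card ι := by
    calc nsq (fun k => (b k : ℂ)) ≤ ∑ _k : ι, (1 : ℝ) := by
          refine Finset.sum_le_sum fun k _ => ?_
          rw [Complex.norm_real, Real.norm_of_nonneg (hb0 k)]
          exact pow_le_one₀ (hb0 k) (hb1 k)
      _ = _ := by simp
  have hn2 : nsq (fun _ : ι => (φ : ℂ)) ≤ Fintype.card ι := by
    calc nsq (fun _ : ι => (φ : ℂ)) ≤ ∑ _k : ι, (1 : ℝ) := by
          refine Finset.sum_le_sum fun k _ => ?_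
          rw [Complex.norm_real, Real.norm_of_nonneg (gaussChar_nonneg s)]
          exact pow_le_one₀ (gaussChar_nonneg s) (gaussChar_le_one s)
      _ = _ := by simp
  have hn3 : nsq (fun j => ((a j - φ : ℝ) : ℂ)) ≤ s ^ 4 / 4 * normDev X := by
    refine le_trans (le_of_eq ?_) hsa
    simp only [nsq, Complex.norm_real, Real.norm_eq_abs, sq_abs]
    rfl
  have hn4 : nsq (fun j => ((b j - ψ : ℝ) : ℂ)) ≤ t ^ 4 / 4 * normDev X := by
    refine le_trans (le_of_eq ?_) hsb
    simp only [nsq, Complex.norm_real, Real.norm_eq_abs, sq_abs]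
    rfl
  have hN := normDev_nonneg X
  have b1 := h.norm_dotProduct_mulVec_sq_le hc (fun j => ((a j - φ : ℝ) : ℂ)) (fun k => (b k : ℂ))
  have b2 := h.norm_dotProduct_mulVec_sq_le hc (fun _ => (φ : ℂ)) (fun k => ((b k - ψ : ℝ) : ℂ))
  have b3 := h.norm_sum_mul_sq_le hc (fun j k => (D j k : ℂ))
  simp only [Complex.norm_real, Real.norm_eq_abs, sq_abs] at b3
  have b1' := b1.trans (mul_le_mul_of_nonneg_left
    (mul_le_mul hn3 hn1 (nsq_nonneg _) (by positivity)) (sq_nonneg c))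
  have b2' := b2.trans (mul_le_mul_of_nonneg_left
    (mul_le_mul hn2 hn4 (nsq_nonneg _) (by positivity)) (sq_nonneg c))
  have b3' := b3.trans (mul_le_mul_of_nonneg_left
    (mul_le_mul_of_nonneg_left hDsum (by positivity)) (sq_nonneg c))
  rw [hdecomp, norm_mul, mul_pow, norm_inv, Complex.norm_natCast]
  set u := (fun j => ((a j - φ : ℝ) : ℂ)) ⬝ᵥ (M.mulVec fun k => (b k : ℂ))
  set v := (fun _ => (φ : ℂ)) ⬝ᵥ (M.mulVec fun k => ((b k - ψ : ℝ) : ℂ))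
  set w := ∑ j, ∑ k, M j k * (D j k : ℂ)
  have h3 : ‖u + v + w‖ ^ 2 ≤ 3 * (‖u‖ ^ 2 + ‖v‖ ^ 2 + ‖w‖ ^ 2) := by
    have := pow_le_pow_left₀ (norm_nonneg _) (norm_add₃_le (a := u) (b := v) (c := w)) 2
    nlinarith [sq_nonneg (‖u‖ - ‖v‖), sq_nonneg (‖u‖ - ‖w‖), sq_nonneg (‖v‖ - ‖w‖)]
  calc ((p : ℝ)⁻¹) ^ 2 * ‖u + v + w‖ ^ 2
      ≤ ((p : ℝ)⁻¹) ^ 2 * (3 * (c ^ 2 * (s ^ 4 / 4 * normDev X * Fintype.card ι)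
        + c ^ 2 * (Fintype.card ι * (t ^ 4 / 4 * normDev X))
        + c ^ 2 * (Fintype.card ι * (C ^ 2 * normDev X + 6 * η * (s * t) ^ 4 * offGram X
      + 2 / η * Fintype.card ι * (s ^ 4 / 4 + t ^ 4 / 4) * normDev X)))) := by
        gcongr
        linarith
    _ = _ := by
      rw [inv_pow]
      ring

end TrigForms

/-! ### Gaussian samples -/

theorem _root_.MeasureTheory.MeasurePreserving.integral_comp_of_measurable {α β : Type*}
    [MeasurableSpace α] [MeasurableSpace β] {μ : Measure α} {ν : Measure β} {f : α → β}
    (hf : MeasurePreserving f μ ν) {g : β → ℝ} (hg : Measurable g) :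
    ∫ x, g (f x) ∂μ = ∫ y, g y ∂ν := by
  rw [← hf.map_eq, integral_map hf.measurable.aemeasurable hg.aestronglyMeasurable]

section Sample

theorem integral_const_add_mul_add_mul {α : Type*} [MeasurableSpace α] {μ : Measure α}
    [IsProbabilityMeasure μ] {f g : α → ℝ} (hf : Integrable f μ) (hg : Integrable g μ)
    (a b c : ℝ) :
    ∫ x, (a + b * f x + c * g x) ∂μ = a + b * ∫ x, f x ∂μ + c * ∫ x, g x ∂μ := by
  have h1 : Integrable (fun x => a + b * f x) μ := (integrable_const _).add (hf.const_mul _)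
  rw [integral_add h1 (hg.const_mul _), integral_add (integrable_const _) (hf.const_mul _),
    integral_const_mul, integral_const_mul]
  simp

/-- The law of a sample of `n` independent `N(0, p⁻¹ I_p)` vectors. -/
def sampleLaw (n p : ℕ) : Measure (Fin n → Fin p → ℝ) := Measure.pi fun _ => gaussianVec p

instance isProbabilityMeasure_sampleLaw (n p : ℕ) : IsProbabilityMeasure (sampleLaw n p) := by
  unfold sampleLaw; infer_instance

theorem measurePreserving_sampleLaw_eval {n : ℕ} (p : ℕ) (j : Fin n) :
    MeasurePreserving (fun X : Fin n → Fin p → ℝ => X j) (sampleLaw n p) (gaussianVec p) :=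
  measurePreserving_eval _ j

theorem measurePreserving_sampleLaw_eval₂ {n : ℕ} (p : ℕ) {j k : Fin n} (h : j ≠ k) :
    MeasurePreserving (fun X : Fin n → Fin p → ℝ => (X j, X k)) (sampleLaw n p)
      ((gaussianVec p).prod (gaussianVec p)) := by
  have h1 : iIndepFun (fun (i : Fin n) (X : Fin n → Fin p → ℝ) => X i) (sampleLaw n p) :=
    iIndepFun_pi (μ := fun _ => gaussianVec p) (X := fun _ => id) (fun _ => aemeasurable_id)
  have h2 := (indepFun_iff_map_prod_eq_prod_map_map
    (measurable_pi_apply j).aemeasurable (measurable_pi_apply k).aemeasurable).1 (h1.indepFun h)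
  refine ⟨by fun_prop, ?_⟩
  rw [h2, (measurePreserving_sampleLaw_eval p j).map_eq,
    (measurePreserving_sampleLaw_eval p k).map_eq]

theorem measurePreserving_xiLaw (p : ℕ) :
    MeasurePreserving (fun w : (Fin p → ℝ) × (Fin p → ℝ) => √(p : ℝ) * (w.1 ⬝ᵥ w.2))
      ((gaussianVec p).prod (gaussianVec p)) (xiLaw p) :=
  ⟨by fun_prop, rfl⟩

theorem measurePreserving_sqrt_mul_dotProduct {n : ℕ} (p : ℕ) {j k : Fin n} (h : j ≠ k) :
    MeasurePreserving (fun X : Fin n → Fin p → ℝ => √(p : ℝ) * (X j ⬝ᵥ X k)) (sampleLaw n p)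
      (xiLaw p) :=
  (measurePreserving_xiLaw p).comp (measurePreserving_sampleLaw_eval₂ p h)

theorem measurePreserving_sqrt_mul_dotProduct_prod {n : ℕ} (p : ℕ) (j : Fin n) :
    MeasurePreserving (fun w : (Fin n → Fin p → ℝ) × (Fin p → ℝ) => √(p : ℝ) * (w.1 j ⬝ᵥ w.2))
      ((sampleLaw n p).prod (gaussianVec p)) (xiLaw p) :=
  (measurePreserving_xiLaw p).comp
    ((measurePreserving_sampleLaw_eval p j).prod (MeasurePreserving.id _))

theorem offGram_nonneg {ι : Type*} [Fintype ι] [DecidableEq ι] {p : ℕ} (X : ι → Fin p → ℝ) :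
    0 ≤ offGram X :=
  Finset.sum_nonneg fun _ _ => Finset.sum_nonneg fun _ _ => by split_ifs <;> positivity

theorem integrable_normDev (n p : ℕ) : Integrable (normDev (ι := Fin n) (p := p)) (sampleLaw n p) :=
  integrable_finsetSum _ fun j _ =>
    (measurePreserving_sampleLaw_eval p j).integrable_comp_of_integrable
      (integrable_dotProduct_self_sub_one_sq p)

theorem integral_normDev_le (n : ℕ) {p : ℕ} (hp : 1 ≤ p) :
    ∫ X : Fin n → Fin p → ℝ, normDev X ∂(sampleLaw n p) ≤ n * (gaussMoment 2 / p) := by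
  have hi : ∀ j : Fin n, Integrable (fun X : Fin n → Fin p → ℝ => (X j ⬝ᵥ X j - 1) ^ 2)
      (sampleLaw n p) := fun j =>
    (measurePreserving_sampleLaw_eval p j).integrable_comp_of_integrable
      (integrable_dotProduct_self_sub_one_sq p)
  unfold normDev
  rw [integral_finsetSum _ fun j _ => hi j]
  have : ∀ j : Fin n, ∫ X : Fin n → Fin p → ℝ, (X j ⬝ᵥ X j - 1) ^ 2 ∂(sampleLaw n p)
      ≤ gaussMoment 2 / p := by
    intro j
    rw [(measurePreserving_sampleLaw_eval p j).integral_comp_of_measurable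
      (g := fun y : Fin p → ℝ => (y ⬝ᵥ y - 1) ^ 2) (by fun_prop)]
    exact integral_dotProduct_self_sub_one_sq_le hp
  calc _ ≤ ∑ _j : Fin n, gaussMoment 2 / p := Finset.sum_le_sum fun j _ => this j
    _ = _ := by simp

theorem dotProduct_pow_four_eq {p : ℕ} (hp : 1 ≤ p) (x y : Fin p → ℝ) :
    (x ⬝ᵥ y) ^ 4 = ((p : ℝ) ^ 2)⁻¹ * (√(p : ℝ) * (x ⬝ᵥ y)) ^ (2 * 2) := by
  have hp' : (0 : ℝ) < p := by exact_mod_cast hp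
  rw [mul_pow, pow_mul √_, Real.sq_sqrt hp'.le]
  field_simp

theorem integrable_dotProduct_pow_four {n p : ℕ} (hp : 1 ≤ p) {j k : Fin n} (h : j ≠ k) :
    Integrable (fun X : Fin n → Fin p → ℝ => (X j ⬝ᵥ X k) ^ 4) (sampleLaw n p) := by
  simp_rw [dotProduct_pow_four_eq hp]
  exact ((measurePreserving_sqrt_mul_dotProduct p h).integrable_comp_of_integrable
    (integrable_pow_xiLaw hp (2 * 2))).const_mul _

theorem integrable_offGram (n : ℕ) {p : ℕ} (hp : 1 ≤ p) :
    Integrable (offGram (ι := Fin n) (p := p)) (sampleLaw n p) := by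
  refine integrable_finsetSum _ fun j _ => integrable_finsetSum _ fun k _ => ?_
  by_cases h : j = k
  · simp [h]
  · simpa [h] using integrable_dotProduct_pow_four hp h

theorem integral_offGram_le (n : ℕ) {p : ℕ} (hp : 1 ≤ p) :
    ∫ X : Fin n → Fin p → ℝ, offGram X ∂(sampleLaw n p)
      ≤ (n / p : ℝ) ^ 2 * ((1 + gaussMoment 2) * gaussMoment 2) := by
  have h0 : 0 ≤ (1 + gaussMoment 2) * gaussMoment 2 := by
    have := gaussMoment_nonneg 2; positivity
  have hterm : ∀ j k : Fin n, Integrable (fun X : Fin n → Fin p → ℝ =>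
      if j = k then 0 else (X j ⬝ᵥ X k) ^ 4) (sampleLaw n p) := by
    intro j k
    by_cases h : j = k
    · simp [h]
    · simpa [h] using integrable_dotProduct_pow_four hp h
  have hle : ∀ j k : Fin n, ∫ X : Fin n → Fin p → ℝ,
      (if j = k then 0 else (X j ⬝ᵥ X k) ^ 4) ∂(sampleLaw n p)
      ≤ ((p : ℝ) ^ 2)⁻¹ * ((1 + gaussMoment 2) * gaussMoment 2) := by
    intro j k
    by_cases h : j = k
    · simp only [h, if_true, integral_zero]; positivity
    · simp only [h, if_false]
      simp_rw [dotProduct_pow_four_eq hp]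
      rw [integral_const_mul]
      rw [(measurePreserving_sqrt_mul_dotProduct p h).integral_comp_of_measurable
        (g := fun x : ℝ => x ^ (2 * 2)) (by fun_prop)]
      exact mul_le_mul_of_nonneg_left (integral_pow_xiLaw_le hp 2) (by positivity)
  unfold offGram
  rw [integral_finsetSum _ fun j _ => integrable_finsetSum _ fun k _ => hterm j k]
  calc _ ≤ ∑ _j : Fin n, ∑ _k : Fin n, ((p : ℝ) ^ 2)⁻¹ * ((1 + gaussMoment 2) * gaussMoment 2) := by
        refine Finset.sum_le_sum fun j _ => ?_
        rw [integral_finsetSum _ fun k _ => hterm j k]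
        exact Finset.sum_le_sum fun k _ => hle j k
    _ = _ := by
      simp only [Finset.sum_const, Finset.card_univ, Fintype.card_fin, nsmul_eq_mul]
      ring

/-- The Frobenius norm of the Gram matrix is controlled by `normDev` and `offGram`. -/
theorem sqrt_sum_gram_sq_le {n p : ℕ} (hp : 1 ≤ p) (X : Fin n → Fin p → ℝ) :
    √(∑ j, ∑ k, (X j ⬝ᵥ X k) ^ 2) ≤ (√p + (2 * n + 2 * normDev X + n ^ 2 / (2 * p)
      + p / 2 * offGram X) / √p) / 2 := by
  have hp' : (0 : ℝ) < p := by exact_mod_cast hp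
  have hs : 0 < √(p : ℝ) := Real.sqrt_pos.2 hp'
  set F := ∑ j, ∑ k, (X j ⬝ᵥ X k) ^ 2 with hF
  have hF0 : 0 ≤ F := Finset.sum_nonneg fun _ _ => Finset.sum_nonneg fun _ _ => sq_nonneg _
  have h1 : √F ≤ (√p + F / √p) / 2 := by
    have h2 := Real.sq_sqrt hF0
    have h3 : √p + F / √p - 2 * √F = (√p - √F) ^ 2 / √p := by
      field_simp
      rw [← h2]
      simp only [Real.sqrt_sq (Real.sqrt_nonneg F)]
      ring
    have : 0 ≤ (√(p : ℝ) - √F) ^ 2 / √p := by positivity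
    linarith
  have h4 : F ≤ 2 * n + 2 * normDev X + n ^ 2 / (2 * p) + p / 2 * offGram X := by
    calc F ≤ ∑ j, ∑ k, ((if j = k then 2 + 2 * (X j ⬝ᵥ X j - 1) ^ 2 else 0) + 1 / (2 * p)
          + p / 2 * (if j = k then 0 else (X j ⬝ᵥ X k) ^ 4)) := by
          refine Finset.sum_le_sum fun j _ => Finset.sum_le_sum fun k _ => ?_
          by_cases h : j = k
          · subst h
            simp only [if_true]
            have : (0 : ℝ) ≤ 1 / (2 * p) := by positivity
            nlinarith [sq_nonneg (X j ⬝ᵥ X j - 2)]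
          · simp only [h, if_false]
            have : (0 : ℝ) ≤ (1 - p * (X j ⬝ᵥ X k) ^ 2) ^ 2 / (2 * p) := by positivity
            have e : (1 - p * (X j ⬝ᵥ X k) ^ 2) ^ 2 / (2 * p)
              = 1 / (2 * p) + p / 2 * (X j ⬝ᵥ X k) ^ 4 - (X j ⬝ᵥ X k) ^ 2 := by
              field_simp; ring
            linarith
      _ = _ := by
          simp only [Finset.sum_add_distrib, ← Finset.mul_sum, Finset.sum_ite_eq, Finset.mem_univ,
            if_true, normDev, offGram, Finset.sum_const, Finset.card_univ, nsmul_eq_mul,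
            Fintype.card_fin]
          ring
  refine h1.trans ?_
  gcongr

theorem norm_bilForm_expI_le {ι : Type*} [Fintype ι] {p : ℕ} (M : Matrix ι ι ℂ) (s t : ℝ)
    (X : ι → Fin p → ℝ) (x : Fin p → ℝ) :
    ‖bilForm M (expI s) (expI t) X x‖ ≤ (p : ℝ)⁻¹ * ∑ j, ∑ k, ‖M j k‖ := by
  rw [bilForm, norm_mul, norm_inv, Complex.norm_natCast]
  gcongr
  refine (norm_sum_le _ _).trans (Finset.sum_le_sum fun j _ => (norm_sum_le _ _).trans
    (Finset.sum_le_sum fun k _ => ?_))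
  rw [norm_mul, norm_mul, norm_expI, norm_expI, mul_one, mul_one]

theorem measurable_bilForm_expI {ι : Type*} [Fintype ι] {p : ℕ} (M : Matrix ι ι ℂ) (s t : ℝ)
    (X : ι → Fin p → ℝ) : Measurable (bilForm M (expI s) (expI t) X) := by
  rw [bilForm_expI_eq_trigSum]; fun_prop

/-- A bound for the mean square deviation of a quadratic form in the exponentials of frequencies
`s`, `t`, over all matrices of operator norm at most `c`. -/
def formDev (s t c : ℝ) {n p : ℕ} (X : Fin n → Fin p → ℝ) : ℝ :=
  2 * (2 * (s ^ 2 + t ^ 2) * c ^ 2 * n / (p : ℝ) ^ 2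
          * ((√p + (2 * n + 2 * normDev X + n ^ 2 / (2 * p) + p / 2 * offGram X) / √p) / 2))
    + 2 * (3 * c ^ 2 * n / (p : ℝ) ^ 2 *
        ((s ^ 4 / 4 + t ^ 4 / 4 + ((s + t) ^ 2 / 2 + |s * t| + s ^ 2 / 2 + t ^ 2 / 2) ^ 2
          + 2 / √p * n * (s ^ 4 / 4 + t ^ 4 / 4)) * normDev X
          + 6 * √p * (s * t) ^ 4 * offGram X))

/-- For fixed `X`, the mean square deviation of a quadratic form in exponentials from its limit is
bounded uniformly over the matrices `M` of bounded norm. -/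
theorem integral_norm_bilForm_sub_formLimit_sq_le {n p : ℕ} (hp : 1 ≤ p)
    {M : Matrix (Fin n) (Fin n) ℂ} (hM : M.IsSymm) {c : ℝ} (hc : 0 ≤ c) (h : OpBound M c) (s t : ℝ)
    (X : Fin n → Fin p → ℝ) :
    ∫ x, ‖bilForm M (expI s) (expI t) X x
        - formLimit M X (gaussChar (s + t)) (gaussChar s * gaussChar t)
          (-(s * t * (gaussChar s * gaussChar t)))‖ ^ 2 ∂(gaussianVec p)
      ≤ formDev s t c X := by
  have h1 := integral_norm_bilForm_expI_sub_sq_le hp hM h s t X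
  have hη : 1 ≤ √(p : ℝ) := by
    rw [Real.one_le_sqrt]; exact_mod_cast hp
  have h2 := norm_integral_bilForm_expI_sub_sq_le hp hc h s t X hη
  rw [Fintype.card_fin] at h1 h2
  have h3 := h1.trans (mul_le_mul_of_nonneg_left (sqrt_sum_gram_sq_le hp X) (by positivity))
  set Q := bilForm M (expI s) (expI t) X with hQ
  set μ := ∫ y, Q y ∂(gaussianVec p) with hμ
  set L := formLimit M X (gaussChar (s + t)) (gaussChar s * gaussChar t)
          (-(s * t * (gaussChar s * gaussChar t))) with hL
  have hQm : Measurable Q := measurable_bilForm_expI M s t X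
  have hint : Integrable (fun x => ‖Q x - μ‖ ^ 2) (gaussianVec p) := by
    refine .of_bound (Measurable.aestronglyMeasurable (by fun_prop))
      (((p : ℝ)⁻¹ * ∑ j, ∑ k, ‖M j k‖ + ‖μ‖) ^ 2) (ae_of_all _ fun x => ?_)
    rw [Real.norm_of_nonneg (by positivity)]
    gcongr
    exact (norm_sub_le _ _).trans (by gcongr; exact norm_bilForm_expI_le M s t X x)
  calc ∫ x, ‖Q x - L‖ ^ 2 ∂(gaussianVec p)
      ≤ ∫ x, (2 * ‖Q x - μ‖ ^ 2 + 2 * ‖μ - L‖ ^ 2) ∂(gaussianVec p) := by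
        refine integral_mono_of_nonneg (ae_of_all _ fun x => by positivity)
          ((hint.const_mul 2).add (integrable_const _)) (ae_of_all _ fun x => ?_)
        have := norm_add_sq_le (Q x - μ) (μ - L)
        rwa [sub_add_sub_cancel] at this
    _ = 2 * ∫ x, ‖Q x - μ‖ ^ 2 ∂(gaussianVec p) + 2 * ‖μ - L‖ ^ 2 := by
        rw [integral_add (hint.const_mul 2) (integrable_const _), integral_const_mul]
        simp
    _ ≤ _ := by rw [formDev]; linarith

theorem formDev_nonneg (s t c : ℝ) {n p : ℕ} (X : Fin n → Fin p → ℝ) : 0 ≤ formDev s t c X := by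
  have h1 := normDev_nonneg X
  have h2 := offGram_nonneg X
  unfold formDev
  positivity

/-- The mean square deviation is `O(p^(-1/2))` on average over the sample, as long as `n = O(p)`. -/
theorem exists_integral_formDev_le (s t c : ℝ) {Θ : ℝ} (hΘ : 0 ≤ Θ) :
    ∃ K : ℝ, 0 ≤ K ∧ ∀ n p : ℕ, 1 ≤ p → (n : ℝ) ≤ Θ * p →
      Integrable (formDev s t c) (sampleLaw n p) ∧
      ∫ X, formDev s t c X ∂(sampleLaw n p) ≤ K / √p := by
  set g2 := gaussMoment 2 with hg2
  have hg20 : 0 ≤ g2 := gaussMoment_nonneg 2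
  set C4 := (1 + g2) * g2 with hC4
  have hC40 : 0 ≤ C4 := by positivity
  set B := s ^ 4 / 4 + t ^ 4 / 4 with hB
  have hB0 : 0 ≤ B := by positivity
  set A := B + ((s + t) ^ 2 / 2 + |s * t| + s ^ 2 / 2 + t ^ 2 / 2) ^ 2 with hA
  have hA0 : 0 ≤ A := by positivity
  set K₁ := 2 * (s ^ 2 + t ^ 2) * c ^ 2 * Θ *
    (1 + 2 * Θ + 2 * Θ * g2 + Θ ^ 2 / 2 + Θ ^ 2 * C4 / 2) with hK₁
  set K₂ := 6 * c ^ 2 * Θ * (A * Θ * g2 + 2 * Θ ^ 2 * B * g2 + 6 * (s * t) ^ 4 * Θ ^ 2 * C4) with hK₂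
  have hK₁0 : 0 ≤ K₁ := by positivity
  have hK₂0 : 0 ≤ K₂ := by positivity
  refine ⟨K₁ + K₂, by positivity, fun n p hp hn => ?_⟩
  have hp' : (1 : ℝ) ≤ p := by exact_mod_cast hp
  have hp0 : (0 : ℝ) < p := by linarith
  set η := √(p : ℝ) with hη
  have hη2 : η ^ 2 = p := Real.sq_sqrt hp0.le
  have hη1 : 1 ≤ η := Real.one_le_sqrt.2 hp'
  have hη0 : 0 < η := by linarith
  have hN := integrable_normDev n p
  have hO := integrable_offGram n hp
  set V := 2 * (s ^ 2 + t ^ 2) * c ^ 2 * n / (p : ℝ) ^ 2 with hV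
  set U := 3 * c ^ 2 * n / (p : ℝ) ^ 2 with hU
  have hGaff : formDev s t c (n := n) (p := p) = fun X => (V * (η + (2 * n + n ^ 2 / (2 * p)) / η)
      + (2 * V / η + 2 * U * (A + 2 / η * n * B)) * normDev X)
      + (V * (p / 2) / η + 2 * U * (6 * η * (s * t) ^ 4)) * offGram X := by
    funext X
    rw [formDev]
    ring
  have hGint : Integrable (formDev s t c) (sampleLaw n p) := by
    rw [hGaff]
    exact ((integrable_const _).add (hN.const_mul _)).add (hO.const_mul _)
  have hnp : (n / p : ℝ) ≤ Θ := by rw [div_le_iff₀ hp0]; exact hn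
  have hnp0 : (0 : ℝ) ≤ n / p := by positivity
  refine ⟨hGint, ?_⟩
  have hGle : ∫ X, formDev s t c X ∂(sampleLaw n p) ≤ (K₁ + K₂) / η := by
    have hEN0 : 0 ≤ ∫ X : Fin n → Fin p → ℝ, normDev X ∂(sampleLaw n p) :=
      integral_nonneg fun X => normDev_nonneg X
    have hEO0 : 0 ≤ ∫ X : Fin n → Fin p → ℝ, offGram X ∂(sampleLaw n p) :=
      integral_nonneg fun X => offGram_nonneg X
    have hEN := integral_normDev_le n hp
    have hEO := integral_offGram_le n hp
    have hsub : ∫ X, formDev s t c X ∂(sampleLaw n p) = (V * (η + (2 * n + n ^ 2 / (2 * p)) / η)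
      + (2 * V / η + 2 * U * (A + 2 / η * n * B)) * ∫ X : Fin n → Fin p → ℝ, normDev X ∂(sampleLaw n p))
      + (V * (p / 2) / η + 2 * U * (6 * η * (s * t) ^ 4))
        * ∫ X : Fin n → Fin p → ℝ, offGram X ∂(sampleLaw n p) := by
      rw [hGaff]
      exact integral_const_add_mul_add_mul hN hO _ _ _
    rw [hsub]
    set EN := ∫ X : Fin n → Fin p → ℝ, normDev X ∂(sampleLaw n p)
    set EO := ∫ X : Fin n → Fin p → ℝ, offGram X ∂(sampleLaw n p)
    set w : ℝ := n / p with hw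
    have hnw : (n : ℝ) = w * η ^ 2 := by rw [hη2, hw]; field_simp
    have hEN' : EN ≤ Θ * g2 := by
      refine hEN.trans ?_
      rw [← mul_div_assoc, mul_div_right_comm]
      gcongr
    have hEO' : EO ≤ Θ ^ 2 * C4 := hEO.trans (by gcongr)
    have hEN2 : EN / η ^ 2 ≤ Θ * g2 :=
      (div_le_self hEN0 (one_le_pow₀ hη1)).trans hEN'
    have hAN : A * EN / η ≤ A * (Θ * g2) :=
      (div_le_self (by positivity) hη1).trans (by gcongr)
    have e : (V * (η + (2 * n + n ^ 2 / (2 * p)) / η)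
      + (2 * V / η + 2 * U * (A + 2 / η * n * B)) * EN)
      + (V * (p / 2) / η + 2 * U * (6 * η * (s * t) ^ 4)) * EO
      = (2 * (s ^ 2 + t ^ 2) * c ^ 2 * w * (1 + 2 * w + 2 * (EN / η ^ 2) + w ^ 2 / 2 + EO / 2)
        + 6 * c ^ 2 * w * (A * EN / η + 2 * w * B * EN + 6 * (s * t) ^ 4 * EO)) / η := by
      rw [hV, hU, hnw, ← hη2]
      field_simp
      ring
    rw [e]
    gcongr
    · rw [hK₁]
      calc _ ≤ 2 * (s ^ 2 + t ^ 2) * c ^ 2 * Θ *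
            (1 + 2 * Θ + 2 * (Θ * g2) + Θ ^ 2 / 2 + Θ ^ 2 * C4 / 2) := by gcongr
        _ = _ := by ring
    · rw [hK₂]
      calc _ ≤ 6 * c ^ 2 * Θ * (A * (Θ * g2) + 2 * Θ * B * (Θ * g2) + 6 * (s * t) ^ 4 * (Θ ^ 2 * C4)) := by
            gcongr
        _ = _ := by ring
  exact hGle

/-- Averaged over the sample, a quadratic form in exponentials is close to its limit, at a rate
that does not depend on the (sample dependent) matrices `M`. -/
theorem exists_lintegral_bilForm_expI_sub_le (s t : ℝ) {c Θ : ℝ} (hc : 0 ≤ c) (hΘ : 0 ≤ Θ) :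
    ∃ C : ℝ, 0 ≤ C ∧ ∀ n p : ℕ, 1 ≤ p → (n : ℝ) ≤ Θ * p →
      ∀ M : (Fin n → Fin p → ℝ) → Matrix (Fin n) (Fin n) ℂ, (∀ X, (M X).IsSymm) →
      (∀ X, OpBound (M X) c) →
      ∫⁻ X, ∫⁻ x, ‖bilForm (M X) (expI s) (expI t) X x
        - formLimit (M X) X (gaussChar (s + t)) (gaussChar s * gaussChar t)
          (-(s * t * (gaussChar s * gaussChar t)))‖ₑ ∂(gaussianVec p) ∂(sampleLaw n p)
        ≤ ENNReal.ofReal (C / √(√p)) := by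
  obtain ⟨K, hK0, hK⟩ := exists_integral_formDev_le s t c hΘ
  refine ⟨(1 + K) / 2, by positivity, fun n p hp hn M hM hMc => ?_⟩
  obtain ⟨hGint, hGle⟩ := hK n p hp hn
  have hp' : (1 : ℝ) ≤ p := by exact_mod_cast hp
  set η := √(p : ℝ) with hη
  have hη0 : 0 < η := Real.sqrt_pos.2 (by linarith)
  -- a mean deviation is bounded through `2 |y| ≤ 1/r + r y²`
  set r := √η with hr
  have hr2 : r ^ 2 = η := Real.sq_sqrt hη0.le
  have hr0 : 0 < r := Real.sqrt_pos.2 hη0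
  have hinner : ∀ X, ∫⁻ x, ‖bilForm (M X) (expI s) (expI t) X x
        - formLimit (M X) X (gaussChar (s + t)) (gaussChar s * gaussChar t)
          (-(s * t * (gaussChar s * gaussChar t)))‖ₑ ∂(gaussianVec p)
      ≤ ENNReal.ofReal ((1 / r + r * formDev s t c X) / 2) := by
    intro X
    have h1 := integral_norm_bilForm_sub_formLimit_sq_le hp (hM X) hc (hMc X) s t X
    set L := formLimit (M X) X (gaussChar (s + t)) (gaussChar s * gaussChar t)
          (-(s * t * (gaussChar s * gaussChar t))) with hL
    set Q := bilForm (M X) (expI s) (expI t) X with hQ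
    have hQm : Measurable Q := measurable_bilForm_expI (M X) s t X
    have hb : ∀ x, ‖Q x - L‖ ≤ (p : ℝ)⁻¹ * ∑ j, ∑ k, ‖M X j k‖ + ‖L‖ := fun x =>
      (norm_sub_le _ _).trans (by gcongr; exact norm_bilForm_expI_le (M X) s t X x)
    have hi1 : Integrable (fun x => Q x - L) (gaussianVec p) :=
      .of_bound (Measurable.aestronglyMeasurable (by fun_prop)) _ (ae_of_all _ hb)
    have hi2 : Integrable (fun x => ‖Q x - L‖ ^ 2) (gaussianVec p) := by
      refine .of_bound (Measurable.aestronglyMeasurable (by fun_prop))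
        (((p : ℝ)⁻¹ * ∑ j, ∑ k, ‖M X j k‖ + ‖L‖) ^ 2) (ae_of_all _ fun x => ?_)
      rw [Real.norm_of_nonneg (by positivity)]
      exact pow_le_pow_left₀ (norm_nonneg _) (hb x) 2
    rw [← ofReal_integral_norm_eq_lintegral_enorm hi1]
    apply ENNReal.ofReal_le_ofReal
    calc ∫ x, ‖Q x - L‖ ∂(gaussianVec p)
        ≤ ∫ x, (1 / r + r * ‖Q x - L‖ ^ 2) / 2 ∂(gaussianVec p) := by
          refine integral_mono hi1.norm (((integrable_const _).add (hi2.const_mul r)).div_const 2) fun x => ?_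
          have e : 1 / r + r * ‖Q x - L‖ ^ 2 - 2 * ‖Q x - L‖ = r * (1 / r - ‖Q x - L‖) ^ 2 := by
            field_simp; ring
          have : 0 ≤ r * (1 / r - ‖Q x - L‖) ^ 2 := by positivity
          linarith
      _ = (1 / r + r * ∫ x, ‖Q x - L‖ ^ 2 ∂(gaussianVec p)) / 2 := by
          rw [integral_div, integral_add (integrable_const _) (hi2.const_mul r), integral_const_mul]
          simp
      _ ≤ (1 / r + r * formDev s t c X) / 2 := by
          gcongr
  refine (lintegral_mono hinner).trans ?_
  have hi3 : Integrable (fun X => (1 / r + r * formDev s t c X) / 2) (sampleLaw n p) :=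
    ((integrable_const _).add (hGint.const_mul r)).div_const 2
  rw [← ofReal_integral_eq_lintegral_ofReal hi3
    (ae_of_all _ fun X => by have := formDev_nonneg s t c X; positivity)]
  apply ENNReal.ofReal_le_ofReal
  rw [integral_div, integral_add (integrable_const _) (hGint.const_mul r), integral_const_mul]
  calc _ ≤ (1 / r + r * (K / η)) / 2 := by
        simp only [integral_const, probReal_univ, one_smul]
        gcongr
    _ = _ := by
      rw [← hr2]; field_simp

end Sample

/-! ### Approximation of the kernel by trigonometric sums -/

section ExpApprox

theorem orthoPoly_natDegree_le (μ : Measure ℝ) (l : ℕ) : (orthoPoly μ l).natDegree ≤ l := by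
  induction l using Nat.strong_induction_on with
  | _ l ih =>
    rw [orthoPoly]
    refine (Polynomial.natDegree_C_mul_le _ _).trans ?_
    refine (Polynomial.natDegree_sub_le _ _).trans (max_le (Polynomial.natDegree_X_pow_le l) ?_)
    refine Polynomial.natDegree_sum_le_of_forall_le _ _ fun j _ => ?_
    exact (Polynomial.natDegree_C_mul_le _ _).trans ((ih j j.isLt).trans j.isLt.le)

theorem orthoPoly_zero (μ : Measure ℝ) [IsProbabilityMeasure μ] : orthoPoly μ 0 = 1 := by
  rw [orthoPoly]; simp

theorem orthoPoly_one_xiLaw {p : ℕ} (hp : 1 ≤ p) : orthoPoly (xiLaw p) 1 = Polynomial.X := by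
  have h1 := integral_id_xiLaw hp
  have h2 := integral_sq_xiLaw hp
  rw [orthoPoly]
  simp [orthoPoly_zero, h1, h2]

theorem coeff_one_eq {k : ℕ → ℝ → ℝ} {p : ℕ} (hp : 1 ≤ p) :
    coeff k 1 p = ∫ x, x * k p x ∂(xiLaw p) := by
  simp only [coeff, orthoPoly_one_xiLaw hp, Polynomial.eval_X, mul_comm]

theorem exists_truncation_eq_sum (k : ℕ → ℝ → ℝ) (L p : ℕ) :
    ∃ b : Fin (L + 1) → ℝ, ∀ x, truncation k L p x = ∑ i, b i * x ^ (i : ℕ) := by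
  set q : Polynomial ℝ := ∑ l ∈ Finset.range (L + 1),
    Polynomial.C (coeff k l p) * orthoPoly (xiLaw p) l with hq
  have hdeg : q.natDegree < L + 1 := by
    refine Nat.lt_succ_of_le (Polynomial.natDegree_sum_le_of_forall_le _ _ fun l hl => ?_)
    exact (Polynomial.natDegree_C_mul_le _ _).trans ((orthoPoly_natDegree_le _ l).trans
      (Nat.le_of_lt_succ (Finset.mem_range.1 hl)))
  refine ⟨fun i => q.coeff i, fun x => ?_⟩
  rw [Fin.sum_univ_eq_sum_range (fun i => q.coeff i * x ^ i), ← Polynomial.eval_eq_sum_range' hdeg]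
  simp [hq, truncation, Polynomial.eval_finsetSum]

/-- The coefficients of a polynomial are controlled by its norm in `L²` of the Gaussian law. -/
theorem exists_norm_coeff_sq_le (L : ℕ) : ∃ C : ℝ, 0 < C ∧ ∀ b : Fin (L + 1) → ℝ,
    ‖b‖ ^ 2 ≤ C * ∫ g, (∑ i, b i * g ^ (i : ℕ)) ^ 2 ∂(gaussianReal 0 1) := by
  set N : (Fin (L + 1) → ℝ) → ℝ := fun b => ∫ g, (∑ i, b i * g ^ (i : ℕ)) ^ 2 ∂(gaussianReal 0 1)
    with hN
  have hexp : ∀ (b : Fin (L + 1) → ℝ) (g : ℝ), (∑ i, b i * g ^ (i : ℕ)) ^ 2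
      = ∑ i, ∑ j, b i * b j * g ^ ((i : ℕ) + j) := by
    intro b g
    rw [pow_two, Finset.sum_mul_sum]
    exact Finset.sum_congr rfl fun i _ => Finset.sum_congr rfl fun j _ => by ring
  have hint : ∀ b : Fin (L + 1) → ℝ,
      Integrable (fun g : ℝ => (∑ i, b i * g ^ (i : ℕ)) ^ 2) (gaussianReal 0 1) := by
    intro b
    simp_rw [hexp]
    exact integrable_finsetSum _ fun i _ => integrable_finsetSum _ fun j _ =>
      (integrable_pow_gaussianReal 1 _).const_mul _
  have hNeq : ∀ b, N b = ∑ i : Fin (L + 1), ∑ j : Fin (L + 1), b i * b j * ∫ g : ℝ, g ^ ((i : ℕ) + (j : ℕ)) ∂(gaussianReal 0 1) := by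
    intro b
    simp only [hN]
    simp_rw [hexp]
    rw [integral_finsetSum _ fun i _ => integrable_finsetSum _ fun j _ =>
      (integrable_pow_gaussianReal 1 _).const_mul _]
    refine Finset.sum_congr rfl fun i _ => ?_
    rw [integral_finsetSum _ fun j _ => (integrable_pow_gaussianReal 1 _).const_mul _]
    simp_rw [integral_const_mul]
  have hNc : Continuous N := by
    have : N = fun b : Fin (L + 1) → ℝ => ∑ i : Fin (L + 1), ∑ j : Fin (L + 1), b i * b j * ∫ g : ℝ, g ^ ((i : ℕ) + (j : ℕ)) ∂(gaussianReal 0 1) :=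
      funext hNeq
    rw [this]
    fun_prop
  have hpos : ∀ b, b ≠ 0 → 0 < N b := by
    intro b hb
    refine lt_of_le_of_ne (integral_nonneg fun g => sq_nonneg _) fun h0 => hb ?_
    have h1 := (integral_eq_zero_iff_of_nonneg (fun g => sq_nonneg _) (hint b)).1 h0.symm
    set q : Polynomial ℝ := ∑ i : Fin (L + 1), Polynomial.C (b i) * Polynomial.X ^ (i : ℕ) with hq
    have hqe : ∀ g, q.eval g = ∑ i, b i * g ^ (i : ℕ) := fun g => by
      simp [hq, Polynomial.eval_finsetSum]
    have hq0 : q = 0 := by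
      by_contra hne
      have hfin : (q.rootSet ℝ).Finite := Polynomial.rootSet_finite q ℝ
      have : ∀ᵐ g ∂(gaussianReal 0 1), g ∉ q.rootSet ℝ := by
        rw [ae_iff]
        simp only [not_not, Set.ofPred_mem_eq]
        have := nullSingletonClass_gaussianReal (μ := 0) (v := 1) one_ne_zero
        exact hfin.measure_zero _
      obtain ⟨g, hg1, hg2⟩ := (this.and h1).exists
      apply hg1
      rw [Polynomial.mem_rootSet]
      refine ⟨hne, ?_⟩
      simp only [Pi.zero_apply] at hg2
      rw [Polynomial.coe_aeval_eq_eval, hqe]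
      exact pow_eq_zero_iff two_ne_zero |>.1 hg2
    funext i
    have := congrArg (fun r : Polynomial ℝ => r.coeff i) hq0
    simp only [hq, Polynomial.finsetSum_coeff, Polynomial.coeff_C_mul, Polynomial.coeff_X_pow,
      Polynomial.coeff_zero] at this
    rw [Finset.sum_eq_single i] at this
    · simpa using this
    · intro j _ hj
      rw [if_neg (fun h => hj (Fin.ext h.symm)), mul_zero]
    · simp
  -- the quadratic form `N` is positive definite, hence bounded below on the unit sphere
  obtain ⟨b₀, hb₀, hmin⟩ := (isCompact_sphere (0 : Fin (L + 1) → ℝ) 1).exists_isMinOn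
    (NormedSpace.sphere_nonempty.2 zero_le_one) hNc.continuousOn
  have hb₀1 : ‖b₀‖ = 1 := by simpa using hb₀
  have hb₀0 : 0 < N b₀ := hpos b₀ fun h => by rw [h, norm_zero] at hb₀1; exact zero_ne_one hb₀1
  refine ⟨(N b₀)⁻¹, inv_pos.2 hb₀0, fun b => ?_⟩
  by_cases hb : b = 0
  · rw [hb, norm_zero]
    have : 0 ≤ N 0 := integral_nonneg fun g => sq_nonneg _
    rw [zero_pow two_ne_zero]
    exact mul_nonneg (inv_nonneg.2 hb₀0.le) this
  have hbn : 0 < ‖b‖ := norm_pos_iff.2 hb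
  have hs : ‖b‖⁻¹ • b ∈ Metric.sphere (0 : Fin (L + 1) → ℝ) 1 := by
    rw [mem_sphere_zero_iff_norm, norm_smul, norm_inv, norm_norm, inv_mul_cancel₀ hbn.ne']
  have h2 : N b₀ ≤ N (‖b‖⁻¹ • b) := hmin hs
  have h3 : N (‖b‖⁻¹ • b) = (‖b‖ ^ 2)⁻¹ * N b := by
    rw [hNeq, hNeq, Finset.mul_sum]
    refine Finset.sum_congr rfl fun i _ => ?_
    rw [Finset.mul_sum]
    refine Finset.sum_congr rfl fun j _ => ?_
    simp only [Pi.smul_apply, smul_eq_mul]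
    ring
  rw [h3, inv_mul_eq_div, le_div_iff₀ (by positivity)] at h2
  rw [inv_mul_eq_div, le_div_iff₀ hb₀0]
  linarith

theorem gaussianVec_real_half_le (p : ℕ) (hp : 1 ≤ p) :
    (gaussianVec p).real {y | y ⬝ᵥ y < 1 / 2} ≤ 4 * gaussMoment 2 / p := by
  have h1 := mul_meas_ge_le_integral_of_nonneg (μ := gaussianVec p)
    (f := fun y => (y ⬝ᵥ y - 1) ^ 2) (ae_of_all _ fun y => sq_nonneg _)
    (integrable_dotProduct_self_sub_one_sq p) (1 / 4)
  have h2 := integral_dotProduct_self_sub_one_sq_le hp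
  have h3 : (gaussianVec p).real {y | y ⬝ᵥ y < 1 / 2}
      ≤ (gaussianVec p).real {y | 1 / 4 ≤ (y ⬝ᵥ y - 1) ^ 2} := by
    refine measureReal_mono fun y hy => ?_
    simp only [Set.mem_ofPred_eq] at hy ⊢
    nlinarith
  have e : 4 * gaussMoment 2 / (p : ℝ) = 4 * (gaussMoment 2 / p) := by ring
  rw [e]
  linarith

/-- The coefficients of a polynomial are controlled, uniformly in large `p`, by its norm in
`L²(xiLaw p)`. -/
theorem exists_norm_coeff_sq_le_xiLaw (L : ℕ) : ∃ C : ℝ, 0 < C ∧ ∀ᶠ p : ℕ in atTop,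
    ∀ b : Fin (L + 1) → ℝ, ‖b‖ ^ 2 ≤ C * ∫ x, (∑ i, b i * x ^ (i : ℕ)) ^ 2 ∂(xiLaw p) := by
  obtain ⟨C, hC, hCb⟩ := exists_norm_coeff_sq_le L
  refine ⟨C * 2 ^ L * 2, by positivity, ?_⟩
  have hlim : Tendsto (fun p : ℕ => 4 * gaussMoment 2 / (p : ℝ)) atTop (𝓝 0) :=
    tendsto_const_div_atTop_nhds_zero_nat _
  filter_upwards [eventually_ge_atTop 1, hlim.eventually_lt_const (by norm_num : (0 : ℝ) < 1 / 2)]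
    with p hp hp2 b
  -- given `Y` the law is Gaussian of variance `|Y|²`, which is at least `1/2` with probability at
  -- least `1/2`
  have hE : (1 : ℝ) / 2 ≤ (gaussianVec p).real {y | y ⬝ᵥ y < 1 / 2}ᶜ := by
    have hm : MeasurableSet {y : Fin p → ℝ | y ⬝ᵥ y < 1 / 2} :=
      measurableSet_lt (by fun_prop) measurable_const
    rw [probReal_compl_eq_one_sub hm]
    have := gaussianVec_real_half_le p hp
    linarith
  have hexp : ∀ (x : ℝ), (∑ i, b i * x ^ (i : ℕ)) ^ 2
      = ∑ i, ∑ j, b i * b j * x ^ ((i : ℕ) + j) := by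
    intro x
    rw [pow_two, Finset.sum_mul_sum]
    exact Finset.sum_congr rfl fun i _ => Finset.sum_congr rfl fun j _ => by ring
  have hint : Integrable (fun x : ℝ => (∑ i, b i * x ^ (i : ℕ)) ^ 2) (xiLaw p) := by
    simp_rw [hexp]
    exact integrable_finsetSum _ fun i _ => integrable_finsetSum _ fun j _ =>
      (integrable_pow_xiLaw hp _).const_mul _
  have hmeas : Measurable fun w : (Fin p → ℝ) × ℝ => √(w.1 ⬝ᵥ w.1) * w.2 := by fun_prop
  have hint2 : Integrable (fun w : (Fin p → ℝ) × ℝ =>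
      (∑ i, b i * (√(w.1 ⬝ᵥ w.1) * w.2) ^ (i : ℕ)) ^ 2)
      ((gaussianVec p).prod (gaussianReal 0 1)) := by
    rw [xiLaw_eq_map hp, integrable_map_measure (by fun_prop) hmeas.aemeasurable] at hint
    exact hint
  rw [xiLaw_eq_map hp, integral_map hmeas.aemeasurable (by fun_prop), integral_prod _ hint2]
  have hlow : ∀ y : Fin p → ℝ, Set.indicator {y : Fin p → ℝ | y ⬝ᵥ y < 1 / 2}ᶜ
      (fun _ => ‖b‖ ^ 2 / (C * 2 ^ L)) y
      ≤ ∫ g, (∑ i, b i * (√(y ⬝ᵥ y) * g) ^ (i : ℕ)) ^ 2 ∂(gaussianReal 0 1) := by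
    intro y
    by_cases hy : y ⬝ᵥ y < 1 / 2
    · rw [Set.indicator_of_notMem (by simpa using hy)]
      exact integral_nonneg fun g => sq_nonneg _
    rw [Set.indicator_of_mem (by simpa using hy)]
    have hy' : 1 / 2 ≤ y ⬝ᵥ y := le_of_not_gt hy
    set v := y ⬝ᵥ y with hv
    have h1 := hCb fun i => b i * √v ^ (i : ℕ)
    have h2 : ∀ g : ℝ, ∑ i : Fin (L + 1), b i * √v ^ (i : ℕ) * g ^ (i : ℕ)
        = ∑ i : Fin (L + 1), b i * (√v * g) ^ (i : ℕ) := fun g =>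
      Finset.sum_congr rfl fun i _ => by rw [mul_pow]; ring
    simp_rw [h2] at h1
    have h3 : ‖b‖ ^ 2 ≤ 2 ^ L * ‖fun i : Fin (L + 1) => b i * √v ^ (i : ℕ)‖ ^ 2 := by
      set B := ‖fun i : Fin (L + 1) => b i * √v ^ (i : ℕ)‖ with hB
      have h4 : ‖b‖ ≤ √(2 ^ L) * B := by
        refine (pi_norm_le_iff_of_nonneg (by positivity)).2 fun i => ?_
        have h5 : ‖b i * √v ^ (i : ℕ)‖ ≤ B :=
          norm_le_pi_norm (fun i : Fin (L + 1) => b i * √v ^ (i : ℕ)) i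
        rw [norm_mul, norm_pow, Real.norm_of_nonneg (Real.sqrt_nonneg v)] at h5
        have h6 : 1 ≤ √(2 ^ L) * √v ^ (i : ℕ) := by
          have hv0 : 0 < √v := Real.sqrt_pos.2 (by linarith)
          have h7 : (1 : ℝ) ≤ √2 * √v := by
            rw [← Real.sqrt_mul (by norm_num), Real.one_le_sqrt]; linarith
          have h8 : √2 ^ (i : ℕ) ≤ √2 ^ L :=
            pow_le_pow_right₀ (Real.one_le_sqrt.2 (by norm_num)) (Nat.le_of_lt_succ i.isLt)
          have h9 : √((2 : ℝ) ^ L) = √2 ^ L := by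
            rw [Real.sqrt_eq_iff_mul_self_eq (by positivity) (by positivity), ← mul_pow,
              Real.mul_self_sqrt (by norm_num)]
          rw [h9]
          calc (1 : ℝ) ≤ (√2 * √v) ^ (i : ℕ) := one_le_pow₀ h7
            _ = √2 ^ (i : ℕ) * √v ^ (i : ℕ) := mul_pow _ _ _
            _ ≤ _ := by gcongr
        calc ‖b i‖ ≤ ‖b i‖ * (√(2 ^ L) * √v ^ (i : ℕ)) := le_mul_of_one_le_right (norm_nonneg _) h6
          _ = √(2 ^ L) * (‖b i‖ * √v ^ (i : ℕ)) := by ring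
          _ ≤ _ := by gcongr
      calc ‖b‖ ^ 2 ≤ (√(2 ^ L) * B) ^ 2 := by gcongr
        _ = _ := by rw [mul_pow, Real.sq_sqrt (by positivity)]
    rw [div_le_iff₀ (by positivity)]
    calc ‖b‖ ^ 2 ≤ _ := h3
      _ ≤ 2 ^ L * (C * ∫ g, (∑ i, b i * (√v * g) ^ (i : ℕ)) ^ 2 ∂(gaussianReal 0 1)) := by gcongr
      _ = _ := by ring
  have hm2 : MeasurableSet {y : Fin p → ℝ | y ⬝ᵥ y < 1 / 2}ᶜ :=
    (measurableSet_lt (by fun_prop) measurable_const).compl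
  have h5 := integral_mono_of_nonneg (μ := gaussianVec p) (ae_of_all _ fun y =>
    Set.indicator_nonneg (fun _ _ => by positivity) y) hint2.integral_prod_left (ae_of_all _ hlow)
  rw [integral_indicator hm2, setIntegral_const, smul_eq_mul] at h5
  simp only at h5
  have h6 : 1 / 2 * (‖b‖ ^ 2 / (C * 2 ^ L)) ≤ (gaussianVec p).real {y | y ⬝ᵥ y < 1 / 2}ᶜ
      * (‖b‖ ^ 2 / (C * 2 ^ L)) := by gcongr
  have h7 := h6.trans h5
  calc ‖b‖ ^ 2 = C * 2 ^ L * 2 * (1 / 2 * (‖b‖ ^ 2 / (C * 2 ^ L))) := by field_simp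
    _ ≤ _ := by gcongr

/-- The trigonometric sums on the line: the finite combinations of the characters `expI s`. -/
def IsTrig (g : ℝ → ℂ) : Prop :=
  ∃ (κ : Type) (_ : Fintype κ) (s : κ → ℝ) (c : κ → ℂ), ∀ x, g x = ∑ k, c k * expI (s k) x

theorem isTrig_one : IsTrig fun _ => 1 :=
  ⟨Unit, inferInstance, fun _ => 0, fun _ => 1, fun x => by simp [expI]⟩

theorem IsTrig.mul {g h : ℝ → ℂ} (hg : IsTrig g) (hh : IsTrig h) : IsTrig fun x => g x * h x := by
  obtain ⟨κ, _, s, c, hg⟩ := hg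
  obtain ⟨κ', _, s', c', hh⟩ := hh
  refine ⟨κ × κ', inferInstance, fun q => s q.1 + s' q.2, fun q => c q.1 * c' q.2, fun x => ?_⟩
  simp only [hg, hh, Finset.sum_mul_sum, Fintype.sum_prod_type]
  refine Finset.sum_congr rfl fun i _ => Finset.sum_congr rfl fun j _ => ?_
  rw [mul_mul_mul_comm, expI_mul_expI]

theorem IsTrig.pow {g : ℝ → ℂ} (hg : IsTrig g) (l : ℕ) : IsTrig fun x => g x ^ l := by
  induction l with
  | zero => simpa using isTrig_one
  | succ l ih => simpa only [pow_succ] using ih.mul hg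

theorem isTrig_mul_sin (M : ℝ) : IsTrig fun x => ((M * Real.sin (x / M) : ℝ) : ℂ) := by
  refine ⟨Fin 2, inferInstance, ![-(1 / M), 1 / M],
    ![M * Complex.I / 2, -(M * Complex.I / 2)], fun x => ?_⟩
  simp only [Fin.sum_univ_two, Matrix.cons_val_zero, Matrix.cons_val_one, expI]
  push_cast
  rw [Complex.sin]
  have e1 : -(1 / (M : ℂ)) * x * Complex.I = -((x : ℂ) / M) * Complex.I := by ring
  have e2 : 1 / (M : ℂ) * x * Complex.I = (x : ℂ) / M * Complex.I := by ring
  rw [e1, e2]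
  ring

theorem IsTrig.continuous {g : ℝ → ℂ} (hg : IsTrig g) : Continuous g := by
  obtain ⟨κ, _, s, c, hg⟩ := hg
  rw [funext hg]
  unfold expI
  fun_prop

theorem IsTrig.exists_norm_le {g : ℝ → ℂ} (hg : IsTrig g) : ∃ K, ∀ x, ‖g x‖ ≤ K := by
  obtain ⟨κ, _, s, c, hg⟩ := hg
  refine ⟨∑ k, ‖c k‖, fun x => ?_⟩
  rw [hg]
  refine (norm_sum_le _ _).trans (Finset.sum_le_sum fun k _ => ?_)
  rw [norm_mul, norm_expI, mul_one]

theorem abs_sub_sin_le (u : ℝ) : |u - Real.sin u| ≤ |u| ^ 3 / 6 := by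
  have key : ∀ u : ℝ, 0 ≤ u → |u - Real.sin u| ≤ |u| ^ 3 / 6 := by
    intro u hu
    rcases hu.eq_or_lt with h | h
    · rw [← h]; simp
    · rw [abs_of_nonneg (by linarith [Real.sin_le hu]), abs_of_nonneg hu]
      linarith [Real.sin_gt_sub_cube h]
  rcases le_total 0 u with h | h
  · exact key u h
  · have := key (-u) (by linarith)
    rw [Real.sin_neg, abs_neg, ← neg_add', abs_neg] at this
    simpa [sub_eq_add_neg] using this

/-- Monomials are approximated by powers of `M sin(x / M)`, uniformly in `p`. -/
theorem exists_isTrig_pow_approx (l : ℕ) {ε : ℝ} (hε : 0 < ε) :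
    ∃ g : ℝ → ℂ, IsTrig g ∧ ∀ p : ℕ, 1 ≤ p → ∫ x, ‖(x : ℂ) ^ l - g x‖ ^ 2 ∂(xiLaw p) ≤ ε := by
  set K := (1 + gaussMoment (l + 2)) * gaussMoment (l + 2) with hK
  have hK0 : 0 ≤ K := by have := gaussMoment_nonneg (l + 2); positivity
  -- the error is at most `l² K / M` for `M ≥ 1`
  obtain ⟨N, hN⟩ := exists_nat_gt ((l : ℝ) ^ 2 * K / ε)
  set M : ℝ := N + 1 with hM
  have hM1 : 1 ≤ M := by rw [hM]; linarith [Nat.cast_nonneg (α := ℝ) N]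
  refine ⟨fun x => ((M * Real.sin (x / M) : ℝ) : ℂ) ^ l, (isTrig_mul_sin M).pow l, fun p hp => ?_⟩
  have hpt : ∀ x : ℝ, ‖(x : ℂ) ^ l - ((M * Real.sin (x / M) : ℝ) : ℂ) ^ l‖ ^ 2
      ≤ (l : ℝ) ^ 2 / M * x ^ (2 * (l + 2)) := by
    intro x
    rw [← Complex.ofReal_pow, ← Complex.ofReal_pow, ← Complex.ofReal_sub, Complex.norm_real,
      Real.norm_eq_abs]
    set y := M * Real.sin (x / M) with hy
    have hyx : |y| ≤ |x| := by
      rw [hy, abs_mul, abs_of_pos (by linarith : 0 < M)]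
      calc M * |Real.sin (x / M)| ≤ M * |x / M| := by exact mul_le_mul_of_nonneg_left Real.abs_sin_le_abs (by linarith)
        _ = |x| := by rw [abs_div, abs_of_pos (by linarith : 0 < M)]; field_simp
    have hd : |x - y| ≤ |x| ^ 3 / M := by
      have e : x - y = M * (x / M - Real.sin (x / M)) := by rw [hy]; field_simp
      rw [e, abs_mul, abs_of_pos (by linarith : 0 < M)]
      calc M * |x / M - Real.sin (x / M)| ≤ M * (|x / M| ^ 3 / 6) := by
            gcongr; exact abs_sub_sin_le _
        _ = |x| ^ 3 / M * (1 / (6 * M)) := by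
            rw [abs_div, abs_of_pos (by linarith : 0 < M)]; field_simp
        _ ≤ |x| ^ 3 / M * 1 := by
            gcongr
            rw [div_le_one (by positivity)]; linarith
        _ = _ := mul_one _
    have h1 := abs_pow_sub_pow_le x y l
    rw [max_eq_left hyx] at h1
    have h2 : |x ^ l - y ^ l| ≤ l / M * |x| ^ (l + 2) := by
      rcases Nat.eq_zero_or_pos l with h | h
      · subst h; simp
      · refine h1.trans ?_
        calc |x - y| * l * |x| ^ (l - 1) ≤ |x| ^ 3 / M * l * |x| ^ (l - 1) := by gcongr
          _ = l / M * (|x| ^ 3 * |x| ^ (l - 1)) := by ring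
          _ = _ := by
            rw [← pow_add]
            congr 2
            omega
    calc |x ^ l - y ^ l| ^ 2 ≤ (l / M * |x| ^ (l + 2)) ^ 2 := by gcongr
      _ = (l : ℝ) ^ 2 / M ^ 2 * x ^ (2 * (l + 2)) := by
        rw [mul_pow, div_pow, ← pow_mul, mul_comm (l + 2) 2, pow_mul, sq_abs, pow_mul]
      _ ≤ _ := by
        have : 0 ≤ x ^ (2 * (l + 2)) := by rw [pow_mul]; positivity
        gcongr
        nlinarith
  calc ∫ x, ‖(x : ℂ) ^ l - ((M * Real.sin (x / M) : ℝ) : ℂ) ^ l‖ ^ 2 ∂(xiLaw p)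
      ≤ ∫ x, (l : ℝ) ^ 2 / M * x ^ (2 * (l + 2)) ∂(xiLaw p) :=
        integral_mono_of_nonneg (ae_of_all _ fun x => by positivity)
          ((integrable_pow_xiLaw hp _).const_mul _) (ae_of_all _ hpt)
    _ ≤ (l : ℝ) ^ 2 / M * K := by
        rw [integral_const_mul]
        exact mul_le_mul_of_nonneg_left (integral_pow_xiLaw_le hp _) (by positivity)
    _ ≤ ε := by
        rw [div_lt_iff₀ hε] at hN
        rw [div_mul_eq_mul_div, div_le_iff₀ (by linarith)]
        nlinarith

/-- Approximability in `L²(xiLaw p)`, uniformly in large `p`, by trigonometric sums whose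
frequencies do not depend on `p` and whose coefficients are bounded. -/
def ExpApprox (h : ℕ → ℝ → ℂ) : Prop :=
  ∀ ε : ℝ, 0 < ε → ∃ (κ : Type) (_ : Fintype κ) (s : κ → ℝ) (C : ℝ), ∀ᶠ p : ℕ in atTop,
    ∃ c : κ → ℂ, (∀ k, ‖c k‖ ≤ C) ∧
      ∫ x, ‖h p x - ∑ k, c k * expI (s k) x‖ ^ 2 ∂(xiLaw p) ≤ ε

theorem expApprox_id : ExpApprox fun _ x => (x : ℂ) := by
  intro ε hε
  obtain ⟨g, ⟨κ, _, s, c, hg⟩, h⟩ := exists_isTrig_pow_approx 1 hε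
  refine ⟨κ, inferInstance, s, ∑ k, ‖c k‖, ?_⟩
  filter_upwards [eventually_ge_atTop 1] with p hp
  refine ⟨c, fun k => Finset.single_le_sum (f := fun k => ‖c k‖) (fun _ _ => norm_nonneg _)
    (Finset.mem_univ k), ?_⟩
  simpa only [pow_one, hg] using h p hp

theorem integral_sq_eq_variance {k : ℕ → ℝ → ℝ} {ν : ℝ} (h : CVariance k ν) {p : ℕ} (hp : 1 ≤ p) :
    ∫ x, k p x ^ 2 ∂(xiLaw p) = variance (k p) (xiLaw p) := by
  rw [variance_eq_sub (h.memLp p hp), h.mean_zero p hp]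
  simp

/-- Polynomials of bounded degree with bounded coefficients are approximated by trigonometric sums
whose frequencies depend only on the degree, the bound and the accuracy. -/
theorem exists_trig_approx_polynomial (L : ℕ) {S ε : ℝ} (hS0 : 0 < S) (hε : 0 < ε) :
    ∃ (κ : Type) (_ : Fintype κ) (s : κ → ℝ) (C : ℝ), ∀ p : ℕ, 1 ≤ p → ∀ b : Fin (L + 1) → ℝ,
      ‖b‖ ^ 2 ≤ S → ∃ c : κ → ℂ, (∀ k, ‖c k‖ ≤ C) ∧
      Integrable (fun x : ℝ => ‖(∑ i, (b i : ℂ) * (x : ℂ) ^ (i : ℕ)) - ∑ k, c k * expI (s k) x‖ ^ 2)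
        (xiLaw p) ∧
      ∫ x : ℝ, ‖(∑ i, (b i : ℂ) * (x : ℂ) ^ (i : ℕ)) - ∑ k, c k * expI (s k) x‖ ^ 2 ∂(xiLaw p)
        ≤ ε := by
  set δ := ε / ((L + 1) ^ 2 * S) with hδ
  have hδ0 : 0 < δ := by positivity
  choose g hgT hg using fun i : Fin (L + 1) => exists_isTrig_pow_approx (i : ℕ) hδ0
  choose κ inst s c hgc using hgT
  refine ⟨Σ i, κ i, inferInstance, fun q => s q.1 q.2, √S * ∑ i, ∑ k, ‖c i k‖, fun p hp b hbS => ?_⟩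
  have hbn : ‖b‖ ≤ √S := Real.le_sqrt_of_sq_le hbS
  have hgi : ∀ i : Fin (L + 1), Integrable (fun x : ℝ => ‖(x : ℂ) ^ (i : ℕ) - g i x‖ ^ 2)
      (xiLaw p) := by
    intro i
    have hgt : IsTrig (g i) := ⟨κ i, inst i, s i, c i, hgc i⟩
    have hgc := hgt.continuous
    obtain ⟨K, hK⟩ := hgt.exists_norm_le
    refine Integrable.mono' (g := fun x => 2 * x ^ (2 * (i : ℕ)) + 2 * K ^ 2)
      (((integrable_pow_xiLaw hp _).const_mul 2).add (integrable_const _))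
      (Continuous.aestronglyMeasurable (by fun_prop)) (ae_of_all _ fun x => ?_)
    rw [Real.norm_of_nonneg (by positivity), sub_eq_add_neg]
    refine (norm_add_sq_le _ _).trans ?_
    rw [norm_neg, norm_pow, Complex.norm_real, Real.norm_eq_abs, ← pow_mul, mul_comm (i : ℕ) 2,
      pow_mul, sq_abs, pow_mul]
    have := hK x
    gcongr
  have hpt : ∀ x : ℝ, ‖(∑ i, (b i : ℂ) * (x : ℂ) ^ (i : ℕ))
        - ∑ q : Σ i, κ i, (b q.1 : ℂ) * c q.1 q.2 * expI (s q.1 q.2) x‖ ^ 2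
      ≤ S * ((L + 1) * ∑ i : Fin (L + 1), ‖(x : ℂ) ^ (i : ℕ) - g i x‖ ^ 2) := by
    intro x
    have e1 : ∑ q : Σ i, κ i, (b q.1 : ℂ) * c q.1 q.2 * expI (s q.1 q.2) x = ∑ i, (b i : ℂ) * g i x := by
      rw [Fintype.sum_sigma]
      refine Finset.sum_congr rfl fun i _ => ?_
      rw [hgc, Finset.mul_sum]
      exact Finset.sum_congr rfl fun q _ => by ring
    rw [e1, ← Finset.sum_sub_distrib]
    simp_rw [← mul_sub]
    calc ‖∑ i, (b i : ℂ) * ((x : ℂ) ^ (i : ℕ) - g i x)‖ ^ 2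
        ≤ (∑ i : Fin (L + 1), √S * ‖(x : ℂ) ^ (i : ℕ) - g i x‖) ^ 2 := by
          gcongr
          refine (norm_sum_le _ _).trans (Finset.sum_le_sum fun i _ => ?_)
          rw [norm_mul, Complex.norm_real]
          gcongr
          exact (norm_le_pi_norm b i).trans hbn
      _ = S * (∑ i : Fin (L + 1), ‖(x : ℂ) ^ (i : ℕ) - g i x‖) ^ 2 := by
          rw [← Finset.mul_sum, mul_pow, Real.sq_sqrt hS0.le]
      _ ≤ _ := by
          gcongr
          have := sq_sum_le_card_mul_sum_sq (s := Finset.univ)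
            (f := fun i : Fin (L + 1) => ‖(x : ℂ) ^ (i : ℕ) - g i x‖)
          simpa using this
  have hI : Integrable (fun x : ℝ =>
      S * ((L + 1) * ∑ i : Fin (L + 1), ‖(x : ℂ) ^ (i : ℕ) - g i x‖ ^ 2)) (xiLaw p) :=
    ((integrable_finsetSum Finset.univ fun i _ => hgi i).const_mul _).const_mul _
  refine ⟨fun q => b q.1 * c q.1 q.2, fun q => ?_, ?_, ?_⟩
  · rw [norm_mul, Complex.norm_real]
    have h1 : ‖c q.1 q.2‖ ≤ ∑ i, ∑ k, ‖c i k‖ :=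
      (Finset.single_le_sum (f := fun k => ‖c q.1 k‖) (fun _ _ => norm_nonneg _)
        (Finset.mem_univ q.2)).trans
      (Finset.single_le_sum (f := fun i => ∑ k, ‖c i k‖)
        (fun _ _ => Finset.sum_nonneg fun _ _ => norm_nonneg _) (Finset.mem_univ q.1))
    exact mul_le_mul ((norm_le_pi_norm b q.1).trans hbn) h1 (norm_nonneg _) (Real.sqrt_nonneg _)
  · refine hI.mono' (Continuous.aestronglyMeasurable ?_) (ae_of_all _ fun x => ?_)
    · unfold expI
      fun_prop
    · rw [Real.norm_of_nonneg (by positivity)]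
      exact hpt x
  calc _ ≤ ∫ x : ℝ, S * ((L + 1) * ∑ i : Fin (L + 1), ‖(x : ℂ) ^ (i : ℕ) - g i x‖ ^ 2) ∂(xiLaw p) :=
        integral_mono_of_nonneg (ae_of_all _ fun x => by positivity) hI (ae_of_all _ hpt)
    _ = S * ((L + 1) * ∑ i : Fin (L + 1), ∫ x : ℝ, ‖(x : ℂ) ^ (i : ℕ) - g i x‖ ^ 2 ∂(xiLaw p)) := by
        rw [integral_const_mul, integral_const_mul, integral_finsetSum _ fun i _ => hgi i]
    _ ≤ S * ((L + 1) * ∑ _i : Fin (L + 1), δ) := by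
        gcongr with i
        exact hg i p hp
    _ = ε := by
        rw [Finset.sum_const, Finset.card_univ, Fintype.card_fin, nsmul_eq_mul, hδ]
        push_cast
        field_simp

/-- The truncated expansion of the kernel has bounded norm, hence bounded coefficients in the
monomial basis, and the monomials are approximated by trigonometric sums. -/
theorem expApprox_of_cUniform {k : ℕ → ℝ → ℝ} {ν : ℝ} (hV : CVariance k ν) (hU : CUniform k) :
    ExpApprox fun p x => (k p x : ℂ) := by
  intro ε hε
  obtain ⟨L, p₀, hL⟩ := hU (ε / 4) (by positivity)
  obtain ⟨C, hC, hCb⟩ := exists_norm_coeff_sq_le_xiLaw L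
  set S := C * (2 * (|ν| + 1) + ε) with hS
  have hS0 : 0 < S := by positivity
  obtain ⟨κ, _, s, C', hκ⟩ := exists_trig_approx_polynomial L hS0 (by positivity : 0 < ε / 4)
  refine ⟨κ, inferInstance, s, C', ?_⟩
  filter_upwards [hCb, eventually_gt_atTop p₀, eventually_ge_atTop 1,
    hV.tendsto_variance.eventually_lt_const (lt_of_le_of_lt (le_abs_self ν) (lt_add_one |ν|))]
    with p hCp hp₀ hp hvar
  obtain ⟨b, hb⟩ := exists_truncation_eq_sum k L p
  have hk2 := (hV.memLp p hp).integrable_sq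
  have htL : MemLp (truncation k L p) 2 (xiLaw p) := by
    have e : truncation k L p = fun x => ∑ i, b i * x ^ (i : ℕ) := funext hb
    rw [e]
    refine memLp_finsetSum _ fun i _ => MemLp.const_mul ?_ _
    rw [memLp_two_iff_integrable_sq (by fun_prop)]
    simpa only [← pow_mul] using integrable_pow_xiLaw hp _
  have hd2 : Integrable (fun x => (k p x - truncation k L p x) ^ 2) (xiLaw p) :=
    ((hV.memLp p hp).sub htL).integrable_sq
  have hLp := hL p hp₀
  have hbS : ‖b‖ ^ 2 ≤ S := by
    refine (hCp b).trans (mul_le_mul_of_nonneg_left ?_ hC.le)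
    simp_rw [← hb]
    calc ∫ x, truncation k L p x ^ 2 ∂(xiLaw p)
        ≤ ∫ x, (2 * k p x ^ 2 + 2 * (k p x - truncation k L p x) ^ 2) ∂(xiLaw p) := by
          refine integral_mono htL.integrable_sq ((hk2.const_mul 2).add (hd2.const_mul 2))
            fun x => ?_
          simp only
          nlinarith [sq_nonneg (2 * k p x - truncation k L p x)]
      _ = 2 * variance (k p) (xiLaw p) + 2 * ∫ x, (k p x - truncation k L p x) ^ 2 ∂(xiLaw p) := by
          rw [integral_add (hk2.const_mul 2) (hd2.const_mul 2), integral_const_mul,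
            integral_const_mul, integral_sq_eq_variance hV hp]
      _ ≤ _ := by linarith
  obtain ⟨c, hc, hci, hce⟩ := hκ p hp b hbS
  refine ⟨c, hc, ?_⟩
  have hpt : ∀ x : ℝ, ‖(k p x : ℂ) - ∑ q, c q * expI (s q) x‖ ^ 2
      ≤ 2 * (k p x - truncation k L p x) ^ 2
        + 2 * ‖(∑ i, (b i : ℂ) * (x : ℂ) ^ (i : ℕ)) - ∑ k, c k * expI (s k) x‖ ^ 2 := by
    intro x
    have e2 : (k p x : ℂ) - ∑ q, c q * expI (s q) x = ((k p x - truncation k L p x : ℝ) : ℂ)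
        + ((∑ i, (b i : ℂ) * (x : ℂ) ^ (i : ℕ)) - ∑ k, c k * expI (s k) x) := by
      rw [hb]
      push_cast
      ring
    rw [e2]
    refine (norm_add_sq_le _ _).trans ?_
    rw [Complex.norm_real, Real.norm_eq_abs, sq_abs]
  calc _ ≤ ∫ x : ℝ, (2 * (k p x - truncation k L p x) ^ 2
        + 2 * ‖(∑ i, (b i : ℂ) * (x : ℂ) ^ (i : ℕ)) - ∑ k, c k * expI (s k) x‖ ^ 2) ∂(xiLaw p) :=
        integral_mono_of_nonneg (ae_of_all _ fun x => by positivity)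
          ((hd2.const_mul 2).add (hci.const_mul 2)) (ae_of_all _ hpt)
    _ ≤ ε := by
        rw [integral_add (hd2.const_mul 2) (hci.const_mul 2), integral_const_mul,
          integral_const_mul]
        linarith

end ExpApprox

/-! ### Concentration of quadratic forms in functions of a new Gaussian vector -/

section Forms

/-- The limit of `bilForm M h h' X`, with the expectations taken under `xiLaw p`. -/
def formMean {ι : Type*} [Fintype ι] {p : ℕ} (M : Matrix ι ι ℂ) (X : ι → Fin p → ℝ)
    (h h' : ℝ → ℂ) : ℂ :=
  formLimit M X (∫ x, h x * h' x ∂(xiLaw p)) ((∫ x, h x ∂(xiLaw p)) * ∫ x, h' x ∂(xiLaw p))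
    ((∫ x, (x : ℂ) * h x ∂(xiLaw p)) * ∫ x, (x : ℂ) * h' x ∂(xiLaw p))

/-- A measurable family of complex symmetric matrices of operator norm at most `c`. -/
structure SymmFamily {n p : ℕ} (c : ℝ) (M : (Fin n → Fin p → ℝ) → Matrix (Fin n) (Fin n) ℂ) :
    Prop where
  isSymm : ∀ X, (M X).IsSymm
  opBound : ∀ X, OpBound (M X) c
  measurable : ∀ j k, Measurable fun X => M X j k

/-- The deviation of the quadratic form from its limit, as a function of the sample `w.1` and the
new vector `w.2`. -/
def formDiff {n p : ℕ} (M : (Fin n → Fin p → ℝ) → Matrix (Fin n) (Fin n) ℂ) (h h' : ℝ → ℂ)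
    (w : (Fin n → Fin p → ℝ) × (Fin p → ℝ)) : ℂ :=
  bilForm (M w.1) h h' w.1 w.2 - formMean (M w.1) w.1 h h'

/-- The joint law of the sample and of an independent new vector. -/
def jointLaw (n p : ℕ) : Measure ((Fin n → Fin p → ℝ) × (Fin p → ℝ)) :=
  (sampleLaw n p).prod (gaussianVec p)

variable {n p : ℕ} {c : ℝ} {M : (Fin n → Fin p → ℝ) → Matrix (Fin n) (Fin n) ℂ}

theorem SymmFamily.measurable_bilForm (hM : SymmFamily c M) {h h' : ℝ → ℂ} (hh : Measurable h)
    (hh' : Measurable h') : Measurable fun w : (Fin n → Fin p → ℝ) × (Fin p → ℝ) =>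
      bilForm (M w.1) h h' w.1 w.2 := by
  unfold bilForm
  refine measurable_const.mul (Finset.measurable_fun_sum _ fun j _ =>
    Finset.measurable_fun_sum _ fun k _ => ?_)
  exact ((hM.measurable j k).comp measurable_fst).mul
    ((hh.comp (by fun_prop)).mul (hh'.comp (by fun_prop)))

theorem SymmFamily.measurable_formLimit (hM : SymmFamily c M) (e m k : ℂ) :
    Measurable fun X => formLimit (M X) X e m k := by
  unfold formLimit Matrix.trace
  have h1 : ∀ j, Measurable fun X => (M X).diag j := fun j => hM.measurable j j
  have h2 := hM.measurable
  refine measurable_const.mul (((measurable_const.mul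
    (Finset.measurable_fun_sum _ fun j _ => h1 j)).add (measurable_const.mul
    (Finset.measurable_fun_sum _ fun j _ => Finset.measurable_fun_sum _ fun l _ =>
      (h2 j l).mul (by fun_prop)))).add (measurable_const.mul
    (Finset.measurable_fun_sum _ fun j _ => Finset.measurable_fun_sum _ fun l _ => h2 j l)))

theorem SymmFamily.measurable_formDiff (hM : SymmFamily c M) {h h' : ℝ → ℂ} (hh : Measurable h)
    (hh' : Measurable h') : Measurable (formDiff M h h') :=
  (hM.measurable_bilForm hh hh').sub ((hM.measurable_formLimit _ _ _).comp measurable_fst)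

theorem formLimit_sub {ι : Type*} [Fintype ι] {p : ℕ} (M : Matrix ι ι ℂ) (X : ι → Fin p → ℝ)
    (e m k e' m' k' : ℂ) : formLimit M X e m k - formLimit M X e' m' k'
      = formLimit M X (e - e') (m - m') (k - k') := by
  unfold formLimit; ring

theorem formLimit_add {ι : Type*} [Fintype ι] {p : ℕ} (M : Matrix ι ι ℂ) (X : ι → Fin p → ℝ)
    (e m k e' m' k' : ℂ) : formLimit M X e m k + formLimit M X e' m' k'
      = formLimit M X (e + e') (m + m') (k + k') := by
  unfold formLimit; ring

theorem formLimit_mul {ι : Type*} [Fintype ι] {p : ℕ} (M : Matrix ι ι ℂ) (X : ι → Fin p → ℝ)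
    (a e m k : ℂ) : a * formLimit M X e m k = formLimit M X (a * e) (a * m) (a * k) := by
  unfold formLimit; ring

theorem norm_sum_gram_le {ι : Type*} [Fintype ι] {p : ℕ} {M : Matrix ι ι ℂ} {c : ℝ} (hc : 0 ≤ c)
    (hM : OpBound M c) (X : ι → Fin p → ℝ) :
    ‖∑ j, ∑ l, M j l * ((X j ⬝ᵥ X l : ℝ) : ℂ)‖ ≤ c * ∑ j, X j ⬝ᵥ X j := by
  have e : ∑ j, ∑ l, M j l * ((X j ⬝ᵥ X l : ℝ) : ℂ)
      = ∑ α, (fun j => (X j α : ℂ)) ⬝ᵥ (M.mulVec fun j => (X j α : ℂ)) := by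
    simp_rw [dotProduct_mulVec_eq_sum]
    symm
    rw [Finset.sum_comm]
    refine Finset.sum_congr rfl fun j _ => ?_
    rw [Finset.sum_comm]
    refine Finset.sum_congr rfl fun l _ => ?_
    rw [← Finset.mul_sum, dotProduct]
    push_cast
    rfl
  rw [e]
  calc _ ≤ ∑ α, c * nsq (fun j => (X j α : ℂ)) := by
        refine (norm_sum_le _ _).trans (Finset.sum_le_sum fun α _ => ?_)
        refine (hM.norm_dotProduct_mulVec_le hc _ _).trans (le_of_eq ?_)
        rw [Real.mul_self_sqrt (nsq_nonneg _)]
    _ = _ := by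
        rw [← Finset.mul_sum]
        unfold nsq
        rw [Finset.sum_comm]
        congr 1
        refine Finset.sum_congr rfl fun j _ => ?_
        rw [dotProduct]
        refine Finset.sum_congr rfl fun α _ => ?_
        rw [Complex.norm_real, Real.norm_eq_abs, sq_abs, pow_two]

theorem norm_sum_entries_le {ι : Type*} [Fintype ι] {M : Matrix ι ι ℂ} {c : ℝ} (hc : 0 ≤ c)
    (hM : OpBound M c) : ‖∑ j, ∑ l, M j l‖ ≤ c * Fintype.card ι := by
  have h1 := hM.norm_dotProduct_mulVec_le hc (fun _ => 1) (fun _ => 1)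
  rw [dotProduct_mulVec_eq_sum, Real.mul_self_sqrt (nsq_nonneg _)] at h1
  simpa [nsq] using h1

theorem norm_formLimit_le (hp : 1 ≤ p) (hc : 0 ≤ c) {M : Matrix (Fin n) (Fin n) ℂ}
    (hM : OpBound M c) (X : Fin n → Fin p → ℝ) (e m k : ℂ) :
    ‖formLimit M X e m k‖ ≤ c / p * ((‖e‖ + 2 * ‖m‖ + ‖k‖) * n + ‖k‖ * ∑ j, X j ⬝ᵥ X j) := by
  have h1 := norm_sum_gram_le hc hM X
  have h2 := norm_sum_entries_le hc hM
  have h3 := hM.norm_trace_le hc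
  rw [Fintype.card_fin] at h2 h3
  have h4 : ‖e - m - k‖ ≤ ‖e‖ + ‖m‖ + ‖k‖ :=
    (norm_sub_le _ _).trans (by gcongr; exact norm_sub_le _ _)
  rw [formLimit, norm_mul, norm_inv, Complex.norm_natCast]
  calc _ ≤ (p : ℝ)⁻¹ * ((‖e‖ + ‖m‖ + ‖k‖) * (c * n) + ‖k‖ * (c * ∑ j, X j ⬝ᵥ X j)
        + ‖m‖ * (c * n)) := by
        gcongr
        refine norm_add₃_le.trans ?_
        rw [norm_mul, norm_mul, norm_mul]
        gcongr
    _ = _ := by ring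

theorem integrable_sum_dotProduct_self (n p : ℕ) :
    Integrable (fun X : Fin n → Fin p → ℝ => ∑ j, X j ⬝ᵥ X j) (sampleLaw n p) :=
  integrable_finsetSum _ fun j _ =>
    (measurePreserving_sampleLaw_eval p j).integrable_comp_of_integrable
      (integrable_dotProduct_self p)

theorem integral_sum_dotProduct_self (n : ℕ) {p : ℕ} (hp : 1 ≤ p) :
    ∫ X : Fin n → Fin p → ℝ, ∑ j, X j ⬝ᵥ X j ∂(sampleLaw n p) = n := by
  have hi : ∀ j : Fin n, Integrable (fun X : Fin n → Fin p → ℝ => X j ⬝ᵥ X j) (sampleLaw n p) :=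
    fun j => (measurePreserving_sampleLaw_eval p j).integrable_comp_of_integrable
      (integrable_dotProduct_self p)
  rw [integral_finsetSum _ fun j _ => hi j]
  have : ∀ j : Fin n, ∫ X : Fin n → Fin p → ℝ, X j ⬝ᵥ X j ∂(sampleLaw n p) = 1 := by
    intro j
    rw [(measurePreserving_sampleLaw_eval p j).integral_comp_of_measurable
      (g := fun y : Fin p → ℝ => y ⬝ᵥ y) (by fun_prop)]
    exact integral_dotProduct_self hp
  simp [this]

theorem eLpNorm_one_le_ofReal_integral {α : Type*} [MeasurableSpace α] {μ : Measure α}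
    {f : α → ℂ} {g : α → ℝ} (hg : Integrable g μ) (hfg : ∀ x, ‖f x‖ ≤ g x) :
    eLpNorm f 1 μ ≤ ENNReal.ofReal (∫ x, g x ∂μ) := by
  rw [eLpNorm_one_eq_lintegral_enorm, ofReal_integral_eq_lintegral_ofReal hg
    (ae_of_all _ fun x => (norm_nonneg _).trans (hfg x))]
  refine lintegral_mono fun x => ?_
  rw [← ofReal_norm]
  exact ENNReal.ofReal_le_ofReal (hfg x)

theorem SymmFamily.eLpNorm_formLimit_le (hM : SymmFamily c M) (hp : 1 ≤ p) (hc : 0 ≤ c) {Θ : ℝ}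
    (hn : (n : ℝ) ≤ Θ * p) (e m k : ℂ) :
    eLpNorm (fun X => formLimit (M X) X e m k) 1 (sampleLaw n p)
      ≤ ENNReal.ofReal (c * Θ * (‖e‖ + 2 * ‖m‖ + 2 * ‖k‖)) := by
  have hp0 : (0 : ℝ) < p := by exact_mod_cast hp
  have hi : Integrable (fun X : Fin n → Fin p → ℝ =>
      c / p * ((‖e‖ + 2 * ‖m‖ + ‖k‖) * n + ‖k‖ * ∑ j, X j ⬝ᵥ X j)) (sampleLaw n p) :=
    ((integrable_const _).add ((integrable_sum_dotProduct_self n p).const_mul _)).const_mul _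
  refine (eLpNorm_one_le_ofReal_integral hi fun X => norm_formLimit_le hp hc (hM.opBound X) X _ _ _).trans ?_
  apply ENNReal.ofReal_le_ofReal
  rw [integral_const_mul, integral_add (integrable_const _)
    ((integrable_sum_dotProduct_self n p).const_mul _), integral_const,
    integral_const_mul, integral_sum_dotProduct_self n hp, probReal_univ, one_smul]
  calc _ = c * (n / p) * (‖e‖ + 2 * ‖m‖ + 2 * ‖k‖) := by ring
    _ ≤ _ := by
      gcongr
      rw [div_le_iff₀ hp0]; exact hn

theorem measurePreserving_fst_jointLaw (n p : ℕ) :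
    MeasurePreserving Prod.fst (jointLaw n p) (sampleLaw n p) :=
  measurePreserving_fst

theorem norm_bilForm_le (hc : 0 ≤ c) {M : Matrix (Fin n) (Fin n) ℂ}
    (hM : OpBound M c) (h h' : ℝ → ℂ) (X : Fin n → Fin p → ℝ) (x : Fin p → ℝ) {δ : ℝ} (hδ : 0 < δ) :
    ‖bilForm M h h' X x‖ ≤ c / p * (∑ j, (δ * ‖h (√(p : ℝ) * (X j ⬝ᵥ x))‖ ^ 2
      + ‖h' (√(p : ℝ) * (X j ⬝ᵥ x))‖ ^ 2 / δ) / 2) := by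
  set u : Fin n → ℂ := fun j => h (√(p : ℝ) * (X j ⬝ᵥ x)) with hu
  set w : Fin n → ℂ := fun j => h' (√(p : ℝ) * (X j ⬝ᵥ x)) with hw
  have h1 := hM.norm_dotProduct_mulVec_le hc u w
  rw [dotProduct_mulVec_eq_sum] at h1
  rw [bilForm, norm_mul, norm_inv, Complex.norm_natCast]
  have h2 : √(nsq u) * √(nsq w) ≤ (δ * nsq u + nsq w / δ) / 2 := by
    have e : (δ * √(nsq u) - √(nsq w)) ^ 2 / δ = δ * √(nsq u) ^ 2 + √(nsq w) ^ 2 / δ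
        - 2 * (√(nsq u) * √(nsq w)) := by field_simp; ring
    rw [Real.sq_sqrt (nsq_nonneg _), Real.sq_sqrt (nsq_nonneg _)] at e
    have : 0 ≤ (δ * √(nsq u) - √(nsq w)) ^ 2 / δ := by positivity
    linarith
  calc _ ≤ (p : ℝ)⁻¹ * (c * ((δ * nsq u + nsq w / δ) / 2)) := by
        gcongr
        exact h1.trans (by gcongr)
    _ = _ := by
        rw [← Finset.sum_div, Finset.sum_add_distrib, ← Finset.mul_sum, ← Finset.sum_div]
        simp only [nsq, hu, hw]
        ring

/-- The square norm of `h` in `L²(xiLaw p)`. -/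
def xiNormSq (p : ℕ) (h : ℝ → ℂ) : ℝ := ∫ x, ‖h x‖ ^ 2 ∂(xiLaw p)

theorem xiNormSq_nonneg (p : ℕ) (h : ℝ → ℂ) : 0 ≤ xiNormSq p h :=
  integral_nonneg fun _ => by positivity

theorem integrable_norm_sq_of_memLp {α : Type*} [MeasurableSpace α] {μ : Measure α} {f : α → ℂ}
    (hf : MemLp f 2 μ) : Integrable (fun x => ‖f x‖ ^ 2) μ :=
  (memLp_two_iff_integrable_sq_norm hf.1).1 hf

theorem norm_integral_mul_le {α : Type*} [MeasurableSpace α] {μ : Measure α} {f g : α → ℂ}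
    (hf : MemLp f 2 μ) (hg : MemLp g 2 μ) :
    ‖∫ x, f x * g x ∂μ‖ ≤ √(∫ x, ‖f x‖ ^ 2 ∂μ) * √(∫ x, ‖g x‖ ^ 2 ∂μ) := by
  have h := integral_mul_norm_le_Lp_mul_Lq (μ := μ) (f := f) (g := g) (p := 2) (q := 2)
    Real.HolderConjugate.two_two (by simpa using hf) (by simpa using hg)
  simp only [Real.rpow_two, ← Real.sqrt_eq_rpow] at h
  refine (norm_integral_le_integral_norm _).trans (le_trans (le_of_eq ?_) h)
  simp_rw [norm_mul]

theorem sqrt_mul_sqrt_le {A B δ : ℝ} (hA : 0 ≤ A) (hB : 0 ≤ B) (hδ : 0 < δ) :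
    √A * √B ≤ (δ * A + B / δ) / 2 := by
  have e : (δ * √A - √B) ^ 2 / δ = δ * √A ^ 2 + √B ^ 2 / δ - 2 * (√A * √B) := by
    field_simp; ring
  rw [Real.sq_sqrt hA, Real.sq_sqrt hB] at e
  have : 0 ≤ (δ * √A - √B) ^ 2 / δ := by positivity
  linarith

theorem norm_integral_le_sqrt_xiNormSq {p : ℕ} {h : ℝ → ℂ} (hh : MemLp h 2 (xiLaw p)) :
    ‖∫ x, h x ∂(xiLaw p)‖ ≤ √(xiNormSq p h) := by
  have := norm_integral_mul_le (memLp_const (1 : ℂ)) hh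
  simpa [xiNormSq] using this

theorem memLp_ofReal_xiLaw {p : ℕ} (hp : 1 ≤ p) : MemLp (fun x : ℝ => (x : ℂ)) 2 (xiLaw p) := by
  rw [memLp_two_iff_integrable_sq_norm (Continuous.aestronglyMeasurable (by fun_prop))]
  simpa using integrable_pow_xiLaw hp 2

theorem xiNormSq_ofReal {p : ℕ} (hp : 1 ≤ p) : xiNormSq p (fun x => (x : ℂ)) = 1 := by
  simpa [xiNormSq] using integral_sq_xiLaw hp

theorem norm_integral_ofReal_mul_le_sqrt_xiNormSq {p : ℕ} (hp : 1 ≤ p) {h : ℝ → ℂ}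
    (hh : MemLp h 2 (xiLaw p)) : ‖∫ x, (x : ℂ) * h x ∂(xiLaw p)‖ ≤ √(xiNormSq p h) := by
  have := norm_integral_mul_le (memLp_ofReal_xiLaw hp) hh
  have h1 := xiNormSq_ofReal hp
  rw [xiNormSq] at h1
  rwa [h1, Real.sqrt_one, one_mul] at this

theorem integrable_xiLaw_comp {j : Fin n} {h : ℝ → ℂ} (hh : MemLp h 2 (xiLaw p)) :
    Integrable (fun w : (Fin n → Fin p → ℝ) × (Fin p → ℝ) =>
      ‖h (√(p : ℝ) * (w.1 j ⬝ᵥ w.2))‖ ^ 2) (jointLaw n p) :=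
  (measurePreserving_sqrt_mul_dotProduct_prod p j).integrable_comp_of_integrable
    (integrable_norm_sq_of_memLp hh)

theorem integral_xiLaw_comp (j : Fin n) {h : ℝ → ℂ} (hh : Measurable h) :
    ∫ w : (Fin n → Fin p → ℝ) × (Fin p → ℝ), ‖h (√(p : ℝ) * (w.1 j ⬝ᵥ w.2))‖ ^ 2
      ∂(jointLaw n p) = xiNormSq p h :=
  (measurePreserving_sqrt_mul_dotProduct_prod p j).integral_comp_of_measurable
    (g := fun x => ‖h x‖ ^ 2) (by fun_prop)

theorem SymmFamily.eLpNorm_bilForm_le (hM : SymmFamily c M) (hp : 1 ≤ p) (hc : 0 ≤ c) {Θ : ℝ}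
    (hn : (n : ℝ) ≤ Θ * p) {h h' : ℝ → ℂ} (hhm : Measurable h) (hhm' : Measurable h')
    (hh : MemLp h 2 (xiLaw p)) (hh' : MemLp h' 2 (xiLaw p)) {δ : ℝ} (hδ : 0 < δ) :
    eLpNorm (fun w => bilForm (M w.1) h h' w.1 w.2) 1 (jointLaw n p)
      ≤ ENNReal.ofReal (c * Θ * ((δ * xiNormSq p h + xiNormSq p h' / δ) / 2)) := by
  have hp0 : (0 : ℝ) < p := by exact_mod_cast hp
  have hi : ∀ j : Fin n, Integrable (fun w : (Fin n → Fin p → ℝ) × (Fin p → ℝ) =>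
      δ * ‖h (√(p : ℝ) * (w.1 j ⬝ᵥ w.2))‖ ^ 2
      + ‖h' (√(p : ℝ) * (w.1 j ⬝ᵥ w.2))‖ ^ 2 / δ) (jointLaw n p) := fun j =>
    ((integrable_xiLaw_comp hh).const_mul δ).add ((integrable_xiLaw_comp hh').div_const δ)
  refine (eLpNorm_one_le_ofReal_integral
    (((integrable_finsetSum _ fun j _ => hi j).div_const 2).const_mul _) fun w =>
      (norm_bilForm_le hc (hM.opBound w.1) h h' w.1 w.2 hδ).trans_eq
        (by rw [Finset.sum_div])).trans ?_
  apply ENNReal.ofReal_le_ofReal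
  rw [integral_const_mul, integral_div, integral_finsetSum _ fun j _ => hi j]
  have e : ∀ j : Fin n, ∫ w : (Fin n → Fin p → ℝ) × (Fin p → ℝ),
      (δ * ‖h (√(p : ℝ) * (w.1 j ⬝ᵥ w.2))‖ ^ 2
      + ‖h' (√(p : ℝ) * (w.1 j ⬝ᵥ w.2))‖ ^ 2 / δ) ∂(jointLaw n p)
      = δ * xiNormSq p h + xiNormSq p h' / δ := by
    intro j
    rw [integral_add ((integrable_xiLaw_comp hh).const_mul δ)
      ((integrable_xiLaw_comp hh').div_const δ), integral_const_mul, integral_div,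
      integral_xiLaw_comp j hhm, integral_xiLaw_comp j hhm']
  simp_rw [e]
  rw [Finset.sum_const, Finset.card_univ, Fintype.card_fin, nsmul_eq_mul]
  have h0 := xiNormSq_nonneg p h
  have h0' := xiNormSq_nonneg p h'
  calc _ = c * (n / p) * ((δ * xiNormSq p h + xiNormSq p h' / δ) / 2) := by ring
    _ ≤ _ := by
      gcongr
      rw [div_le_iff₀ hp0]; exact hn

/-- The deviation is bounded by the product of the `L²` norms, in arithmetic-geometric mean form. -/
theorem SymmFamily.eLpNorm_formDiff_le (hM : SymmFamily c M) (hp : 1 ≤ p) (hc : 0 ≤ c) {Θ : ℝ}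
    (hn : (n : ℝ) ≤ Θ * p) {h h' : ℝ → ℂ} (hhm : Measurable h) (hhm' : Measurable h')
    (hh : MemLp h 2 (xiLaw p)) (hh' : MemLp h' 2 (xiLaw p)) {δ : ℝ} (hδ : 0 < δ) :
    eLpNorm (formDiff M h h') 1 (jointLaw n p)
      ≤ ENNReal.ofReal (3 * c * Θ * (δ * xiNormSq p h + xiNormSq p h' / δ)) := by
  have hp0 : (0 : ℝ) < p := by exact_mod_cast hp
  have hΘ : 0 ≤ Θ := by
    by_contra! hneg
    have := Nat.cast_nonneg (α := ℝ) n
    nlinarith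
  have hA := xiNormSq_nonneg p h
  have hB := xiNormSq_nonneg p h'
  set e : ℂ := ∫ x, h x * h' x ∂(xiLaw p) with he
  set m : ℂ := (∫ x, h x ∂(xiLaw p)) * ∫ x, h' x ∂(xiLaw p) with hm
  set k : ℂ := (∫ x, (x : ℂ) * h x ∂(xiLaw p)) * ∫ x, (x : ℂ) * h' x ∂(xiLaw p) with hk
  have hS := sqrt_mul_sqrt_le hA hB hδ
  have he1 : ‖e‖ ≤ (δ * xiNormSq p h + xiNormSq p h' / δ) / 2 := (norm_integral_mul_le hh hh').trans hS
  have hm1 : ‖m‖ ≤ (δ * xiNormSq p h + xiNormSq p h' / δ) / 2 := by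
    refine le_trans ?_ hS
    rw [hm, norm_mul]
    exact mul_le_mul (norm_integral_le_sqrt_xiNormSq hh) (norm_integral_le_sqrt_xiNormSq hh')
      (norm_nonneg _) (Real.sqrt_nonneg _)
  have hk1 : ‖k‖ ≤ (δ * xiNormSq p h + xiNormSq p h' / δ) / 2 := by
    refine le_trans ?_ hS
    rw [hk, norm_mul]
    exact mul_le_mul (norm_integral_ofReal_mul_le_sqrt_xiNormSq hp hh)
      (norm_integral_ofReal_mul_le_sqrt_xiNormSq hp hh') (norm_nonneg _) (Real.sqrt_nonneg _)
  have h1 := hM.eLpNorm_bilForm_le hp hc hn hhm hhm' hh hh' hδ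
  have h2 := hM.eLpNorm_formLimit_le hp hc hn e m k
  rw [← eLpNorm_comp_measurePreserving (hM.measurable_formLimit e m k).aestronglyMeasurable
    (measurePreserving_fst_jointLaw n p)] at h2
  calc eLpNorm (formDiff M h h') 1 (jointLaw n p)
      ≤ eLpNorm (fun w => bilForm (M w.1) h h' w.1 w.2) 1 (jointLaw n p)
        + eLpNorm ((fun X => formLimit (M X) X e m k) ∘ Prod.fst) 1 (jointLaw n p) :=
        eLpNorm_sub_le (hM.measurable_bilForm hhm hhm').aestronglyMeasurable
          ((hM.measurable_formLimit e m k).comp measurable_fst).aestronglyMeasurable le_rfl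
    _ ≤ _ := add_le_add h1 h2
    _ = ENNReal.ofReal (c * Θ * ((δ * xiNormSq p h + xiNormSq p h' / δ) / 2)
          + c * Θ * (‖e‖ + 2 * ‖m‖ + 2 * ‖k‖)) := by
        rw [ENNReal.ofReal_add (by positivity) (by positivity)]
    _ ≤ _ := by
        apply ENNReal.ofReal_le_ofReal
        have : c * Θ * (‖e‖ + 2 * ‖m‖ + 2 * ‖k‖)
            ≤ c * Θ * (5 * ((δ * xiNormSq p h + xiNormSq p h' / δ) / 2)) := by
          gcongr
          linarith
        linarith

theorem formDiff_add_left {h g h' : ℝ → ℂ} (hp : 1 ≤ p) (hh : MemLp h 2 (xiLaw p))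
    (hg : MemLp g 2 (xiLaw p)) (hh' : MemLp h' 2 (xiLaw p))
    (w : (Fin n → Fin p → ℝ) × (Fin p → ℝ)) :
    formDiff M (fun x => h x + g x) h' w = formDiff M h h' w + formDiff M g h' w := by
  have hx := memLp_ofReal_xiLaw hp
  have e1 : ∫ x, (h x + g x) * h' x ∂(xiLaw p)
      = ∫ x, h x * h' x ∂(xiLaw p) + ∫ x, g x * h' x ∂(xiLaw p) := by
    have := integral_add (hh.integrable_mul hh') (hg.integrable_mul hh')
    simp_rw [add_mul]
    exact this
  have e2 : ∫ x, (h x + g x) ∂(xiLaw p) = ∫ x, h x ∂(xiLaw p) + ∫ x, g x ∂(xiLaw p) :=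
    integral_add (hh.integrable one_le_two) (hg.integrable one_le_two)
  have e3 : ∫ x, (x : ℂ) * (h x + g x) ∂(xiLaw p)
      = ∫ x, (x : ℂ) * h x ∂(xiLaw p) + ∫ x, (x : ℂ) * g x ∂(xiLaw p) := by
    have := integral_add (hx.integrable_mul hh) (hx.integrable_mul hg)
    simp_rw [mul_add]
    exact this
  rw [formDiff, formDiff, formDiff, formMean, formMean, formMean, e1, e2, e3, add_mul, add_mul,
    ← formLimit_add]
  simp only [bilForm, add_mul, mul_add, Finset.sum_add_distrib]
  ring

theorem bilForm_comm {M : Matrix (Fin n) (Fin n) ℂ} (hM : M.IsSymm) (h h' : ℝ → ℂ)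
    (X : Fin n → Fin p → ℝ) (x : Fin p → ℝ) : bilForm M h h' X x = bilForm M h' h X x := by
  unfold bilForm
  rw [Finset.sum_comm]
  congr 1
  refine Finset.sum_congr rfl fun j _ => Finset.sum_congr rfl fun k _ => ?_
  rw [hM.apply]
  ring

theorem SymmFamily.formDiff_comm (hM : SymmFamily c M) (h h' : ℝ → ℂ)
    (w : (Fin n → Fin p → ℝ) × (Fin p → ℝ)) : formDiff M h h' w = formDiff M h' h w := by
  rw [formDiff, formDiff, bilForm_comm (hM.isSymm _), formMean, formMean,
    mul_comm (∫ x, h x ∂(xiLaw p)), mul_comm (∫ x, (x : ℂ) * h x ∂(xiLaw p))]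
  simp_rw [mul_comm (h _) (h' _)]

theorem formDiff_smul_left (a : ℂ) (h h' : ℝ → ℂ) (w : (Fin n → Fin p → ℝ) × (Fin p → ℝ)) :
    formDiff M (fun x => a * h x) h' w = a * formDiff M h h' w := by
  rw [formDiff, formDiff, mul_sub, formMean, formMean, formLimit_mul]
  congr 1
  · simp only [bilForm, Finset.mul_sum]
    exact Finset.sum_congr rfl fun j _ => Finset.sum_congr rfl fun k _ => by ring
  · simp_rw [mul_assoc, mul_left_comm _ a, integral_const_mul, mul_assoc]

theorem formDiff_zero_left (h' : ℝ → ℂ) (w : (Fin n → Fin p → ℝ) × (Fin p → ℝ)) :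
    formDiff M (fun _ => 0) h' w = 0 := by
  simp [formDiff, bilForm, formMean, formLimit]

theorem formDiff_sum_left {κ : Type*} (S : Finset κ) {g : κ → ℝ → ℂ} {h' : ℝ → ℂ}
    (hp : 1 ≤ p) (hg : ∀ i, MemLp (g i) 2 (xiLaw p)) (hh' : MemLp h' 2 (xiLaw p))
    (w : (Fin n → Fin p → ℝ) × (Fin p → ℝ)) :
    formDiff M (fun x => ∑ i ∈ S, g i x) h' w = ∑ i ∈ S, formDiff M (g i) h' w := by
  classical
  induction S using Finset.induction_on with
  | empty => simpa using formDiff_zero_left h' w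
  | insert i S hi ih =>
    simp_rw [Finset.sum_insert hi]
    rw [formDiff_add_left hp (hg i) (memLp_finsetSum _ fun i _ => hg i) hh', ih]

theorem memLp_expI (s : ℝ) (p : ℕ) : MemLp (expI s) 2 (xiLaw p) :=
  .of_bound (measurable_expI s).aestronglyMeasurable 1 (ae_of_all _ fun x => (norm_expI s x).le)

/-- The law of `ξ_p` is a mixture of centred Gaussian laws of variance `|Y|²`, and `|Y|²`
concentrates at `1`. -/
theorem tendsto_integral_expI (s : ℝ) :
    Tendsto (fun p : ℕ => ∫ x, expI s x ∂(xiLaw p)) atTop (𝓝 (gaussChar s : ℂ)) := by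
  have hlim : Tendsto (fun p : ℕ => s ^ 2 / 2 * √(gaussMoment 2 / p)) atTop (𝓝 0) := by
    have := (Real.continuous_sqrt.tendsto 0).comp
      (tendsto_const_div_atTop_nhds_zero_nat (gaussMoment 2))
    simpa using this.const_mul (s ^ 2 / 2)
  rw [tendsto_iff_norm_sub_tendsto_zero]
  refine squeeze_zero' (Eventually.of_forall fun _ => norm_nonneg _) ?_ hlim
  filter_upwards [eventually_ge_atTop 1] with p hp
  unfold expI
  rw [integral_exp_xiLaw hp, ← Complex.ofReal_sub, Complex.norm_real, Real.norm_eq_abs]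
  have hi : Integrable (fun y : Fin p → ℝ => Real.exp (-(s ^ 2 * (y ⬝ᵥ y)) / 2)) (gaussianVec p) := by
    refine .of_bound (Measurable.aestronglyMeasurable (by fun_prop)) 1 (ae_of_all _ fun y => ?_)
    rw [Real.norm_of_nonneg (Real.exp_pos _).le, Real.exp_le_one_iff]
    have := mul_nonneg (sq_nonneg s) (dotProduct_self_nonneg y)
    linarith
  have e : (∫ y, Real.exp (-(s ^ 2 * (y ⬝ᵥ y)) / 2) ∂(gaussianVec p)) - gaussChar s
      = ∫ y, (Real.exp (-(s ^ 2 * (y ⬝ᵥ y)) / 2) - gaussChar s) ∂(gaussianVec p) := by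
    rw [integral_sub hi (integrable_const _)]; simp
  have hi2 : Integrable (fun y : Fin p → ℝ => |y ⬝ᵥ y - 1|) (gaussianVec p) :=
    ((integrable_dotProduct_self p).sub (integrable_const 1)).abs
  rw [e, ← Real.norm_eq_abs]
  calc _ ≤ ∫ y : Fin p → ℝ, s ^ 2 / 2 * |y ⬝ᵥ y - 1| ∂(gaussianVec p) :=
        norm_integral_le_of_norm_le (hi2.const_mul _)
          (ae_of_all _ fun y => abs_exp_sub_gaussChar_le s (dotProduct_self_nonneg y))
    _ ≤ _ := by
        rw [integral_const_mul]
        exact mul_le_mul_of_nonneg_left (integral_abs_dotProduct_self_sub_one_le hp) (by positivity)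

theorem tendsto_integral_ofReal_mul_expI (s : ℝ) :
    Tendsto (fun p : ℕ => ∫ x, (x : ℂ) * expI s x ∂(xiLaw p)) atTop
      (𝓝 (Complex.I * s * (gaussChar s : ℂ))) := by
  have hlim : Tendsto (fun p : ℕ => (1 + s ^ 2 / 2) * √(gaussMoment 2 / p)) atTop (𝓝 0) := by
    have := (Real.continuous_sqrt.tendsto 0).comp
      (tendsto_const_div_atTop_nhds_zero_nat (gaussMoment 2))
    simpa using this.const_mul (1 + s ^ 2 / 2)
  have key : Tendsto (fun p : ℕ => ∫ y : Fin p → ℝ, (y ⬝ᵥ y) * Real.exp (-(s ^ 2 * (y ⬝ᵥ y)) / 2)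
      ∂(gaussianVec p)) atTop (𝓝 (gaussChar s)) := by
    rw [tendsto_iff_norm_sub_tendsto_zero]
    refine squeeze_zero' (Eventually.of_forall fun _ => norm_nonneg _) ?_ hlim
    filter_upwards [eventually_ge_atTop 1] with p hp
    have hb : ∀ y : Fin p → ℝ, |Real.exp (-(s ^ 2 * (y ⬝ᵥ y)) / 2)| ≤ 1 := by
      intro y
      rw [abs_of_nonneg (Real.exp_pos _).le, Real.exp_le_one_iff]
      have := mul_nonneg (sq_nonneg s) (dotProduct_self_nonneg y)
      linarith
    have hi : Integrable (fun y : Fin p → ℝ => (y ⬝ᵥ y) * Real.exp (-(s ^ 2 * (y ⬝ᵥ y)) / 2))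
        (gaussianVec p) := by
      refine (integrable_dotProduct_self p).mono (Measurable.aestronglyMeasurable (by fun_prop))
        (ae_of_all _ fun y => ?_)
      rw [norm_mul]
      exact mul_le_of_le_one_right (norm_nonneg _) (hb y)
    have e : (∫ y : Fin p → ℝ, (y ⬝ᵥ y) * Real.exp (-(s ^ 2 * (y ⬝ᵥ y)) / 2) ∂(gaussianVec p))
        - gaussChar s
        = ∫ y, ((y ⬝ᵥ y) * Real.exp (-(s ^ 2 * (y ⬝ᵥ y)) / 2) - gaussChar s) ∂(gaussianVec p) := by
      rw [integral_sub hi (integrable_const _)]; simp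
    have hi2 : Integrable (fun y : Fin p → ℝ => |y ⬝ᵥ y - 1|) (gaussianVec p) :=
      ((integrable_dotProduct_self p).sub (integrable_const 1)).abs
    rw [e]
    calc _ ≤ ∫ y : Fin p → ℝ, (1 + s ^ 2 / 2) * |y ⬝ᵥ y - 1| ∂(gaussianVec p) := by
          refine norm_integral_le_of_norm_le (hi2.const_mul _) (ae_of_all _ fun y => ?_)
          have h1 := abs_exp_sub_gaussChar_le s (dotProduct_self_nonneg y)
          have e2 : (y ⬝ᵥ y) * Real.exp (-(s ^ 2 * (y ⬝ᵥ y)) / 2) - gaussChar s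
              = (y ⬝ᵥ y - 1) * Real.exp (-(s ^ 2 * (y ⬝ᵥ y)) / 2)
                + (Real.exp (-(s ^ 2 * (y ⬝ᵥ y)) / 2) - gaussChar s) := by ring
          rw [Real.norm_eq_abs, e2]
          refine (abs_add_le _ _).trans ?_
          rw [abs_mul]
          have := mul_le_of_le_one_right (abs_nonneg (y ⬝ᵥ y - 1)) (hb y)
          linarith
      _ ≤ _ := by
          rw [integral_const_mul]
          exact mul_le_mul_of_nonneg_left (integral_abs_dotProduct_self_sub_one_le hp) (by positivity)
  have h2 := ((Complex.continuous_ofReal.tendsto _).comp key).const_mul (Complex.I * s)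
  refine h2.congr' ?_
  filter_upwards [eventually_ge_atTop 1] with p hp
  unfold expI
  rw [integral_mul_exp_xiLaw hp]
  rfl

/-- Concentration of quadratic forms in two exponentials. -/
theorem eventually_eLpNorm_formDiff_expI_le (s t : ℝ) {c Θ : ℝ} (hc : 0 ≤ c) (hΘ : 0 ≤ Θ) {ε : ℝ}
    (hε : 0 < ε) : ∀ᶠ p : ℕ in atTop, ∀ n : ℕ, (n : ℝ) ≤ Θ * p →
      ∀ M : (Fin n → Fin p → ℝ) → Matrix (Fin n) (Fin n) ℂ, SymmFamily c M →
      eLpNorm (formDiff M (expI s) (expI t)) 1 (jointLaw n p) ≤ ENNReal.ofReal ε := by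
  obtain ⟨C, hC0, hC⟩ := exists_lintegral_bilForm_expI_sub_le s t hc hΘ
  set e : ℂ := (gaussChar (s + t) : ℂ)
  set m : ℂ := gaussChar s * gaussChar t
  set k : ℂ := -(s * t * (gaussChar s * gaussChar t)) with hk
  set eP : ℕ → ℂ := fun p => ∫ x, expI s x * expI t x ∂(xiLaw p) with heP
  set mP : ℕ → ℂ := fun p => (∫ x, expI s x ∂(xiLaw p)) * ∫ x, expI t x ∂(xiLaw p)
  set kP : ℕ → ℂ := fun p => (∫ x, (x : ℂ) * expI s x ∂(xiLaw p)) * ∫ x, (x : ℂ) * expI t x ∂(xiLaw p)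
  have he : Tendsto eP atTop (𝓝 e) := by
    simp only [heP, expI_mul_expI]
    exact tendsto_integral_expI (s + t)
  have hm : Tendsto mP atTop (𝓝 m) := (tendsto_integral_expI s).mul (tendsto_integral_expI t)
  have hk' : Tendsto kP atTop (𝓝 k) := by
    have := (tendsto_integral_ofReal_mul_expI s).mul (tendsto_integral_ofReal_mul_expI t)
    have e3 : Complex.I * s * (gaussChar s : ℂ) * (Complex.I * t * (gaussChar t : ℂ)) = k := by
      rw [hk]
      linear_combination (s * t * (gaussChar s * gaussChar t) : ℂ) * Complex.I_mul_I
    rwa [e3] at this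
  have h1 : Tendsto (fun p : ℕ => C / √(√(p : ℝ))) atTop (𝓝 0) :=
    Tendsto.div_atTop tendsto_const_nhds (Real.tendsto_sqrt_atTop.comp
      (Real.tendsto_sqrt_atTop.comp tendsto_natCast_atTop_atTop))
  have h2 : Tendsto (fun p => c * Θ * (‖e - eP p‖ + 2 * ‖m - mP p‖ + 2 * ‖k - kP p‖)) atTop (𝓝 0) := by
    have a1 := (he.const_sub e).norm
    have a2 := (hm.const_sub m).norm.const_mul 2
    have a3 := (hk'.const_sub k).norm.const_mul 2
    have := ((a1.add a2).add a3).const_mul (c * Θ)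
    simpa using this
  have h3 := h1.add h2
  rw [add_zero] at h3
  filter_upwards [eventually_ge_atTop 1, h3.eventually_lt_const hε] with p hp hlt n hn M hM
  have hb1 : eLpNorm (fun w : (Fin n → Fin p → ℝ) × (Fin p → ℝ) =>
      bilForm (M w.1) (expI s) (expI t) w.1 w.2 - formLimit (M w.1) w.1 e m k) 1 (jointLaw n p)
      ≤ ENNReal.ofReal (C / √(√(p : ℝ))) := by
    rw [eLpNorm_one_eq_lintegral_enorm, jointLaw, lintegral_prod]
    · exact hC n p hp hn M hM.isSymm hM.opBound
    · exact ((hM.measurable_bilForm (measurable_expI s) (measurable_expI t)).sub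
        ((hM.measurable_formLimit e m k).comp measurable_fst)).enorm.aemeasurable
  have hb2 := hM.eLpNorm_formLimit_le hp hc hn (e - eP p) (m - mP p) (k - kP p)
  have hmL := hM.measurable_formLimit (e - eP p) (m - mP p) (k - kP p)
  rw [← eLpNorm_comp_measurePreserving hmL.aestronglyMeasurable
    (measurePreserving_fst_jointLaw n p)] at hb2
  have hdec : formDiff M (expI s) (expI t)
      = (fun w : (Fin n → Fin p → ℝ) × (Fin p → ℝ) =>
        bilForm (M w.1) (expI s) (expI t) w.1 w.2 - formLimit (M w.1) w.1 e m k)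
        + (fun X => formLimit (M X) X (e - eP p) (m - mP p) (k - kP p)) ∘ Prod.fst := by
    funext w
    simp only [formDiff, Pi.add_apply, Function.comp, ← formLimit_sub]
    simp only [formMean, eP, mP, kP]
    ring
  rw [hdec]
  refine (eLpNorm_add_le ((hM.measurable_bilForm (measurable_expI s) (measurable_expI t)).sub
    ((hM.measurable_formLimit e m k).comp measurable_fst)).aestronglyMeasurable
    (hmL.comp measurable_fst).aestronglyMeasurable le_rfl).trans ?_
  refine (add_le_add hb1 hb2).trans ?_
  rw [← ENNReal.ofReal_add (by positivity) (by positivity)]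
  exact ENNReal.ofReal_le_ofReal hlt.le

/-- Concentration of quadratic forms in two trigonometric sums. -/
theorem eventually_eLpNorm_formDiff_trig_le {κ κ' : Type*} [Fintype κ] [Fintype κ'] (s : κ → ℝ)
    (t : κ' → ℝ) {c Θ : ℝ} (hc : 0 ≤ c) (hΘ : 0 ≤ Θ) (B B' : ℝ) {ε : ℝ} (hε : 0 < ε) :
    ∀ᶠ p : ℕ in atTop, ∀ n : ℕ, (n : ℝ) ≤ Θ * p →
      ∀ M : (Fin n → Fin p → ℝ) → Matrix (Fin n) (Fin n) ℂ, SymmFamily c M →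
      ∀ (b : κ → ℂ) (b' : κ' → ℂ), (∀ i, ‖b i‖ ≤ B) → (∀ i, ‖b' i‖ ≤ B') →
      eLpNorm (formDiff M (fun x => ∑ i, b i * expI (s i) x) (fun x => ∑ i, b' i * expI (t i) x)) 1
        (jointLaw n p) ≤ ENNReal.ofReal ε := by
  set δ := ε / (Fintype.card κ * (Fintype.card κ' * (|B| * |B'|)) + 1) with hδ
  have hδ0 : 0 < δ := by positivity
  have hall : ∀ᶠ p : ℕ in atTop, ∀ i j, ∀ n : ℕ, (n : ℝ) ≤ Θ * p →
      ∀ M : (Fin n → Fin p → ℝ) → Matrix (Fin n) (Fin n) ℂ, SymmFamily c M →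
      eLpNorm (formDiff M (expI (s i)) (expI (t j))) 1 (jointLaw n p) ≤ ENNReal.ofReal δ := by
    rw [eventually_all]
    intro i
    rw [eventually_all]
    intro j
    exact eventually_eLpNorm_formDiff_expI_le (s i) (t j) hc hΘ hδ0
  filter_upwards [eventually_ge_atTop 1, hall] with p hp hpall n hn M hM b b' hb hb'
  have hm : ∀ (a : ℂ) (r : ℝ), MemLp (fun x => a * expI r x) 2 (xiLaw p) := fun a r =>
    (memLp_expI r p).const_mul a
  have hsum : formDiff M (fun x => ∑ i, b i * expI (s i) x) (fun x => ∑ i, b' i * expI (t i) x)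
      = ∑ i, ∑ j, (b i * b' j) • formDiff M (expI (s i)) (expI (t j)) := by
    funext w
    rw [formDiff_sum_left _ hp (fun i => hm _ _) (memLp_finsetSum _ fun i _ => hm _ _)]
    simp only [Finset.sum_apply, Pi.smul_apply, smul_eq_mul]
    refine Finset.sum_congr rfl fun i _ => ?_
    rw [hM.formDiff_comm, formDiff_sum_left _ hp (fun i => hm _ _) (hm _ _)]
    refine Finset.sum_congr rfl fun j _ => ?_
    rw [formDiff_smul_left, hM.formDiff_comm, formDiff_smul_left]
    ring
  have hmeas : ∀ i j, AEStronglyMeasurable ((b i * b' j) • formDiff M (expI (s i)) (expI (t j)))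
      (jointLaw n p) := fun i j =>
    ((hM.measurable_formDiff (measurable_expI _) (measurable_expI _)).const_smul _).aestronglyMeasurable
  rw [hsum]
  calc _ ≤ ∑ i, ∑ j, eLpNorm ((b i * b' j) • formDiff M (expI (s i)) (expI (t j))) 1
        (jointLaw n p) := by
        refine (eLpNorm_sum_le (fun i _ => Finset.aestronglyMeasurable_sum _ fun j _ => hmeas i j)
          le_rfl).trans (Finset.sum_le_sum fun i _ => ?_)
        exact eLpNorm_sum_le (fun j _ => hmeas i j) le_rfl
    _ ≤ ∑ _i : κ, ∑ _j : κ', ENNReal.ofReal (|B| * |B'| * δ) := by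
        refine Finset.sum_le_sum fun i _ => Finset.sum_le_sum fun j _ => ?_
        rw [eLpNorm_const_smul, ENNReal.ofReal_mul (by positivity)]
        refine mul_le_mul' ?_ (hpall i j n hn M hM)
        rw [← ofReal_norm, norm_mul]
        apply ENNReal.ofReal_le_ofReal
        exact mul_le_mul ((hb i).trans (le_abs_self B)) ((hb' j).trans (le_abs_self B'))
          (norm_nonneg _) (abs_nonneg B)
    _ = ENNReal.ofReal (Fintype.card κ * (Fintype.card κ' * (|B| * |B'| * δ))) := by
        rw [Finset.sum_const, Finset.sum_const, Finset.card_univ, Finset.card_univ, nsmul_eq_mul,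
          nsmul_eq_mul, ENNReal.ofReal_mul (p := (Fintype.card κ : ℝ)) (by positivity),
          ENNReal.ofReal_mul (p := (Fintype.card κ' : ℝ)) (by positivity),
          ENNReal.ofReal_natCast, ENNReal.ofReal_natCast]
    _ ≤ ENNReal.ofReal ε := by
        apply ENNReal.ofReal_le_ofReal
        rw [hδ]
        have : (Fintype.card κ * (Fintype.card κ' * (|B| * |B'| * (ε / (Fintype.card κ * (Fintype.card κ' * (|B| * |B'|)) + 1))))
            : ℝ) = ε * ((Fintype.card κ * (Fintype.card κ' * (|B| * |B'|)))
              / (Fintype.card κ * (Fintype.card κ' * (|B| * |B'|)) + 1)) := by ring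
        rw [this]
        refine mul_le_of_le_one_right hε.le ?_
        rw [div_le_one (by positivity)]
        linarith

/-- Concentration of quadratic forms: for functions `h`, `h'` that are approximable by
trigonometric sums and bounded in `L²`, the form `bilForm M h h' X x` is close in mean to
`formMean M X h h'`, uniformly over all symmetric families `M` of bounded norm. -/
theorem eventually_eLpNorm_formDiff_le {h h' : ℕ → ℝ → ℂ} (hh : ExpApprox h) (hh' : ExpApprox h')
    (hm : ∀ p, 1 ≤ p → Measurable (h p)) (hm' : ∀ p, 1 ≤ p → Measurable (h' p))
    (h2 : ∀ p, 1 ≤ p → MemLp (h p) 2 (xiLaw p)) (h2' : ∀ p, 1 ≤ p → MemLp (h' p) 2 (xiLaw p))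
    {K : ℝ} (hK : ∀ᶠ p : ℕ in atTop, xiNormSq p (h p) ≤ K)
    (hK' : ∀ᶠ p : ℕ in atTop, xiNormSq p (h' p) ≤ K)
    {c Θ : ℝ} (hc : 0 ≤ c) (hΘ : 0 ≤ Θ) {ε : ℝ} (hε : 0 < ε) :
    ∀ᶠ p : ℕ in atTop, ∀ n : ℕ, (n : ℝ) ≤ Θ * p →
      ∀ M : (Fin n → Fin p → ℝ) → Matrix (Fin n) (Fin n) ℂ, SymmFamily c M →
      eLpNorm (formDiff M (h p) (h' p)) 1 (jointLaw n p) ≤ ENNReal.ofReal ε := by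
  -- `η` is the accuracy of the approximation
  set D := 3 * c * Θ * (3 * |K| + 4) + 1 with hD
  have hD0 : 0 < D := by positivity
  set η := min 1 (ε / (2 * D)) with hη
  have hη0 : 0 < η := by positivity
  have hη1 : η ≤ 1 := min_le_left _ _
  have hηD : D * η ≤ ε / 2 := by
    calc D * η ≤ D * (ε / (2 * D)) := by gcongr; exact min_le_right _ _
      _ = ε / 2 := by field_simp
  obtain ⟨κ, _, s, C, hκ⟩ := hh (η ^ 2) (by positivity)
  obtain ⟨κ', _, t, C', hκ'⟩ := hh' (η ^ 2) (by positivity)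
  filter_upwards [eventually_ge_atTop 1, hκ, hκ', hK, hK',
    eventually_eLpNorm_formDiff_trig_le s t hc hΘ C C' (by positivity : 0 < ε / 2)]
    with p hp ⟨b, hb, hbe⟩ ⟨b', hb', hbe'⟩ hKp hKp' htrig n hn M hM
  set g : ℝ → ℂ := fun x => ∑ i, b i * expI (s i) x with hg
  set g' : ℝ → ℂ := fun x => ∑ i, b' i * expI (t i) x with hg'
  have hgm : Measurable g := by fun_prop
  have hgm' : Measurable g' := by fun_prop
  have hg2 : MemLp g 2 (xiLaw p) := memLp_finsetSum _ fun i _ => (memLp_expI _ p).const_mul _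
  have hg2' : MemLp g' 2 (xiLaw p) := memLp_finsetSum _ fun i _ => (memLp_expI _ p).const_mul _
  set u : ℝ → ℂ := fun x => h p x - g x with hu
  set u' : ℝ → ℂ := fun x => h' p x - g' x with hu'
  have hum : Measurable u := (hm p hp).sub hgm
  have hum' : Measurable u' := (hm' p hp).sub hgm'
  have hu2 : MemLp u 2 (xiLaw p) := (h2 p hp).sub hg2
  have hu2' : MemLp u' 2 (xiLaw p) := (h2' p hp).sub hg2'
  have hgK : xiNormSq p g ≤ 2 * |K| + 2 := by
    have hi := integrable_norm_sq_of_memLp (h2 p hp)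
    have hi2 := integrable_norm_sq_of_memLp hu2
    calc xiNormSq p g ≤ ∫ x, (2 * ‖h p x‖ ^ 2 + 2 * ‖u x‖ ^ 2) ∂(xiLaw p) := by
          refine integral_mono_of_nonneg (ae_of_all _ fun x => by positivity)
            ((hi.const_mul 2).add (hi2.const_mul 2)) (ae_of_all _ fun x => ?_)
          have := norm_add_sq_le (h p x) (-(u x))
          rw [norm_neg] at this
          simpa [hu] using this
      _ = 2 * xiNormSq p (h p) + 2 * xiNormSq p u := by
          rw [integral_add (hi.const_mul 2) (hi2.const_mul 2), integral_const_mul,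
            integral_const_mul]
          rfl
      _ ≤ _ := by
          have h3 : xiNormSq p u ≤ η ^ 2 := hbe
          have h4 : η ^ 2 ≤ 1 := pow_le_one₀ hη0.le hη1
          linarith [le_abs_self K]
  have e1 : formDiff M (h p) (h' p) = formDiff M u (h' p) + (formDiff M u' g + formDiff M g g') := by
    funext w
    have a1 : h p = fun x => u x + g x := by funext x; simp [hu]
    have a2 : h' p = fun x => u' x + g' x := by funext x; simp [hu']
    calc formDiff M (h p) (h' p) w = formDiff M (fun x => u x + g x) (h' p) w := by rw [← a1]
      _ = formDiff M u (h' p) w + formDiff M g (h' p) w :=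
          formDiff_add_left hp hu2 hg2 (h2' p hp) w
      _ = formDiff M u (h' p) w + formDiff M (fun x => u' x + g' x) g w := by
          rw [hM.formDiff_comm g (h' p), ← a2]
      _ = formDiff M u (h' p) w + (formDiff M u' g w + formDiff M g g' w) := by
          rw [formDiff_add_left hp hu2' hg2' hg2, hM.formDiff_comm g' g]
  have b1 := hM.eLpNorm_formDiff_le hp hc hn hum (hm' p hp) hu2 (h2' p hp) (δ := 1 / η) (by positivity)
  have b2 := hM.eLpNorm_formDiff_le hp hc hn hum' hgm hu2' hg2 (δ := 1 / η) (by positivity)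
  have b3 := htrig n hn M hM b b' hb hb'
  have hn1 : xiNormSq p u ≤ η ^ 2 := hbe
  have hn2 : xiNormSq p u' ≤ η ^ 2 := hbe'
  have hn3 : xiNormSq p (h' p) ≤ |K| := hKp'.trans (le_abs_self K)
  rw [e1]
  refine (eLpNorm_add_le (hM.measurable_formDiff hum (hm' p hp)).aestronglyMeasurable
    ((hM.measurable_formDiff hum' hgm).add (hM.measurable_formDiff hgm hgm')).aestronglyMeasurable
    le_rfl).trans ?_
  refine (add_le_add le_rfl (eLpNorm_add_le (hM.measurable_formDiff hum' hgm).aestronglyMeasurable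
    (hM.measurable_formDiff hgm hgm').aestronglyMeasurable le_rfl)).trans ?_
  refine (add_le_add b1 (add_le_add b2 b3)).trans ?_
  have p1 := xiNormSq_nonneg p u
  have p2 := xiNormSq_nonneg p (h' p)
  have p3 := xiNormSq_nonneg p u'
  have p4 := xiNormSq_nonneg p g
  rw [← ENNReal.ofReal_add (by positivity) (by positivity),
    ← ENNReal.ofReal_add (by positivity) (by positivity)]
  apply ENNReal.ofReal_le_ofReal
  have q1 : 1 / η * xiNormSq p u + xiNormSq p (h' p) / (1 / η) ≤ η * (1 + |K|) := by
    calc _ ≤ 1 / η * η ^ 2 + |K| / (1 / η) := by gcongr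
      _ = _ := by field_simp
  have q2 : 1 / η * xiNormSq p u' + xiNormSq p g / (1 / η) ≤ η * (1 + (2 * |K| + 2)) := by
    calc _ ≤ 1 / η * η ^ 2 + (2 * |K| + 2) / (1 / η) := by gcongr
      _ = _ := by field_simp
  have q3 : 3 * c * Θ * (1 / η * xiNormSq p u + xiNormSq p (h' p) / (1 / η))
      ≤ 3 * c * Θ * (η * (1 + |K|)) := by gcongr
  have q4 : 3 * c * Θ * (1 / η * xiNormSq p u' + xiNormSq p g / (1 / η))
      ≤ 3 * c * Θ * (η * (1 + (2 * |K| + 2))) := by gcongr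
  have q5 : 3 * c * Θ * (η * (1 + |K|)) + 3 * c * Θ * (η * (1 + (2 * |K| + 2))) = (D - 1) * η := by
    rw [hD]; ring
  linarith

end Forms

/-! ### The kernel matrix under replacement of a sample vector -/

section Replacement

theorem measurable_inv_apply {α ι : Type*} [MeasurableSpace α] [Fintype ι] [DecidableEq ι]
    {A : α → Matrix ι ι ℂ} (hA : ∀ j k, Measurable fun x => A x j k) (j k : ι) :
    Measurable fun x => (A x)⁻¹ j k := by
  have hdet : ∀ B : α → Matrix ι ι ℂ, (∀ j k, Measurable fun x => B x j k) →
      Measurable fun x => (B x).det := by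
    intro B hB
    simp only [Matrix.det_apply]
    refine Finset.measurable_fun_sum _ fun σ _ => ?_
    exact (Finset.measurable_fun_prod _ fun i _ => hB _ _).const_smul (Equiv.Perm.sign σ : ℤ)
  simp only [Matrix.inv_def, Ring.inverse_eq_inv', Matrix.smul_apply, smul_eq_mul,
    Matrix.adjugate_apply]
  refine (hdet A hA).inv.mul (hdet _ fun i l => ?_)
  by_cases h : i = k
  · subst h; simp
  · simpa [Matrix.updateRow_ne h] using hA i l

theorem measurable_resolv {α ι : Type*} [MeasurableSpace α] [Fintype ι] [DecidableEq ι]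
    {A : α → Matrix ι ι ℝ} (hA : ∀ j k, Measurable fun x => A x j k) (z : ℂ) (j k : ι) :
    Measurable fun x => resolv (A x) z j k := by
  refine measurable_inv_apply (fun j k => ?_) j k
  simp only [shifted, Matrix.sub_apply, Matrix.map_apply]
  exact (Complex.measurable_ofReal.comp (hA j k)).sub measurable_const

theorem measurable_minorResolv {α ι : Type*} [MeasurableSpace α] [Fintype ι] [DecidableEq ι]
    {A : α → Matrix ι ι ℝ} (hA : ∀ j k, Measurable fun x => A x j k) (z : ℂ) (i j k : ι) :
    Measurable fun x => minorResolv (A x) z i j k := by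
  simp only [minorResolv, Matrix.mul_apply]
  refine Finset.measurable_fun_sum _ fun l _ => Measurable.mul_const ?_ _
  refine measurable_resolv (fun j k => ?_) z j l
  by_cases h : j = i ∨ k = i
  · simp [cut, h]
  · simpa [cut, h] using hA j k

variable {n p : ℕ}

theorem kernelMatrix_isSymm (f : ℕ → ℝ → ℝ) (X : Fin n → Fin p → ℝ) :
    (kernelMatrix f X).IsSymm := by
  have := (kernelMatrix_isHermitian f X).eq
  rwa [Matrix.conjTranspose_eq_transpose_of_trivial] at this

theorem kernelMatrix_apply_self (f : ℕ → ℝ → ℝ) (X : Fin n → Fin p → ℝ) (i : Fin n) :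
    kernelMatrix f X i i = 0 := by simp [kernelMatrix]

theorem measurable_kernelMatrix {f : ℕ → ℝ → ℝ} (hf : ∀ p, Measurable (f p)) (j k : Fin n) :
    Measurable fun X : Fin n → Fin p → ℝ => kernelMatrix f X j k := by
  by_cases h : j = k
  · simp [kernelMatrix, h]
  · simp only [kernelMatrix, Matrix.of_apply, h, if_false]
    exact (hf p).comp (by fun_prop)

theorem cut_kernelMatrix_update (f : ℕ → ℝ → ℝ) (X : Fin n → Fin p → ℝ) (i : Fin n)
    (x : Fin p → ℝ) :
    cut (kernelMatrix f (Function.update X i x)) i = cut (kernelMatrix f X) i := by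
  ext j k
  by_cases h : j = i ∨ k = i
  · simp [cut, h]
  · have h' := not_or.1 h
    simp [cut, h, kernelMatrix, Function.update_of_ne h'.1, Function.update_of_ne h'.2]

theorem minorResolv_kernelMatrix_update (f : ℕ → ℝ → ℝ) (X : Fin n → Fin p → ℝ) (z : ℂ)
    (i : Fin n) (x : Fin p → ℝ) :
    minorResolv (kernelMatrix f (Function.update X i x)) z i
      = minorResolv (kernelMatrix f X) z i := by
  rw [minorResolv, minorResolv, cut_kernelMatrix_update]

theorem symmFamily_minorResolv {f : ℕ → ℝ → ℝ} (hf : ∀ p, Measurable (f p)) {z : ℂ}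
    (hz : 0 < z.im) (i : Fin n) :
    SymmFamily (1 / z.im) fun X : Fin n → Fin p → ℝ => minorResolv (kernelMatrix f X) z i where
  isSymm X := minorResolv_isSymm (kernelMatrix_isSymm f X) hz i
  opBound X := opBound_minorResolv (kernelMatrix_isSymm f X) hz i
  measurable j k := measurable_minorResolv (measurable_kernelMatrix hf) z i j k

theorem symmFamily_resolv {f : ℕ → ℝ → ℝ} (hf : ∀ p, Measurable (f p)) {z : ℂ} (hz : 0 < z.im) :
    SymmFamily (1 / z.im) fun X : Fin n → Fin p → ℝ => resolv (kernelMatrix f X) z where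
  isSymm X := resolv_isSymm (kernelMatrix_isSymm f X) z
  opBound X := opBound_resolv (kernelMatrix_isSymm f X) hz
  measurable j k := measurable_resolv (measurable_kernelMatrix hf) z j k

/-- Replacing one sample vector by an independent copy preserves the law of the sample. -/
theorem measurePreserving_update (n p : ℕ) (i : Fin n) :
    MeasurePreserving (fun w : (Fin n → Fin p → ℝ) × (Fin p → ℝ) => Function.update w.1 i w.2)
      (jointLaw n p) (sampleLaw n p) := by
  have hm : Measurable fun w : (Fin n → Fin p → ℝ) × (Fin p → ℝ) => Function.update w.1 i w.2 := by
    rw [measurable_pi_iff]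
    intro j
    by_cases h : j = i
    · subst h; simpa using measurable_snd
    · simp only [Function.update_of_ne h]; fun_prop
  refine ⟨hm, ?_⟩
  symm
  refine Measure.pi_eq fun s hs => ?_
  rw [Measure.map_apply hm (MeasurableSet.univ_pi hs)]
  have e : (fun w : (Fin n → Fin p → ℝ) × (Fin p → ℝ) => Function.update w.1 i w.2) ⁻¹'
      (Set.pi Set.univ s) = (Set.pi Set.univ (Function.update s i Set.univ)) ×ˢ s i := by
    ext w
    simp only [Set.mem_preimage, Set.mem_pi, Set.mem_univ, forall_true_left, Set.mem_prod]
    constructor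
    · intro h
      refine ⟨fun j => ?_, by simpa using h i⟩
      by_cases hj : j = i
      · subst hj; simp
      · simpa [Function.update_of_ne hj] using h j
    · rintro ⟨h1, h2⟩ j
      by_cases hj : j = i
      · subst hj; simpa using h2
      · simpa [Function.update_of_ne hj] using h1 j
  rw [e, jointLaw, Measure.prod_prod, sampleLaw, Measure.pi_pi,
    ← Finset.mul_prod_erase Finset.univ (fun j => gaussianVec p (s j)) (Finset.mem_univ i),
    ← Finset.mul_prod_erase Finset.univ _ (Finset.mem_univ i)]
  simp only [Function.update_self, measure_univ, one_mul]
  rw [mul_comm]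
  congr 1
  refine Finset.prod_congr rfl fun j hj => ?_
  rw [Function.update_of_ne (Finset.ne_of_mem_erase hj)]

/-- A quadratic form in the `i`-th row of two rescaled kernels, through a matrix that vanishes in
row and column `i`. -/
theorem dotProduct_mulVec_eq_bilForm (hp : 1 ≤ p) {M : Matrix (Fin n) (Fin n) ℂ} {i : Fin n}
    (hl : ∀ k, M i k = 0) (hr : ∀ j, M j i = 0) (h h' : ℝ → ℂ) (X : Fin n → Fin p → ℝ)
    {u w : Fin n → ℂ}
    (hu : ∀ j, j ≠ i → u j = ((√(p : ℝ) : ℝ) : ℂ)⁻¹ * h (√(p : ℝ) * (X j ⬝ᵥ X i)))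
    (hw : ∀ j, j ≠ i → w j = ((√(p : ℝ) : ℝ) : ℂ)⁻¹ * h' (√(p : ℝ) * (X j ⬝ᵥ X i))) :
    u ⬝ᵥ (M.mulVec w) = bilForm M h h' X (X i) := by
  have hp' : (0 : ℝ) < p := by exact_mod_cast hp
  have hs : (((√(p : ℝ) : ℝ) : ℂ)⁻¹) * ((√(p : ℝ) : ℝ) : ℂ)⁻¹ = (p : ℂ)⁻¹ := by
    rw [← mul_inv, ← Complex.ofReal_mul, Real.mul_self_sqrt hp'.le]; simp
  rw [dotProduct_mulVec_eq_sum, bilForm, Finset.mul_sum]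
  refine Finset.sum_congr rfl fun j _ => ?_
  rw [Finset.mul_sum]
  refine Finset.sum_congr rfl fun k _ => ?_
  by_cases hj : j = i
  · rw [hj, hl]; simp
  by_cases hk : k = i
  · rw [hk, hr]; simp
  rw [hu j hj, hw k hk, ← hs]; ring

theorem bilForm_update {M : Matrix (Fin n) (Fin n) ℂ} {i : Fin n}
    (hl : ∀ k, M i k = 0) (hr : ∀ j, M j i = 0) (h h' : ℝ → ℂ) (X : Fin n → Fin p → ℝ)
    (x y : Fin p → ℝ) : bilForm M h h' (Function.update X i y) x = bilForm M h h' X x := by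
  unfold bilForm
  congr 1
  refine Finset.sum_congr rfl fun j _ => Finset.sum_congr rfl fun k _ => ?_
  by_cases hj : j = i
  · rw [hj, hl]; simp
  by_cases hk : k = i
  · rw [hk, hr]; simp
  rw [Function.update_of_ne hj, Function.update_of_ne hk]

theorem formLimit_update {M : Matrix (Fin n) (Fin n) ℂ} {i : Fin n}
    (hl : ∀ k, M i k = 0) (hr : ∀ j, M j i = 0) (e m κ : ℂ) (X : Fin n → Fin p → ℝ)
    (y : Fin p → ℝ) : formLimit M (Function.update X i y) e m κ = formLimit M X e m κ := by
  unfold formLimit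
  congr 4
  refine Finset.sum_congr rfl fun j _ => Finset.sum_congr rfl fun k _ => ?_
  by_cases hj : j = i
  · rw [hj, hl]; simp
  by_cases hk : k = i
  · rw [hk, hr]; simp
  rw [Function.update_of_ne hj, Function.update_of_ne hk]

/-- The expected root of the sum of squares of the Gram matrix is of order `√p`. -/
theorem exists_integral_sqrt_sum_gram_sq_le {Θ : ℝ} (hΘ : 0 ≤ Θ) :
    ∃ K : ℝ, 0 ≤ K ∧ ∀ n p : ℕ, 1 ≤ p → (n : ℝ) ≤ Θ * p →
      Integrable (fun X : Fin n → Fin p → ℝ => √(∑ j, ∑ k, (X j ⬝ᵥ X k) ^ 2)) (sampleLaw n p) ∧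
      ∫ X : Fin n → Fin p → ℝ, √(∑ j, ∑ k, (X j ⬝ᵥ X k) ^ 2) ∂(sampleLaw n p) ≤ K * √p := by
  set g2 := gaussMoment 2 with hg2
  have hg20 : 0 ≤ g2 := gaussMoment_nonneg 2
  refine ⟨(1 + 2 * Θ + 2 * (Θ * g2) + Θ ^ 2 / 2 + Θ ^ 2 * ((1 + g2) * g2) / 2) / 2,
    by positivity, fun n p hp hn => ?_⟩
  have hp' : (0 : ℝ) < p := by exact_mod_cast hp
  have hp1 : (1 : ℝ) ≤ p := by exact_mod_cast hp
  have hs : 0 < √(p : ℝ) := Real.sqrt_pos.2 hp'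
  have hss : √(p : ℝ) * √(p : ℝ) = p := Real.mul_self_sqrt hp'.le
  have e : ∀ X : Fin n → Fin p → ℝ, (√p + (2 * n + 2 * normDev X + n ^ 2 / (2 * p)
      + p / 2 * offGram X) / √p) / 2 = ((√p + (2 * n + n ^ 2 / (2 * p)) / √p) / 2)
      + (1 / √p) * normDev X + (p / (4 * √p)) * offGram X := fun X => by field_simp; ring
  have hi1 := integrable_normDev n p
  have hi2 := integrable_offGram n hp
  have hint : Integrable (fun X : Fin n → Fin p → ℝ => (√p + (2 * n + 2 * normDev X
      + n ^ 2 / (2 * p) + p / 2 * offGram X) / √p) / 2) (sampleLaw n p) := by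
    simp_rw [e]
    have h1 : Integrable (fun X : Fin n → Fin p → ℝ => ((√p + (2 * n + n ^ 2 / (2 * p)) / √p) / 2)
        + (1 / √p) * normDev X) (sampleLaw n p) := (integrable_const _).add (hi1.const_mul _)
    exact h1.add (hi2.const_mul _)
  have hmeas : Measurable fun X : Fin n → Fin p → ℝ => √(∑ j, ∑ k, (X j ⬝ᵥ X k) ^ 2) := by
    fun_prop
  have hle := fun X => sqrt_sum_gram_sq_le hp (n := n) X
  refine ⟨hint.mono' hmeas.aestronglyMeasurable (ae_of_all _ fun X => ?_), ?_⟩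
  · rw [Real.norm_of_nonneg (Real.sqrt_nonneg _)]; exact hle X
  refine (integral_mono_of_nonneg (ae_of_all _ fun X => Real.sqrt_nonneg _) hint
    (ae_of_all _ hle)).trans ?_
  simp_rw [e]
  rw [integral_const_add_mul_add_mul hi1 hi2]
  have h1 := integral_normDev_le n hp
  have h2 := integral_offGram_le n hp
  have hn0 : (0 : ℝ) ≤ n := Nat.cast_nonneg n
  have hnp : (n / p : ℝ) ≤ Θ := by rw [div_le_iff₀ hp']; exact hn
  have h3 : n * (g2 / p) ≤ Θ * g2 := by
    calc n * (g2 / p) = n / p * g2 := by ring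
      _ ≤ _ := by gcongr
  have h4 : (n / p : ℝ) ^ 2 * ((1 + g2) * g2) ≤ Θ ^ 2 * ((1 + g2) * g2) := by gcongr
  have h5 : (n : ℝ) ^ 2 / (2 * p) ≤ Θ ^ 2 / 2 * p := by
    calc (n : ℝ) ^ 2 / (2 * p) = (n / p) ^ 2 / 2 * p := by field_simp
      _ ≤ _ := by gcongr
  calc _ ≤ (√p + (2 * (Θ * p) + Θ ^ 2 / 2 * p) / √p) / 2 + 1 / √p * (Θ * g2)
        + p / (4 * √p) * (Θ ^ 2 * ((1 + g2) * g2)) := by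
        gcongr
        · exact h1.trans h3
        · exact h2.trans h4
    _ = ((1 + 2 * Θ + Θ ^ 2 / 2 + Θ ^ 2 * ((1 + g2) * g2) / 2) / 2) * √p
        + (1 / √p) * (Θ * g2) := by
        have aux : ∀ r P : ℝ, 0 < r → r * r = P →
            (r + (2 * (Θ * P) + Θ ^ 2 / 2 * P) / r) / 2 + 1 / r * (Θ * g2)
              + P / (4 * r) * (Θ ^ 2 * ((1 + g2) * g2))
            = ((1 + 2 * Θ + Θ ^ 2 / 2 + Θ ^ 2 * ((1 + g2) * g2) / 2) / 2) * r
              + (1 / r) * (Θ * g2) := by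
          rintro r P hr rfl
          field_simp
          ring
        exact aux _ _ hs hss
    _ ≤ ((1 + 2 * Θ + Θ ^ 2 / 2 + Θ ^ 2 * ((1 + g2) * g2) / 2) / 2) * √p
        + √p * (Θ * g2) := by
        have : 1 / √(p : ℝ) ≤ √p := by
          rw [div_le_iff₀ hs, hss]; exact hp1
        gcongr
    _ = _ := by ring

end Replacement

/-! ### The approximate self-consistent equations -/

section SelfConsistent

theorem integrable_of_eLpNorm_one_le {α : Type*} [MeasurableSpace α] {μ : Measure α} {g : α → ℂ}
    (hg : Measurable g) {ε : ℝ} (hε : 0 ≤ ε) (h : eLpNorm g 1 μ ≤ ENNReal.ofReal ε) :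
    Integrable g μ ∧ ∫ x, ‖g x‖ ∂μ ≤ ε := by
  have hi : Integrable g μ :=
    memLp_one_iff_integrable.1 ⟨hg.aestronglyMeasurable, h.trans_lt ENNReal.ofReal_lt_top⟩
  refine ⟨hi, ?_⟩
  rw [eLpNorm_one_eq_lintegral_enorm, ← ofReal_integral_norm_eq_lintegral_enorm hi] at h
  exact (ENNReal.ofReal_le_ofReal_iff hε).1 h

variable {n p : ℕ}

/-- The deviation of the quadratic form of the `i`-th sample vector from a deterministic function
of the resolvent. -/
def rowDev (f : ℕ → ℝ → ℝ) (z : ℂ) (h h' : ℝ → ℂ) (i : Fin n) (X : Fin n → Fin p → ℝ) : ℂ :=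
  bilForm (minorResolv (kernelMatrix f X) z i) h h' X (X i)
    - formMean (resolv (kernelMatrix f X) z) X h h'

theorem norm_formLimit_minorResolv_sub_le (hp : 1 ≤ p) (f : ℕ → ℝ → ℝ) {z : ℂ} (hz : 0 < z.im)
    (i : Fin n) (X : Fin n → Fin p → ℝ) {e κ : ℂ} {K : ℝ} (he : ‖e‖ ≤ K) (hκ : ‖κ‖ ≤ K) :
    ‖formLimit (minorResolv (kernelMatrix f X) z i) X e 0 κ
      - formLimit (resolv (kernelMatrix f X) z) X e 0 κ‖
      ≤ K / (z.im * p) * (2 + √(∑ j, ∑ k, (X j ⬝ᵥ X k) ^ 2)) := by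
  have hp' : (0 : ℝ) < p := by exact_mod_cast hp
  have hK : 0 ≤ K := (norm_nonneg _).trans he
  have h1 := norm_trace_resolv_sub_le (kernelMatrix_isSymm f X) hz (kernelMatrix_apply_self f X i)
  have h2 := norm_sum_resolv_sub_minorResolv_le (kernelMatrix_isSymm f X) hz
    (kernelMatrix_apply_self f X i) fun j k => ((X j ⬝ᵥ X k : ℝ) : ℂ)
  simp only [Complex.norm_real, Real.norm_eq_abs, sq_abs] at h2
  rw [norm_sub_rev, formLimit, formLimit, ← mul_sub, norm_mul, norm_inv, Complex.norm_natCast]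
  set S := √(∑ j, ∑ k, (X j ⬝ᵥ X k) ^ 2) with hS
  have hS0 : 0 ≤ S := Real.sqrt_nonneg _
  have e1 : ∀ t t' s s' : ℂ, (e - 0 - κ) * t + κ * s + 0 * ∑ j, ∑ l, resolv (kernelMatrix f X) z j l
      - ((e - 0 - κ) * t' + κ * s' + 0 * ∑ j, ∑ l, minorResolv (kernelMatrix f X) z i j l)
      = (e - κ) * (t - t') + κ * (s - s') := fun t t' s s' => by ring
  rw [e1]
  calc _ ≤ (p : ℝ)⁻¹ * ((K + K) * (1 / z.im) + K * (1 / z.im * S)) := by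
        gcongr
        refine (norm_add_le _ _).trans ?_
        rw [norm_mul, norm_mul]
        gcongr
        exact (norm_sub_le _ _).trans (add_le_add he hκ)
    _ = _ := by field_simp; ring

/-- The quadratic forms of the rows concentrate. The resolvent of the minor does not depend on
`X_i`, so `X_i` plays the role of the new vector; passing from the minor to the full resolvent in
the limit value changes it by `O(p^(-1/2))`. The hypothesis `h0` removes the term `∑ M_jl`, which
this comparison would not control. -/
theorem eventually_integral_norm_rowDev_le {f : ℕ → ℝ → ℝ} (hf : ∀ p, Measurable (f p))
    {z : ℂ} (hz : 0 < z.im) {h h' : ℕ → ℝ → ℂ} (hh : ExpApprox h) (hh' : ExpApprox h')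
    (hm : ∀ p, 1 ≤ p → Measurable (h p)) (hm' : ∀ p, 1 ≤ p → Measurable (h' p))
    (h2 : ∀ p, 1 ≤ p → MemLp (h p) 2 (xiLaw p)) (h2' : ∀ p, 1 ≤ p → MemLp (h' p) 2 (xiLaw p))
    {K : ℝ} (hK : ∀ᶠ p : ℕ in atTop, xiNormSq p (h p) ≤ K)
    (hK' : ∀ᶠ p : ℕ in atTop, xiNormSq p (h' p) ≤ K)
    (h0 : ∀ p, 1 ≤ p → ∫ x, h' p x ∂(xiLaw p) = 0)
    {Θ : ℝ} (hΘ : 0 ≤ Θ) {ε : ℝ} (hε : 0 < ε) :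
    ∀ᶠ p : ℕ in atTop, ∀ n : ℕ, (n : ℝ) ≤ Θ * p → ∀ i : Fin n,
      Integrable (rowDev (p := p) f z (h p) (h' p) i) (sampleLaw n p) ∧
      ∫ X, ‖rowDev (p := p) f z (h p) (h' p) i X‖ ∂(sampleLaw n p) ≤ ε := by
  obtain ⟨B, hB0, hB⟩ := exists_integral_sqrt_sum_gram_sq_le hΘ
  have hlim : Tendsto (fun p : ℕ => |K| / z.im * ((2 + B) / √(p : ℝ))) atTop (𝓝 0) := by
    have h1 : Tendsto (fun p : ℕ => √(p : ℝ)) atTop atTop :=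
      Real.tendsto_sqrt_atTop.comp tendsto_natCast_atTop_atTop
    simpa using (h1.const_div_atTop (2 + B)).const_mul (|K| / z.im)
  filter_upwards [eventually_ge_atTop 1, hK, hK', hlim.eventually_le_const (half_pos hε),
    eventually_eLpNorm_formDiff_le hh hh' hm hm' h2 h2' hK hK'
      (by positivity : (0 : ℝ) ≤ 1 / z.im) hΘ (half_pos hε)]
    with p hp hKp hKp' hsmall hdiff n hn i
  have hp' : (0 : ℝ) < p := by exact_mod_cast hp
  have hp1 : (1 : ℝ) ≤ p := by exact_mod_cast hp
  have hs : 0 < √(p : ℝ) := Real.sqrt_pos.2 hp'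
  set M : (Fin n → Fin p → ℝ) → Matrix (Fin n) (Fin n) ℂ :=
    fun X => minorResolv (kernelMatrix f X) z i with hMdef
  set R : (Fin n → Fin p → ℝ) → Matrix (Fin n) (Fin n) ℂ :=
    fun X => resolv (kernelMatrix f X) z with hRdef
  have hM : SymmFamily (1 / z.im) M := symmFamily_minorResolv hf hz i
  have hR : SymmFamily (1 / z.im) R := symmFamily_resolv hf hz
  have hl : ∀ X k, M X i k = 0 := fun X k =>
    minorResolv_apply_left (kernelMatrix_isSymm f X) hz i k
  have hr : ∀ X j, M X j i = 0 := fun X j => minorResolv_apply_right _ z i j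
  set G : (Fin n → Fin p → ℝ) → ℂ := fun X => formDiff M (h p) (h' p) (X, X i) with hG
  have hGm : Measurable G := (hM.measurable_formDiff (hm p hp) (hm' p hp)).comp (by fun_prop)
  -- inserting an independent copy as the `i`-th row preserves the law of the sample
  have hGu : (G ∘ fun w : (Fin n → Fin p → ℝ) × (Fin p → ℝ) => Function.update w.1 i w.2)
      = formDiff M (h p) (h' p) := by
    funext w
    simp only [hG, Function.comp_apply, formDiff, formMean, Function.update_self]
    have e : M (Function.update w.1 i w.2) = M w.1 := minorResolv_kernelMatrix_update f w.1 z i w.2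
    rw [e, bilForm_update (hl _) (hr _), formLimit_update (hl _) (hr _)]
  have hGn : eLpNorm G 1 (sampleLaw n p) ≤ ENNReal.ofReal (ε / 2) := by
    rw [← eLpNorm_comp_measurePreserving hGm.aestronglyMeasurable (measurePreserving_update n p i),
      hGu]
    exact hdiff n hn M hM
  obtain ⟨hGi, hGle⟩ := integrable_of_eLpNorm_one_le hGm (half_pos hε).le hGn
  -- the cost of passing from the minor to the full resolvent
  set e := ∫ x, h p x * h' p x ∂(xiLaw p) with he
  set κ := (∫ x, (x : ℂ) * h p x ∂(xiLaw p)) * ∫ x, (x : ℂ) * h' p x ∂(xiLaw p) with hκ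
  have hs1 : √(xiNormSq p (h p)) ≤ √|K| := Real.sqrt_le_sqrt (hKp.trans (le_abs_self K))
  have hs2 : √(xiNormSq p (h' p)) ≤ √|K| := Real.sqrt_le_sqrt (hKp'.trans (le_abs_self K))
  have hprod : √(xiNormSq p (h p)) * √(xiNormSq p (h' p)) ≤ |K| := by
    calc _ ≤ √|K| * √|K| := by gcongr
      _ = |K| := Real.mul_self_sqrt (abs_nonneg K)
  have heK : ‖e‖ ≤ |K| := (norm_integral_mul_le (h2 p hp) (h2' p hp)).trans hprod
  have hκK : ‖κ‖ ≤ |K| := by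
    rw [hκ, norm_mul]
    refine le_trans ?_ hprod
    gcongr
    · exact norm_integral_ofReal_mul_le_sqrt_xiNormSq hp (h2 p hp)
    · exact norm_integral_ofReal_mul_le_sqrt_xiNormSq hp (h2' p hp)
  have hmean : ∀ N : Matrix (Fin n) (Fin n) ℂ, ∀ X : Fin n → Fin p → ℝ,
      formMean N X (h p) (h' p) = formLimit N X e 0 κ := fun N X => by
    rw [formMean, h0 p hp, mul_zero]
  set J : (Fin n → Fin p → ℝ) → ℂ := fun X => formLimit (M X) X e 0 κ - formLimit (R X) X e 0 κ
    with hJ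
  have hJm : Measurable J := (hM.measurable_formLimit _ _ _).sub (hR.measurable_formLimit _ _ _)
  obtain ⟨hBi, hBle⟩ := hB n p hp hn
  have hdom : Integrable (fun X : Fin n → Fin p → ℝ =>
      |K| / (z.im * p) * (2 + √(∑ j, ∑ k, (X j ⬝ᵥ X k) ^ 2))) (sampleLaw n p) :=
    ((integrable_const _).add hBi).const_mul _
  have hJle : ∀ X, ‖J X‖ ≤ |K| / (z.im * p) * (2 + √(∑ j, ∑ k, (X j ⬝ᵥ X k) ^ 2)) := fun X =>
    norm_formLimit_minorResolv_sub_le hp f hz i X heK hκK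
  have hJi : Integrable J (sampleLaw n p) :=
    hdom.mono' hJm.aestronglyMeasurable (ae_of_all _ hJle)
  have hJint : ∫ X, ‖J X‖ ∂(sampleLaw n p) ≤ ε / 2 := by
    refine le_trans ?_ hsmall
    calc _ ≤ ∫ X : Fin n → Fin p → ℝ, |K| / (z.im * p) * (2 + √(∑ j, ∑ k, (X j ⬝ᵥ X k) ^ 2))
          ∂(sampleLaw n p) := integral_mono hJi.norm hdom hJle
      _ = |K| / (z.im * p) * (2 + ∫ X : Fin n → Fin p → ℝ, √(∑ j, ∑ k, (X j ⬝ᵥ X k) ^ 2)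
          ∂(sampleLaw n p)) := by
          rw [integral_const_mul, integral_add (integrable_const _) hBi]; simp
      _ ≤ |K| / (z.im * p) * (2 * √p + B * √p) := by
          have : (1 : ℝ) ≤ √p := by rwa [Real.one_le_sqrt]
          gcongr
          linarith
      _ = |K| / z.im * ((2 + B) / √(p : ℝ)) := by
          have aux : ∀ r P : ℝ, 0 < r → r * r = P →
              |K| / (z.im * P) * (2 * r + B * r) = |K| / z.im * ((2 + B) / r) := by
            rintro r P hr rfl
            field_simp
          exact aux _ _ hs (Real.mul_self_sqrt hp'.le)
  have hsum : rowDev (p := p) f z (h p) (h' p) i = fun X => G X + J X := by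
    funext X
    simp only [rowDev, hG, hJ, formDiff, hmean]
    ring
  rw [hsum]
  refine ⟨hGi.add hJi, ?_⟩
  calc _ ≤ ∫ X, (‖G X‖ + ‖J X‖) ∂(sampleLaw n p) :=
        integral_mono (hGi.add hJi).norm (hGi.norm.add hJi.norm) fun X => norm_add_le _ _
    _ = ∫ X, ‖G X‖ ∂(sampleLaw n p) + ∫ X, ‖J X‖ ∂(sampleLaw n p) :=
        integral_add hGi.norm hJi.norm
    _ ≤ ε := by linarith

/-- The normalized trace of the resolvent of the kernel matrix. -/
def normTrace (f : ℕ → ℝ → ℝ) (z : ℂ) (X : Fin n → Fin p → ℝ) : ℂ :=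
  (n : ℂ)⁻¹ * (resolv (kernelMatrix f X) z).trace

theorem norm_normTrace_le (f : ℕ → ℝ → ℝ) {z : ℂ} (hz : 0 < z.im) (X : Fin n → Fin p → ℝ) :
    ‖normTrace f z X‖ ≤ 1 / z.im := by
  have h := (opBound_resolv (kernelMatrix_isSymm f X) hz).norm_trace_le (by positivity)
  rw [normTrace, norm_mul, norm_inv, Complex.norm_natCast]
  rw [Fintype.card_fin] at h
  rcases Nat.eq_zero_or_pos n with h0 | h0
  · subst h0; simp [hz.le]
  · have : (0 : ℝ) < n := by exact_mod_cast h0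
    calc (n : ℝ)⁻¹ * ‖(resolv (kernelMatrix f X) z).trace‖ ≤ (n : ℝ)⁻¹ * (1 / z.im * n) := by gcongr
      _ = _ := by field_simp

theorem measurable_normTrace {f : ℕ → ℝ → ℝ} (hf : ∀ p, Measurable (f p)) (z : ℂ) :
    Measurable (normTrace (n := n) (p := p) f z) := by
  unfold normTrace Matrix.trace
  exact measurable_const.mul (Finset.measurable_fun_sum _ fun i _ =>
    measurable_resolv (measurable_kernelMatrix hf) z i i)

theorem kernelMatrix_apply_of_ne (hp : 1 ≤ p) (f : ℕ → ℝ → ℝ) (X : Fin n → Fin p → ℝ)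
    {i j : Fin n} (h : j ≠ i) :
    kernelMatrix f X i j = (√(p : ℝ))⁻¹ * rescaledKernel f p (√(p : ℝ) * (X j ⬝ᵥ X i)) := by
  have hp' : (0 : ℝ) < p := by exact_mod_cast hp
  have hs : √(p : ℝ) ≠ 0 := (Real.sqrt_pos.2 hp').ne'
  rw [kernelMatrix, Matrix.of_apply, if_neg h.symm, rescaledKernel, dotProduct_comm]
  rw [mul_div_cancel_left₀ _ hs, inv_mul_cancel_left₀ hs]

theorem schurForm_kernelMatrix (hp : 1 ≤ p) (f : ℕ → ℝ → ℝ) {z : ℂ} (hz : 0 < z.im)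
    (X : Fin n → Fin p → ℝ) (i : Fin n) :
    schurForm (kernelMatrix f X) z i = bilForm (minorResolv (kernelMatrix f X) z i)
      (fun x => (rescaledKernel f p x : ℂ)) (fun x => (rescaledKernel f p x : ℂ)) X (X i) := by
  have h : ∀ j, j ≠ i → (kernelMatrix f X i j : ℂ) = ((√(p : ℝ) : ℝ) : ℂ)⁻¹ *
      (fun x => (rescaledKernel f p x : ℂ)) (√(p : ℝ) * (X j ⬝ᵥ X i)) := fun j hj => by
    rw [kernelMatrix_apply_of_ne hp f X hj]; push_cast; rfl
  exact dotProduct_mulVec_eq_bilForm hp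
    (minorResolv_apply_left (kernelMatrix_isSymm f X) hz i) (minorResolv_apply_right _ z i) _ _ X
    h h

/-- The column of the resolvent paired with the column of the Gram matrix. -/
theorem sum_resolv_mul_gram (hp : 1 ≤ p) (f : ℕ → ℝ → ℝ) {z : ℂ} (hz : 0 < z.im)
    (X : Fin n → Fin p → ℝ) (i : Fin n) :
    ∑ j, resolv (kernelMatrix f X) z j i * ((X j ⬝ᵥ X i : ℝ) : ℂ)
      = resolv (kernelMatrix f X) z i i * (((X i ⬝ᵥ X i : ℝ) : ℂ)
        - bilForm (minorResolv (kernelMatrix f X) z i) (fun x => (x : ℂ))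
          (fun x => (rescaledKernel f p x : ℂ)) X (X i)) := by
  have hp' : (0 : ℝ) < p := by exact_mod_cast hp
  have hs : ((√(p : ℝ) : ℝ) : ℂ) ≠ 0 := by exact_mod_cast (Real.sqrt_pos.2 hp').ne'
  have h1 : ∀ j, j ≠ i → ((X j ⬝ᵥ X i : ℝ) : ℂ) = ((√(p : ℝ) : ℝ) : ℂ)⁻¹ *
      (fun x : ℝ => (x : ℂ)) (√(p : ℝ) * (X j ⬝ᵥ X i)) := fun j _ => by
    simp only [Complex.ofReal_mul, inv_mul_cancel_left₀ hs]
  have h2 : ∀ j, j ≠ i → (kernelMatrix f X i j : ℂ) = ((√(p : ℝ) : ℝ) : ℂ)⁻¹ *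
      (fun x => (rescaledKernel f p x : ℂ)) (√(p : ℝ) * (X j ⬝ᵥ X i)) := fun j hj => by
    rw [kernelMatrix_apply_of_ne hp f X hj]; push_cast; rfl
  rw [← dotProduct_mulVec_eq_bilForm hp
    (minorResolv_apply_left (kernelMatrix_isSymm f X) hz i) (minorResolv_apply_right _ z i) _ _ X
    h1 h2]
  have e : ∀ j, resolv (kernelMatrix f X) z j i * ((X j ⬝ᵥ X i : ℝ) : ℂ)
      = resolv (kernelMatrix f X) z i i * (schurVec (kernelMatrix f X) z i j
        * ((X j ⬝ᵥ X i : ℝ) : ℂ)) := fun j => by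
    rw [resolv_apply_eq (kernelMatrix_isSymm f X) hz (kernelMatrix_apply_self f X i) j, mul_assoc]
  rw [Finset.sum_congr rfl fun j _ => e j, ← Finset.mul_sum]
  congr 1
  simp only [schurVec, Pi.sub_apply, sub_mul, Finset.sum_sub_distrib]
  congr 1
  · rw [Finset.sum_eq_single i]
    · simp
    · intro j _ hj; simp [hj]
    · simp
  · exact Finset.sum_congr rfl fun j _ => mul_comm _ _

end SelfConsistent

section SelfConsistentLimit

variable {n p : ℕ}

/-- The algebra behind the limiting equation: up to the deviations of the rows, the normalized
trace `m` of the resolvent and the pairing `T = p⁻¹ ∑ R_jl X_j·X_l` satisfy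
`1 + (z + (E - κ²) m / γ + κ² T) m = 0` and `T = m (1 - κ T) / γ`, and eliminating `T` gives the
cubic equation for `m`. -/
theorem norm_limitPoly_normTrace_le (hp : 1 ≤ p) (f : ℕ → ℝ → ℝ) {z : ℂ} (hz : 0 < z.im) {γ : ℝ}
    (hγ : 0 < γ) (hpn : (p : ℝ) / n = γ) (X : Fin n → Fin p → ℝ) (E κ : ℝ) {d d' : Fin n → ℂ}
    (hd : ∀ i, bilForm (minorResolv (kernelMatrix f X) z i) (fun x => (rescaledKernel f p x : ℂ))
      (fun x => (rescaledKernel f p x : ℂ)) X (X i)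
        = formLimit (resolv (kernelMatrix f X) z) X E 0 (κ ^ 2) + d i)
    (hd' : ∀ i, bilForm (minorResolv (kernelMatrix f X) z i) (fun x => (x : ℂ))
      (fun x => (rescaledKernel f p x : ℂ)) X (X i)
        = formLimit (resolv (kernelMatrix f X) z) X κ 0 κ + d' i) :
    ‖limitPoly γ κ E z (normTrace f z X)‖
      ≤ (1 + |κ| / γ / z.im) / z.im * ((n : ℝ)⁻¹ * ∑ i, ‖d i‖)
        + κ ^ 2 / z.im ^ 2 / γ * ((n : ℝ)⁻¹ * ∑ i, (‖d' i‖ + |X i ⬝ᵥ X i - 1|)) := by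
  have hp' : (0 : ℝ) < p := by exact_mod_cast hp
  have hn' : (0 : ℝ) < n := by
    rcases Nat.eq_zero_or_pos n with h | h
    · subst h; simp at hpn; exact absurd hpn hγ.ne
    · exact_mod_cast h
  have hpn' : (p : ℝ) = γ * n := by rw [← hpn]; field_simp
  have hpnC : (p : ℂ) = γ * n := by exact_mod_cast hpn'
  have hnC : (n : ℂ) ≠ 0 := by exact_mod_cast hn'.ne'
  have hγC : (γ : ℂ) ≠ 0 := by exact_mod_cast hγ.ne'
  set A := kernelMatrix f X with hA
  set R := resolv A z with hR
  set m := normTrace f z X with hm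
  set S := ∑ j, ∑ l, R j l * ((X j ⬝ᵥ X l : ℝ) : ℂ) with hS
  set T := (p : ℂ)⁻¹ * S with hT
  have hAs := kernelMatrix_isSymm f X
  have hm' : m = (n : ℂ)⁻¹ * ∑ i, R i i := rfl
  have htr : R.trace = n * m := by
    rw [hm, normTrace, mul_inv_cancel_left₀ hnC]
  have hmv : ‖m‖ ≤ 1 / z.im := norm_normTrace_le f hz X
  have hRv : ∀ i, ‖R i i‖ ≤ 1 / z.im := fun i =>
    (opBound_resolv hAs hz).norm_entry_le (by positivity) i i
  have hl1 : formLimit R X E 0 (κ ^ 2) = ((E - κ ^ 2) / γ : ℂ) * m + κ ^ 2 * T := by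
    rw [formLimit, htr, hT, hpnC]; field_simp; ring
  have hl2 : formLimit R X κ 0 κ = κ * T := by
    rw [formLimit, htr, hT]; ring
  -- the residuals of the two equations; the combination in `e3` eliminates `T`
  set F₁ := 1 + z * m + (((E - κ ^ 2) / γ : ℂ) * m + κ ^ 2 * T) * m with hF₁
  set F₂ := T - (1 / γ : ℂ) * m * (1 - κ * T) with hF₂
  have e1 : F₁ = - ((n : ℂ)⁻¹ * ∑ i, R i i * d i) := by
    have h1 : ∀ i, R i i * d i = - 1 - z * R i i
        - (((E - κ ^ 2) / γ : ℂ) * m + κ ^ 2 * T) * R i i := fun i => by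
      have h2 := resolv_apply_self_mul hAs hz (kernelMatrix_apply_self f X i)
      rw [schurForm_kernelMatrix hp f hz X i, hd i, hl1] at h2
      linear_combination -h2
    rw [Finset.sum_congr rfl fun i _ => h1 i, Finset.sum_sub_distrib, Finset.sum_sub_distrib,
      ← Finset.mul_sum, ← Finset.mul_sum]
    have h3 : ∑ i, R i i = n * m := htr
    rw [h3, hF₁]
    simp only [Finset.sum_const, Finset.card_univ, Fintype.card_fin, nsmul_eq_mul]
    field_simp
    ring
  have e2 : F₂ = (p : ℂ)⁻¹ * ∑ i, R i i * (((X i ⬝ᵥ X i - 1 : ℝ) : ℂ) - d' i) := by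
    have h1 : ∀ i, R i i * (((X i ⬝ᵥ X i - 1 : ℝ) : ℂ) - d' i)
        = ∑ j, R j i * ((X j ⬝ᵥ X i : ℝ) : ℂ) - (1 - κ * T) * R i i := fun i => by
      rw [sum_resolv_mul_gram hp f hz X i, hd' i, hl2]
      push_cast; ring
    rw [Finset.sum_congr rfl fun i _ => h1 i, Finset.sum_sub_distrib, ← Finset.mul_sum,
      Finset.sum_comm]
    have h3 : ∑ i, R i i = n * m := htr
    rw [h3, mul_sub, hF₂, ← hS, ← hT, hpnC]
    field_simp
  have e3 : limitPoly γ κ E z m = (1 + (κ / γ : ℂ) * m) * F₁ - κ ^ 2 * m * F₂ := by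
    rw [limitPoly, hF₁, hF₂]; ring
  have b1 : ‖F₁‖ ≤ 1 / z.im * ((n : ℝ)⁻¹ * ∑ i, ‖d i‖) := by
    rw [e1, norm_neg, norm_mul, norm_inv, Complex.norm_natCast]
    calc _ ≤ (n : ℝ)⁻¹ * ∑ i, 1 / z.im * ‖d i‖ := by
          gcongr
          refine (norm_sum_le _ _).trans (Finset.sum_le_sum fun i _ => ?_)
          rw [norm_mul]
          gcongr
          exact hRv i
      _ = _ := by rw [← Finset.mul_sum]; ring
  have b2 : ‖F₂‖ ≤ 1 / z.im / γ * ((n : ℝ)⁻¹ * ∑ i, (‖d' i‖ + |X i ⬝ᵥ X i - 1|)) := by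
    rw [e2, norm_mul, norm_inv, Complex.norm_natCast]
    calc _ ≤ (p : ℝ)⁻¹ * ∑ i, 1 / z.im * (‖d' i‖ + |X i ⬝ᵥ X i - 1|) := by
          gcongr
          refine (norm_sum_le _ _).trans (Finset.sum_le_sum fun i _ => ?_)
          rw [norm_mul]
          gcongr
          · exact hRv i
          · refine (norm_sub_le _ _).trans (le_of_eq ?_)
            rw [Complex.norm_real, Real.norm_eq_abs, add_comm]
      _ = _ := by rw [← Finset.mul_sum, hpn']; field_simp
  have b3 : ‖1 + (κ / γ : ℂ) * m‖ ≤ 1 + |κ| / γ / z.im := by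
    refine (norm_add_le _ _).trans ?_
    rw [norm_one, norm_mul, norm_div, Complex.norm_real, Complex.norm_real, Real.norm_eq_abs,
      Real.norm_eq_abs, abs_of_pos hγ]
    calc 1 + |κ| / γ * ‖m‖ ≤ 1 + |κ| / γ * (1 / z.im) := by gcongr
      _ = _ := by ring
  have b4 : ‖(κ ^ 2 : ℂ) * m‖ ≤ κ ^ 2 / z.im := by
    rw [norm_mul, norm_pow, Complex.norm_real, Real.norm_eq_abs, sq_abs]
    calc κ ^ 2 * ‖m‖ ≤ κ ^ 2 * (1 / z.im) := by gcongr
      _ = _ := by ring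
  rw [e3]
  calc _ ≤ ‖1 + (κ / γ : ℂ) * m‖ * ‖F₁‖ + ‖(κ ^ 2 : ℂ) * m‖ * ‖F₂‖ := by
        refine (norm_sub_le _ _).trans (le_of_eq ?_)
        rw [norm_mul, norm_mul (_ * m)]
    _ ≤ (1 + |κ| / γ / z.im) * (1 / z.im * ((n : ℝ)⁻¹ * ∑ i, ‖d i‖))
        + κ ^ 2 / z.im * (1 / z.im / γ * ((n : ℝ)⁻¹ * ∑ i, (‖d' i‖ + |X i ⬝ᵥ X i - 1|))) := by
        gcongr
    _ = _ := by field_simp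

theorem coeff_one_sq_le {k : ℕ → ℝ → ℝ} {ν : ℝ} (hV : CVariance k ν) (hp : 1 ≤ p) :
    coeff k 1 p ^ 2 ≤ ∫ x, k p x ^ 2 ∂(xiLaw p) := by
  have h1 := norm_integral_ofReal_mul_le_sqrt_xiNormSq hp (hV.memLp p hp).ofReal
  have h2 : ∫ x, (x : ℂ) * (k p x : ℂ) ∂(xiLaw p) = (coeff k 1 p : ℂ) := by
    rw [coeff_one_eq hp, ← integral_complex_ofReal]
    push_cast; rfl
  have h3 : xiNormSq p (fun x => (k p x : ℂ)) = ∫ x, k p x ^ 2 ∂(xiLaw p) := by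
    simp [xiNormSq]
  simp only [RCLike.ofReal_eq_complex_ofReal] at h1
  rw [h2, h3, Complex.norm_real, Real.norm_eq_abs] at h1
  have h4 := pow_le_pow_left₀ (abs_nonneg _) h1 2
  rwa [sq_abs, Real.sq_sqrt (integral_nonneg fun x => sq_nonneg _)] at h4

/-- The normalized trace of the resolvent is an approximate root of the cubic polynomial. -/
theorem eventually_integral_norm_limitPoly_le {f : ℕ → ℝ → ℝ} (hf : ∀ p, Measurable (f p)) {ν : ℝ}
    (hV : CVariance (rescaledKernel f) ν) (hU : CUniform (rescaledKernel f)) {γ : ℝ} (hγ : 0 < γ)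
    {z : ℂ} (hz : 0 < z.im) {ε : ℝ} (hε : 0 < ε) :
    ∀ᶠ p : ℕ in atTop, ∀ n : ℕ, (p : ℝ) / n = γ →
      ∫ X, ‖limitPoly γ (coeff (rescaledKernel f) 1 p) (∫ x, rescaledKernel f p x ^ 2 ∂(xiLaw p)) z
        (normTrace (n := n) (p := p) f z X)‖ ∂(sampleLaw n p) ≤ ε := by
  set k : ℕ → ℝ → ℂ := fun p x => (rescaledKernel f p x : ℂ) with hk
  have hkm : ∀ p, Measurable (rescaledKernel f p) := fun p => by
    unfold rescaledKernel
    exact measurable_const.mul ((hf p).comp (by fun_prop))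
  have hkm' : ∀ p, 1 ≤ p → Measurable (k p) := fun p _ => Complex.measurable_ofReal.comp (hkm p)
  have hk2 : ∀ p, 1 ≤ p → MemLp (k p) 2 (xiLaw p) := fun p hp => (hV.memLp p hp).ofReal
  have hkn : ∀ p, xiNormSq p (k p) = ∫ x, rescaledKernel f p x ^ 2 ∂(xiLaw p) := fun p => by
    simp [xiNormSq, hk]
  set K := |ν| + 1 with hK
  have hK1 : 1 ≤ K := by rw [hK]; linarith [abs_nonneg ν]
  have hK0 : 0 < K := by linarith
  have hkK : ∀ᶠ p : ℕ in atTop, xiNormSq p (k p) ≤ K := by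
    have h1 : ∀ᶠ p : ℕ in atTop, variance (rescaledKernel f p) (xiLaw p) ≤ K :=
      hV.tendsto_variance.eventually_le_const (by rw [hK]; linarith [le_abs_self ν])
    filter_upwards [h1, eventually_ge_atTop 1] with p h1 hp
    rw [hkn, integral_sq_eq_variance hV hp]; exact h1
  have hidK : ∀ᶠ p : ℕ in atTop, xiNormSq p (fun x => (x : ℂ)) ≤ K := by
    filter_upwards [eventually_ge_atTop 1] with p hp
    rw [xiNormSq_ofReal hp]; exact hK1
  have hk0 : ∀ p, 1 ≤ p → ∫ x, k p x ∂(xiLaw p) = 0 := fun p hp => by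
    rw [hk]; simp only; rw [integral_complex_ofReal, hV.mean_zero p hp]; rfl
  have hkA : ExpApprox k := expApprox_of_cUniform hV hU
  set C := (1 + (1 + K) / γ / z.im) / z.im with hC
  set C' := K / z.im ^ 2 / γ with hC'
  have hC0 : 0 < C := by positivity
  have hC0' : 0 < C' := by positivity
  have hlim : Tendsto (fun p : ℕ => √(gaussMoment 2 / p)) atTop (𝓝 0) := by
    have := (Real.continuous_sqrt.tendsto 0).comp
      (tendsto_const_div_atTop_nhds_zero_nat (gaussMoment 2))
    rw [Real.sqrt_zero] at this
    exact this
  filter_upwards [eventually_ge_atTop 1, hkK,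
    eventually_integral_norm_rowDev_le hf hz hkA hkA hkm' hkm' hk2 hk2 hkK hkK hk0
      (by positivity : (0 : ℝ) ≤ γ⁻¹) (by positivity : 0 < ε / (3 * C)),
    eventually_integral_norm_rowDev_le hf hz expApprox_id hkA
      (fun _ _ => Complex.measurable_ofReal) hkm' (fun p hp => memLp_ofReal_xiLaw hp) hk2 hidK hkK
      hk0 (by positivity : (0 : ℝ) ≤ γ⁻¹) (by positivity : 0 < ε / (3 * C')),
    hlim.eventually_le_const (by positivity : 0 < ε / (3 * C'))]
    with p hp hkp hdev hdev' hnorm n hpn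
  have hp' : (0 : ℝ) < p := by exact_mod_cast hp
  have hn' : (0 : ℝ) < n := by
    rcases Nat.eq_zero_or_pos n with h | h
    · subst h; simp at hpn; exact absurd hpn hγ.ne
    · exact_mod_cast h
  have hn : (n : ℝ) ≤ γ⁻¹ * p := by rw [← hpn]; field_simp; exact le_rfl
  set E := ∫ x, rescaledKernel f p x ^ 2 ∂(xiLaw p) with hE
  set κ := coeff (rescaledKernel f) 1 p with hκ
  have hEK : E ≤ K := by rw [hE, ← hkn]; exact hkp
  have hκ2 : κ ^ 2 ≤ K := (coeff_one_sq_le hV hp).trans hEK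
  have hκ1 : |κ| ≤ 1 + K := by nlinarith [sq_abs κ, sq_nonneg (|κ| - 1)]
  have hxk : ∫ x, (x : ℂ) * k p x ∂(xiLaw p) = (κ : ℂ) := by
    rw [hκ, coeff_one_eq hp, ← integral_complex_ofReal]
    push_cast; rfl
  have hkk : ∫ x, k p x * k p x ∂(xiLaw p) = (E : ℂ) := by
    rw [hE, ← integral_complex_ofReal]
    push_cast; simp only [sq]; rfl
  have hxx : ∫ x : ℝ, (x : ℂ) * (x : ℂ) ∂(xiLaw p) = 1 := by
    rw [← Complex.ofReal_one, ← integral_sq_xiLaw hp, ← integral_complex_ofReal]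
    push_cast; simp only [sq]
  have hd : ∀ (X : Fin n → Fin p → ℝ) i, bilForm (minorResolv (kernelMatrix f X) z i) (k p) (k p)
      X (X i) = formLimit (resolv (kernelMatrix f X) z) X E 0 (κ ^ 2)
        + rowDev f z (k p) (k p) i X := fun X i => by
    rw [rowDev, formMean, hk0 p hp, hxk, hkk, mul_zero, ← sq]; ring
  have hd' : ∀ (X : Fin n → Fin p → ℝ) i, bilForm (minorResolv (kernelMatrix f X) z i)
      (fun x => (x : ℂ)) (k p) X (X i) = formLimit (resolv (kernelMatrix f X) z) X κ 0 κ
        + rowDev f z (fun x => (x : ℂ)) (k p) i X := fun X i => by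
    rw [rowDev, formMean, hk0 p hp, hxk, hxx, mul_zero, one_mul]; ring
  have hi1 : ∀ i, Integrable (fun X => ‖rowDev (p := p) f z (k p) (k p) i X‖) (sampleLaw n p) :=
    fun i => (hdev n hn i).1.norm
  have hi2 : ∀ i, Integrable (fun X => ‖rowDev (p := p) f z (fun x => (x : ℂ)) (k p) i X‖)
      (sampleLaw n p) := fun i => (hdev' n hn i).1.norm
  have hi3 : ∀ i : Fin n, Integrable (fun X : Fin n → Fin p → ℝ => |X i ⬝ᵥ X i - 1|)
      (sampleLaw n p) := fun i =>
    (measurePreserving_sampleLaw_eval p i).integrable_comp_of_integrable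
      (g := fun y => |y ⬝ᵥ y - 1|) ((integrable_dotProduct_self p).sub (integrable_const 1)).abs
  have hi23 : ∀ i : Fin n, Integrable (fun X : Fin n → Fin p → ℝ =>
      ‖rowDev (p := p) f z (fun x => (x : ℂ)) (k p) i X‖ + |X i ⬝ᵥ X i - 1|) (sampleLaw n p) :=
    fun i => (hi2 i).add (hi3 i)
  have hs1 : Integrable (fun X : Fin n → Fin p → ℝ =>
      C * ((n : ℝ)⁻¹ * ∑ i, ‖rowDev (p := p) f z (k p) (k p) i X‖)) (sampleLaw n p) :=
    ((integrable_finsetSum _ fun i _ => hi1 i).const_mul _).const_mul _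
  have hs2 : Integrable (fun X : Fin n → Fin p → ℝ =>
      C' * ((n : ℝ)⁻¹ * ∑ i, (‖rowDev (p := p) f z (fun x => (x : ℂ)) (k p) i X‖
        + |X i ⬝ᵥ X i - 1|))) (sampleLaw n p) :=
    ((integrable_finsetSum _ fun i _ => hi23 i).const_mul _).const_mul _
  have hav : ∀ (b : Fin n → ℝ) (δ : ℝ), (∀ i, b i ≤ δ) → (n : ℝ)⁻¹ * ∑ i, b i ≤ δ := by
    intro b δ hb
    calc (n : ℝ)⁻¹ * ∑ i, b i ≤ (n : ℝ)⁻¹ * ∑ _i : Fin n, δ := by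
          gcongr with i _; exact hb i
      _ = δ := by
          simp only [Finset.sum_const, Finset.card_univ, Fintype.card_fin, nsmul_eq_mul]
          field_simp
  calc _ ≤ ∫ X : Fin n → Fin p → ℝ,
        (C * ((n : ℝ)⁻¹ * ∑ i, ‖rowDev (p := p) f z (k p) (k p) i X‖)
        + C' * ((n : ℝ)⁻¹ * ∑ i, (‖rowDev (p := p) f z (fun x => (x : ℂ)) (k p) i X‖
        + |X i ⬝ᵥ X i - 1|))) ∂(sampleLaw n p) := by
        refine integral_mono_of_nonneg (ae_of_all _ fun X => norm_nonneg _) (hs1.add hs2)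
          (ae_of_all _ fun X => ?_)
        refine (norm_limitPoly_normTrace_le hp f hz hγ hpn X E κ (hd X) (hd' X)).trans ?_
        dsimp only
        have hCle : (1 + |κ| / γ / z.im) / z.im ≤ C := by rw [hC]; gcongr
        have hCle' : κ ^ 2 / z.im ^ 2 / γ ≤ C' := by rw [hC']; gcongr
        gcongr
    _ = C * ((n : ℝ)⁻¹ * ∑ i, ∫ X, ‖rowDev (p := p) f z (k p) (k p) i X‖ ∂(sampleLaw n p))
        + C' * ((n : ℝ)⁻¹ * ∑ i : Fin n,
          (∫ X, ‖rowDev (p := p) f z (fun x => (x : ℂ)) (k p) i X‖ ∂(sampleLaw n p)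
            + ∫ y, |y ⬝ᵥ y - 1| ∂(gaussianVec p))) := by
        rw [integral_add hs1 hs2, integral_const_mul, integral_const_mul, integral_const_mul,
          integral_const_mul, integral_finsetSum _ fun i _ => hi1 i,
          integral_finsetSum _ fun i _ => hi23 i]
        congr 3
        refine Finset.sum_congr rfl fun i _ => ?_
        rw [integral_add (hi2 i) (hi3 i)]
        congr 1
        exact (measurePreserving_sampleLaw_eval p i).integral_comp_of_measurable
          (g := fun y => |y ⬝ᵥ y - 1|) (by fun_prop)
    _ ≤ C * (ε / (3 * C)) + C' * (ε / (3 * C') + ε / (3 * C')) := by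
        gcongr
        · exact hav _ _ fun i => (hdev n hn i).2
        · exact hav _ _ fun i => add_le_add (hdev' n hn i).2
            ((integral_abs_dotProduct_self_sub_one_le hp).trans hnorm)
    _ = ε := by field_simp; ring

end SelfConsistentLimit

/-! ### Concentration of functions with bounded differences -/

section BoundedDifferences

variable {α : Type*} [MeasurableSpace α] (ρ : Measure α) [IsProbabilityMeasure ρ]

theorem measurePreserving_cons (n : ℕ) :
    MeasurePreserving (fun w : α × (Fin n → α) => (Fin.cons w.1 w.2 : Fin (n + 1) → α))
      (ρ.prod (Measure.pi fun _ => ρ)) (Measure.pi fun _ => ρ) := by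
  have h := (measurePreserving_piFinSuccAbove (fun _ : Fin (n + 1) => ρ) 0).symm
  convert h using 1
  funext w
  exact (Fin.insertNth_zero' w.1 w.2).symm

theorem integrable_of_abs_le {β : Type*} [MeasurableSpace β] {μ : Measure β} [IsFiniteMeasure μ]
    {g : β → ℝ} (hg : Measurable g) {B : ℝ} (hB : ∀ x, |g x| ≤ B) : Integrable g μ :=
  (integrable_const B).mono' hg.aestronglyMeasurable (ae_of_all _ hB)

/-- The exponential moment bound behind McDiarmid's inequality, by conditioning on one coordinate
after the other and Hoeffding's lemma. -/
theorem integral_exp_mul_sub_integral_le (n : ℕ) {F : (Fin n → α) → ℝ} (hF : Measurable F) {B : ℝ}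
    (hB : ∀ X, |F X| ≤ B) {c : ℝ} (hc : 0 ≤ c)
    (hd : ∀ X i x, |F (Function.update X i x) - F X| ≤ c) (t : ℝ) :
    ∫ X, Real.exp (t * (F X - ∫ Y, F Y ∂(Measure.pi fun _ => ρ))) ∂(Measure.pi fun _ => ρ)
      ≤ Real.exp (n * c ^ 2 * t ^ 2 / 2) := by
  induction n with
  | zero =>
    have h : ∀ X, F X = F default := fun X => by rw [Subsingleton.elim X default]
    have hconst : F = fun _ => F default := funext h
    rw [hconst]; simp
  | succ n ih =>
    set π : Measure (Fin n → α) := Measure.pi fun _ => ρ with hπ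
    set Φ : α × (Fin n → α) → ℝ := fun w => F (Fin.cons w.1 w.2) with hΦ
    have hmp := measurePreserving_cons ρ n
    have hΦm : Measurable Φ := hF.comp hmp.measurable
    have hΦB : ∀ w, |Φ w| ≤ B := fun w => hB _
    have hΦi : Integrable Φ (ρ.prod π) := integrable_of_abs_le hΦm hΦB
    -- the conditional mean given the first coordinate; it oscillates by at most `c`
    set G : α → ℝ := fun x => ∫ y, Φ (x, y) ∂π with hG
    have hGm : Measurable G := hΦm.stronglyMeasurable.integral_prod_right.measurable
    have hsi : ∀ x, Integrable (fun y => Φ (x, y)) π := fun x =>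
      integrable_of_abs_le (hΦm.comp (by fun_prop)) fun y => hΦB _
    have hmean : ∫ Y, F Y ∂(Measure.pi fun _ => ρ) = ∫ x, G x ∂ρ := by
      rw [← hmp.integral_comp_of_measurable hF, integral_prod _ hΦi]
    have hGB : ∀ x, |G x| ≤ B := fun x => by
      have := norm_integral_le_of_norm_le_const (μ := π) (C := B)
        (f := fun y => Φ (x, y)) (ae_of_all _ fun y => hΦB (x, y))
      simpa using this
    have hGd : ∀ x x', |G x' - G x| ≤ c := fun x x' => by
      rw [hG, ← integral_sub (hsi x') (hsi x)]
      have := norm_integral_le_of_norm_le_const (μ := π) (C := c)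
        (f := fun y => Φ (x', y) - Φ (x, y)) (ae_of_all _ fun y => by
          have := hd (Fin.cons x y) 0 x'
          rwa [Fin.update_cons_zero] at this)
      simpa using this
    obtain ⟨x₀⟩ : Nonempty α := nonempty_of_isProbabilityMeasure ρ
    have hsub := hasSubgaussianMGF_of_mem_Icc (μ := ρ) (X := G) (a := G x₀ - c) (b := G x₀ + c)
      hGm.aemeasurable (ae_of_all _ fun x => by
        have := abs_le.1 (hGd x₀ x)
        constructor <;> linarith [this.1, this.2])
    have hparam : (((‖G x₀ + c - (G x₀ - c)‖₊ / 2) ^ 2 : ℝ≥0) : ℝ) = c ^ 2 := by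
      have : G x₀ + c - (G x₀ - c) = 2 * c := by ring
      rw [this]
      push_cast
      rw [Real.norm_of_nonneg (by positivity)]; ring
    have hmgf := hsub.mgf_le t
    rw [hparam, mgf] at hmgf
    have hih : ∀ x, ∫ y, Real.exp (t * (Φ (x, y) - G x)) ∂π
        ≤ Real.exp (n * c ^ 2 * t ^ 2 / 2) := fun x => by
      refine ih (F := fun y => Φ (x, y)) (hΦm.comp (by fun_prop)) (fun y => hΦB _) fun y i u => ?_
      have := hd (Fin.cons x y) i.succ u
      rwa [← Fin.cons_update] at this
    set EF := ∫ x, G x ∂ρ with hEF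
    have hexpm : Measurable fun X => Real.exp (t * (F X - EF)) := by fun_prop
    have hbound : ∀ w, |Real.exp (t * (Φ w - EF))| ≤ Real.exp (|t| * (B + |EF|)) := fun w => by
      rw [Real.abs_exp]
      apply Real.exp_le_exp.2
      calc t * (Φ w - EF) ≤ |t| * |Φ w - EF| := by rw [← abs_mul]; exact le_abs_self _
        _ ≤ |t| * (B + |EF|) := by
          gcongr; exact (abs_sub _ _).trans (by linarith [hΦB w])
    have hexpi : Integrable (fun w => Real.exp (t * (Φ w - EF))) (ρ.prod π) :=
      integrable_of_abs_le (hexpm.comp hmp.measurable) hbound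
    rw [hmean, ← hmp.integral_comp_of_measurable hexpm]
    change ∫ w, Real.exp (t * (Φ w - EF)) ∂(ρ.prod π) ≤ _
    rw [integral_prod _ hexpi]
    calc ∫ x, ∫ y, Real.exp (t * (Φ (x, y) - EF)) ∂π ∂ρ
        ≤ ∫ x, Real.exp (n * c ^ 2 * t ^ 2 / 2) * Real.exp (t * (G x - EF)) ∂ρ := by
          refine integral_mono_of_nonneg (ae_of_all _ fun x => integral_nonneg fun y =>
            (Real.exp_pos _).le) ((hsub.integrable_exp_mul t).const_mul _)
            (ae_of_all _ fun x => ?_)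
          have e : ∀ y, Real.exp (t * (Φ (x, y) - EF))
              = Real.exp (t * (G x - EF)) * Real.exp (t * (Φ (x, y) - G x)) := fun y => by
            rw [← Real.exp_add]; congr 1; ring
          simp only [e]
          rw [integral_const_mul, mul_comm]
          gcongr
          exact hih x
      _ = Real.exp (n * c ^ 2 * t ^ 2 / 2) * ∫ x, Real.exp (t * (G x - EF)) ∂ρ :=
          integral_const_mul _ _
      _ ≤ Real.exp (n * c ^ 2 * t ^ 2 / 2) * Real.exp (c ^ 2 * t ^ 2 / 2) := by gcongr
      _ = _ := by rw [← Real.exp_add]; congr 1; push_cast; ring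

/-- McDiarmid's inequality. -/
theorem measureReal_abs_sub_integral_ge_le (n : ℕ) {F : (Fin n → α) → ℝ} (hF : Measurable F)
    {B : ℝ} (hB : ∀ X, |F X| ≤ B) {c : ℝ} (hc : 0 ≤ c)
    (hd : ∀ X i x, |F (Function.update X i x) - F X| ≤ c) {ε : ℝ} (hε : 0 ≤ ε) :
    (Measure.pi fun _ => ρ).real {X | ε ≤ |F X - ∫ Y, F Y ∂(Measure.pi fun _ => ρ)|}
      ≤ 2 * Real.exp (-ε ^ 2 / (2 * (n * c ^ 2))) := by
  set π : Measure (Fin n → α) := Measure.pi fun _ => ρ with hπ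
  set EF := ∫ Y, F Y ∂π with hEF
  have hsub : HasSubgaussianMGF (fun X => F X - EF) (⟨n * c ^ 2, by positivity⟩ : ℝ≥0) π := by
    refine ⟨fun t => ?_, fun t => ?_⟩
    · refine integrable_of_abs_le (B := Real.exp (|t| * (B + |EF|))) (by fun_prop) fun X => ?_
      rw [Real.abs_exp]
      apply Real.exp_le_exp.2
      calc t * (F X - EF) ≤ |t| * |F X - EF| := by rw [← abs_mul]; exact le_abs_self _
        _ ≤ |t| * (B + |EF|) := by
          gcongr; exact (abs_sub _ _).trans (by linarith [hB X])
    · exact integral_exp_mul_sub_integral_le ρ n hF hB hc hd t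
  have h1 := hsub.measure_ge_le hε
  have h2 := hsub.neg.measure_ge_le hε
  have hcov : {X | ε ≤ |F X - EF|} ⊆ {X | ε ≤ F X - EF} ∪ {X | ε ≤ (-fun X => F X - EF) X} := by
    intro X hX
    have hX' : ε ≤ |F X - EF| := hX
    rcases le_abs'.1 hX' with h | h
    · right; change ε ≤ -(F X - EF); linarith
    · left; exact h
  calc _ ≤ π.real {X | ε ≤ F X - EF} + π.real {X | ε ≤ (-fun X => F X - EF) X} :=
        (measureReal_mono hcov).trans (measureReal_union_le _ _)
    _ ≤ Real.exp (-ε ^ 2 / (2 * (n * c ^ 2))) + Real.exp (-ε ^ 2 / (2 * (n * c ^ 2))) :=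
        add_le_add h1 h2
    _ = _ := by ring

end BoundedDifferences

section NormTraceConcentration

variable {n p : ℕ}

/-- Bounded differences: both traces are within `1 / Im z` of the trace of the resolvent of the
same minor. -/
theorem norm_normTrace_update_sub_le (f : ℕ → ℝ → ℝ) {z : ℂ} (hz : 0 < z.im)
    (X : Fin n → Fin p → ℝ) (i : Fin n) (x : Fin p → ℝ) :
    ‖normTrace f z (Function.update X i x) - normTrace f z X‖ ≤ 2 / z.im / n := by
  have h1 := norm_trace_resolv_sub_le (kernelMatrix_isSymm f X) hz (kernelMatrix_apply_self f X i)
  have h2 := norm_trace_resolv_sub_le (kernelMatrix_isSymm f (Function.update X i x)) hz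
    (kernelMatrix_apply_self f (Function.update X i x) i)
  rw [minorResolv_kernelMatrix_update] at h2
  rw [normTrace, normTrace, ← mul_sub, norm_mul, norm_inv, Complex.norm_natCast]
  calc _ ≤ (n : ℝ)⁻¹ * (1 / z.im + 1 / z.im) := by
        gcongr
        have e : ∀ a b c : ℂ, a - b = (a - c) - (b - c) := fun a b c => by ring
        rw [e _ _ (minorResolv (kernelMatrix f X) z i).trace]
        exact (norm_sub_le _ _).trans (add_le_add h2 h1)
    _ = _ := by ring

/-- The expected normalized trace of the resolvent. -/
def meanNormTrace (f : ℕ → ℝ → ℝ) (z : ℂ) (n p : ℕ) : ℂ :=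
  ∫ X, normTrace (n := n) (p := p) f z X ∂(sampleLaw n p)

theorem integrable_normTrace {f : ℕ → ℝ → ℝ} (hf : ∀ p, Measurable (f p)) {z : ℂ}
    (hz : 0 < z.im) : Integrable (normTrace (n := n) (p := p) f z) (sampleLaw n p) :=
  (integrable_const (1 / z.im)).mono' (measurable_normTrace hf z).aestronglyMeasurable
    (ae_of_all _ fun X => norm_normTrace_le f hz X)

theorem norm_meanNormTrace_le (f : ℕ → ℝ → ℝ) {z : ℂ} (hz : 0 < z.im) (n p : ℕ) :
    ‖meanNormTrace f z n p‖ ≤ 1 / z.im := by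
  have := norm_integral_le_of_norm_le_const (μ := sampleLaw n p)
    (ae_of_all _ fun X => norm_normTrace_le f hz X)
  simpa [meanNormTrace] using this

/-- McDiarmid's inequality for the real and the imaginary part of the normalized trace, with bounded
differences `2 / (n Im z)`. -/
theorem measureReal_norm_normTrace_sub_ge_le {f : ℕ → ℝ → ℝ} (hf : ∀ p, Measurable (f p)) {z : ℂ}
    (hz : 0 < z.im) (hn : 1 ≤ n) {ε : ℝ} (hε : 0 < ε) :
    (sampleLaw n p).real {X | ε ≤ ‖normTrace f z X - meanNormTrace f z n p‖}
      ≤ 4 * Real.exp (-(ε ^ 2 * z.im ^ 2 / 32)) ^ n := by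
  have hn' : (0 : ℝ) < n := by exact_mod_cast hn
  have hi := integrable_normTrace (n := n) (p := p) hf hz
  have hm := measurable_normTrace (n := n) (p := p) hf z
  have hd := norm_normTrace_update_sub_le (n := n) (p := p) f hz
  have hb := norm_normTrace_le (n := n) (p := p) f hz
  have hre : (meanNormTrace f z n p).re
      = ∫ X, (normTrace (n := n) (p := p) f z X).re ∂(sampleLaw n p) :=
    (integral_re hi).symm
  have him : (meanNormTrace f z n p).im
      = ∫ X, (normTrace (n := n) (p := p) f z X).im ∂(sampleLaw n p) :=
    (integral_im hi).symm
  have h1 := measureReal_abs_sub_integral_ge_le (gaussianVec p) n (F := fun X =>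
    (normTrace (n := n) (p := p) f z X).re) (Complex.measurable_re.comp hm)
    (fun X => (Complex.abs_re_le_norm _).trans (hb X)) (c := 2 / z.im / n) (by positivity)
    (fun X i x => by
      rw [← Complex.sub_re]; exact (Complex.abs_re_le_norm _).trans (hd X i x))
    (half_pos hε).le
  have h2 := measureReal_abs_sub_integral_ge_le (gaussianVec p) n (F := fun X =>
    (normTrace (n := n) (p := p) f z X).im) (Complex.measurable_im.comp hm)
    (fun X => (Complex.abs_im_le_norm _).trans (hb X)) (c := 2 / z.im / n) (by positivity)
    (fun X i x => by
      rw [← Complex.sub_im]; exact (Complex.abs_im_le_norm _).trans (hd X i x))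
    (half_pos hε).le
  have e : Real.exp (-(ε / 2) ^ 2 / (2 * (n * (2 / z.im / n) ^ 2)))
      = Real.exp (-(ε ^ 2 * z.im ^ 2 / 32)) ^ n := by
    rw [← Real.exp_nat_mul]
    congr 1
    field_simp
    ring
  rw [e] at h1 h2
  have hcov : {X : Fin n → Fin p → ℝ | ε ≤ ‖normTrace f z X - meanNormTrace f z n p‖}
      ⊆ {X | ε / 2 ≤ |(normTrace f z X).re
          - ∫ Y, (normTrace (n := n) (p := p) f z Y).re ∂(sampleLaw n p)|}
        ∪ {X | ε / 2 ≤ |(normTrace f z X).im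
          - ∫ Y, (normTrace (n := n) (p := p) f z Y).im ∂(sampleLaw n p)|} := by
    intro X hX
    have h3 : ε ≤ ‖normTrace f z X - meanNormTrace f z n p‖ := hX
    have h4 := Complex.norm_le_abs_re_add_abs_im (normTrace f z X - meanNormTrace f z n p)
    rw [Complex.sub_re, Complex.sub_im, hre, him] at h4
    by_cases h5 : ε / 2 ≤ |(normTrace f z X).re
        - ∫ Y, (normTrace (n := n) (p := p) f z Y).re ∂(sampleLaw n p)|
    · exact Or.inl h5
    · right
      change ε / 2 ≤ _
      linarith [not_le.1 h5]
  refine (measureReal_mono hcov).trans ((measureReal_union_le _ _).trans ?_)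
  have := add_le_add h1 h2
  refine this.trans (le_of_eq ?_)
  ring

end NormTraceConcentration

/-! ### Convergence of the expected Stieltjes transform -/

section MeanLimit

/-- The cubic has no real roots when `Im z > 0`, so a limit of points of the upper half-plane that
is a root again lies in the upper half-plane. -/
theorem limitPoly_ofReal_ne_zero {γ a ν : ℝ} (hγ : 0 < γ) {z : ℂ} (hz : 0 < z.im) (x : ℝ) :
    limitPoly γ a ν z x ≠ 0 := by
  intro h
  have hc : limitPoly γ a ν z x = (((1 + a / γ * x) * (1 + (ν - a ^ 2) / γ * x ^ 2)
      + a ^ 2 / γ * x ^ 2 : ℝ) : ℂ) + (((1 + a / γ * x) * x : ℝ) : ℂ) * z := by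
    rw [limitPoly]; push_cast; ring
  rw [hc] at h
  have him := congrArg Complex.im h
  have hre := congrArg Complex.re h
  rw [Complex.add_im, Complex.ofReal_im, Complex.im_ofReal_mul, zero_add, Complex.zero_im,
    mul_eq_zero, or_iff_left hz.ne'] at him
  rw [Complex.add_re, Complex.ofReal_re, Complex.re_ofReal_mul, him, zero_mul, add_zero,
    Complex.zero_re] at hre
  rcases mul_eq_zero.1 him with h0 | h0
  · rw [h0, zero_mul, zero_add, mul_eq_zero] at hre
    rcases hre with h1 | h1
    · have h2 : a = 0 := by
        rcases div_eq_zero_iff.1 h1 with h | h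
        · exact pow_eq_zero_iff two_ne_zero |>.1 h
        · exact absurd h hγ.ne'
      rw [h2] at h0; norm_num at h0
    · have h2 : x = 0 := pow_eq_zero_iff two_ne_zero |>.1 h1
      rw [h2] at h0; norm_num at h0
  · rw [h0] at hre; norm_num at hre

theorem continuous_limitPoly_params (γ : ℝ) (z : ℂ) :
    Continuous fun q : ℝ × ℝ × ℂ => limitPoly γ q.1 q.2.1 z q.2.2 := by
  unfold limitPoly
  fun_prop

theorem continuous_limitPoly (γ a ν : ℝ) (z : ℂ) : Continuous (limitPoly γ a ν z) := by
  unfold limitPoly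
  fun_prop

theorem isProbabilityMeasure_esd {n : ℕ} (hn : 1 ≤ n) (A : Matrix (Fin n) (Fin n) ℝ)
    (hA : A.IsHermitian) : IsProbabilityMeasure (esd A hA : Measure ℝ) := by
  have e : (esd A hA : Measure ℝ) = (n : ℝ≥0)⁻¹ • ∑ i, Measure.dirac (hA.eigenvalues i) := rfl
  refine ⟨?_⟩
  rw [e]
  simp only [Measure.smul_apply, Measure.finsetSum_apply, measure_univ, Finset.sum_const,
    Finset.card_univ, Fintype.card_fin, nsmul_eq_mul, mul_one]
  have hn0 : (n : ℝ≥0) ≠ 0 := by exact_mod_cast (by lia : n ≠ 0)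
  rw [ENNReal.smul_def, smul_eq_mul, ENNReal.coe_inv hn0, ENNReal.coe_natCast]
  exact ENNReal.inv_mul_cancel (by exact_mod_cast (by lia : n ≠ 0)) (ENNReal.natCast_ne_top n)

theorem normTrace_eq_stieltjes {n p : ℕ} (f : ℕ → ℝ → ℝ) {z : ℂ} (hz : 0 < z.im)
    (X : Fin n → Fin p → ℝ) : normTrace f z X
      = stieltjes (esd (kernelMatrix f X) (kernelMatrix_isHermitian f X) : Measure ℝ) z :=
  (stieltjes_esd _ _ hz).symm

theorem im_normTrace_pos {n p : ℕ} (hn : 1 ≤ n) (f : ℕ → ℝ → ℝ) {z : ℂ} (hz : 0 < z.im)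
    (X : Fin n → Fin p → ℝ) : 0 < (normTrace f z X).im := by
  have := isProbabilityMeasure_esd hn (kernelMatrix f X) (kernelMatrix_isHermitian f X)
  rw [normTrace_eq_stieltjes f hz]
  exact im_stieltjes_pos _ hz

theorem norm_normTrace_sub_le {n p : ℕ} (hn : 1 ≤ n) (f : ℕ → ℝ → ℝ) {z w : ℂ} (hz : 0 < z.im)
    (hw : 0 < w.im) (X : Fin n → Fin p → ℝ) :
    ‖normTrace f z X - normTrace f w X‖ ≤ ‖z - w‖ / (z.im * w.im) := by
  have := isProbabilityMeasure_esd hn (kernelMatrix f X) (kernelMatrix_isHermitian f X)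
  rw [normTrace_eq_stieltjes f hz, normTrace_eq_stieltjes f hw]
  exact norm_stieltjes_sub_le _ hz hw

variable {f : ℕ → ℝ → ℝ} {γ a ν : ℝ} {n p : ℕ → ℕ}

theorem one_le_of_div_eq (hγ : 0 < γ) (hpn : ∀ N, (p N : ℝ) / (n N : ℝ) = γ) (N : ℕ) :
    1 ≤ n N ∧ 1 ≤ p N := by
  constructor
  · by_contra h
    have h0 : n N = 0 := by lia
    have := hpn N
    rw [h0] at this; simp at this; exact hγ.ne this
  · by_contra h
    have h0 : p N = 0 := by lia
    have := hpn N
    rw [h0] at this; simp at this; exact hγ.ne this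

theorem tendsto_atTop_of_div_eq (hγ : 0 < γ) (hn : StrictMono n)
    (hpn : ∀ N, (p N : ℝ) / (n N : ℝ) = γ) : Tendsto p atTop atTop := by
  rw [← tendsto_natCast_atTop_iff (R := ℝ)]
  have h : ∀ N, (p N : ℝ) = γ * n N := fun N => by
    have h1 : (n N : ℝ) ≠ 0 := by
      have := (one_le_of_div_eq hγ hpn N).1
      exact_mod_cast (by lia : n N ≠ 0)
    rw [← hpn N]; field_simp
  simp_rw [h]
  exact (tendsto_natCast_atTop_atTop.comp hn.tendsto_atTop).const_mul_atTop hγ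

theorem tendsto_integral_norm_normTrace_sub (hf : ∀ p, Measurable (f p)) {z : ℂ} (hz : 0 < z.im)
    (hn : StrictMono n) (hn1 : ∀ N, 1 ≤ n N) :
    Tendsto (fun N => ∫ X, ‖normTrace (n := n N) (p := p N) f z X
      - meanNormTrace f z (n N) (p N)‖ ∂(sampleLaw (n N) (p N))) atTop (𝓝 0) := by
  rw [Metric.tendsto_atTop']
  intro ε hε
  set r := Real.exp (-((ε / 2) ^ 2 * z.im ^ 2 / 32)) with hr
  have hr1 : r < 1 := by
    have : 0 < (ε / 2) ^ 2 * z.im ^ 2 / 32 := by positivity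
    rw [hr, Real.exp_lt_one_iff]
    linarith
  have hlim : Tendsto (fun N => 2 / z.im * (4 * r ^ n N)) atTop (𝓝 0) := by
    have := ((tendsto_pow_atTop_nhds_zero_of_lt_one (Real.exp_pos _).le hr1).comp
      hn.tendsto_atTop).const_mul (2 / z.im * 4)
    simpa [mul_assoc] using this
  obtain ⟨N₀, hN₀⟩ := eventually_atTop.1 (hlim.eventually_lt_const (half_pos hε))
  refine ⟨N₀, fun N hN => ?_⟩
  set S := {X : Fin (n N) → Fin (p N) → ℝ | ε / 2 ≤ ‖normTrace f z X
    - meanNormTrace f z (n N) (p N)‖} with hS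
  have hSm : MeasurableSet S :=
    measurableSet_le measurable_const ((measurable_normTrace hf z).sub_const _).norm
  have htail := measureReal_norm_normTrace_sub_ge_le (p := p N) hf hz (hn1 N) (half_pos hε)
  have hi : Integrable (fun X : Fin (n N) → Fin (p N) → ℝ =>
      ε / 2 + S.indicator (fun _ => 2 / z.im) X) (sampleLaw (n N) (p N)) :=
    (integrable_const _).add ((integrable_const _).indicator hSm)
  rw [dist_zero_right, Real.norm_of_nonneg (integral_nonneg fun X => norm_nonneg _)]
  calc _ ≤ ∫ X, (ε / 2 + S.indicator (fun _ => 2 / z.im) X) ∂(sampleLaw (n N) (p N)) := by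
        refine integral_mono_of_nonneg (ae_of_all _ fun X => norm_nonneg _) hi
          (ae_of_all _ fun X => ?_)
        dsimp only
        by_cases h : X ∈ S
        · rw [Set.indicator_of_mem h]
          refine (norm_sub_le _ _).trans ?_
          have h1 := norm_normTrace_le f hz X
          have h2 := norm_meanNormTrace_le f hz (n N) (p N)
          have : 2 / z.im = 1 / z.im + 1 / z.im := by ring
          linarith
        · rw [Set.indicator_of_notMem h, add_zero]
          exact (not_le.1 h).le
    _ = ε / 2 + 2 / z.im * (sampleLaw (n N) (p N)).real S := by
        rw [integral_add (integrable_const _) ((integrable_const _).indicator hSm),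
          integral_indicator_const _ hSm]
        simp [mul_comm]
    _ ≤ ε / 2 + 2 / z.im * (4 * r ^ n N) := by gcongr
    _ < ε := by linarith [hN₀ N hN.le]

/-- The expected Stieltjes transform converges to a solution of the limiting equation, by
compactness and uniqueness. -/
theorem exists_tendsto_meanNormTrace (hf : ∀ p, Measurable (f p))
    (hV : CVariance (rescaledKernel f) ν) (hU : CUniform (rescaledKernel f))
    (hL : CLinear (rescaledKernel f) a) (hγ : 0 < γ) (hν : a ^ 2 ≤ ν) (hn : StrictMono n)
    (hpn : ∀ N, (p N : ℝ) / (n N : ℝ) = γ) {z : ℂ} (hz : 0 < z.im) :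
    ∃ m : ℂ, (0 < m.im ∧ LimitEq γ a ν z m) ∧
      Tendsto (fun N => meanNormTrace f z (n N) (p N)) atTop (𝓝 m) := by
  set κ : ℕ → ℝ := fun N => coeff (rescaledKernel f) 1 (p N) with hκ
  set E : ℕ → ℝ := fun N => ∫ x, rescaledKernel f (p N) x ^ 2 ∂(xiLaw (p N)) with hE
  have hpt := tendsto_atTop_of_div_eq hγ hn hpn
  have hn1 : ∀ N, 1 ≤ n N := fun N => (one_le_of_div_eq hγ hpn N).1
  have hκa : Tendsto κ atTop (𝓝 a) := hL.comp hpt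
  have hEν : Tendsto E atTop (𝓝 ν) :=
    (hV.tendsto_variance.comp hpt).congr fun N =>
      (integral_sq_eq_variance hV (one_le_of_div_eq hγ hpn N).2).symm
  set w : ℕ → ℂ := fun N => meanNormTrace f z (n N) (p N) with hw
  have hcont := continuous_limitPoly_params γ z
  -- the parameters of the approximate equation are those of size `p`; they converge to `a` and `ν`
  have hcubic : Tendsto (fun N => ∫ X, ‖limitPoly γ (κ N) (E N) z
      (normTrace (n := n N) (p := p N) f z X)‖ ∂(sampleLaw (n N) (p N))) atTop (𝓝 0) := by
    rw [Metric.tendsto_atTop']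
    intro ε hε
    obtain ⟨N₀, hN₀⟩ := eventually_atTop.1
      (hpt.eventually (eventually_integral_norm_limitPoly_le hf hV hU hγ hz (half_pos hε)))
    refine ⟨N₀, fun N hN => ?_⟩
    rw [dist_zero_right, Real.norm_of_nonneg (integral_nonneg fun X => norm_nonneg _)]
    linarith [hN₀ N hN.le (n N) (hpn N)]
  -- a sample for which the transform is close to its mean and to a root of the cubic
  have hsample : ∀ N, ∃ X : Fin (n N) → Fin (p N) → ℝ,
      ‖normTrace f z X - w N‖ + ‖limitPoly γ (κ N) (E N) z (normTrace f z X)‖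
      ≤ ∫ X, ‖normTrace (n := n N) (p := p N) f z X - w N‖ ∂(sampleLaw (n N) (p N))
        + ∫ X, ‖limitPoly γ (κ N) (E N) z (normTrace (n := n N) (p := p N) f z X)‖
          ∂(sampleLaw (n N) (p N)) := by
    intro N
    have hm := measurable_normTrace (n := n N) (p := p N) hf z
    have hc : Continuous (limitPoly γ (κ N) (E N) z) := continuous_limitPoly γ _ _ z
    obtain ⟨C, hC⟩ := (isCompact_closedBall (0 : ℂ) (1 / z.im)).exists_bound_of_continuousOn
      hc.continuousOn
    have h1 : Integrable (fun X => ‖normTrace (n := n N) (p := p N) f z X - w N‖)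
      (sampleLaw (n N) (p N)) := ((integrable_normTrace hf hz).sub (integrable_const _)).norm
    have h2 : Integrable (fun X => ‖limitPoly γ (κ N) (E N) z
        (normTrace (n := n N) (p := p N) f z X)‖) (sampleLaw (n N) (p N)) :=
      Integrable.norm ((integrable_const C).mono' (hc.measurable.comp hm).aestronglyMeasurable
        (ae_of_all _ fun X => hC _ (by simpa using norm_normTrace_le f hz X)))
    obtain ⟨X, hX⟩ := exists_le_integral (h1.add h2)
    refine ⟨X, ?_⟩
    rw [← integral_add h1 h2]
    exact hX
  choose X hX using hsample
  have hsum := (tendsto_integral_norm_normTrace_sub (p := p) hf hz hn hn1).add hcubic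
  rw [add_zero] at hsum
  set s : ℕ → ℂ := fun N => normTrace f z (X N) with hs
  have hsw : Tendsto (fun N => s N - w N) atTop (𝓝 0) :=
    squeeze_zero_norm (fun N => (le_add_of_nonneg_right (norm_nonneg _)).trans (hX N)) hsum
  have hroots : Tendsto (fun N => limitPoly γ (κ N) (E N) z (s N)) atTop (𝓝 0) :=
    squeeze_zero_norm (fun N => (le_add_of_nonneg_left (norm_nonneg _)).trans (hX N)) hsum
  have hroot : ∀ (φ : ℕ → ℕ) (m : ℂ), Tendsto φ atTop atTop → Tendsto (s ∘ φ) atTop (𝓝 m) →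
      0 < m.im ∧ LimitEq γ a ν z m := by
    intro φ m hφ hm
    have h0 : limitPoly γ a ν z m = 0 := by
      have h1 : Tendsto (fun N => (κ (φ N), E (φ N), s (φ N))) atTop (𝓝 (a, ν, m)) :=
        (hκa.comp hφ).prodMk_nhds ((hEν.comp hφ).prodMk_nhds hm)
      have h2 := (hcont.tendsto (a, ν, m)).comp h1
      exact tendsto_nhds_unique h2 (hroots.comp hφ)
    have him : 0 ≤ m.im := ge_of_tendsto ((Complex.continuous_im.tendsto m).comp hm)
      (Eventually.of_forall fun N => (im_normTrace_pos (hn1 _) f hz _).le)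
    have hpos : 0 < m.im := by
      refine him.lt_of_ne fun h => ?_
      have e : m = (m.re : ℂ) := by
        apply Complex.ext <;> simp [← h]
      rw [e] at h0
      exact limitPoly_ofReal_ne_zero hγ hz _ h0
    exact ⟨hpos, (limitEq_iff_limitPoly hγ hpos).2 h0⟩
  have hball : ∀ N, s N ∈ Metric.closedBall (0 : ℂ) (1 / z.im) := fun N => by
    simpa using norm_normTrace_le f hz (X N)
  obtain ⟨m, -, φ, hφ, hm⟩ := tendsto_subseq_of_bounded Metric.isBounded_closedBall hball
  have hmr := hroot φ m hφ.tendsto_atTop hm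
  refine ⟨m, hmr, ?_⟩
  have hsm : Tendsto s atTop (𝓝 m) := by
    refine tendsto_of_subseq_tendsto fun ns hns => ?_
    obtain ⟨m', -, ψ, hψ, hm'⟩ := tendsto_subseq_of_bounded Metric.isBounded_closedBall
      fun N => hball (ns N)
    have hmr' := hroot (ns ∘ ψ) m' (hns.comp hψ.tendsto_atTop) hm'
    rw [LimitEq.unique hγ hν hz hmr.1 hmr'.1 hmr.2 hmr'.2]
    exact ⟨ψ, hm'⟩
  simpa using hsm.sub hsw

end MeanLimit

/-! ### Almost sure convergence of the Stieltjes transforms -/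

section AlmostSure

theorem norm_meanNormTrace_sub_le {f : ℕ → ℝ → ℝ} (hf : ∀ p, Measurable (f p)) {n p : ℕ}
    (hn : 1 ≤ n) {z w : ℂ} (hz : 0 < z.im) (hw : 0 < w.im) :
    ‖meanNormTrace f z n p - meanNormTrace f w n p‖ ≤ ‖z - w‖ / (z.im * w.im) := by
  rw [meanNormTrace, meanNormTrace,
    ← integral_sub (integrable_normTrace hf hz) (integrable_normTrace hf hw)]
  have := norm_integral_le_of_norm_le_const (μ := sampleLaw n p) (C := ‖z - w‖ / (z.im * w.im))
    (f := fun X => normTrace (n := n) (p := p) f z X - normTrace f w X)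
    (ae_of_all _ fun X => norm_normTrace_sub_le hn f hz hw X)
  simpa using this

variable {Ω : Type*} [MeasurableSpace Ω] {P : Measure Ω} {f : ℕ → ℝ → ℝ} {n p : ℕ → ℕ}
  {X : (N : ℕ) → Ω → Fin (n N) → Fin (p N) → ℝ}

/-- Almost sure concentration at one point, by the Borel-Cantelli lemma. No assumption on the joint
law of the different samples is involved. -/
theorem ae_tendsto_normTrace_sub (hf : ∀ p, Measurable (f p)) (hn : StrictMono n)
    (hn1 : ∀ N, 1 ≤ n N) (hX : ∀ N, HasLaw (X N) (sampleLaw (n N) (p N)) P) {z : ℂ}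
    (hz : 0 < z.im) :
    ∀ᵐ ω ∂P, Tendsto (fun N => normTrace f z (X N ω) - meanNormTrace f z (n N) (p N)) atTop
      (𝓝 0) := by
  have key : ∀ j : ℕ, ∀ᵐ ω ∂P, ∀ᶠ N in atTop,
      ‖normTrace f z (X N ω) - meanNormTrace f z (n N) (p N)‖ < 1 / ((j : ℝ) + 1) := by
    intro j
    set ε : ℝ := 1 / ((j : ℝ) + 1) with hε
    have hε0 : 0 < ε := by positivity
    set r := Real.exp (-(ε ^ 2 * z.im ^ 2 / 32)) with hr
    have hr0 : 0 ≤ r := (Real.exp_pos _).le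
    have hr1 : r < 1 := by
      have : 0 < ε ^ 2 * z.im ^ 2 / 32 := by positivity
      rw [hr, Real.exp_lt_one_iff]
      linarith
    set S : (N : ℕ) → Set (Fin (n N) → Fin (p N) → ℝ) := fun N =>
      {x | ε ≤ ‖normTrace f z x - meanNormTrace f z (n N) (p N)‖} with hS
    have hSm : ∀ N, MeasurableSet (S N) := fun N =>
      measurableSet_le measurable_const ((measurable_normTrace hf z).sub_const _).norm
    have hP : ∀ N, P ((X N) ⁻¹' S N) ≤ ENNReal.ofReal (4 * r ^ N) := by
      intro N
      rw [← Measure.map_apply_of_aemeasurable (hX N).aemeasurable (hSm N), (hX N).map_eq,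
        ← ofReal_measureReal]
      apply ENNReal.ofReal_le_ofReal
      refine (measureReal_norm_normTrace_sub_ge_le hf hz (hn1 N) hε0).trans ?_
      exact mul_le_mul_of_nonneg_left (pow_le_pow_of_le_one hr0 hr1.le (hn.id_le N)) (by norm_num)
    have hsum : ∑' N, P ((X N) ⁻¹' S N) ≠ ∞ :=
      ne_top_of_le_ne_top ((summable_geometric_of_lt_one hr0 hr1).mul_left 4).tsum_ofReal_ne_top
        (ENNReal.tsum_le_tsum hP)
    filter_upwards [ae_eventually_notMem hsum] with ω hω
    filter_upwards [hω] with N hN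
    exact not_le.1 hN
  filter_upwards [ae_all_iff.2 key] with ω hω
  rw [Metric.tendsto_nhds]
  intro ε hε
  obtain ⟨j, hj⟩ := exists_nat_one_div_lt hε
  filter_upwards [hω j] with N hN
  rw [dist_zero_right]
  exact hN.trans hj

/-- Almost surely, the Stieltjes transforms concentrate at all points of the upper half plane, since
they are locally Lipschitz with uniform constants. -/
theorem ae_forall_tendsto_normTrace_sub (hf : ∀ p, Measurable (f p)) (hn : StrictMono n)
    (hn1 : ∀ N, 1 ≤ n N) (hX : ∀ N, HasLaw (X N) (sampleLaw (n N) (p N)) P) :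
    ∀ᵐ ω ∂P, ∀ z : ℂ, 0 < z.im →
      Tendsto (fun N => normTrace f z (X N ω) - meanNormTrace f z (n N) (p N)) atTop (𝓝 0) := by
  obtain ⟨s, hsc, hsd⟩ := TopologicalSpace.exists_countable_dense ℂ
  have h1 : ∀ᵐ ω ∂P, ∀ d ∈ s, 0 < d.im →
      Tendsto (fun N => normTrace f d (X N ω) - meanNormTrace f d (n N) (p N)) atTop (𝓝 0) := by
    rw [ae_ball_iff hsc]
    intro d _
    by_cases hd : 0 < d.im
    · filter_upwards [ae_tendsto_normTrace_sub hf hn hn1 hX hd] with ω hω _ using hω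
    · exact ae_of_all _ fun ω h => absurd h hd
  filter_upwards [h1] with ω hω z hz
  rw [Metric.tendsto_nhds]
  intro ε hε
  obtain ⟨d, hds, hd⟩ := hsd.exists_dist_lt z
    (by positivity : 0 < min (z.im / 2) (ε * z.im ^ 2 / 6))
  rw [dist_eq_norm, lt_min_iff] at hd
  have hdim : z.im / 2 < d.im := by
    have := (abs_le.1 ((Complex.abs_im_le_norm (z - d)).trans hd.1.le)).2
    have h2 := hd.1
    have h3 := lt_of_le_of_lt (Complex.abs_im_le_norm (z - d)) hd.1
    rw [Complex.sub_im] at h3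
    linarith [(abs_lt.1 h3).2]
  have hd0 : 0 < d.im := by linarith
  have hL : ‖z - d‖ / (z.im * d.im) < ε / 3 := by
    rw [div_lt_iff₀ (by positivity)]
    calc ‖z - d‖ < ε * z.im ^ 2 / 6 := hd.2
      _ = ε / 3 * (z.im * (z.im / 2)) := by ring
      _ ≤ ε / 3 * (z.im * d.im) := by gcongr
  filter_upwards [Metric.tendsto_nhds.1 (hω d hds hd0) (ε / 3) (by positivity)] with N hN
  rw [dist_zero_right] at hN ⊢
  have a1 := norm_normTrace_sub_le (hn1 N) f hz hd0 (X N ω)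
  have a2 := norm_meanNormTrace_sub_le (p := p N) hf (hn1 N) hz hd0
  have e : normTrace f z (X N ω) - meanNormTrace f z (n N) (p N)
      = (normTrace f z (X N ω) - normTrace f d (X N ω))
        + (normTrace f d (X N ω) - meanNormTrace f d (n N) (p N))
        - (meanNormTrace f z (n N) (p N) - meanNormTrace f d (n N) (p N)) := by ring
  rw [e]
  calc _ ≤ _ := (norm_sub_le _ _).trans (add_le_add_left (norm_add_le _ _) _)
    _ < ε := by linarith

end AlmostSure

/-! ### Reduction to measurable kernels -/

section MeasurableModification

variable {k k' : ℕ → ℝ → ℝ}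

theorem coeff_congr {p : ℕ} (h : k p =ᵐ[xiLaw p] k' p) (l : ℕ) : coeff k l p = coeff k' l p :=
  integral_congr_ae (by filter_upwards [h] with x hx; rw [hx])

theorem CVariance.congr {ν : ℝ} (hV : CVariance k ν) (h : ∀ p, k p =ᵐ[xiLaw p] k' p) :
    CVariance k' ν where
  memLp p hp := (hV.memLp p hp).ae_eq (h p)
  mean_zero p hp := by rw [← integral_congr_ae (h p)]; exact hV.mean_zero p hp
  tendsto_variance := hV.tendsto_variance.congr fun p => variance_congr (h p)

theorem CUniform.congr (hU : CUniform k) (h : ∀ p, k p =ᵐ[xiLaw p] k' p) : CUniform k' := by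
  intro ε hε
  obtain ⟨L, p₀, hL⟩ := hU ε hε
  refine ⟨L, p₀, fun p hp => ?_⟩
  rw [← integral_congr_ae (μ := xiLaw p) (f := fun x => (k p x - truncation k L p x) ^ 2)]
  · exact hL p hp
  · filter_upwards [h p] with x hx
    simp only [truncation, coeff_congr (h p), hx]

theorem CLinear.congr {a : ℝ} (hL : CLinear k a) (h : ∀ p, k p =ᵐ[xiLaw p] k' p) :
    CLinear k' a :=
  Tendsto.congr (fun p => coeff_congr (h p) 1) hL

/-- A kernel in `L²` agrees almost everywhere with a measurable one. -/
theorem exists_measurable_kernel {f : ℕ → ℝ → ℝ} {ν : ℝ} (hV : CVariance (rescaledKernel f) ν) :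
    ∃ g : ℕ → ℝ → ℝ, (∀ p, Measurable (g p)) ∧
      ∀ p, rescaledKernel f p =ᵐ[xiLaw p] rescaledKernel g p := by
  have h : ∀ p, ∃ g : ℝ → ℝ, Measurable g ∧
      rescaledKernel f p =ᵐ[xiLaw p] fun x => √(p : ℝ) * g (x / √(p : ℝ)) := by
    intro p
    rcases Nat.eq_zero_or_pos p with hp | hp
    · refine ⟨fun _ => 0, measurable_const, ae_of_all _ fun x => ?_⟩
      simp [rescaledKernel, hp]
    · have hae := (hV.memLp p hp).1.aemeasurable
      have hs : √(p : ℝ) ≠ 0 := (Real.sqrt_pos.2 (by exact_mod_cast hp)).ne'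
      refine ⟨fun y => (√(p : ℝ))⁻¹ * hae.mk _ (√(p : ℝ) * y),
        measurable_const.mul (hae.measurable_mk.comp (by fun_prop)), ?_⟩
      filter_upwards [hae.ae_eq_mk] with x hx
      rw [hx, mul_inv_cancel_left₀ hs, mul_div_cancel₀ _ hs]
  choose g hg hfg using h
  exact ⟨g, hg, hfg⟩

/-- Almost surely, two kernels that agree almost everywhere give the same matrix. -/
theorem ae_kernelMatrix_eq {f g : ℕ → ℝ → ℝ} {n p : ℕ} (hp : 1 ≤ p)
    (h : rescaledKernel f p =ᵐ[xiLaw p] rescaledKernel g p) :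
    ∀ᵐ X : Fin n → Fin p → ℝ ∂(sampleLaw n p), kernelMatrix f X = kernelMatrix g X := by
  have h1 : ∀ i j : Fin n, ∀ᵐ X : Fin n → Fin p → ℝ ∂(sampleLaw n p),
      kernelMatrix f X i j = kernelMatrix g X i j := by
    intro i j
    by_cases hij : j = i
    · exact ae_of_all _ fun X => by rw [hij, kernelMatrix_apply_self, kernelMatrix_apply_self]
    · have h2 := (measurePreserving_sqrt_mul_dotProduct p hij).quasiMeasurePreserving.ae h
      filter_upwards [h2] with X hX
      rw [kernelMatrix_apply_of_ne hp f X hij, kernelMatrix_apply_of_ne hp g X hij, hX]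
  filter_upwards [ae_all_iff.2 fun i => ae_all_iff.2 (h1 i)] with X hX
  ext i j
  exact hX i j

/-- The linear coefficient is at most the norm, and so are the limits. -/
theorem CVariance.sq_le {a ν : ℝ} (hV : CVariance k ν) (hL : CLinear k a) : a ^ 2 ≤ ν := by
  refine le_of_tendsto_of_tendsto (Tendsto.pow hL 2) hV.tendsto_variance ?_
  filter_upwards [eventually_ge_atTop 1] with p hp
  rw [← integral_sq_eq_variance hV hp]
  exact coeff_one_sq_le hV hp

end MeasurableModification

end RandomKernel

end

theorem theorem3p1
    {Ω : Type*} [MeasurableSpace Ω] (P : Measure Ω) [IsProbabilityMeasure P]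
    (f : ℕ → ℝ → ℝ) (γ a ν : ℝ) (hγ : 0 < γ)
    (hVar : RandomKernel.CVariance (RandomKernel.rescaledKernel f) ν)
    (hUnif : RandomKernel.CUniform (RandomKernel.rescaledKernel f))
    (hLin : RandomKernel.CLinear (RandomKernel.rescaledKernel f) a)
    (n p : ℕ → ℕ) (hn : StrictMono n) (hpn : ∀ N, (p N : ℝ) / (n N : ℝ) = γ)
    (X : (N : ℕ) → Fin (n N) → Ω → (Fin (p N) → ℝ))
    (hLaw : ∀ N i, HasLaw (X N i) (RandomKernel.gaussianVec (p N)) P)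
    (hIndep : ∀ N, iIndepFun (X N) P) :
    (∀ z : ℂ, 0 < z.im → ∃! m : ℂ, 0 < m.im ∧ RandomKernel.LimitEq γ a ν z m) ∧
    ∃ μ : ProbabilityMeasure ℝ,
      (∀ᵐ ω ∂P, Tendsto
        (fun N => RandomKernel.esd (RandomKernel.kernelMatrix f (fun i => X N i ω))
          (RandomKernel.kernelMatrix_isHermitian f (fun i => X N i ω)))
        atTop (𝓝 μ.toFiniteMeasure)) ∧
      (∀ z : ℂ, 0 < z.im →
        0 < (RandomKernel.stieltjes (μ : Measure ℝ) z).im ∧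
        RandomKernel.LimitEq γ a ν z (RandomKernel.stieltjes (μ : Measure ℝ) z)) ∧
      ((a ^ 2 < ν ∨ (a ≠ 0 ∧ 1 ≤ γ)) → (μ : Measure ℝ) ≪ volume) ∧
      (a ≠ 0 → a ^ 2 < ν → ∀ u : ℝ, Tendsto
        (fun v : ℝ => (RandomKernel.stieltjes (μ : Measure ℝ)
          ((u : ℂ) + (v : ℂ) * Complex.I)).im)
        (𝓝[>] 0) (𝓝 (RandomKernel.boundaryIm γ a ν u))) := by
  have hn1 : ∀ N, 1 ≤ n N := fun N => (RandomKernel.one_le_of_div_eq hγ hpn N).1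
  have hp1 : ∀ N, 1 ≤ p N := fun N => (RandomKernel.one_le_of_div_eq hγ hpn N).2
  have hν : a ^ 2 ≤ ν := hVar.sq_le hLin
  -- `g` is a measurable kernel with almost surely the same kernel matrices
  obtain ⟨g, hg, hfg⟩ := RandomKernel.exists_measurable_kernel hVar
  have hm : ∀ z : ℂ, ∃ m : ℂ, 0 < z.im → (0 < m.im ∧ RandomKernel.LimitEq γ a ν z m) ∧
      Tendsto (fun N => RandomKernel.meanNormTrace g z (n N) (p N)) atTop (𝓝 m) := by
    intro z
    by_cases hz : 0 < z.im
    · obtain ⟨m, hm⟩ := RandomKernel.exists_tendsto_meanNormTrace hg (hVar.congr hfg)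
        (hUnif.congr hfg) (hLin.congr hfg) hγ hν hn hpn hz
      exact ⟨m, fun _ => hm⟩
    · exact ⟨0, fun h => absurd h hz⟩
  choose m hm using hm
  have him : ∀ z : ℂ, 0 < z.im → 0 < (m z).im := fun z hz => (hm z hz).1.1
  have hmeq : ∀ z : ℂ, 0 < z.im → RandomKernel.LimitEq γ a ν z (m z) := fun z hz => (hm z hz).1.2
  have hXlaw : ∀ N, HasLaw (fun ω i => X N i ω) (RandomKernel.sampleLaw (n N) (p N)) P :=
    fun N => (hIndep N).hasLaw_pi (hLaw N)
  have hker : ∀ᵐ ω ∂P, ∀ N, RandomKernel.kernelMatrix f (fun i => X N i ω)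
      = RandomKernel.kernelMatrix g (fun i => X N i ω) := by
    rw [ae_all_iff]
    intro N
    have h := RandomKernel.ae_kernelMatrix_eq (n := n N) (hp1 N) (hfg (p N))
    rw [← (hXlaw N).map_eq] at h
    exact ae_of_ae_map (hXlaw N).aemeasurable h
  let μs : Ω → ℕ → ProbabilityMeasure ℝ := fun ω N =>
    ⟨RandomKernel.esd (RandomKernel.kernelMatrix f (fun i => X N i ω))
      (RandomKernel.kernelMatrix_isHermitian f (fun i => X N i ω)),
      RandomKernel.isProbabilityMeasure_esd (hn1 N) _ _⟩
  have hconv : ∀ᵐ ω ∂P, ∃ μ : ProbabilityMeasure ℝ, Tendsto (μs ω) atTop (𝓝 μ) ∧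
      ∀ z : ℂ, 0 < z.im → RandomKernel.stieltjes (μ : Measure ℝ) z = m z := by
    filter_upwards [hker, RandomKernel.ae_forall_tendsto_normTrace_sub hg hn hn1 hXlaw]
      with ω hω hω'
    refine RandomKernel.exists_tendsto_of_tendsto_stieltjes (fun z hz => ?_)
      (RandomKernel.tendsto_mul_im_of_limitEq hγ hν him hmeq)
    have h1 := (hω' z hz).add (hm z hz).2
    rw [zero_add] at h1
    refine h1.congr fun N => ?_
    rw [sub_add_cancel, RandomKernel.normTrace, ← hω N]
    exact (RandomKernel.stieltjes_esd _ _ hz).symm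
  -- any realization of the limit will do, as its Stieltjes transform is the deterministic `m`
  obtain ⟨ω₀, μ, -, hμ⟩ := hconv.exists
  have hμim : ∀ z : ℂ, 0 < z.im → 0 < (RandomKernel.stieltjes (μ : Measure ℝ) z).im :=
    fun z hz => by rw [hμ z hz]; exact him z hz
  have hμeq : ∀ z : ℂ, 0 < z.im →
      RandomKernel.LimitEq γ a ν z (RandomKernel.stieltjes (μ : Measure ℝ) z) :=
    fun z hz => by rw [hμ z hz]; exact hmeq z hz
  refine ⟨fun z hz => ⟨m z, (hm z hz).1, fun m' hm' => ?_⟩, μ, ?_, fun z hz => ⟨hμim z hz, hμeq z hz⟩,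
    fun h => ?_, fun ha hlt u => RandomKernel.tendsto_im_boundaryIm hγ ha hlt hμim hμeq u⟩
  · exact RandomKernel.LimitEq.unique hγ hν hz hm'.1 (him z hz) hm'.2 (hmeq z hz)
  · filter_upwards [hconv] with ω ⟨μ', hμ', hst⟩
    have e : μ' = μ := RandomKernel.eq_of_stieltjes_eq fun z hz => by rw [hst z hz, hμ z hz]
    rw [e, ProbabilityMeasure.tendsto_nhds_iff_toFiniteMeasure_tendsto_nhds] at hμ'
    exact hμ'
  · rcases hν.lt_or_eq with hlt | heq
    · exact RandomKernel.absolutelyContinuous_of_lt hγ hlt μ hμeq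
    · rcases h with h | ⟨ha, hγ1⟩
      · exact absurd heq h.ne
      · subst heq
        exact RandomKernel.absolutelyContinuous_of_eq hγ1 ha μ hμeq
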